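/- Let $r\ge 0$ be an integer. For $\tau\in\mathbb R$ let $C$ be a contour running from $\infty e^{5i\pi/6}$ to $\infty e^{i\pi/6}$ such that $-i\tau$ lies above $C$, and put $$A_r^{\pm}(u;\tau)=\int_C e^{\frac13 ia^3+iau}(\mp ia-\tau)^{\pm r}\frac{da}{2\pi},\qquad A(u)=\int_C e^{\frac13 ia^3+iau}\frac{da}{2\pi}$$ (so $A$ is the Airy function), $$K^{(0)}(u,v)=\int_0^\infty A(w+u)A(w+v)\,dw,\qquad K^{(r)}_\tau(u,v)=\int_0^\infty A_r^-(w+u;\tau)A_r^+(w+v;\tau)\,dw .$$ Write $\det(I-K)_{(x,\infty)}$ for the Fredholm determinant on $L^2(x,\infty)$ and $$Q(t,x)=\log\det(I-K_t^{(r)})_{(x,\infty)},\qquad Q_0(x)=\log\det(I-K^{(0)})_{(x,\infty)} .$$ Put \begin{align*} K_1^{(r)}(u,v)&=-rA(u)A(v),\\ K_2^{(r)}(u,v)&=-\tfrac{r^2}{2}\bigl(A'(u)A(v)+A(u)A'(v)\bigr)+\tfrac r2(u-v)K^{(0)}(u,v),\\ K_3^{(r)}(u,v)&=-\tfrac{r^3}{6}\bigl(A''(u)A(v)+2A'(u)A'(v)+A(u)A''(v)\bigr)+\tfrac{r^2}{2}(v-u)A(u)A(v)\\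 &\quad-\tfrac r3\bigl(A''(u)A(v)+A(u)A''(v)-A'(u)A'(v)\bigr). \end{align*} These are the first coefficients of the $r$-Airy kernel: for all $u,v\in\mathbb R$, as $t\to-\infty$, $$K_t^{(r)}(u,v)=K^{(0)}(u,v)+\frac{K_1^{(r)}(u,v)}{t}+\frac{K_2^{(r)}(u,v)}{t^2}+\frac{K_3^{(r)}(u,v)}{t^3}+O\Bigl(\frac1{t^4}\Bigr).$$ Moreover, for every $x\in\mathbb R$ the following holds. The Fredholm series of $\det(I-K^{(0)})_{(x,\infty)}$ and, for all sufficiently negative $t$, that of $\det(I-K^{(r)}_t)_{(x,\infty)}$ converge absolutely and their sums are positive; the operator $I-K^{(0)}$ is invertible on $L^2(x,\infty)$; and, with the operators $L_i=(I-K^{(0)})^{-1}K_i^{(r)}$ on $L^2(x,\infty)$, the operators $L_1$, $L_2+\frac12L_1^2$ and $L_3+L_1L_2+\frac13L_1^3$ are of trace class. With $$Q_1=-\operatorname{Tr}L_1,\qquad Q_2=-\operatorname{Tr}\Bigl(L_2+\frac{L_1^2}{2}\Bigr),\qquad Q_3=-\operatorname{Tr}\Bigl(L_3+L_1L_2+\frac{L_1^3}{3}\Bigr)$$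 one has $$Q(t,x)=Q_0(x)+\frac{Q_1(x)}{t}+\frac{Q_2(x)}{t^2}+\frac{Q_3(x)}{t^3}+O\Bigl(\frac1{t^4}\Bigr)\qquad (t\to-\infty).$$ Finally, $Q_0$ is three times continuously differentiable on $\mathbb R$ and $$Q_1=rQ_0',\qquad Q_2=\frac{r^2}{2!}Q_0'',\qquad Q_3=\frac{r^3}{3!}Q_0'''+\frac r3\,xQ_0' .$$ -/

import Mathlib

open MeasureTheory Set Asymptotics

noncomputable section

namespace RAiry

/-- The integral of `f` along the contour that comes in from `∞ e^{5πi/6}` on a straight ray to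
the vertex `i h`, and goes out from there on a straight ray to `∞ e^{πi/6}`. -/
def contourIntegral (h : ℝ) (f : ℂ → ℂ) : ℂ :=
  ∫ ρ in Ioi (0 : ℝ),
    (Complex.exp (Real.pi / 6 * Complex.I) *
        f (Complex.I * h + ρ * Complex.exp (Real.pi / 6 * Complex.I))
      - Complex.exp (5 * Real.pi / 6 * Complex.I) *
        f (Complex.I * h + ρ * Complex.exp (5 * Real.pi / 6 * Complex.I)))

/-- The height of the vertex of the contour used for the parameter `τ`. -/
def vertex (τ : ℝ) : ℝ := min 1 (-τ - 1)

/-- The point `-iτ` lies above the contour. -/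
lemma vertex_lt (τ : ℝ) : vertex τ < -τ :=
  lt_of_le_of_lt (min_le_right _ _) (by linarith)

/-- `exp (i a³ / 3 + i a u)`. -/
def phase (u : ℝ) (a : ℂ) : ℂ :=
  Complex.exp (Complex.I * a ^ 3 / 3 + Complex.I * a * u)

/-- The Airy function `A(u) = ∫_C exp (i a³ / 3 + i a u) da / 2π`, as a complex number. -/
def airyC (u : ℝ) : ℂ :=
  contourIntegral 1 (fun a => phase u a) / (2 * Real.pi)

/-- `A_r^-(u; τ) = ∫_C exp (i a³ / 3 + i a u) (i a - τ)^{-r} da / 2π`, as a complex number. -/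
def airyMinusC (r : ℕ) (τ u : ℝ) : ℂ :=
  contourIntegral (vertex τ) (fun a => phase u a * ((Complex.I * a - τ) ^ r)⁻¹) / (2 * Real.pi)

/-- `A_r^+(u; τ) = ∫_C exp (i a³ / 3 + i a u) (-i a - τ)^{r} da / 2π`, as a complex number. -/
def airyPlusC (r : ℕ) (τ u : ℝ) : ℂ :=
  contourIntegral (vertex τ) (fun a => phase u a * (-(Complex.I * a) - τ) ^ r) / (2 * Real.pi)

/-- The Airy function; its values are real, see `airyC_eq`. -/
def airy (u : ℝ) : ℝ := (airyC u).re

/-- The function `A_r^-(u; τ)`; its values are real, see `airyMinusC_eq`. -/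
def airyMinus (r : ℕ) (τ u : ℝ) : ℝ := (airyMinusC r τ u).re

/-- The function `A_r^+(u; τ)`; its values are real, see `airyPlusC_eq`. -/
def airyPlus (r : ℕ) (τ u : ℝ) : ℝ := (airyPlusC r τ u).re

lemma conj_exp_ray : (starRingEnd ℂ) (Complex.exp (Real.pi / 6 * Complex.I))
    = -Complex.exp (5 * Real.pi / 6 * Complex.I) := by
  have h : (5 * Real.pi / 6 * Complex.I : ℂ)
      = Real.pi * Complex.I + -(Real.pi / 6 * Complex.I) := by ring
  rw [h, Complex.exp_add, Complex.exp_pi_mul_I, ← Complex.exp_conj]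
  simp [map_ofNat]

lemma conj_contourIntegral (h : ℝ) (f : ℂ → ℂ)
    (hf : ∀ a, f (-(starRingEnd ℂ) a) = (starRingEnd ℂ) (f a)) :
    (starRingEnd ℂ) (contourIntegral h f) = contourIntegral h f := by
  unfold contourIntegral
  rw [← integral_conj]
  congr 1
  funext ρ
  have h1 := conj_exp_ray
  have h2 : (starRingEnd ℂ) (Complex.exp (5 * Real.pi / 6 * Complex.I))
      = -Complex.exp (Real.pi / 6 * Complex.I) := by
    rw [← neg_eq_iff_eq_neg, ← map_neg, ← h1, Complex.conj_conj]
  simp only [map_sub, map_mul, ← hf, h1, h2, map_add, Complex.conj_I, Complex.conj_ofReal]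
  ring_nf

lemma conj_phase (u : ℝ) (a : ℂ) :
    phase u (-(starRingEnd ℂ) a) = (starRingEnd ℂ) (phase u a) := by
  simp only [phase, ← Complex.exp_conj, map_add, map_mul, map_div₀, map_pow, Complex.conj_I,
    Complex.conj_ofReal, map_ofNat]
  ring_nf

lemma airyC_eq (u : ℝ) : airyC u = (airy u : ℂ) := by
  symm
  apply Complex.conj_eq_iff_re.mp
  rw [airyC, map_div₀, conj_contourIntegral _ _ (conj_phase u)]
  simp [map_ofNat]

lemma airyMinusC_eq (r : ℕ) (τ u : ℝ) : airyMinusC r τ u = (airyMinus r τ u : ℂ) := by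
  symm
  apply Complex.conj_eq_iff_re.mp
  rw [airyMinusC, map_div₀, conj_contourIntegral]
  · simp [map_ofNat]
  · intro a
    simp [conj_phase]

lemma airyPlusC_eq (r : ℕ) (τ u : ℝ) : airyPlusC r τ u = (airyPlus r τ u : ℂ) := by
  symm
  apply Complex.conj_eq_iff_re.mp
  rw [airyPlusC, map_div₀, conj_contourIntegral]
  · simp [map_ofNat]
  · intro a
    simp [conj_phase]

/-- The Airy kernel `K^{(0)}`. -/
def airyKernel (u v : ℝ) : ℝ := ∫ w in Ioi (0 : ℝ), airy (w + u) * airy (w + v)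

/-- The `r`-Airy kernel `K_τ^{(r)}`. -/
def rAiryKernel (r : ℕ) (τ u v : ℝ) : ℝ :=
  ∫ w in Ioi (0 : ℝ), airyMinus r τ (w + u) * airyPlus r τ (w + v)

/-- The `n`-th term of the Fredholm series of `det (I - K)` on `L²(x, ∞)`. -/
def fredholmTerm (K : ℝ → ℝ → ℝ) (x : ℝ) (n : ℕ) : ℝ :=
  (-1) ^ n / (n.factorial : ℝ) *
    ∫ u in Set.univ.pi (fun _ : Fin n => Ioi x), (Matrix.of fun i j => K (u i) (u j)).det

/-- The Fredholm determinant `det (I - K)` on `L²(x, ∞)`. -/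
def fredholmDet (K : ℝ → ℝ → ℝ) (x : ℝ) : ℝ := ∑' n, fredholmTerm K x n

/-- All terms of the Fredholm series are given by absolutely convergent integrals, and the series
converges absolutely. -/
def FredholmConverges (K : ℝ → ℝ → ℝ) (x : ℝ) : Prop :=
  (∀ n : ℕ, IntegrableOn (fun u : Fin n → ℝ => (Matrix.of fun i j => K (u i) (u j)).det)
    (Set.univ.pi (fun _ : Fin n => Ioi x))) ∧
  Summable (fredholmTerm K x)

/-- `Q₀(x) = log det (I - K^{(0)})_{(x, ∞)}`. -/
def Q0 (x : ℝ) : ℝ := Real.log (fredholmDet airyKernel x)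

/-- `Q(t, x) = log det (I - K_t^{(r)})_{(x, ∞)}`. -/
def Q (r : ℕ) (t x : ℝ) : ℝ := Real.log (fredholmDet (rAiryKernel r t) x)

/-- The coefficient `K_1^{(r)}` of `1 / t` in the `r`-Airy kernel as `t → -∞`. -/
def kernel1 (r : ℕ) (u v : ℝ) : ℝ := -(r : ℝ) * (airy u * airy v)

/-- The coefficient `K_2^{(r)}` of `1 / t²` in the `r`-Airy kernel as `t → -∞`. -/
def kernel2 (r : ℕ) (u v : ℝ) : ℝ :=
  -((r : ℝ) ^ 2 / 2) * (deriv airy u * airy v + airy u * deriv airy v)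
    + (r : ℝ) / 2 * ((u - v) * airyKernel u v)

/-- The coefficient `K_3^{(r)}` of `1 / t³` in the `r`-Airy kernel as `t → -∞`. -/
def kernel3 (r : ℕ) (u v : ℝ) : ℝ :=
  -((r : ℝ) ^ 3 / 6) * (deriv (deriv airy) u * airy v + 2 * (deriv airy u * deriv airy v)
      + airy u * deriv (deriv airy) v)
    + (r : ℝ) ^ 2 / 2 * ((v - u) * (airy u * airy v))
    - (r : ℝ) / 3 * (deriv (deriv airy) u * airy v + airy u * deriv (deriv airy) v
      - deriv airy u * deriv airy v)

/-- The real Hilbert space `L²(x, ∞)`. -/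
abbrev L2 (x : ℝ) : Type := Lp ℝ 2 (volume.restrict (Ioi x))

/-- `T` is the integral operator on `L²(x, ∞)` with kernel `K`. For a given `K` there is at most
one such `T`. -/
def IsIntegralOperator (x : ℝ) (K : ℝ → ℝ → ℝ) (T : L2 x →L[ℝ] L2 x) : Prop :=
  ∀ f : L2 x, ∀ᵐ u ∂(volume.restrict (Ioi x)),
    IntegrableOn (fun v => K u v * f v) (Ioi x) ∧ T f u = ∫ v in Ioi x, K u v * f v

/-- `T` is of trace class and has trace `c`. The first clause, with two independent orthonormal
bases, says that `T` is of trace class. -/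
def HasTrace {x : ℝ} (T : L2 x →L[ℝ] L2 x) (c : ℝ) : Prop :=
  (∀ (ι : Type) (b e : HilbertBasis ι ℝ (L2 x)), Summable fun i => inner ℝ (b i) (T (e i))) ∧
  (∀ (ι : Type) (b : HilbertBasis ι ℝ (L2 x)), HasSum (fun i => inner ℝ (b i) (T (b i))) c)

end RAiry

end

noncomputable section

namespace RAiry

open Filter Topology

/-! ### Determinants -/

/-! Let U be the symmetric 3×3 matrix of the numbers ⟨A⁽ʲ⁾, (I - K⁽⁰⁾)⁻¹ A⁽ᵏ⁾⟩ on L²(x, ∞) with j, k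
≤ 2 (`resMat`). The Airy equation and integration by parts turn K₁, K₂, K₃ into combinations of the
products A⁽ʲ⁾(u)A⁽ᵏ⁾(v). So, up to O(t⁻⁴), the r-Airy kernel is a finite rank perturbation of K⁽⁰⁾
with a 3×3 coefficient matrix c(1/t). Such a perturbation multiplies det(I - K⁽⁰⁾) by det(1 - Uc)
(`fredholmDet_add_prodKernel`), and the logarithm of this small determinant yields Q₁, Q₂, Q₃ as
polynomials in the entries of U. The operators L_i multiply like the matrices c, with U inserted
between them (`airyRes_mul_prodOp_mul`), so the traces give the same polynomials.

The same formula differentiates in x. Moving the endpoint translates the kernel, and K⁽⁰⁾(u + e, v +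
e) is K⁽⁰⁾ - e A⊗A to first order. This gives Q₀' = U₀₀ and the derivatives of U₀₀ and U₀₁, hence
Q₀'' and Q₀'''. It then turns out that Q₃ - (r³/6) Q₀''' = (r/3)(2U₀₂ - U₁₁). Dilating the kernel
instead of translating it shows 2U₀₂ - U₁₁ = x U₀₀ (`mul_resMat_zero_zero`), which is the source of
the extra term.

Two analytic supports are needed. The first is a theory of Fredholm determinants for kernels
dominated by C wt(u) wt(v): Hadamard's inequality makes the determinant Lipschitz in the weighted
supremum norm (`Adm.abs_fredholmDet_sub_le`), and discretization makes it multiplicative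
(`fredholmDet_mul`).

The second is the injectivity of I - sK⁽⁰⁾ for 0 ≤ s ≤ 1 (`airyKernel_injective`), which gives
invertibility and positivity. The quadratic form of K⁽⁰⁾ is the squared norm of the Airy transform
over w > 0, and the full Airy transform is a contraction. The contraction is obtained with a factor
exp(2ηw), η → 0, from the Gaussian form of the correlations of A and from the moments ∫ exp(θs) A(s)
ds = exp(θ³/3). Hence if sK⁽⁰⁾F = F, the transform of F vanishes for w < 0, and by continuity F is
orthogonal to A and A'. The formula (u - v)K⁽⁰⁾ = A⊗A' - A'⊗A then makes the eigenspace invariant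
under multiplication by the variable. Being finite dimensional, it is zero. -/

/-- The **Hadamard inequality** for a square matrix given by its rows. -/
lemma abs_det_le_prod_norm {n : ℕ} (v : Fin n → EuclideanSpace ℝ (Fin n)) :
    |(Matrix.of fun i j => v i j).det| ≤ ∏ i, ‖v i‖ := by
  rcases n with - | n
  · simp
  have : Fact (Module.finrank ℝ (EuclideanSpace ℝ (Fin (n + 1))) = n + 1) := ⟨by simp⟩
  let b := EuclideanSpace.basisFun (Fin (n + 1)) ℝ
  have h := b.toBasis.orientation.abs_volumeForm_apply_le v
  rw [Orientation.volumeForm_robust' _ b] at h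
  convert h using 2
  rw [Module.Basis.det_apply, ← Matrix.det_transpose]
  congr 1

/-- The Euclidean norm of a row is at most √n times its supremum norm. The factor √n ^ n is harmless
because √n ^ n / n! still decays faster than any geometric sequence. -/
lemma abs_det_le_sqrt_pow {n : ℕ} (m : Fin n → Fin n → ℝ) :
    |(Matrix.of m).det| ≤ √n ^ n * ∏ i, ‖m i‖ := by
  have h := abs_det_le_prod_norm (fun i => WithLp.toLp 2 (m i))
  refine h.trans ?_
  have : ∀ i, ‖(WithLp.toLp 2 (m i) : EuclideanSpace ℝ (Fin n))‖ ≤ √n * ‖m i‖ := by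
    intro i
    rw [EuclideanSpace.norm_eq]
    refine Real.sqrt_le_iff.2 ⟨by positivity, ?_⟩
    rw [mul_pow, Real.sq_sqrt (Nat.cast_nonneg n)]
    calc ∑ j, ‖m i j‖ ^ 2 ≤ ∑ _j : Fin n, ‖m i‖ ^ 2 := by
          gcongr with j; exact norm_le_pi_norm (m i) j
      _ = n * ‖m i‖ ^ 2 := by simp
  calc ∏ i, ‖(WithLp.toLp 2 (m i) : EuclideanSpace ℝ (Fin n))‖ ≤ ∏ i, (√n * ‖m i‖) := by
        gcongr with i; exact this i
    _ = √n ^ n * ∏ i, ‖m i‖ := by simp [Finset.prod_mul_distrib]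

lemma abs_det_le_of_entries {n : ℕ} {m : Fin n → Fin n → ℝ} {C : ℝ} (hC : 0 ≤ C)
    (hm : ∀ i j, |m i j| ≤ C) : |(Matrix.of m).det| ≤ √n ^ n * C ^ n := by
  refine (abs_det_le_sqrt_pow m).trans ?_
  gcongr
  calc ∏ i, ‖m i‖ ≤ ∏ _i : Fin n, C := by
        gcongr with i; exact (pi_norm_le_iff_of_nonneg hC).2 (hm i)
    _ = C ^ n := by simp

/-- The determinant is multilinear in its rows, so the general estimate for differences of values of
a bounded multilinear map applies, with the Hadamard constant as bound. -/
lemma abs_det_sub_le_of_entries {n : ℕ} {m m' : Fin n → Fin n → ℝ} {C δ : ℝ} (hC : 0 ≤ C)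
    (hδ : 0 ≤ δ) (hm : ∀ i j, |m i j| ≤ C) (hm' : ∀ i j, |m' i j| ≤ C)
    (hd : ∀ i j, |m i j - m' i j| ≤ δ) :
    |(Matrix.of m).det - (Matrix.of m').det| ≤ √n ^ n * n * C ^ (n - 1) * δ := by
  have h := MultilinearMap.norm_image_sub_le_of_bound
    (Matrix.detRowAlternating (R := ℝ) (n := Fin n)).toMultilinearMap
    (C := √n ^ n) (by positivity) (fun m => abs_det_le_sqrt_pow m) m m'
  rw [Fintype.card_fin] at h
  refine le_trans h ?_
  gcongr
  · refine max_le ?_ ?_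
    · exact (pi_norm_le_iff_of_nonneg hC).2 fun i => (pi_norm_le_iff_of_nonneg hC).2 (hm i)
    · exact (pi_norm_le_iff_of_nonneg hC).2 fun i => (pi_norm_le_iff_of_nonneg hC).2 (hm' i)
  · exact (pi_norm_le_iff_of_nonneg hδ).2 fun i => (pi_norm_le_iff_of_nonneg hδ).2 (hd i)

/-- By nⁿ ≤ n! eⁿ the square of the n-th term is at most (a²e)ⁿ / n!. Splitting this as (2a²e)ⁿ / n!
times 2⁻ⁿ, the term is at most the sum of the two factors, both of which are summable. -/
lemma summable_hadamard (a : ℝ) (ha : 0 ≤ a) :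
    Summable fun n : ℕ => √n ^ n / (n.factorial : ℝ) * a ^ n := by
  have h1 : Summable fun n : ℕ => (2 * (a ^ 2 * Real.exp 1)) ^ n / (n.factorial : ℝ) :=
    Real.summable_pow_div_factorial _
  have h2 : Summable fun n : ℕ => (1 / 2 : ℝ) ^ n := summable_geometric_two
  refine Summable.of_nonneg_of_le (fun n => by positivity) (fun n => ?_) (h1.add h2)
  have hf : (0 : ℝ) < n.factorial := by positivity
  have h3 : (n : ℝ) ^ n ≤ n.factorial * Real.exp 1 ^ n := by
    have := Real.pow_div_factorial_le_exp (n : ℝ) (Nat.cast_nonneg n) n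
    rw [div_le_iff₀ hf] at this
    rw [← Real.exp_nat_mul, mul_one, mul_comm]
    exact this
  have h4 : (√n ^ n / (n.factorial : ℝ) * a ^ n) ^ 2
      ≤ ((2 * (a ^ 2 * Real.exp 1)) ^ n / (n.factorial : ℝ)) * (1 / 2) ^ n := by
    have e1 : (√(n : ℝ) ^ n) ^ 2 = (n : ℝ) ^ n := by
      rw [← pow_mul, mul_comm, pow_mul, Real.sq_sqrt (Nat.cast_nonneg n)]
    have e2 : ((2 * (a ^ 2 * Real.exp 1)) ^ n / (n.factorial : ℝ)) * (1 / 2) ^ n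
        = (a ^ n) ^ 2 * Real.exp 1 ^ n / n.factorial := by
      rw [mul_pow, mul_pow, div_pow, one_pow, ← pow_mul, mul_comm 2 n, pow_mul]
      field_simp
    rw [e2, mul_pow, div_pow, e1, le_div_iff₀ hf]
    calc (n : ℝ) ^ n / (n.factorial : ℝ) ^ 2 * (a ^ n) ^ 2 * n.factorial
        = (n : ℝ) ^ n / (n.factorial : ℝ) * (a ^ n) ^ 2 := by field_simp
      _ ≤ (n.factorial * Real.exp 1 ^ n) / (n.factorial : ℝ) * (a ^ n) ^ 2 := by gcongr
      _ = (a ^ n) ^ 2 * Real.exp 1 ^ n := by field_simp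
  have hA : 0 ≤ (2 * (a ^ 2 * Real.exp 1)) ^ n / (n.factorial : ℝ) := by positivity
  have hB : (0 : ℝ) ≤ (1 / 2) ^ n := by positivity
  have hc : 0 ≤ √(n : ℝ) ^ n / (n.factorial : ℝ) * a ^ n := by positivity
  nlinarith [sq_nonneg ((2 * (a ^ 2 * Real.exp 1)) ^ n / (n.factorial : ℝ) - (1 / 2) ^ n)]

/-- The sum over all `n`-tuples of indices of the corresponding determinants vanishes on the
tuples with a repetition, and counts every principal minor `n!` times. -/
lemma sum_det_tuples {ι : Type*} [Fintype ι] [DecidableEq ι] (G : Matrix ι ι ℝ) (n : ℕ) :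
    ∑ c : Fin n → ι, (G.submatrix c c).det
      = n.factorial * ∑ s ∈ Finset.univ.powersetCard n,
        (G.submatrix (Subtype.val : s → ι) (Subtype.val : s → ι)).det := by
  classical
  have h0 : ∀ c : Fin n → ι, ¬ Function.Injective c → (G.submatrix c c).det = 0 := by
    intro c hc
    simp only [Function.Injective, not_forall] at hc
    obtain ⟨i, j, hij, hne⟩ := hc
    exact Matrix.det_zero_of_row_eq hne (by ext k; simp [hij])
  rw [← Finset.sum_filter_of_ne (p := Function.Injective)
    (fun c _ hc => by by_contra h; exact hc (h0 c h))]
  -- The injective tuples are grouped by their image s. Each tuple with image s enumerates s, so it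
  -- gives the same principal minor, and there are n! such enumerations.
  rw [← Finset.sum_fiberwise_of_maps_to (s := Finset.univ.filter Function.Injective)
    (t := Finset.univ.powersetCard n) (g := fun c : Fin n → ι => Finset.univ.image c)
    (fun c hc => by
      rw [Finset.mem_filter] at hc
      simp [Finset.mem_powersetCard, Finset.card_image_of_injective _ hc.2]), Finset.mul_sum]
  refine Finset.sum_congr rfl fun s hs => ?_
  rw [Finset.mem_powersetCard] at hs
  have h1 : ∀ c ∈ (Finset.univ.filter Function.Injective).filter
      (fun c : Fin n → ι => Finset.univ.image c = s), (G.submatrix c c).det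
        = (G.submatrix (Subtype.val : s → ι) (Subtype.val : s → ι)).det := by
    intro c hc
    simp only [Finset.mem_filter, Finset.mem_univ, true_and] at hc
    let e : Fin n ≃ s := Equiv.ofBijective (fun i => ⟨c i, by rw [← hc.2]; simp⟩) (by
      constructor
      · intro i j hij
        exact hc.1 (by simpa using hij)
      · rintro ⟨y, hy⟩
        rw [← hc.2] at hy
        obtain ⟨i, -, hi⟩ := Finset.mem_image.1 hy
        exact ⟨i, by simp [hi]⟩)
    rw [← Matrix.det_submatrix_equiv_self e]
    rfl
  rw [Finset.sum_congr rfl h1, Finset.sum_const, nsmul_eq_mul]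
  congr 2
  have h2 : Fintype.card (Fin n ≃ s) = n.factorial := by
    have e : Fin n ≃ s := (Fintype.equivFinOfCardEq (by simp [hs.2])).symm
    rw [Fintype.card_equiv e, Fintype.card_fin]
  rw [← h2]
  symm
  refine Finset.card_bij (s := Finset.univ) (fun (e : Fin n ≃ s) _ => fun i => (e i : ι)) ?_ ?_ ?_
  · intro e _
    simp only [Finset.mem_filter, Finset.mem_univ, true_and]
    refine ⟨fun i j h => e.injective (Subtype.ext h), ?_⟩
    ext y
    simp only [Finset.mem_image, Finset.mem_univ, true_and]
    constructor
    · rintro ⟨i, rfl⟩; exact (e i).2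
    · intro hy; exact ⟨e.symm ⟨y, hy⟩, by simp⟩
  · intro e _ e' _ h
    ext i
    exact congrFun h i
  · intro c hc
    simp only [Finset.mem_filter, Finset.mem_univ, true_and] at hc
    refine ⟨Equiv.ofBijective (fun i => ⟨c i, by rw [← hc.2]; simp⟩) ?_, Finset.mem_univ _, rfl⟩
    constructor
    · intro i j hij
      exact hc.1 (by simpa using hij)
    · rintro ⟨y, hy⟩
      rw [← hc.2] at hy
      obtain ⟨i, -, hi⟩ := Finset.mem_image.1 hy
      exact ⟨i, by simp [hi]⟩

/-- The Fredholm expansion of the determinant of a finite matrix. -/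
lemma hasSum_det_tuples {ι : Type*} [Fintype ι] [DecidableEq ι] (G : Matrix ι ι ℝ) :
    HasSum (fun n : ℕ => (-1) ^ n / (n.factorial : ℝ) * ∑ c : Fin n → ι, (G.submatrix c c).det)
      (1 - G).det := by
  -- The n-th term is the coefficient of Xⁿ in the polynomial det(1 - X G), whose value at 1 is the
  -- determinant in question.
  have key : ∀ n : ℕ, (-1) ^ n / (n.factorial : ℝ) * ∑ c : Fin n → ι, (G.submatrix c c).det
      = (Matrix.det (1 + (Polynomial.X : Polynomial ℝ) • (-G).map Polynomial.C)).coeff n := by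
    intro n
    rw [Matrix.coeff_det_one_add_X_smul_eq_sum_minors, sum_det_tuples]
    rw [← mul_assoc, div_mul_cancel₀ _ (by positivity), Finset.mul_sum]
    refine Finset.sum_congr rfl fun s hs => ?_
    have : (-G).submatrix (Subtype.val : s → ι) (Subtype.val : s → ι)
      = -(G.submatrix (Subtype.val : s → ι) (Subtype.val : s → ι)) := rfl
    rw [this, Matrix.det_neg, Fintype.card_coe, (Finset.mem_powersetCard.1 hs).2]
  simp_rw [key]
  set p := Matrix.det (1 + (Polynomial.X : Polynomial ℝ) • (-G).map Polynomial.C) with hp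
  have h1 : (1 - G).det = p.eval 1 := by
    rw [hp, ← Polynomial.coe_evalRingHom, RingHom.map_det]
    congr 1
    ext i j
    by_cases h : i = j <;> simp [h, sub_eq_add_neg]
  rw [h1, Polynomial.eval_eq_sum_range]
  simp only [one_pow, mul_one]
  refine hasSum_sum_of_ne_finset_zero fun n hn => ?_
  rw [Finset.mem_range, not_lt] at hn
  exact Polynomial.coeff_eq_zero_of_natDegree_lt (by omega)

end RAiry
end

noncomputable section

namespace RAiry

open Filter Topology

/-! ### Kernels dominated by a weight -/

/-- The weight that dominates all kernels. -/
def wt (u : ℝ) : ℝ := Real.exp (-(u / 2))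

/-- Lebesgue measure on `(x, ∞)`. -/
abbrev mu (x : ℝ) : Measure ℝ := volume.restrict (Ioi x)

/-- The kernel `k` is measurable and bounded by `C wt(u) wt(v)` for `u, v > x`. -/
structure Adm (x C : ℝ) (k : ℝ → ℝ → ℝ) : Prop where
  meas : Measurable (Function.uncurry k)
  bound : ∀ u ∈ Ioi x, ∀ v ∈ Ioi x, |k u v| ≤ C * (wt u * wt v)

lemma wt_pos (u : ℝ) : 0 < wt u := Real.exp_pos _

lemma continuous_wt : Continuous wt := by unfold wt; fun_prop

lemma wt_sq (u : ℝ) : wt u ^ 2 = Real.exp (-u) := by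
  rw [wt, ← Real.exp_nat_mul]; congr 1; push_cast; ring

lemma integrable_wt_sq (x : ℝ) : Integrable (fun u => wt u ^ 2) (mu x) := by
  simp_rw [wt_sq]
  have h := exp_neg_integrableOn_Ioi x one_pos
  simp only [neg_mul, one_mul] at h
  exact h

/-- The total mass of `wt²`. -/
def mass (x : ℝ) : ℝ := ∫ u, wt u ^ 2 ∂(mu x)

lemma mass_nonneg (x : ℝ) : 0 ≤ mass x := integral_nonneg fun _ => sq_nonneg _

lemma Adm.nonneg {x C : ℝ} {k : ℝ → ℝ → ℝ} (h : Adm x C k) : 0 ≤ C := by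
  have h1 := (abs_nonneg _).trans (h.bound (x + 1) (by simp) (x + 1) (by simp))
  exact nonneg_of_mul_nonneg_left h1 (mul_pos (wt_pos _) (wt_pos _))

lemma Adm.mono {x C C' : ℝ} {k : ℝ → ℝ → ℝ} (h : Adm x C k) (hC : C ≤ C') : Adm x C' k :=
  ⟨h.meas, fun u hu v hv => (h.bound u hu v hv).trans (by
    have := wt_pos u; have := wt_pos v; gcongr)⟩

lemma Adm.add {x C C' : ℝ} {k l : ℝ → ℝ → ℝ} (h : Adm x C k) (h' : Adm x C' l) :
    Adm x (C + C') fun u v => k u v + l u v :=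
  ⟨h.meas.add h'.meas, fun u hu v hv => (abs_add_le _ _).trans (by
    rw [add_mul]; exact add_le_add (h.bound u hu v hv) (h'.bound u hu v hv))⟩

lemma Adm.smul {x C : ℝ} {k : ℝ → ℝ → ℝ} (h : Adm x C k) (c : ℝ) :
    Adm x (|c| * C) fun u v => c * k u v :=
  ⟨h.meas.const_mul c, fun u hu v hv => by
    rw [abs_mul, mul_assoc]
    exact mul_le_mul_of_nonneg_left (h.bound u hu v hv) (abs_nonneg c)⟩

lemma adm_mul {x C C' : ℝ} {f g : ℝ → ℝ} (hf : Measurable f) (hg : Measurable g)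
    (hfb : ∀ u ∈ Ioi x, |f u| ≤ C * wt u) (hgb : ∀ u ∈ Ioi x, |g u| ≤ C' * wt u) :
    Adm x (C * C') fun u v => f u * g v :=
  ⟨(hf.comp measurable_fst).mul (hg.comp measurable_snd), fun u hu v hv => by
    rw [abs_mul]
    calc |f u| * |g v| ≤ (C * wt u) * (C' * wt v) :=
          mul_le_mul (hfb u hu) (hgb v hv) (abs_nonneg _) ((abs_nonneg _).trans (hfb u hu))
      _ = _ := by ring⟩

/-! ### The Fredholm series -/

lemma fredholmTerm_eq (k : ℝ → ℝ → ℝ) (x : ℝ) (n : ℕ) :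
    fredholmTerm k x n = (-1) ^ n / (n.factorial : ℝ) *
      ∫ u, (Matrix.of fun i j => k (u i) (u j)).det ∂(Measure.pi fun _ : Fin n => mu x) := by
  rw [fredholmTerm, volume_pi, Measure.restrict_pi_pi]

lemma ae_pi_mem (x : ℝ) (n : ℕ) :
    ∀ᵐ u ∂(Measure.pi fun _ : Fin n => mu x), ∀ i, u i ∈ Ioi x := by
  rw [← Measure.restrict_pi_pi, ← volume_pi]
  filter_upwards [ae_restrict_mem (MeasurableSet.univ_pi fun _ => measurableSet_Ioi)] with u hu
  exact fun i => hu i (mem_univ i)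

lemma integrable_prod_wt (x : ℝ) (n : ℕ) :
    Integrable (fun u : Fin n → ℝ => ∏ i, wt (u i) ^ 2) (Measure.pi fun _ : Fin n => mu x) :=
  Integrable.fintype_prod fun _ => integrable_wt_sq x

lemma integral_prod_wt (x : ℝ) (n : ℕ) :
    ∫ u : Fin n → ℝ, ∏ i, wt (u i) ^ 2 ∂(Measure.pi fun _ : Fin n => mu x) = mass x ^ n := by
  rw [integral_fintype_prod_eq_pow (fun u : ℝ => wt u ^ 2), Fintype.card_fin, mass]

/-- Scaling rows and columns by the weight takes out the integrable density ∏ wt² and leaves a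
matrix with bounded entries, to which the Hadamard bounds apply. -/
lemma det_kernel_eq {n : ℕ} (k : ℝ → ℝ → ℝ) (u : Fin n → ℝ) :
    (Matrix.of fun i j => k (u i) (u j)).det
      = (∏ i, wt (u i) ^ 2)
        * (Matrix.of fun i j => k (u i) (u j) / (wt (u i) * wt (u j))).det := by
  have h : (Matrix.of fun i j => k (u i) (u j)) = Matrix.of fun i j => wt (u i) *
      (Matrix.of fun i j => wt (u j) *
        (Matrix.of fun i j => k (u i) (u j) / (wt (u i) * wt (u j))) i j) i j := by
    ext i j
    have := (wt_pos (u i)).ne'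
    have := (wt_pos (u j)).ne'
    simp only [Matrix.of_apply]
    field_simp
  rw [h, Matrix.det_mul_column, Matrix.det_mul_row, ← mul_assoc, ← Finset.prod_mul_distrib]
  simp only [pow_two]

lemma abs_div_wt_le {a C u v : ℝ} (h : |a| ≤ C * (wt u * wt v)) :
    |a / (wt u * wt v)| ≤ C := by
  have := mul_pos (wt_pos u) (wt_pos v)
  rwa [abs_div, abs_of_pos this, div_le_iff₀ this]

lemma Adm.abs_det_le {x C : ℝ} {k : ℝ → ℝ → ℝ} (h : Adm x C k) {n : ℕ} {u : Fin n → ℝ}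
    (hu : ∀ i, u i ∈ Ioi x) :
    |(Matrix.of fun i j => k (u i) (u j)).det| ≤ √n ^ n * C ^ n * ∏ i, wt (u i) ^ 2 := by
  rw [det_kernel_eq, abs_mul, abs_of_nonneg (by positivity), mul_comm]
  gcongr
  exact abs_det_le_of_entries h.nonneg fun i j => abs_div_wt_le (h.bound _ (hu i) _ (hu j))

lemma measurable_det_kernel {k : ℝ → ℝ → ℝ} (hk : Measurable (Function.uncurry k)) (n : ℕ) :
    Measurable fun u : Fin n → ℝ => (Matrix.of fun i j => k (u i) (u j)).det := by
  simp only [Matrix.det_apply', Matrix.of_apply]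
  refine Finset.measurable_sum _ fun σ _ => Measurable.const_mul ?_ _
  refine Finset.measurable_prod _ fun i _ => ?_
  have : Measurable fun u : Fin n → ℝ => (u (σ i), u i) := by fun_prop
  exact hk.comp this

lemma Adm.integrable_det {x C : ℝ} {k : ℝ → ℝ → ℝ} (h : Adm x C k) (n : ℕ) :
    Integrable (fun u : Fin n → ℝ => (Matrix.of fun i j => k (u i) (u j)).det)
      (Measure.pi fun _ : Fin n => mu x) := by
  refine Integrable.mono' ((integrable_prod_wt x n).const_mul (√n ^ n * C ^ n))
    (measurable_det_kernel h.meas n).aestronglyMeasurable ?_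
  filter_upwards [ae_pi_mem x n] with u hu
  exact h.abs_det_le hu

lemma abs_neg_one_pow_div_factorial (n : ℕ) :
    |(-1 : ℝ) ^ n / (n.factorial : ℝ)| = 1 / n.factorial := by
  rw [abs_div, abs_pow, abs_neg, abs_one, one_pow, abs_of_nonneg (by positivity)]

lemma Adm.abs_fredholmTerm_le {x C : ℝ} {k : ℝ → ℝ → ℝ} (h : Adm x C k) (n : ℕ) :
    |fredholmTerm k x n| ≤ √n ^ n / (n.factorial : ℝ) * (C * mass x) ^ n := by
  rw [fredholmTerm_eq, abs_mul, abs_neg_one_pow_div_factorial]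
  have : |∫ u, (Matrix.of fun i j => k (u i) (u j)).det ∂(Measure.pi fun _ : Fin n => mu x)|
      ≤ √n ^ n * C ^ n * mass x ^ n := by
    rw [← integral_prod_wt, ← integral_const_mul]
    refine norm_integral_le_of_norm_le (G := ℝ) ((integrable_prod_wt x n).const_mul _) ?_
    filter_upwards [ae_pi_mem x n] with u hu
    exact h.abs_det_le hu
  calc 1 / (n.factorial : ℝ) * _ ≤ 1 / (n.factorial : ℝ) * (√n ^ n * C ^ n * mass x ^ n) := by
        gcongr
    _ = _ := by rw [mul_pow]; ring

lemma Adm.summable_fredholmTerm {x C : ℝ} {k : ℝ → ℝ → ℝ} (h : Adm x C k) :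
    Summable (fredholmTerm k x) :=
  Summable.of_norm_bounded (summable_hadamard _ (mul_nonneg h.nonneg (mass_nonneg x)))
    h.abs_fredholmTerm_le

lemma Adm.fredholmConverges {x C : ℝ} {k : ℝ → ℝ → ℝ} (h : Adm x C k) :
    FredholmConverges k x := by
  refine ⟨fun n => ?_, h.summable_fredholmTerm⟩
  rw [IntegrableOn, volume_pi, Measure.restrict_pi_pi]
  exact h.integrable_det n

/-- A Lipschitz constant of the Fredholm determinant. -/
def lipConst (x C : ℝ) : ℝ := ∑' n : ℕ, √n ^ n / (n.factorial : ℝ) * (2 * C * mass x) ^ n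

/-- This is the estimate that transfers expansions of kernels, with errors measured in the weighted
supremum norm, to expansions of determinants. -/
lemma Adm.abs_fredholmDet_sub_le {x C δ : ℝ} {k l : ℝ → ℝ → ℝ} (hk : Adm x C k) (hl : Adm x C l)
    (hC : 1 ≤ C) (hδ : 0 ≤ δ)
    (hd : ∀ u ∈ Ioi x, ∀ v ∈ Ioi x, |k u v - l u v| ≤ δ * (wt u * wt v)) :
    |fredholmDet k x - fredholmDet l x| ≤ lipConst x C * δ := by
  have hC0 : 0 ≤ C := by linarith
  have hm := mass_nonneg x
  have key : ∀ n : ℕ, ‖fredholmTerm k x n - fredholmTerm l x n‖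
      ≤ √n ^ n / (n.factorial : ℝ) * (2 * C * mass x) ^ n * δ := by
    intro n
    rw [fredholmTerm_eq, fredholmTerm_eq, ← mul_sub,
      ← integral_sub (hk.integrable_det n) (hl.integrable_det n), norm_mul, Real.norm_eq_abs,
      abs_neg_one_pow_div_factorial]
    have : ‖∫ u, ((Matrix.of fun i j => k (u i) (u j)).det
        - (Matrix.of fun i j => l (u i) (u j)).det) ∂(Measure.pi fun _ : Fin n => mu x)‖
        ≤ √n ^ n * n * C ^ (n - 1) * δ * mass x ^ n := by
      rw [← integral_prod_wt, ← integral_const_mul]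
      refine norm_integral_le_of_norm_le ((integrable_prod_wt x n).const_mul _) ?_
      filter_upwards [ae_pi_mem x n] with u hu
      rw [det_kernel_eq k, det_kernel_eq l, ← mul_sub, norm_mul, Real.norm_of_nonneg
        (by positivity), mul_comm]
      gcongr
      refine abs_det_sub_le_of_entries hC0 hδ (fun i j => abs_div_wt_le (hk.bound _ (hu i) _ (hu j)))
        (fun i j => abs_div_wt_le (hl.bound _ (hu i) _ (hu j))) fun i j => ?_
      rw [← sub_div]
      exact abs_div_wt_le (hd _ (hu i) _ (hu j))
    -- The assumption 1 ≤ C permits raising the exponent from n - 1 to n. At n = 0, where n - 1 is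
    -- truncated, the factor n vanishes.
    have h2 : (n : ℝ) * C ^ (n - 1) ≤ 2 ^ n * C ^ n := by
      have : (n : ℝ) ≤ 2 ^ n := by exact_mod_cast Nat.lt_two_pow_self.le
      have : C ^ (n - 1) ≤ C ^ n := pow_le_pow_right₀ hC (by omega)
      gcongr
    calc 1 / (n.factorial : ℝ) * _
        ≤ 1 / (n.factorial : ℝ) * (√n ^ n * n * C ^ (n - 1) * δ * mass x ^ n) := by gcongr
      _ = √n ^ n / (n.factorial : ℝ) * (n * C ^ (n - 1)) * mass x ^ n * δ := by ring
      _ ≤ √n ^ n / (n.factorial : ℝ) * (2 ^ n * C ^ n) * mass x ^ n * δ := by gcongr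
      _ = _ := by rw [mul_pow, mul_pow]; ring
  have hs := summable_hadamard (2 * C * mass x) (by positivity)
  rw [fredholmDet, fredholmDet, ← hk.summable_fredholmTerm.tsum_sub hl.summable_fredholmTerm,
    lipConst, ← tsum_mul_right]
  exact tsum_of_norm_bounded (hs.mul_right δ).hasSum key

lemma fredholmDet_congr {x : ℝ} {k l : ℝ → ℝ → ℝ}
    (h : ∀ u ∈ Ioi x, ∀ v ∈ Ioi x, k u v = l u v) : fredholmDet k x = fredholmDet l x := by
  unfold fredholmDet
  congr 1
  funext n
  rw [fredholmTerm_eq, fredholmTerm_eq]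
  congr 1
  refine integral_congr_ae ?_
  filter_upwards [ae_pi_mem x n] with u hu
  congr 1
  ext i j
  exact h _ (hu i) _ (hu j)

/-- Dominated convergence for Fredholm determinants. -/
lemma tendsto_fredholmDet {x C : ℝ} {k : ℕ → ℝ → ℝ → ℝ} {l : ℝ → ℝ → ℝ}
    (hk : ∀ N, Adm x C (k N))
    (hlim : ∀ u ∈ Ioi x, ∀ v ∈ Ioi x, Tendsto (fun N => k N u v) atTop (𝓝 (l u v))) :
    Tendsto (fun N => fredholmDet (k N) x) atTop (𝓝 (fredholmDet l x)) := by
  have hC := (hk 0).nonneg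
  refine tendsto_tsum_of_dominated_convergence
    (summable_hadamard _ (mul_nonneg hC (mass_nonneg x))) (fun n => ?_)
    (Eventually.of_forall fun N n => (hk N).abs_fredholmTerm_le n)
  simp_rw [fredholmTerm_eq]
  refine Tendsto.const_mul _ ?_
  refine tendsto_integral_of_dominated_convergence (fun u => √n ^ n * C ^ n * ∏ i, wt (u i) ^ 2)
    (fun N => (measurable_det_kernel (hk N).meas n).aestronglyMeasurable)
    ((integrable_prod_wt x n).const_mul _) (fun N => ?_) ?_
  · filter_upwards [ae_pi_mem x n] with u hu
    exact (hk N).abs_det_le hu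
  · filter_upwards [ae_pi_mem x n] with u hu
    simp only [Matrix.det_apply', Matrix.of_apply]
    refine tendsto_finsetSum _ fun σ _ => Tendsto.const_mul _ ?_
    exact tendsto_finsetProd _ fun i _ => hlim _ (hu _) _ (hu _)

lemma fredholmTerm_smul (k : ℝ → ℝ → ℝ) (x s : ℝ) (n : ℕ) :
    fredholmTerm (fun u v => s * k u v) x n = s ^ n * fredholmTerm k x n := by
  rw [fredholmTerm_eq, fredholmTerm_eq, mul_left_comm, ← integral_const_mul (s ^ n)]
  congr 2
  funext u
  have : (Matrix.of fun i j => s * k (u i) (u j)) = s • Matrix.of fun i j => k (u i) (u j) := rfl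
  rw [this, Matrix.det_smul, Fintype.card_fin]

lemma fredholmDet_zero (x : ℝ) : fredholmDet (fun _ _ => 0) x = 1 := by
  rw [fredholmDet, tsum_eq_single 0]
  · simp [fredholmTerm_eq, Measure.real]
  · intro n hn
    have := fredholmTerm_smul (fun _ _ => 0) x 0 n
    simpa [hn] using this

/-- The n-th term scales by sⁿ, so for 0 ≤ s ≤ 1 the series is dominated by the absolutely
convergent series at s = 1. -/
lemma Adm.continuousOn_fredholmDet_smul {x C : ℝ} {k : ℝ → ℝ → ℝ} (h : Adm x C k) :
    ContinuousOn (fun s : ℝ => fredholmDet (fun u v => s * k u v) x) (Icc 0 1) := by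
  unfold fredholmDet
  refine continuousOn_tsum (u := fun n => |fredholmTerm k x n|) (fun n => ?_)
    h.summable_fredholmTerm.abs fun n s hs => ?_
  · simp_rw [fredholmTerm_smul]; fun_prop
  · rw [fredholmTerm_smul, norm_mul, norm_pow, Real.norm_eq_abs, Real.norm_eq_abs,
      abs_of_nonneg hs.1]
    exact mul_le_of_le_one_left (abs_nonneg _) (pow_le_one₀ hs.1 hs.2)

/-! ### Degenerate kernels -/

/-- Multilinearity expands the determinant over the choice c of one summand in each row. Reindexing
the φ-factors by the permutation collects everything that depends on u b into the b-th factor, which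
prepares for integration one variable at a time. -/
lemma det_sum_mul {n : ℕ} {ι : Type*} [Fintype ι] (φ ψ : ι → ℝ → ℝ)
    (u : Fin n → ℝ) :
    (Matrix.of fun a b => ∑ i, φ i (u a) * ψ i (u b)).det
      = ∑ c : Fin n → ι, ∑ σ : Equiv.Perm (Fin n), (Equiv.Perm.sign σ : ℝ) *
          ∏ b, (φ (c b) (u b) * ψ (c (σ b)) (u b)) := by
  classical
  have h := MultilinearMap.map_sum
    (Matrix.detRowAlternating (R := ℝ) (n := Fin n)).toMultilinearMap
    (fun (a : Fin n) (i : ι) (b : Fin n) => φ i (u a) * ψ i (u b))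
  have e : (Matrix.of fun a b => ∑ i, φ i (u a) * ψ i (u b)).det
      = (Matrix.detRowAlternating (R := ℝ) (n := Fin n)).toMultilinearMap
        (fun a => ∑ i, fun b => φ i (u a) * ψ i (u b)) := by
    change Matrix.det _ = Matrix.det _
    congr 1
    ext a b
    simp
  rw [e, h]
  refine Finset.sum_congr rfl fun c _ => ?_
  change Matrix.det (Matrix.of fun a b => φ (c a) (u a) * ψ (c a) (u b)) = _
  rw [Matrix.det_apply']
  refine Finset.sum_congr rfl fun σ _ => ?_
  congr 1
  simp only [Matrix.of_apply, Finset.prod_mul_distrib]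
  congr 1
  exact Equiv.prod_comp σ fun a => φ (c a) (u a)

/-- The Fredholm determinant of a degenerate kernel is a finite determinant. -/
lemma fredholmDet_degenerate {ι : Type*} [Fintype ι] [DecidableEq ι] {x : ℝ} (φ ψ : ι → ℝ → ℝ)
    (hint : ∀ i j, Integrable (fun u => φ i u * ψ j u) (mu x)) :
    fredholmDet (fun u v => ∑ i, φ i u * ψ i v) x
      = (1 - Matrix.of fun i j => ∫ u, ψ i u * φ j u ∂(mu x)).det := by
  set G : Matrix ι ι ℝ := Matrix.of fun i j => ∫ u, ψ i u * φ j u ∂(mu x) with hG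
  rw [fredholmDet, ← (hasSum_det_tuples G).tsum_eq]
  congr 1
  funext n
  rw [fredholmTerm_eq]
  congr 1
  simp_rw [det_sum_mul]
  have hI : ∀ (c : Fin n → ι) (σ : Equiv.Perm (Fin n)), Integrable
      (fun u : Fin n → ℝ => (Equiv.Perm.sign σ : ℝ) * ∏ b, (φ (c b) (u b) * ψ (c (σ b)) (u b)))
      (Measure.pi fun _ : Fin n => mu x) := fun c σ =>
    (Integrable.fintype_prod (f := fun b u => φ (c b) u * ψ (c (σ b)) u)
      fun b => hint _ _).const_mul _
  rw [integral_finsetSum _ fun c _ => integrable_finsetSum _ fun σ _ => hI c σ]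
  refine Finset.sum_congr rfl fun c _ => ?_
  -- Each term is a product of functions of one variable, so its integral is a product of entries of
  -- `G`. Summing over the permutations rebuilds the determinant of the submatrix of `G` indexed by
  -- c.
  rw [integral_finsetSum _ fun σ _ => hI c σ, Matrix.det_apply']
  refine Finset.sum_congr rfl fun σ _ => ?_
  rw [integral_const_mul,
    integral_fintype_prod_eq_prod (fun (b : Fin n) (u : ℝ) => φ (c b) u * ψ (c (σ b)) u)]
  congr 1
  refine Finset.prod_congr rfl fun b _ => ?_
  simp only [hG, Matrix.submatrix_apply, Matrix.of_apply]
  congr 1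
  funext u
  ring

end RAiry
end

noncomputable section

namespace RAiry

open Filter Topology

/-! ### Composition of kernels and multiplicativity of the Fredholm determinant -/

/-- The kernel of the composition of two integral operators on `L²(x, ∞)`. -/
def comp (x : ℝ) (k l : ℝ → ℝ → ℝ) (u v : ℝ) : ℝ := ∫ w, k u w * l w v ∂(mu x)

lemma Adm.abs_mul_le {x C C' : ℝ} {k l : ℝ → ℝ → ℝ} (hk : Adm x C k) (hl : Adm x C' l)
    {u v w : ℝ} (hu : u ∈ Ioi x) (hv : v ∈ Ioi x) (hw : w ∈ Ioi x) :
    |k u w * l w v| ≤ C * C' * (wt u * wt v) * wt w ^ 2 := by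
  rw [abs_mul]
  calc |k u w| * |l w v| ≤ (C * (wt u * wt w)) * (C' * (wt w * wt v)) :=
        mul_le_mul (hk.bound u hu w hw) (hl.bound w hw v hv) (abs_nonneg _)
          ((abs_nonneg _).trans (hk.bound u hu w hw))
    _ = _ := by ring

lemma Adm.measurable_mul {x C C' : ℝ} {k l : ℝ → ℝ → ℝ} (hk : Adm x C k) (hl : Adm x C' l)
    (u v : ℝ) : Measurable fun w => k u w * l w v :=
  (hk.meas.comp (measurable_const.prodMk measurable_id)).mul
    (hl.meas.comp (measurable_id.prodMk measurable_const))

/-! ### Discretization of kernels and Riemann sums -/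

/-- The `i`-th cell of the grid of width `1 / n` on `(x, x + n]`. -/
def cell (x : ℝ) (n i : ℕ) : Set ℝ := Ioc (x + i / n) (x + (i + 1) / n)

/-- The right endpoint of the `i`-th cell. -/
def node (x : ℝ) (n i : ℕ) : ℝ := x + (i + 1) / n

/-- The right endpoint of the cell containing `u`. -/
def sample (x : ℝ) (n : ℕ) (u : ℝ) : ℝ := x + ⌈(u - x) * n⌉₊ / n

/-- The indicator function of a cell. -/
def cellInd (x : ℝ) (n i : ℕ) : ℝ → ℝ := (cell x n i).indicator 1

lemma measurable_cellInd (x : ℝ) (n i : ℕ) : Measurable (cellInd x n i) :=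
  measurable_one.indicator measurableSet_Ioc

lemma le_sample {x u : ℝ} {n : ℕ} (hn : 0 < n) : u ≤ sample x n u := by
  have hn' : (0 : ℝ) < n := by exact_mod_cast hn
  have := Nat.le_ceil ((u - x) * n)
  have : u - x ≤ ⌈(u - x) * n⌉₊ / n := by rwa [le_div_iff₀ hn']
  rw [sample]; linarith

lemma sample_le {x u : ℝ} {n : ℕ} (hn : 0 < n) (hu : x < u) : sample x n u ≤ u + 1 / n := by
  have hn' : (0 : ℝ) < n := by exact_mod_cast hn
  have := (Nat.ceil_lt_add_one (mul_nonneg (sub_pos.2 hu).le hn'.le)).le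
  have : (⌈(u - x) * n⌉₊ : ℝ) / n ≤ u - x + 1 / n := by
    rw [div_le_iff₀ hn', add_mul, one_div, inv_mul_cancel₀ hn'.ne']; exact this
  rw [sample]; linarith

lemma tendsto_sample {x u : ℝ} (hu : x < u) :
    Tendsto (fun N : ℕ => sample x (N + 1) u) atTop (𝓝 u) := by
  have h1 : Tendsto (fun N : ℕ => u + 1 / ((N : ℝ) + 1)) atTop (𝓝 (u + 0)) :=
    tendsto_const_nhds.add tendsto_one_div_add_atTop_nhds_zero_nat
  rw [add_zero] at h1
  refine tendsto_of_tendsto_of_tendsto_of_le_of_le tendsto_const_nhds h1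
    (fun N => le_sample N.succ_pos) fun N => ?_
  have := sample_le (n := N + 1) N.succ_pos hu
  push_cast at this
  exact this

lemma mem_cell_iff {x u : ℝ} {n i : ℕ} (hn : 0 < n) :
    u ∈ cell x n i ↔ ⌈(u - x) * n⌉₊ = i + 1 := by
  have hn' : (0 : ℝ) < n := by exact_mod_cast hn
  rw [Nat.ceil_eq_iff (by omega), cell, mem_Ioc]
  push_cast
  rw [← lt_sub_iff_add_lt', div_lt_iff₀ hn', ← sub_le_iff_le_add', le_div_iff₀ hn']

/-- At most one cell contains u, and its node is the sample point of u. There are n² cells of width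
1/n, so that the mesh shrinks while the grid exhausts (x, ∞). -/
lemma sum_cellInd_mul {x u : ℝ} {n : ℕ} (hn : 0 < n) (F : ℝ → ℝ) :
    ∑ i : Fin (n * n), cellInd x n i u * F (node x n i)
      = (Ioc x (x + n)).indicator (fun u => F (sample x n u)) u := by
  classical
  have hn' : (0 : ℝ) < n := by exact_mod_cast hn
  have hc : (u ∈ Ioc x (x + n)) ↔ 0 < ⌈(u - x) * n⌉₊ ∧ ⌈(u - x) * n⌉₊ ≤ n * n := by
    rw [Nat.ceil_pos, Nat.ceil_le, mem_Ioc]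
    push_cast
    constructor
    · rintro ⟨h1, h2⟩
      exact ⟨mul_pos (by linarith) hn', mul_le_mul_of_nonneg_right (by linarith) hn'.le⟩
    · rintro ⟨h1, h2⟩
      exact ⟨by linarith [pos_of_mul_pos_left h1 hn'.le],
        by linarith [le_of_mul_le_mul_right h2 hn']⟩
  by_cases hu : u ∈ Ioc x (x + n)
  · rw [indicator_of_mem hu]
    rw [hc] at hu
    rw [Finset.sum_eq_single (⟨⌈(u - x) * n⌉₊ - 1, by omega⟩ : Fin (n * n))]
    · have h1 : ⌈(u - x) * n⌉₊ = (⌈(u - x) * n⌉₊ - 1) + 1 := by omega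
      have : u ∈ cell x n (⌈(u - x) * n⌉₊ - 1) := (mem_cell_iff hn).2 h1
      rw [cellInd, indicator_of_mem this, Pi.one_apply, one_mul, node, sample]
      congr 3
      rw [Nat.cast_sub (by omega)]
      simp
    · intro i _ hi
      have : u ∉ cell x n i := by
        rw [mem_cell_iff hn]
        intro h
        apply hi
        ext
        simp [h]
      rw [cellInd, indicator_of_notMem this, zero_mul]
    · simp
  · rw [indicator_of_notMem hu]
    refine Finset.sum_eq_zero fun i _ => ?_
    have : u ∉ cell x n i := by
      rw [mem_cell_iff hn]
      rw [hc] at hu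
      have := i.2
      omega
    rw [cellInd, indicator_of_notMem this, zero_mul]

lemma integrable_cellInd (x : ℝ) (n i : ℕ) : Integrable (cellInd x n i) (mu x) := by
  have : Integrable (cellInd x n i) volume :=
    (integrable_indicator_iff measurableSet_Ioc).2 (integrableOn_const (by simp))
  exact this.mono_measure Measure.restrict_le_self

lemma integral_cellInd {x : ℝ} {n i : ℕ} (hn : 0 < n) :
    ∫ u, cellInd x n i u ∂(mu x) = 1 / n := by
  have hn' : (0 : ℝ) < n := by exact_mod_cast hn
  have hsub : cell x n i ⊆ Ioi x := fun u hu => lt_of_le_of_lt (by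
    have : (0 : ℝ) ≤ i / n := by positivity
    linarith) hu.1
  rw [cell] at hsub
  rw [cellInd, cell, integral_indicator_one measurableSet_Ioc, Measure.real,
    Measure.restrict_apply measurableSet_Ioc]
  rw [inter_eq_self_of_subset_left hsub, Real.volume_Ioc, ENNReal.toReal_ofReal]
  · ring
  · have : (x + ((i : ℝ) + 1) / n) - (x + i / n) = 1 / n := by ring
    rw [this]; positivity

lemma cellInd_mul_cellInd {x : ℝ} {n i j : ℕ} (hn : 0 < n) (u : ℝ) :
    cellInd x n i u * cellInd x n j u = if i = j then cellInd x n i u else 0 := by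
  by_cases hij : i = j
  · subst hij
    by_cases hu : u ∈ cell x n i <;> simp [cellInd, hu]
  · rw [if_neg hij]
    by_cases hu : u ∈ cell x n i
    · have : u ∉ cell x n j := by
        rw [mem_cell_iff hn] at hu ⊢
        omega
      simp [cellInd, this]
    · simp [cellInd, hu]

/-- The kernel that is constant, equal to the value of `b` at the corner, on the cells of the
grid. -/
def stepKernel (x : ℝ) (n : ℕ) (b : ℝ → ℝ → ℝ) (u v : ℝ) : ℝ :=
  ∑ i : Fin (n * n), cellInd x n i u *
    ∑ j : Fin (n * n), cellInd x n j v * b (node x n i) (node x n j)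

lemma stepKernel_eq {x : ℝ} {n : ℕ} (hn : 0 < n) (b : ℝ → ℝ → ℝ) (u v : ℝ) :
    stepKernel x n b u v = (Ioc x (x + n)).indicator (fun u =>
      (Ioc x (x + n)).indicator (fun v => b (sample x n u) (sample x n v)) v) u := by
  rw [stepKernel]
  simp_rw [sum_cellInd_mul hn]
  exact sum_cellInd_mul hn
    (fun p => (Ioc x (x + n)).indicator (fun v => b p (sample x n v)) v)

lemma measurable_stepKernel (x : ℝ) (n : ℕ) (b : ℝ → ℝ → ℝ) :
    Measurable (Function.uncurry (stepKernel x n b)) := by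
  unfold stepKernel Function.uncurry
  have := measurable_cellInd x n
  fun_prop

lemma wt_anti {u v : ℝ} (h : u ≤ v) : wt v ≤ wt u := Real.exp_le_exp.2 (by linarith)

/-- Sampling at right endpoints keeps the constant C unchanged, because the weight is decreasing.
This uniformity in n is what dominated convergence requires. -/
lemma adm_stepKernel {x C : ℝ} {n : ℕ} (hn : 0 < n) {b : ℝ → ℝ → ℝ}
    (hb : ∀ u ∈ Ioi x, ∀ v ∈ Ioi x, |b u v| ≤ C * (wt u * wt v)) :
    Adm x C (stepKernel x n b) := by
  have hC : 0 ≤ C := nonneg_of_mul_nonneg_left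
    ((abs_nonneg _).trans (hb (x + 1) (by simp) (x + 1) (by simp))) (mul_pos (wt_pos _) (wt_pos _))
  refine ⟨measurable_stepKernel x n b, fun u hu v hv => ?_⟩
  rw [stepKernel_eq hn]
  have h0 : 0 ≤ C * (wt u * wt v) := by have := wt_pos u; have := wt_pos v; positivity
  by_cases h1 : u ∈ Ioc x (x + n)
  · rw [indicator_of_mem h1]
    by_cases h2 : v ∈ Ioc x (x + n)
    · rw [indicator_of_mem h2]
      refine (hb _ (lt_of_lt_of_le h1.1 (le_sample hn)) _
        (lt_of_lt_of_le h2.1 (le_sample hn))).trans ?_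
      have := wt_pos (sample x n v)
      have := wt_pos u
      have := wt_anti (le_sample hn : u ≤ sample x n u)
      have := wt_anti (le_sample hn : v ≤ sample x n v)
      gcongr
    · rw [indicator_of_notMem h2, abs_zero]; exact h0
  · rw [indicator_of_notMem h1, abs_zero]; exact h0

/-- A step kernel is degenerate, and its Gram integrals over disjoint cells of length 1/n are the
values at the nodes divided by n. -/
lemma fredholmDet_stepKernel {x : ℝ} {n : ℕ} (hn : 0 < n) (b : ℝ → ℝ → ℝ) :
    fredholmDet (stepKernel x n b) x
      = (1 - Matrix.of fun i j : Fin (n * n) => b (node x n i) (node x n j) / n).det := by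
  have hmul : ∀ i j : Fin (n * n), ∀ u, (∑ m : Fin (n * n), cellInd x n m u
      * b (node x n i) (node x n m)) * cellInd x n j u
      = b (node x n i) (node x n j) * cellInd x n j u := by
    intro i j u
    rw [Finset.sum_mul, Finset.sum_eq_single j]
    · rw [mul_right_comm, cellInd_mul_cellInd hn, if_pos rfl, mul_comm]
    · intro m _ hm
      rw [mul_right_comm, cellInd_mul_cellInd hn, if_neg (by simpa [Fin.ext_iff] using hm),
        zero_mul]
    · simp
  have h := fredholmDet_degenerate (x := x) (fun i : Fin (n * n) => cellInd x n i)
    (fun i v => ∑ m : Fin (n * n), cellInd x n m v * b (node x n i) (node x n m))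
    (fun i j => by
      simp_rw [mul_comm (cellInd x n i _), hmul]
      exact (integrable_cellInd x n i).const_mul _)
  unfold stepKernel
  rw [h]
  simp_rw [hmul, integral_const_mul, integral_cellInd hn, mul_one_div]

lemma eventually_mem_Ioc {x u : ℝ} (hu : x < u) :
    ∀ᶠ N : ℕ in atTop, u ∈ Ioc x (x + ((N + 1 : ℕ) : ℝ)) := by
  obtain ⟨N₀, hN₀⟩ := exists_nat_ge (u - x)
  filter_upwards [eventually_ge_atTop N₀] with N hN
  refine ⟨hu, ?_⟩
  have : (N₀ : ℝ) ≤ N := by exact_mod_cast hN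
  push_cast
  linarith

lemma tendsto_kernel_sample {x : ℝ} {k : ℝ → ℝ → ℝ}
    (hk : ContinuousOn (Function.uncurry k) (Ioi x ×ˢ Ioi x)) {u v : ℝ} (hu : u ∈ Ioi x)
    (hv : v ∈ Ioi x) :
    Tendsto (fun N : ℕ => k (sample x (N + 1) u) (sample x (N + 1) v)) atTop (𝓝 (k u v)) := by
  have hc : ContinuousAt (Function.uncurry k) (u, v) :=
    hk.continuousAt ((isOpen_Ioi.prod isOpen_Ioi).mem_nhds ⟨hu, hv⟩)
  exact hc.tendsto.comp ((tendsto_sample hu).prodMk_nhds (tendsto_sample hv))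

lemma tendsto_stepKernel {x : ℝ} {b : ℕ → ℝ → ℝ → ℝ} {c u v : ℝ} (hu : u ∈ Ioi x)
    (hv : v ∈ Ioi x)
    (hb : Tendsto (fun N : ℕ => b N (sample x (N + 1) u) (sample x (N + 1) v)) atTop (𝓝 c)) :
    Tendsto (fun N : ℕ => stepKernel x (N + 1) (b N) u v) atTop (𝓝 c) := by
  refine hb.congr' ?_
  filter_upwards [eventually_mem_Ioc hu, eventually_mem_Ioc hv] with N h1 h2
  rw [stepKernel_eq N.succ_pos, indicator_of_mem h1, indicator_of_mem h2]

/-- The Riemann sum that approximates the composition of two kernels. -/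
def compSum (x : ℝ) (n : ℕ) (k l : ℝ → ℝ → ℝ) (u v : ℝ) : ℝ :=
  ∑ m : Fin (n * n), k u (node x n m) * l (node x n m) v / n

lemma compSum_eq {x : ℝ} {n : ℕ} (hn : 0 < n) (k l : ℝ → ℝ → ℝ) (u v : ℝ) :
    compSum x n k l u v = ∫ w, (Ioc x (x + n)).indicator
      (fun w => k u (sample x n w) * l (sample x n w) v) w ∂(mu x) := by
  have : ∀ w, (Ioc x (x + n)).indicator (fun w => k u (sample x n w) * l (sample x n w) v) w
      = ∑ i : Fin (n * n), cellInd x n i w * (k u (node x n i) * l (node x n i) v) :=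
    fun w => (sum_cellInd_mul hn fun p => k u p * l p v).symm
  simp_rw [this]
  rw [integral_finsetSum _ fun (i : Fin (n * n)) _ => (integrable_cellInd x n i).mul_const _]
  simp_rw [integral_mul_const, integral_cellInd hn, compSum]
  exact Finset.sum_congr rfl fun i _ => by ring

lemma Adm.abs_indicator_le {x C C' : ℝ} {k l : ℝ → ℝ → ℝ} (hk : Adm x C k) (hl : Adm x C' l)
    {n : ℕ} (hn : 0 < n) {u v : ℝ} (hu : u ∈ Ioi x) (hv : v ∈ Ioi x) (w : ℝ) :
    |(Ioc x (x + n)).indicator (fun w => k u (sample x n w) * l (sample x n w) v) w|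
      ≤ C * C' * (wt u * wt v) * wt w ^ 2 := by
  have := hk.nonneg
  have := hl.nonneg
  have := wt_pos u
  have := wt_pos v
  by_cases hw : w ∈ Ioc x (x + n)
  · rw [indicator_of_mem hw]
    refine (hk.abs_mul_le hl hu hv (lt_of_lt_of_le hw.1 (le_sample hn))).trans ?_
    have := wt_anti (le_sample hn : w ≤ sample x n w)
    have := wt_pos (sample x n w)
    gcongr
  · rw [indicator_of_notMem hw, abs_zero]
    positivity

lemma Adm.abs_compSum_le {x C C' : ℝ} {k l : ℝ → ℝ → ℝ} (hk : Adm x C k) (hl : Adm x C' l)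
    {n : ℕ} (hn : 0 < n) {u v : ℝ} (hu : u ∈ Ioi x) (hv : v ∈ Ioi x) :
    |compSum x n k l u v| ≤ C * C' * mass x * (wt u * wt v) := by
  rw [compSum_eq hn]
  have h := norm_integral_le_of_norm_le (G := ℝ)
    ((integrable_wt_sq x).const_mul (C * C' * (wt u * wt v)))
    (Eventually.of_forall fun w => hk.abs_indicator_le hl hn hu hv w)
  rw [integral_const_mul] at h
  calc _ ≤ _ := h
    _ = _ := by rw [mass]; ring

lemma measurable_sample (x : ℝ) (n : ℕ) : Measurable (sample x n) := by
  unfold sample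
  exact ((measurable_from_top (f := fun m : ℕ => (m : ℝ))).comp
    (Nat.measurable_ceil.comp (by fun_prop))).div_const _ |>.const_add x

lemma tendsto_compSum {x C C' : ℝ} {k l : ℝ → ℝ → ℝ} (hk : Adm x C k) (hl : Adm x C' l)
    (hkc : ContinuousOn (Function.uncurry k) (Ioi x ×ˢ Ioi x))
    (hlc : ContinuousOn (Function.uncurry l) (Ioi x ×ˢ Ioi x)) {u v : ℝ} (hu : u ∈ Ioi x)
    (hv : v ∈ Ioi x) :
    Tendsto (fun N : ℕ => compSum x (N + 1) k l (sample x (N + 1) u) (sample x (N + 1) v)) atTop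
      (𝓝 (RAiry.comp x k l u v)) := by
  simp_rw [compSum_eq (Nat.succ_pos _)]
  have hs : ∀ (N : ℕ) (u : ℝ), u ∈ Ioi x → sample x (N + 1) u ∈ Ioi x := fun N u hu =>
    lt_of_lt_of_le (mem_Ioi.1 hu) (le_sample N.succ_pos)
  refine tendsto_integral_of_dominated_convergence
    (fun w => C * C' * (wt u * wt v) * wt w ^ 2) (fun N => ?_)
    ((integrable_wt_sq x).const_mul _) (fun N => ?_) ?_
  · refine Measurable.aestronglyMeasurable (Measurable.indicator ?_ measurableSet_Ioc)
    exact (hk.measurable_mul hl _ _).comp (measurable_sample x (N + 1))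
  · refine Eventually.of_forall fun w => ?_
    refine (hk.abs_indicator_le hl N.succ_pos (hs N u hu) (hs N v hv) w).trans ?_
    have := hk.nonneg
    have := hl.nonneg
    have := wt_pos u
    have := wt_anti (le_sample N.succ_pos : u ≤ sample x (N + 1) u)
    have := wt_anti (le_sample N.succ_pos : v ≤ sample x (N + 1) v)
    have := wt_pos (sample x (N + 1) v)
    gcongr
  · filter_upwards [ae_restrict_mem measurableSet_Ioi] with w hw
    refine ((tendsto_kernel_sample hkc hu hw).mul (tendsto_kernel_sample hlc hw hv)).congr' ?_
    filter_upwards [eventually_mem_Ioc hw] with N hN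
    rw [indicator_of_mem hN]

/-- The Fredholm determinant is multiplicative. -/
theorem fredholmDet_mul {x C C' : ℝ} {k l : ℝ → ℝ → ℝ} (hk : Adm x C k) (hl : Adm x C' l)
    (hkc : ContinuousOn (Function.uncurry k) (Ioi x ×ˢ Ioi x))
    (hlc : ContinuousOn (Function.uncurry l) (Ioi x ×ˢ Ioi x)) :
    fredholmDet (fun u v => k u v + l u v - RAiry.comp x k l u v) x
      = fredholmDet k x * fredholmDet l x := by
  -- For the matrices of values at the nodes divided by n, the product (1 - k)(1 - l) is 1 minus the
  -- matrix of `b`. So multiplicativity is the product rule for finite determinants at each stage,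
  -- followed by three limits of step kernels.
  let b : ℕ → ℝ → ℝ → ℝ := fun N u v => k u v + l u v - compSum x (N + 1) k l u v
  have h1 : Tendsto (fun N : ℕ => fredholmDet (stepKernel x (N + 1) k) x) atTop
      (𝓝 (fredholmDet k x)) := by
    refine tendsto_fredholmDet (C := C) (fun N => adm_stepKernel N.succ_pos hk.bound)
      fun u hu v hv => ?_
    exact tendsto_stepKernel (b := fun _ => k) hu hv (tendsto_kernel_sample hkc hu hv)
  have h2 : Tendsto (fun N : ℕ => fredholmDet (stepKernel x (N + 1) l) x) atTop
      (𝓝 (fredholmDet l x)) := by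
    refine tendsto_fredholmDet (C := C') (fun N => adm_stepKernel N.succ_pos hl.bound)
      fun u hu v hv => ?_
    exact tendsto_stepKernel (b := fun _ => l) hu hv (tendsto_kernel_sample hlc hu hv)
  have h3 : Tendsto (fun N : ℕ => fredholmDet (stepKernel x (N + 1) (b N)) x) atTop
      (𝓝 (fredholmDet (fun u v => k u v + l u v - RAiry.comp x k l u v) x)) := by
    refine tendsto_fredholmDet (C := C + C' + C * C' * mass x)
      (fun N => adm_stepKernel N.succ_pos fun u hu v hv => ?_) fun u hu v hv => ?_
    · refine (abs_sub _ _).trans ?_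
      refine (add_le_add ((abs_add_le _ _).trans (add_le_add (hk.bound u hu v hv)
        (hl.bound u hu v hv))) (hk.abs_compSum_le hl N.succ_pos hu hv)).trans (le_of_eq ?_)
      ring
    · exact tendsto_stepKernel hu hv (((tendsto_kernel_sample hkc hu hv).add
        (tendsto_kernel_sample hlc hu hv)).sub (tendsto_compSum hk hl hkc hlc hu hv))
  refine tendsto_nhds_unique h3 ((h1.mul h2).congr fun N => ?_)
  rw [fredholmDet_stepKernel N.succ_pos, fredholmDet_stepKernel N.succ_pos,
    fredholmDet_stepKernel N.succ_pos, ← Matrix.det_mul]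
  congr 1
  rw [sub_mul, mul_sub, mul_sub, one_mul, one_mul, mul_one]
  have : ((Matrix.of fun i j : Fin ((N + 1) * (N + 1)) =>
      b N (node x (N + 1) i) (node x (N + 1) j) / ((N + 1 : ℕ) : ℝ)) : Matrix _ _ ℝ)
      = (Matrix.of fun i j : Fin ((N + 1) * (N + 1)) =>
          k (node x (N + 1) i) (node x (N + 1) j) / ((N + 1 : ℕ) : ℝ))
        + (Matrix.of fun i j : Fin ((N + 1) * (N + 1)) =>
          l (node x (N + 1) i) (node x (N + 1) j) / ((N + 1 : ℕ) : ℝ))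
        - (Matrix.of fun i j : Fin ((N + 1) * (N + 1)) =>
          k (node x (N + 1) i) (node x (N + 1) j) / ((N + 1 : ℕ) : ℝ))
        * (Matrix.of fun i j : Fin ((N + 1) * (N + 1)) =>
          l (node x (N + 1) i) (node x (N + 1) j) / ((N + 1 : ℕ) : ℝ)) := by
    ext i j
    simp only [b, compSum, Matrix.of_apply, Matrix.sub_apply, Matrix.add_apply, Matrix.mul_apply,
      sub_div, add_div, Finset.sum_div]
    congr 1
    refine Finset.sum_congr rfl fun m _ => ?_
    ring
  rw [this]
  abel

/-! ### Change of variables -/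

lemma fredholmDet_translate (k : ℝ → ℝ → ℝ) (x e : ℝ) :
    fredholmDet k (x + e) = fredholmDet (fun u v => k (u + e) (v + e)) x := by
  unfold fredholmDet
  congr 1
  funext n
  unfold fredholmTerm
  congr 1
  rw [← integral_indicator (MeasurableSet.univ_pi fun _ => measurableSet_Ioi),
    ← integral_indicator (MeasurableSet.univ_pi fun _ => measurableSet_Ioi),
    ← integral_add_right_eq_self _ (fun _ : Fin n => e)]
  congr 1
  funext u
  have : (u + fun _ : Fin n => e) ∈ Set.univ.pi (fun _ : Fin n => Ioi (x + e))
      ↔ u ∈ Set.univ.pi (fun _ : Fin n => Ioi x) := by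
    simp
  by_cases h : u ∈ Set.univ.pi (fun _ : Fin n => Ioi x)
  · rw [indicator_of_mem h, indicator_of_mem (this.2 h)]; rfl
  · rw [indicator_of_notMem h, indicator_of_notMem (fun h' => h (this.1 h'))]

lemma fredholmDet_dilate (k : ℝ → ℝ → ℝ) (x : ℝ) {c : ℝ} (hc : 0 < c) :
    fredholmDet k (c * x) = fredholmDet (fun u v => c * k (c * u) (c * v)) x := by
  unfold fredholmDet
  congr 1
  funext n
  rw [fredholmTerm_smul]
  unfold fredholmTerm
  rw [mul_left_comm]
  congr 1
  rw [← integral_indicator (MeasurableSet.univ_pi fun _ => measurableSet_Ioi),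
    ← integral_indicator (MeasurableSet.univ_pi fun _ => measurableSet_Ioi)]
  have h1 := Measure.integral_comp_smul (volume : Measure (Fin n → ℝ))
    ((Set.univ.pi fun _ : Fin n => Ioi (c * x)).indicator
      fun u => (Matrix.of fun i j => k (u i) (u j)).det) c
  have h2 : ∀ u : Fin n → ℝ, (Set.univ.pi fun _ : Fin n => Ioi (c * x)).indicator
      (fun u => (Matrix.of fun i j => k (u i) (u j)).det) (c • u)
      = (Set.univ.pi fun _ : Fin n => Ioi x).indicator
      (fun u => (Matrix.of fun i j => k (c * u i) (c * u j)).det) u := by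
    intro u
    have : (c • u) ∈ Set.univ.pi (fun _ : Fin n => Ioi (c * x))
        ↔ u ∈ Set.univ.pi (fun _ : Fin n => Ioi x) := by
      simp [hc]
    by_cases h : u ∈ Set.univ.pi (fun _ : Fin n => Ioi x)
    · rw [indicator_of_mem h, indicator_of_mem (this.2 h)]; rfl
    · rw [indicator_of_notMem h, indicator_of_notMem (fun h' => h (this.1 h'))]
  simp_rw [h2] at h1
  rw [h1, Module.finrank_fin_fun, abs_of_pos (by positivity), smul_eq_mul, ← mul_assoc,
    mul_inv_cancel₀ (by positivity), one_mul]

end RAiry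
end

noncomputable section

namespace RAiry

open Filter Topology

/-! ### Integral operators on `L²(x, ∞)` -/

open scoped Classical in
/-- The class of `f` in `L²(x, ∞)`. -/
def vec (x : ℝ) (f : ℝ → ℝ) : L2 x :=
  if h : MemLp f 2 (mu x) then h.toLp f else 0

lemma vec_eq {x : ℝ} {f : ℝ → ℝ} (h : MemLp f 2 (mu x)) : vec x f = h.toLp f := dif_pos h

lemma coeFn_vec {x : ℝ} {f : ℝ → ℝ} (h : MemLp f 2 (mu x)) : vec x f =ᵐ[mu x] f := by
  rw [vec_eq h]; exact h.coeFn_toLp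

lemma eq_vec {x : ℝ} {f : ℝ → ℝ} (h : MemLp f 2 (mu x)) {F : L2 x} (hF : F =ᵐ[mu x] f) :
    F = vec x f := Lp.ext (hF.trans (coeFn_vec h).symm)

lemma inner_eq_integral {x : ℝ} (F G : L2 x) : inner ℝ F G = ∫ u, F u * G u ∂(mu x) := by
  rw [L2.inner_def]
  congr 1
  funext u
  simp [mul_comm]

lemma integrable_mul_L2 {x : ℝ} (F G : L2 x) : Integrable (fun u => F u * G u) (mu x) := by
  have := L2.integrable_inner (𝕜 := ℝ) F G
  refine this.congr (Eventually.of_forall fun u => ?_)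
  simp [mul_comm]

lemma inner_vec_left {x : ℝ} {f : ℝ → ℝ} (h : MemLp f 2 (mu x)) (F : L2 x) :
    inner ℝ (vec x f) F = ∫ u, f u * F u ∂(mu x) := by
  rw [inner_eq_integral]
  refine integral_congr_ae ?_
  filter_upwards [coeFn_vec h] with u hu
  rw [hu]

lemma integrable_mul_vec {x : ℝ} {f : ℝ → ℝ} (h : MemLp f 2 (mu x)) (F : L2 x) :
    Integrable (fun u => f u * F u) (mu x) := by
  refine (integrable_mul_L2 (vec x f) F).congr ?_
  filter_upwards [coeFn_vec h] with u hu
  rw [hu]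

lemma inner_vec_vec {x : ℝ} {f g : ℝ → ℝ} (hf : MemLp f 2 (mu x)) (hg : MemLp g 2 (mu x)) :
    inner ℝ (vec x f) (vec x g) = ∫ u, f u * g u ∂(mu x) := by
  rw [inner_vec_left hf]
  refine integral_congr_ae ?_
  filter_upwards [coeFn_vec hg] with u hu
  rw [hu]

/-- The function `f` is measurable and bounded by `C wt(u)` for `u > x`. -/
structure Dom (x C : ℝ) (f : ℝ → ℝ) : Prop where
  meas : Measurable f
  bound : ∀ u ∈ Ioi x, |f u| ≤ C * wt u

lemma memLp_wt (x : ℝ) : MemLp wt 2 (mu x) := by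
  rw [memLp_two_iff_integrable_sq continuous_wt.aestronglyMeasurable]
  exact integrable_wt_sq x

lemma Dom.ae_bound {x C : ℝ} {f : ℝ → ℝ} (h : Dom x C f) :
    ∀ᵐ u ∂(mu x), ‖f u‖ ≤ C * ‖wt u‖ := by
  filter_upwards [ae_restrict_mem measurableSet_Ioi] with u hu
  rw [Real.norm_of_nonneg (wt_pos u).le]
  exact h.bound u hu

lemma Dom.memLp {x C : ℝ} {f : ℝ → ℝ} (h : Dom x C f) : MemLp f 2 (mu x) :=
  (memLp_wt x).of_le_mul h.meas.aestronglyMeasurable h.ae_bound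

lemma norm_le_of_ae_le_wt {x c : ℝ} {F : L2 x} (h : ∀ᵐ u ∂(mu x), |F u| ≤ c * wt u) :
    ‖F‖ ≤ c * ‖vec x wt‖ := by
  refine Lp.norm_le_mul_norm_of_ae_le_mul ?_
  filter_upwards [h, coeFn_vec (memLp_wt x)] with u h1 h2
  rw [h2, Real.norm_of_nonneg (wt_pos u).le]
  exact h1

lemma Dom.norm_vec_le {x C : ℝ} {f : ℝ → ℝ} (h : Dom x C f) :
    ‖vec x f‖ ≤ C * ‖vec x wt‖ := by
  refine norm_le_of_ae_le_wt ?_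
  filter_upwards [coeFn_vec h.memLp, ae_restrict_mem measurableSet_Ioi] with u h1 h2
  rw [h1]
  exact h.bound u h2

lemma Adm.dom_left {x C : ℝ} {k : ℝ → ℝ → ℝ} (h : Adm x C k) {u : ℝ} (hu : u ∈ Ioi x) :
    Dom x (C * wt u) (k u) :=
  ⟨h.meas.comp (measurable_const.prodMk measurable_id), fun v hv =>
    (h.bound u hu v hv).trans (le_of_eq (by ring))⟩

lemma Adm.swap {x C : ℝ} {k : ℝ → ℝ → ℝ} (h : Adm x C k) : Adm x C fun u v => k v u :=
  ⟨h.meas.comp measurable_swap, fun u hu v hv => (h.bound v hv u hu).trans (le_of_eq (by ring))⟩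

lemma Adm.dom_right {x C : ℝ} {k : ℝ → ℝ → ℝ} (h : Adm x C k) {v : ℝ} (hv : v ∈ Ioi x) :
    Dom x (C * wt v) fun u => k u v := h.swap.dom_left hv

/-- The value at `u` of the integral operator with kernel `k` applied to `F`. -/
def apply (x : ℝ) (k : ℝ → ℝ → ℝ) (F : L2 x) (u : ℝ) : ℝ := ∫ v, k u v * F v ∂(mu x)

lemma Adm.apply_eq_inner {x C : ℝ} {k : ℝ → ℝ → ℝ} (h : Adm x C k) {u : ℝ} (hu : u ∈ Ioi x)
    (F : L2 x) : apply x k F u = inner ℝ (vec x (k u)) F := by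
  rw [inner_vec_left (h.dom_left hu).memLp, apply]

lemma Adm.measurable_apply {x C : ℝ} {k : ℝ → ℝ → ℝ} (h : Adm x C k) (F : L2 x) :
    Measurable (apply x k F) := by
  have : StronglyMeasurable fun p : ℝ × ℝ => k p.1 p.2 * F p.2 :=
    h.meas.stronglyMeasurable.mul ((Lp.stronglyMeasurable F).comp_measurable measurable_snd)
  exact this.integral_prod_right.measurable

lemma Adm.dom_apply {x C : ℝ} {k : ℝ → ℝ → ℝ} (h : Adm x C k) (F : L2 x) :
    Dom x (C * ‖vec x wt‖ * ‖F‖) (apply x k F) := by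
  refine ⟨h.measurable_apply F, fun u hu => ?_⟩
  rw [h.apply_eq_inner hu]
  refine (abs_real_inner_le_norm _ _).trans ?_
  calc ‖vec x (k u)‖ * ‖F‖ ≤ (C * wt u * ‖vec x wt‖) * ‖F‖ := by
        gcongr; exact (h.dom_left hu).norm_vec_le
    _ = _ := by ring

/-- The integral operator with kernel `k`. -/
def Adm.op {x C : ℝ} {k : ℝ → ℝ → ℝ} (h : Adm x C k) : L2 x →L[ℝ] L2 x :=
  LinearMap.mkContinuous
    { toFun := fun F => vec x (apply x k F)
      map_add' := fun F G => by
        symm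
        refine eq_vec (h.dom_apply _).memLp ?_
        filter_upwards [Lp.coeFn_add (vec x (apply x k F)) (vec x (apply x k G)),
          coeFn_vec (h.dom_apply F).memLp, coeFn_vec (h.dom_apply G).memLp,
          ae_restrict_mem measurableSet_Ioi] with u h1 h2 h3 hu
        rw [h1, Pi.add_apply, h2, h3, h.apply_eq_inner hu, h.apply_eq_inner hu,
          h.apply_eq_inner hu, inner_add_right]
      map_smul' := fun c F => by
        symm
        refine eq_vec (h.dom_apply _).memLp ?_
        filter_upwards [Lp.coeFn_smul c (vec x (apply x k F)),
          coeFn_vec (h.dom_apply F).memLp,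
          ae_restrict_mem measurableSet_Ioi] with u h1 h2 hu
        rw [RingHom.id_apply, h1, Pi.smul_apply, h2, h.apply_eq_inner hu, h.apply_eq_inner hu,
          inner_smul_right, smul_eq_mul] }
    (C * ‖vec x wt‖ * ‖vec x wt‖)
    (fun F => by
      refine (h.dom_apply F).norm_vec_le.trans (le_of_eq ?_)
      ring)

lemma Adm.op_apply {x C : ℝ} {k : ℝ → ℝ → ℝ} (h : Adm x C k) (F : L2 x) :
    h.op F = vec x (apply x k F) := rfl

lemma Adm.op_ae {x C : ℝ} {k : ℝ → ℝ → ℝ} (h : Adm x C k) (F : L2 x) :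
    ∀ᵐ u ∂(mu x), h.op F u = inner ℝ (vec x (k u)) F := by
  filter_upwards [coeFn_vec (h.dom_apply F).memLp, ae_restrict_mem measurableSet_Ioi] with u h1 hu
  rw [h.op_apply, h1, h.apply_eq_inner hu]

lemma Adm.isIntegralOperator {x C : ℝ} {k : ℝ → ℝ → ℝ} (h : Adm x C k) :
    IsIntegralOperator x k h.op := by
  intro F
  filter_upwards [coeFn_vec (h.dom_apply F).memLp, ae_restrict_mem measurableSet_Ioi] with u h1 hu
  exact ⟨integrable_mul_vec (h.dom_left hu).memLp F, by rw [h.op_apply, h1, apply]⟩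

lemma Adm.inner_op {x C : ℝ} {k : ℝ → ℝ → ℝ} (h : Adm x C k) (hsymm : ∀ u v, k u v = k v u)
    (F G : L2 x) : inner ℝ (h.op F) G = inner ℝ F (h.op G) := by
  have e1 : inner ℝ (h.op F) G = ∫ u, ∫ v, k u v * F v * G u ∂(mu x) ∂(mu x) := by
    rw [inner_eq_integral]
    refine integral_congr_ae ?_
    filter_upwards [coeFn_vec (h.dom_apply F).memLp] with u h1
    rw [h.op_apply, h1, apply, ← integral_mul_const]
  have e2 : inner ℝ F (h.op G) = ∫ v, ∫ u, k u v * F v * G u ∂(mu x) ∂(mu x) := by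
    rw [inner_eq_integral]
    refine integral_congr_ae ?_
    filter_upwards [coeFn_vec (h.dom_apply G).memLp] with v h1
    rw [h.op_apply, h1, apply, ← integral_const_mul]
    refine integral_congr_ae (Eventually.of_forall fun u => ?_)
    simp only [hsymm v u]
    ring
  rw [e1, e2]
  refine integral_integral_swap ?_
  have hF : Integrable (fun v => wt v * F v) (mu x) := integrable_mul_vec (memLp_wt x) F
  have hG : Integrable (fun v => wt v * G v) (mu x) := integrable_mul_vec (memLp_wt x) G
  refine Integrable.mono' ((hG.norm.mul_prod hF.norm).const_mul C) ?_ ?_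
  · have : StronglyMeasurable fun p : ℝ × ℝ => k p.1 p.2 * F p.2 * G p.1 :=
      (h.meas.stronglyMeasurable.mul ((Lp.stronglyMeasurable F).comp_measurable measurable_snd)).mul
        ((Lp.stronglyMeasurable G).comp_measurable measurable_fst)
    exact this.aestronglyMeasurable
  · rw [Measure.prod_restrict]
    filter_upwards [ae_restrict_mem (measurableSet_Ioi.prod measurableSet_Ioi)] with p hp
    have hb := h.bound p.1 hp.1 p.2 hp.2
    simp only [Function.uncurry, norm_mul, Real.norm_eq_abs, abs_of_pos (wt_pos _)]
    calc |k p.1 p.2| * |F p.2| * |G p.1| ≤ (C * (wt p.1 * wt p.2)) * |F p.2| * |G p.1| := by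
          gcongr
      _ = _ := by ring

/-! ### Compactness -/

/-- The operator norm is bounded by the Hilbert–Schmidt norm of the difference of the kernels, by
Cauchy–Schwarz at each u. -/
lemma Adm.norm_op_sub_le {x C C' ε : ℝ} {k l : ℝ → ℝ → ℝ} (hk : Adm x C k) (hl : Adm x C' l)
    (hε : 0 ≤ ε)
    (h : ∫ u, ‖vec x (k u) - vec x (l u)‖ ^ 2 ∂(mu x) ≤ ε ^ 2)
    (hi : Integrable (fun u => ‖vec x (k u) - vec x (l u)‖ ^ 2) (mu x)) :
    ‖hk.op - hl.op‖ ≤ ε := by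
  refine ContinuousLinearMap.opNorm_le_bound _ hε fun F => ?_
  refine abs_le_of_sq_le_sq' (a := ‖(hk.op - hl.op) F‖) ?_ (by positivity) |>.2
  rw [← real_inner_self_eq_norm_sq, inner_eq_integral]
  calc ∫ u, ((hk.op - hl.op) F) u * ((hk.op - hl.op) F) u ∂(mu x)
      ≤ ∫ u, ‖vec x (k u) - vec x (l u)‖ ^ 2 * ‖F‖ ^ 2 ∂(mu x) := by
        refine integral_mono_ae (integrable_mul_L2 _ _) (hi.mul_const _) ?_
        filter_upwards [hk.op_ae F, hl.op_ae F, Lp.coeFn_sub (hk.op F) (hl.op F)] with u h1 h2 h3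
        rw [sub_apply, h3, Pi.sub_apply, h1, h2, ← inner_sub_left, ← pow_two,
          ← mul_pow, ← sq_abs]
        gcongr
        exact abs_real_inner_le_norm _ _
    _ = (∫ u, ‖vec x (k u) - vec x (l u)‖ ^ 2 ∂(mu x)) * ‖F‖ ^ 2 := integral_mul_const _ _
    _ ≤ ε ^ 2 * ‖F‖ ^ 2 := by gcongr
    _ = (ε * ‖F‖) ^ 2 := by ring

lemma vec_sub {x : ℝ} {f g : ℝ → ℝ} (hf : MemLp f 2 (mu x)) (hg : MemLp g 2 (mu x)) :
    vec x f - vec x g = vec x (f - g) := by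
  refine eq_vec (hf.sub hg) ?_
  filter_upwards [Lp.coeFn_sub (vec x f) (vec x g), coeFn_vec hf, coeFn_vec hg] with u h1 h2 h3
  rw [h1, Pi.sub_apply, h2, h3, Pi.sub_apply]

lemma norm_vec_sq {x : ℝ} {f : ℝ → ℝ} (hf : MemLp f 2 (mu x)) :
    ‖vec x f‖ ^ 2 = ∫ u, f u ^ 2 ∂(mu x) := by
  rw [← real_inner_self_eq_norm_sq, inner_vec_vec hf hf]
  simp only [pow_two]

lemma tendsto_vec {ι : Type*} {L : Filter ι} [L.IsCountablyGenerated] {x C : ℝ}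
    {f : ι → ℝ → ℝ} {g : ℝ → ℝ} (hf : ∀ᶠ i in L, Dom x C (f i)) (hg : Dom x C g)
    (h : ∀ u ∈ Ioi x, Tendsto (fun i => f i u) L (𝓝 (g u))) :
    Tendsto (fun i => vec x (f i)) L (𝓝 (vec x g)) := by
  rw [tendsto_iff_norm_sub_tendsto_zero]
  have h1 : Tendsto (fun i => ‖vec x (f i) - vec x g‖ ^ 2) L (𝓝 0) := by
    have h2 : Tendsto (fun i => ∫ u, (f i u - g u) ^ 2 ∂(mu x)) L (𝓝 (∫ _, (0 : ℝ) ∂(mu x))) := by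
      refine tendsto_integral_filter_of_dominated_convergence
        (fun u => (2 * C) ^ 2 * wt u ^ 2) ?_ ?_ ((integrable_wt_sq x).const_mul _) ?_
      · filter_upwards [hf] with i hi
        exact ((hi.meas.sub hg.meas).pow_const 2).aestronglyMeasurable
      · filter_upwards [hf] with i hi
        filter_upwards [ae_restrict_mem measurableSet_Ioi] with u hu
        rw [Real.norm_eq_abs, abs_pow, ← mul_pow]
        gcongr
        refine (abs_sub _ _).trans ?_
        linarith [hi.bound u hu, hg.bound u hu]
      · filter_upwards [ae_restrict_mem measurableSet_Ioi] with u hu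
        have := ((h u hu).sub_const (g u)).pow 2
        simpa using this
    rw [integral_zero] at h2
    refine h2.congr' ?_
    filter_upwards [hf] with i hi
    rw [vec_sub hi.memLp hg.memLp, norm_vec_sq (hi.memLp.sub hg.memLp)]
    rfl
  have h3 := h1.sqrt
  simpa [Real.sqrt_sq (norm_nonneg _)] using h3

lemma isCompactOperator_rankOne {x : ℝ} (F G : L2 x) :
    IsCompactOperator (InnerProductSpace.rankOne ℝ F G) := by
  rw [InnerProductSpace.rankOne_def']
  have h : IsCompactOperator (innerSL ℝ G : L2 x →L[ℝ] ℝ) :=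
    (isCompactOperator_id (E := ℝ)).comp_clm (innerSL ℝ G : L2 x →L[ℝ] ℝ)
  exact h.clm_comp (ContinuousLinearMap.toSpanSingleton ℝ F)

lemma dom_cellInd (x : ℝ) (n i : ℕ) : MemLp (cellInd x n i) 2 (mu x) := by
  rw [memLp_two_iff_integrable_sq (measurable_cellInd x n i).aestronglyMeasurable]
  refine (integrable_cellInd x n i).congr (Eventually.of_forall fun u => ?_)
  by_cases h : u ∈ cell x n i <;> simp [cellInd, h]

lemma isCompactOperator_op_stepKernel {x C : ℝ} {n : ℕ} {b : ℝ → ℝ → ℝ}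
    (h : Adm x C (stepKernel x n b)) : IsCompactOperator h.op := by
  let ψ : Fin (n * n) → ℝ → ℝ := fun i v =>
    ∑ j : Fin (n * n), cellInd x n j v * b (node x n i) (node x n j)
  have hψ : ∀ i, MemLp (ψ i) 2 (mu x) := fun i =>
    memLp_finsetSum _ fun j _ => (dom_cellInd x n j).mul_const _
  have e : h.op = ∑ i : Fin (n * n),
      InnerProductSpace.rankOne ℝ (vec x (cellInd x n i)) (vec x (ψ i)) := by
    ext1 F
    symm
    refine eq_vec (h.dom_apply F).memLp ?_
    have e1 : ∀ᵐ u ∂(mu x), ((∑ i : Fin (n * n), InnerProductSpace.rankOne ℝ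
        (vec x (cellInd x n i)) (vec x (ψ i))) F : L2 x) u
        = ∑ i : Fin (n * n), inner ℝ (vec x (ψ i)) F * (vec x (cellInd x n i)) u := by
      rw [sum_apply]
      simp only [InnerProductSpace.rankOne_apply]
      have h2 : ∀ᵐ u ∂(mu x), ∀ i : Fin (n * n), (inner ℝ (vec x (ψ i)) F •
          vec x (cellInd x n i) : L2 x) u = inner ℝ (vec x (ψ i)) F * (vec x (cellInd x n i)) u :=
        ae_all_iff.2 fun i => Lp.coeFn_smul _ _
      filter_upwards [Lp.coeFn_finsetSum Finset.univ fun i : Fin (n * n) =>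
        (inner ℝ (vec x (ψ i)) F • vec x (cellInd x n i) : L2 x), h2] with u h1 h2
      rw [h1, Finset.sum_apply]
      exact Finset.sum_congr rfl fun i _ => h2 i
    have e2 : ∀ᵐ u ∂(mu x), ∀ i : Fin (n * n), (vec x (cellInd x n i)) u = cellInd x n i u :=
      ae_all_iff.2 fun i => coeFn_vec (dom_cellInd x n i)
    filter_upwards [e1, e2] with u h1 h2
    rw [h1, apply]
    simp only [stepKernel, Finset.sum_mul]
    rw [integral_finsetSum]
    · refine Finset.sum_congr rfl fun i _ => ?_
      rw [h2 i, inner_vec_left (hψ i), ← integral_mul_const]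
      congr 1
      funext v
      simp only [ψ]
      ring
    · intro i _
      refine ((integrable_mul_vec (hψ i) F).const_mul (cellInd x n i u)).congr
        (Eventually.of_forall fun v => ?_)
      simp only [ψ]
      ring
  rw [e]
  exact (compactOperator (RingHom.id ℝ) (L2 x) (L2 x)).sum_mem
    (fun i _ => isCompactOperator_rankOne _ _)

/-- An integral operator with a continuous kernel is compact. -/
lemma Adm.isCompactOperator {x C : ℝ} {k : ℝ → ℝ → ℝ} (h : Adm x C k)
    (hc : ContinuousOn (Function.uncurry k) (Ioi x ×ˢ Ioi x)) : IsCompactOperator h.op := by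
  -- The step kernels give operators of finite rank. They converge to the operator in
  -- Hilbert–Schmidt norm by dominated convergence, hence in operator norm.
  have hs : ∀ N : ℕ, Adm x C (stepKernel x (N + 1) k) := fun N =>
    adm_stepKernel N.succ_pos h.bound
  have hb : ∀ (N : ℕ), ∀ u ∈ Ioi x, ‖vec x (stepKernel x (N + 1) k u) - vec x (k u)‖
      ≤ 2 * C * ‖vec x wt‖ * wt u := fun N u hu =>
    (norm_sub_le _ _).trans (by
      have h1 := ((hs N).dom_left hu).norm_vec_le
      have h2 := (h.dom_left hu).norm_vec_le
      linarith)
  have hm : ∀ N : ℕ, AEStronglyMeasurable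
      (fun u => ‖vec x (stepKernel x (N + 1) k u) - vec x (k u)‖ ^ 2) (mu x) := by
    intro N
    have h1 : Measurable fun u => ∫ v, (stepKernel x (N + 1) k u v - k u v) ^ 2 ∂(mu x) :=
      (((hs N).meas.sub h.meas).pow_const 2).stronglyMeasurable.integral_prod_right.measurable
    refine h1.aestronglyMeasurable.congr ?_
    filter_upwards [ae_restrict_mem measurableSet_Ioi] with u hu
    have m1 := ((hs N).dom_left hu).memLp
    have m2 := (h.dom_left hu).memLp
    rw [vec_sub m1 m2, norm_vec_sq (m1.sub m2)]
    rfl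
  have hbd : ∀ N : ℕ, ∀ᵐ u ∂(mu x), ‖‖vec x (stepKernel x (N + 1) k u) - vec x (k u)‖ ^ 2‖
      ≤ (2 * C * ‖vec x wt‖) ^ 2 * wt u ^ 2 := by
    intro N
    filter_upwards [ae_restrict_mem measurableSet_Ioi] with u hu
    rw [norm_pow, norm_norm, ← mul_pow]
    gcongr
    exact hb N u hu
  have hdom : Integrable (fun u => (2 * C * ‖vec x wt‖) ^ 2 * wt u ^ 2) (mu x) :=
    (integrable_wt_sq x).const_mul _
  have hlim : Tendsto (fun N : ℕ => ∫ u, ‖vec x (stepKernel x (N + 1) k u) - vec x (k u)‖ ^ 2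
      ∂(mu x)) atTop (𝓝 0) := by
    have := tendsto_integral_of_dominated_convergence (μ := mu x) (f := fun _ => (0 : ℝ))
      (fun u => (2 * C * ‖vec x wt‖) ^ 2 * wt u ^ 2) hm hdom hbd ?_
    · simpa using this
    · filter_upwards [ae_restrict_mem measurableSet_Ioi] with u hu
      have h1 : Tendsto (fun N : ℕ => vec x (stepKernel x (N + 1) k u)) atTop (𝓝 (vec x (k u))) :=
        tendsto_vec (Eventually.of_forall fun N => (hs N).dom_left hu) (h.dom_left hu)
          fun v hv => tendsto_stepKernel (b := fun _ => k) hu hv (tendsto_kernel_sample hc hu hv)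
      have h2 := (tendsto_iff_norm_sub_tendsto_zero.1 h1).pow 2
      simpa using h2
  refine isCompactOperator_of_tendsto (F := fun N : ℕ => (hs N).op) (l := atTop) ?_
    (Eventually.of_forall fun N => isCompactOperator_op_stepKernel (hs N))
  rw [tendsto_iff_norm_sub_tendsto_zero]
  have h2 := hlim.sqrt
  rw [Real.sqrt_zero] at h2
  refine squeeze_zero (fun _ => norm_nonneg _) (fun N => ?_) h2
  refine (hs N).norm_op_sub_le h (Real.sqrt_nonneg _) ?_ (hdom.mono' (hm N) (hbd N))
  rw [Real.sq_sqrt (integral_nonneg fun _ => sq_nonneg _)]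

/-- Fredholm alternative: for a compact operator the number 1 is an eigenvalue or belongs to the
resolvent set. -/
lemma Adm.isUnit_one_sub {x C : ℝ} {k : ℝ → ℝ → ℝ} (h : Adm x C k)
    (hc : ContinuousOn (Function.uncurry k) (Ioi x ×ˢ Ioi x))
    (hinj : ∀ F : L2 x, h.op F = F → F = 0) : IsUnit (1 - h.op) := by
  rcases (h.isCompactOperator hc).hasEigenvalue_or_mem_resolventSet (one_ne_zero (α := ℝ)) with
    h1 | h1
  · obtain ⟨F, hF, hF0⟩ := h1.exists_hasEigenvector
    rw [Module.End.mem_eigenspace_iff, one_smul] at hF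
    exact absurd (hinj F hF) hF0
  · rw [spectrum.mem_resolventSet_iff, map_one] at h1
    exact h1

end RAiry
end

noncomputable section

namespace RAiry

open Filter Topology

/-! ### The resolvent -/

/-- Written this way, the resolvent applied to F is F plus a value of T. For an integral operator
with continuous kernel that value has a continuous representative, which is needed because
multiplicativity of determinants is available for continuous kernels. -/
lemma inverse_apply {E : Type*} [NormedAddCommGroup E] [NormedSpace ℝ E] {T : E →L[ℝ] E}
    (hU : IsUnit (1 - T)) (F : E) :
    Ring.inverse (1 - T) F = F + T (Ring.inverse (1 - T) F) := by
  have h := congrArg (fun S : E →L[ℝ] E => S F) (Ring.mul_inverse_cancel _ hU)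
  simp only [mul_apply_eq_comp, sub_apply] at h
  rw [sub_eq_iff_eq_add] at h
  exact h

lemma Adm.continuousOn_vec {x C : ℝ} {k : ℝ → ℝ → ℝ} (h : Adm x C k)
    (hc : ContinuousOn (Function.uncurry k) (Ioi x ×ˢ Ioi x)) :
    ContinuousOn (fun u => vec x (k u)) (Ioi x) := by
  intro u hu
  refine ContinuousAt.continuousWithinAt ?_
  have hC := h.nonneg
  refine tendsto_vec (C := C * wt x) ?_ ?_ fun v hv => ?_
  · filter_upwards [isOpen_Ioi.mem_nhds hu] with u' hu'
    have hd := h.dom_left hu'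
    refine ⟨hd.meas, fun v hv => (hd.bound v hv).trans ?_⟩
    have := wt_anti (le_of_lt (mem_Ioi.1 hu'))
    have := wt_pos v
    gcongr
  · have hd := h.dom_left hu
    refine ⟨hd.meas, fun v hv => (hd.bound v hv).trans ?_⟩
    have := wt_anti (le_of_lt (mem_Ioi.1 hu))
    have := wt_pos v
    gcongr
  · have hca : ContinuousAt (Function.uncurry k) (u, v) :=
      hc.continuousAt ((isOpen_Ioi.prod isOpen_Ioi).mem_nhds ⟨hu, hv⟩)
    exact hca.tendsto.comp (tendsto_id.prodMk_nhds tendsto_const_nhds)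

/-- The continuous representative of `(I - K)⁻¹ f`, where `R` stands for `(I - K)⁻¹`. -/
def resolve (x : ℝ) (k : ℝ → ℝ → ℝ) (R : L2 x →L[ℝ] L2 x) (f : ℝ → ℝ) : ℝ → ℝ :=
  (Ioi x).indicator fun u => f u + inner ℝ (vec x (k u)) (R (vec x f))

lemma resolve_apply {x : ℝ} (k : ℝ → ℝ → ℝ) (R : L2 x →L[ℝ] L2 x) (f : ℝ → ℝ) {u : ℝ}
    (hu : u ∈ Ioi x) : resolve x k R f u = f u + inner ℝ (vec x (k u)) (R (vec x f)) :=
  indicator_of_mem hu _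

lemma measurable_indicator_of_continuousOn {α : Type*} [TopologicalSpace α] [MeasurableSpace α]
    [BorelSpace α] {s : Set α} (hs : MeasurableSet s) {f : α → ℝ} (hf : ContinuousOn f s) :
    Measurable (s.indicator f) := by
  classical
  rw [← piecewise_eq_indicator]
  exact hf.measurable_piecewise continuousOn_const hs

section

variable {x C : ℝ} {k : ℝ → ℝ → ℝ}

lemma continuousOn_resolve (h : Adm x C k)
    (hc : ContinuousOn (Function.uncurry k) (Ioi x ×ˢ Ioi x)) (R : L2 x →L[ℝ] L2 x) {f : ℝ → ℝ}
    (hf : ContinuousOn f (Ioi x)) :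
    ContinuousOn (resolve x k R f) (Ioi x) :=
  (hf.add ((h.continuousOn_vec hc).inner continuousOn_const)).congr
    fun _ hu => resolve_apply k R f hu

lemma dom_resolve (h : Adm x C k)
    (hc : ContinuousOn (Function.uncurry k) (Ioi x ×ˢ Ioi x)) (R : L2 x →L[ℝ] L2 x) {f : ℝ → ℝ}
    {D : ℝ} (hf : ContinuousOn f (Ioi x)) (hd : Dom x D f) :
    Dom x (D * (1 + C * ‖vec x wt‖ ^ 2 * ‖R‖)) (resolve x k R f) := by
  refine ⟨measurable_indicator_of_continuousOn measurableSet_Ioi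
    (hf.add ((h.continuousOn_vec hc).inner continuousOn_const)), fun u hu => ?_⟩
  rw [resolve_apply k R f hu]
  refine (abs_add_le _ _).trans ?_
  have hC := h.nonneg
  have hw := wt_pos u
  have h1 : |inner ℝ (vec x (k u)) (R (vec x f))|
      ≤ (C * wt u * ‖vec x wt‖) * (‖R‖ * (D * ‖vec x wt‖)) := by
    refine (abs_real_inner_le_norm _ _).trans ?_
    gcongr
    · exact (h.dom_left hu).norm_vec_le
    · exact (R.le_opNorm _).trans (by gcongr; exact hd.norm_vec_le)
  calc _ ≤ D * wt u + (C * wt u * ‖vec x wt‖) * (‖R‖ * (D * ‖vec x wt‖)) :=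
        add_le_add (hd.bound u hu) h1
    _ = _ := by ring

lemma vec_resolve (h : Adm x C k)
    (hc : ContinuousOn (Function.uncurry k) (Ioi x ×ˢ Ioi x)) (hU : IsUnit (1 - h.op)) {f : ℝ → ℝ}
    {D : ℝ} (hf : ContinuousOn f (Ioi x)) (hd : Dom x D f) :
    vec x (resolve x k (Ring.inverse (1 - h.op)) f) = Ring.inverse (1 - h.op) (vec x f) := by
  symm
  refine eq_vec (dom_resolve h hc _ hf hd).memLp ?_
  rw [inverse_apply hU]
  filter_upwards [Lp.coeFn_add (vec x f) (h.op (Ring.inverse (1 - h.op) (vec x f))),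
    coeFn_vec hd.memLp, h.op_ae (Ring.inverse (1 - h.op) (vec x f)),
    ae_restrict_mem measurableSet_Ioi] with u h1 h2 h3 hu
  rw [h1, Pi.add_apply, h2, h3, resolve_apply _ _ _ hu]

lemma inner_vec_resolve (h : Adm x C k)
    (hc : ContinuousOn (Function.uncurry k) (Ioi x ×ˢ Ioi x)) (hU : IsUnit (1 - h.op)) {f : ℝ → ℝ}
    {D : ℝ} (hf : ContinuousOn f (Ioi x)) (hd : Dom x D f) {u : ℝ} (hu : u ∈ Ioi x) :
    inner ℝ (vec x (k u)) (vec x (resolve x k (Ring.inverse (1 - h.op)) f))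
      = resolve x k (Ring.inverse (1 - h.op)) f u - f u := by
  rw [vec_resolve h hc hU hf hd, resolve_apply _ _ _ hu, add_sub_cancel_left]

/-- The Fredholm determinant of a perturbation of finite rank. -/
theorem fredholmDet_add_degenerate (h : Adm x C k)
    (hc : ContinuousOn (Function.uncurry k) (Ioi x ×ˢ Ioi x)) (hU : IsUnit (1 - h.op))
    {ι : Type*} [Fintype ι] [DecidableEq ι]
    {f g : ι → ℝ → ℝ} {D : ℝ} (hf : ∀ i, ContinuousOn (f i) (Ioi x)) (hfd : ∀ i, Dom x D (f i))
    (hg : ∀ i, ContinuousOn (g i) (Ioi x)) (hgd : ∀ i, Dom x D (g i)) :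
    fredholmDet (fun u v => k u v + ∑ i, f i u * g i v) x
      = fredholmDet k x * (1 - Matrix.of fun i j =>
          inner ℝ (vec x (g i)) (Ring.inverse (1 - h.op) (vec x (f j)))).det := by
  set R := Ring.inverse (1 - h.op) with hR
  -- The proof rests on the factorization I - K - ∑ fᵢ⊗gᵢ = (I - K)(I - ∑ φᵢ⊗gᵢ), where φᵢ is the
  -- continuous representative of (I - K)⁻¹ fᵢ. The second factor is degenerate, so its determinant
  -- is finite.
  set φ : ι → ℝ → ℝ := fun i => resolve x k R (f i) with hφ
  have hφd : ∀ i, Dom x (D * (1 + C * ‖vec x wt‖ ^ 2 * ‖R‖)) (φ i) := fun i =>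
    dom_resolve h hc R (hf i) (hfd i)
  have hφc : ∀ i, ContinuousOn (φ i) (Ioi x) := fun i => continuousOn_resolve h hc R (hf i)
  let l : ℝ → ℝ → ℝ := fun u v => ∑ i, φ i u * g i v
  have hl : Adm x (∑ _i : ι, D * (1 + C * ‖vec x wt‖ ^ 2 * ‖R‖) * D) l := by
    constructor
    · refine Finset.measurable_sum (f := fun i (p : ℝ × ℝ) => φ i p.1 * g i p.2) _ fun i _ => ?_
      exact ((hφd i).meas.comp measurable_fst).mul ((hgd i).meas.comp measurable_snd)
    · intro u hu v hv
      rw [Finset.sum_mul]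
      refine (Finset.abs_sum_le_sum_abs _ _).trans (Finset.sum_le_sum fun i _ => ?_)
      exact (adm_mul (hφd i).meas (hgd i).meas (hφd i).bound (hgd i).bound).bound u hu v hv
  have hlc : ContinuousOn (Function.uncurry l) (Ioi x ×ˢ Ioi x) := by
    refine continuousOn_finsetSum (f := fun i (p : ℝ × ℝ) => φ i p.1 * g i p.2) _ fun i _ => ?_
    exact ((hφc i).comp continuousOn_fst fun p hp => hp.1).mul
      ((hg i).comp continuousOn_snd fun p hp => hp.2)
  have h1 := fredholmDet_mul h hl hc hlc
  have h2 : fredholmDet l x = (1 - Matrix.of fun i j =>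
      inner ℝ (vec x (g i)) (R (vec x (f j)))).det := by
    have := fredholmDet_degenerate (x := x) φ g (fun i j =>
      (hφd i).memLp.integrable_mul (hgd j).memLp)
    refine this.trans ?_
    congr 2
    ext i j
    rw [Matrix.of_apply, Matrix.of_apply, ← vec_resolve h hc hU (hf j) (hfd j),
      inner_vec_vec (hgd i).memLp (hφd j).memLp]
  rw [← h2, ← h1]
  refine fredholmDet_congr fun u hu v hv => ?_
  have h3 : RAiry.comp x k l u v = ∑ i, (φ i u - f i u) * g i v := by
    have e : ∀ i, ∫ w, k u w * φ i w ∂(mu x) = φ i u - f i u := fun i => by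
      rw [← inner_vec_vec (h.dom_left hu).memLp (hφd i).memLp]
      exact inner_vec_resolve h hc hU (hf i) (hfd i) hu
    simp_rw [← e, ← integral_mul_const]
    rw [← integral_finsetSum]
    · rw [RAiry.comp]
      congr 1
      funext w
      rw [Finset.mul_sum]
      exact Finset.sum_congr rfl fun i _ => by ring
    · intro i _
      exact ((h.dom_left hu).memLp.integrable_mul (hφd i).memLp).mul_const _
  rw [h3]
  simp only [l, sub_mul, Finset.sum_sub_distrib]
  ring

/-- The Fredholm determinant does not vanish if `I - K` is invertible. -/
theorem fredholmDet_ne_zero (h : Adm x C k)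
    (hc : ContinuousOn (Function.uncurry k) (Ioi x ×ˢ Ioi x)) (hU : IsUnit (1 - h.op)) :
    fredholmDet k x ≠ 0 := by
  set R := Ring.inverse (1 - h.op) with hR
  have hk2 : ∀ v ∈ Ioi x, ContinuousOn (fun u => k u v) (Ioi x) := fun v hv =>
    hc.comp (by fun_prop : ContinuousOn (fun u : ℝ => (u, v)) (Ioi x)) fun u hu => ⟨hu, hv⟩
  -- This is the kernel of -RK, continuous in both variables. Since R = I + RK, the operator I - ρ
  -- is the inverse of I - K, and multiplicativity makes the product of the two determinants equal
  -- to 1.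
  let ρ' : ℝ × ℝ → ℝ := fun p =>
    -(k p.1 p.2 + inner ℝ (vec x (k p.1)) (R (vec x fun w => k w p.2)))
  let ρ : ℝ → ℝ → ℝ := fun u v => (Ioi x ×ˢ Ioi x).indicator ρ' (u, v)
  have hswap : ContinuousOn (Function.uncurry fun u v => k v u) (Ioi x ×ˢ Ioi x) :=
    hc.comp continuous_swap.continuousOn fun p hp => ⟨hp.2, hp.1⟩
  have hρc' : ContinuousOn ρ' (Ioi x ×ˢ Ioi x) := by
    refine (hc.add (ContinuousOn.inner ?_ ?_)).neg
    · exact (h.continuousOn_vec hc).comp continuousOn_fst fun p hp => hp.1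
    · exact R.continuous.comp_continuousOn
        ((h.swap.continuousOn_vec hswap).comp continuousOn_snd fun p hp => hp.2)
  have hρe : ∀ u ∈ Ioi x, ∀ v ∈ Ioi x, ρ u v = -resolve x k R (fun w => k w v) u := by
    intro u hu v hv
    simp only [ρ, ρ']
    rw [indicator_of_mem (mk_mem_prod hu hv), resolve_apply _ _ _ hu]
  have hρc : ContinuousOn (Function.uncurry ρ) (Ioi x ×ˢ Ioi x) :=
    hρc'.congr fun p hp => indicator_of_mem hp _
  have hρ : Adm x (C * (1 + C * ‖vec x wt‖ ^ 2 * ‖R‖)) ρ := by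
    refine ⟨measurable_indicator_of_continuousOn (measurableSet_Ioi.prod measurableSet_Ioi) hρc',
      fun u hu v hv => ?_⟩
    rw [hρe u hu v hv, abs_neg]
    refine ((dom_resolve h hc R (hk2 v hv) (h.dom_right hv)).bound u hu).trans (le_of_eq ?_)
    ring
  have h1 := fredholmDet_mul h hρ hc hρc
  have h2 : fredholmDet (fun u v => k u v + ρ u v - RAiry.comp x k ρ u v) x = 1 := by
    rw [← fredholmDet_zero x]
    refine fredholmDet_congr fun u hu v hv => ?_
    have e : RAiry.comp x k ρ u v = -(resolve x k R (fun w => k w v) u - k u v) := by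
      rw [← inner_vec_resolve h hc hU (hk2 v hv) (h.dom_right hv) hu, inner_vec_vec
        (h.dom_left hu).memLp (dom_resolve h hc R (hk2 v hv) (h.dom_right hv)).memLp,
        ← integral_neg, RAiry.comp]
      refine integral_congr_ae ?_
      filter_upwards [ae_restrict_mem measurableSet_Ioi] with w hw
      rw [hρe w hw v hv, mul_neg]
    rw [e, hρe u hu v hv]
    ring
  rw [h2] at h1
  exact left_ne_zero_of_mul_eq_one h1.symm

end

lemma Adm.smul_op {x C : ℝ} {k : ℝ → ℝ → ℝ} (h : Adm x C k) (s : ℝ) :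
    (h.smul s).op = s • h.op := by
  ext1 F
  symm
  refine eq_vec ((h.smul s).dom_apply F).memLp ?_
  filter_upwards [Lp.coeFn_smul s (h.op F), coeFn_vec (h.dom_apply F).memLp] with u h1 h2
  rw [smul_apply, h1, Pi.smul_apply, h.op_apply, h2, apply, apply,
    smul_eq_mul, ← integral_const_mul]
  congr 1
  funext v
  ring

/-- The Fredholm determinant is positive if `1 / s` is not an eigenvalue for `0 ≤ s ≤ 1`. -/
theorem fredholmDet_pos {x C : ℝ} {k : ℝ → ℝ → ℝ} (h : Adm x C k)
    (hc : ContinuousOn (Function.uncurry k) (Ioi x ×ˢ Ioi x))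
    (hinj : ∀ s ∈ Icc (0 : ℝ) 1, ∀ F : L2 x, s • h.op F = F → F = 0) : 0 < fredholmDet k x := by
  have hne : ∀ s ∈ Icc (0 : ℝ) 1, fredholmDet (fun u v => s * k u v) x ≠ 0 := by
    intro s hs
    have hc' : ContinuousOn (Function.uncurry fun u v => s * k u v) (Ioi x ×ˢ Ioi x) :=
      continuousOn_const.mul hc
    refine fredholmDet_ne_zero (h.smul s) hc' ((h.smul s).isUnit_one_sub hc' fun F hF => ?_)
    rw [h.smul_op] at hF
    exact hinj s hs F hF
  have h1 : fredholmDet (fun u v => (1 : ℝ) * k u v) x = fredholmDet k x := by simp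
  have h0 : fredholmDet (fun u v => (0 : ℝ) * k u v) x = 1 := by simp [fredholmDet_zero]
  -- The function s ↦ det(I - sK) is continuous on [0, 1], equals 1 at s = 0 and has no zero, so it
  -- cannot reach a nonpositive value at s = 1.
  by_contra hneg
  push Not at hneg
  have hivt := intermediate_value_Icc' (zero_le_one (α := ℝ)) h.continuousOn_fredholmDet_smul
  rw [h1, h0] at hivt
  obtain ⟨s, hs, hs0⟩ := hivt ⟨hneg, zero_le_one⟩
  exact hne s hs hs0

/-! ### Traces -/

/-- The value of the trace is Parseval's identity. For two different bases each term is bounded by a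
sum of squares of coefficients of F and of G, which is summable by Bessel's inequality. -/
lemma hasTrace_rankOne {x : ℝ} (F G : L2 x) :
    HasTrace (InnerProductSpace.rankOne ℝ F G) (inner ℝ G F) := by
  constructor
  · intro ι b e
    have h1 := e.orthonormal.inner_products_summable (x := G)
    have h2 := b.orthonormal.inner_products_summable (x := F)
    refine Summable.of_norm_bounded (h1.add h2) fun i => ?_
    rw [InnerProductSpace.rankOne_apply, inner_smul_right, norm_mul, real_inner_comm (e i) G]
    nlinarith [sq_nonneg (‖inner ℝ (e i) G‖ - ‖inner ℝ (b i) F‖),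
      norm_nonneg (inner ℝ (e i) G), norm_nonneg (inner ℝ (b i) F)]
  · intro ι b
    simpa only [InnerProductSpace.rankOne_apply, inner_smul_right] using
      b.hasSum_inner_mul_inner G F

lemma HasTrace.add {x : ℝ} {S T : L2 x →L[ℝ] L2 x} {a b : ℝ} (hS : HasTrace S a)
    (hT : HasTrace T b) : HasTrace (S + T) (a + b) := by
  constructor
  · intro ι c e
    simpa only [add_apply, inner_add_right] using (hS.1 ι c e).add (hT.1 ι c e)
  · intro ι c
    simpa only [add_apply, inner_add_right] using (hS.2 ι c).add (hT.2 ι c)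

lemma HasTrace.smul {x : ℝ} {T : L2 x →L[ℝ] L2 x} {b : ℝ} (c : ℝ) (hT : HasTrace T b) :
    HasTrace (c • T) (c * b) := by
  constructor
  · intro ι d e
    simpa only [smul_apply, inner_smul_right] using (hT.1 ι d e).mul_left c
  · intro ι d
    simpa only [smul_apply, inner_smul_right] using (hT.2 ι d).mul_left c

lemma hasTrace_zero (x : ℝ) : HasTrace (0 : L2 x →L[ℝ] L2 x) 0 :=
  ⟨fun ι b e => by simp, fun ι b => by simp⟩

lemma HasTrace.sum {x : ℝ} {ι : Type*} (s : Finset ι) {T : ι → L2 x →L[ℝ] L2 x} {b : ι → ℝ}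
    (h : ∀ i ∈ s, HasTrace (T i) (b i)) : HasTrace (∑ i ∈ s, T i) (∑ i ∈ s, b i) := by
  classical
  induction s using Finset.induction_on with
  | empty => simpa using hasTrace_zero x
  | insert a s ha ih =>
    rw [Finset.sum_insert ha, Finset.sum_insert ha]
    exact (h a (Finset.mem_insert_self a s)).add
      (ih fun i hi => h i (Finset.mem_insert_of_mem hi))

end RAiry
end

noncomputable section

namespace RAiry

open Filter Topology

/-! ### Contour integrals -/

lemma exp_ray_right : Complex.exp (Real.pi / 6 * Complex.I)
    = ((√3 / 2 : ℝ) : ℂ) + ((1 / 2 : ℝ) : ℂ) * Complex.I := by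
  have h : (Real.pi / 6 * Complex.I : ℂ) = ((Real.pi / 6 : ℝ) : ℂ) * Complex.I := by push_cast; ring
  rw [h, Complex.exp_mul_I, ← Complex.ofReal_cos, ← Complex.ofReal_sin, Real.cos_pi_div_six,
    Real.sin_pi_div_six]

lemma exp_ray_left : Complex.exp (5 * Real.pi / 6 * Complex.I)
    = ((-(√3 / 2) : ℝ) : ℂ) + ((1 / 2 : ℝ) : ℂ) * Complex.I := by
  have h := conj_exp_ray
  rw [exp_ray_right] at h
  simp only [map_add, map_mul, Complex.conj_ofReal, Complex.conj_I] at h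
  have h2 := neg_eq_iff_eq_neg.2 h
  rw [← h2]
  push_cast
  ring

lemma norm_phase (u h ρ p q : ℝ) :
    ‖phase u (Complex.I * h + ρ * ((p : ℂ) + (q : ℂ) * Complex.I))‖
      = Real.exp (h ^ 3 / 3 + h ^ 2 * ρ * q - h * ρ ^ 2 * (p ^ 2 - q ^ 2)
          - ρ ^ 3 * (3 * p ^ 2 * q - q ^ 3) / 3 - u * (h + ρ * q)) := by
  rw [phase, Complex.norm_exp]
  congr 1
  have : Complex.I * (Complex.I * h + ρ * ((p : ℂ) + (q : ℂ) * Complex.I)) ^ 3 / 3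
      + Complex.I * (Complex.I * h + ρ * ((p : ℂ) + (q : ℂ) * Complex.I)) * u
      = ((h ^ 3 / 3 + h ^ 2 * ρ * q - h * ρ ^ 2 * (p ^ 2 - q ^ 2)
          - ρ ^ 3 * (3 * p ^ 2 * q - q ^ 3) / 3 - u * (h + ρ * q) : ℝ) : ℂ)
        + ((-h ^ 2 * ρ * p - 2 * h * ρ ^ 2 * p * q + ρ ^ 3 * (p ^ 3 - 3 * p * q ^ 2) / 3
          + ρ * p * u : ℝ) : ℂ) * Complex.I := by
    have hI : Complex.I ^ 2 = -1 := Complex.I_sq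
    have hI3 : Complex.I ^ 3 = -Complex.I := by rw [pow_succ, hI]; ring
    have hI4 : Complex.I ^ 4 = 1 := Complex.I_pow_four
    push_cast
    ring_nf
    simp only [hI, hI3, hI4]
    ring
  rw [this, Complex.add_re, Complex.ofReal_re, Complex.re_ofReal_mul, Complex.I_re, mul_zero,
    add_zero]

/-- The quadratic term has the coefficient h(p² - q²), positive because the vertex lies above the
real axis, and already gives Gaussian decay in ρ. Of the cubic term only the sign is used. The
factor exp(-uh) is the decay in u that the vertex at height h produces. -/
lemma norm_phase_le {u x h ρ p q : ℝ} (hh : 0 < h) (hρ : 0 ≤ ρ) (hq : 0 ≤ q) (hq1 : q ≤ 1)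
    (hpq : 1 / 2 ≤ p ^ 2 - q ^ 2) (hu : x ≤ u) :
    ‖phase u (Complex.I * h + ρ * ((p : ℂ) + (q : ℂ) * Complex.I))‖
      ≤ Real.exp (-(u * h)) * Real.exp (h ^ 3 / 3 + (h ^ 2 + |x|) * ρ - h * ρ ^ 2 / 2) := by
  rw [norm_phase, ← Real.exp_add]
  refine Real.exp_le_exp.2 ?_
  have h1 : h * ρ ^ 2 * (1 / 2) ≤ h * ρ ^ 2 * (p ^ 2 - q ^ 2) := by gcongr
  have h2 : 0 ≤ ρ ^ 3 * (3 * p ^ 2 * q - q ^ 3) := by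
    have : 0 ≤ 3 * p ^ 2 * q - q ^ 3 := by
      have : 0 ≤ q * (3 * p ^ 2 - q ^ 2) := mul_nonneg hq (by nlinarith [sq_nonneg q])
      nlinarith
    positivity
  have h3 : h ^ 2 * ρ * q ≤ h ^ 2 * ρ := mul_le_of_le_one_right (by positivity) hq1
  have h4 : -(u * (ρ * q)) ≤ |x| * ρ := by
    have hb : 0 ≤ ρ * q := by positivity
    calc -(u * (ρ * q)) ≤ -(x * (ρ * q)) := by
          have := mul_le_mul_of_nonneg_right hu hb
          linarith
      _ = (-x) * (ρ * q) := by ring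
      _ ≤ |x| * (ρ * q) := by gcongr; exact neg_le_abs x
      _ ≤ |x| * ρ := by gcongr; exact mul_le_of_le_one_right hρ hq1
  linarith

lemma exists_gaussian_bound (m : ℕ) (b : ℝ) {h : ℝ} (hh : 0 < h) :
    ∃ C, 0 < C ∧ ∀ ρ : ℝ, 0 ≤ ρ →
      (1 + ρ) ^ m * Real.exp (b * ρ - h * ρ ^ 2 / 2) ≤ C * Real.exp (-ρ) := by
  refine ⟨m.factorial * Real.exp (1 + (b + 2) ^ 2 / (2 * h)), by positivity, fun ρ hρ => ?_⟩
  have h1 := Real.pow_div_factorial_le_exp (1 + ρ) (by linarith) m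
  rw [div_le_iff₀ (by positivity)] at h1
  calc (1 + ρ) ^ m * Real.exp (b * ρ - h * ρ ^ 2 / 2)
      ≤ (Real.exp (1 + ρ) * m.factorial) * Real.exp (b * ρ - h * ρ ^ 2 / 2) := by gcongr
    _ = m.factorial * Real.exp (1 + ρ + (b * ρ - h * ρ ^ 2 / 2)) := by
        rw [Real.exp_add (1 + ρ)]; ring
    _ ≤ m.factorial * Real.exp (1 + (b + 2) ^ 2 / (2 * h) + -ρ) := by
        refine mul_le_mul_of_nonneg_left (Real.exp_le_exp.2 ?_) (by positivity)
        have : (b + 2) * ρ - h * ρ ^ 2 / 2 ≤ (b + 2) ^ 2 / (2 * h) := by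
          rw [le_div_iff₀ (by positivity)]
          nlinarith [sq_nonneg (h * ρ - (b + 2))]
        linarith
    _ = _ := by rw [Real.exp_add _ (-ρ)]; ring

/-- The right-hand ray of the contour with vertex `i`. -/
def rayR (ρ : ℝ) : ℂ :=
  Complex.I * (1 : ℝ) + ρ * (((√3 / 2 : ℝ) : ℂ) + ((1 / 2 : ℝ) : ℂ) * Complex.I)

/-- The left-hand ray of the contour with vertex `i`. -/
def rayL (ρ : ℝ) : ℂ :=
  Complex.I * (1 : ℝ) + ρ * (((-(√3 / 2) : ℝ) : ℂ) + ((1 / 2 : ℝ) : ℂ) * Complex.I)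

/-- The direction of the right-hand ray. -/
def dirR : ℂ := ((√3 / 2 : ℝ) : ℂ) + ((1 / 2 : ℝ) : ℂ) * Complex.I

/-- The direction of the left-hand ray. -/
def dirL : ℂ := ((-(√3 / 2) : ℝ) : ℂ) + ((1 / 2 : ℝ) : ℂ) * Complex.I

lemma sq_sqrt_three : √(3 : ℝ) ^ 2 = 3 := Real.sq_sqrt (by norm_num)

lemma norm_dirR : ‖dirR‖ = 1 := by
  rw [dirR, ← exp_ray_right]
  have h : (Real.pi / 6 * Complex.I : ℂ) = ((Real.pi / 6 : ℝ) : ℂ) * Complex.I := by push_cast; ring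
  rw [h, Complex.norm_exp_ofReal_mul_I]

lemma norm_dirL : ‖dirL‖ = 1 := by
  rw [dirL, ← exp_ray_left]
  have h : (5 * Real.pi / 6 * Complex.I : ℂ) = ((5 * Real.pi / 6 : ℝ) : ℂ) * Complex.I := by
    push_cast; ring
  rw [h, Complex.norm_exp_ofReal_mul_I]

lemma norm_rayR_le {ρ : ℝ} (hρ : 0 ≤ ρ) : ‖rayR ρ‖ ≤ 1 + ρ := by
  refine (norm_add_le _ _).trans ?_
  rw [norm_mul, norm_mul, Complex.norm_I, ← dirR, norm_dirR, Complex.norm_real, Complex.norm_real,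
    Real.norm_of_nonneg hρ]
  simp

lemma norm_rayL_le {ρ : ℝ} (hρ : 0 ≤ ρ) : ‖rayL ρ‖ ≤ 1 + ρ := by
  refine (norm_add_le _ _).trans ?_
  rw [norm_mul, norm_mul, Complex.norm_I, ← dirL, norm_dirL, Complex.norm_real, Complex.norm_real,
    Real.norm_of_nonneg hρ]
  simp

lemma continuous_rayR : Continuous rayR := by unfold rayR; fun_prop

lemma continuous_rayL : Continuous rayL := by unfold rayL; fun_prop

lemma continuous_phase (u : ℝ) : Continuous (phase u) := by unfold phase; fun_prop

/-- The integrand of the contour integral of `phase u a * q a` over the contour with vertex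
`i`. -/
def integrand (q : ℂ → ℂ) (u ρ : ℝ) : ℂ :=
  dirR * (phase u (rayR ρ) * q (rayR ρ)) - dirL * (phase u (rayL ρ) * q (rayL ρ))

lemma contourIntegral_one (q : ℂ → ℂ) (u : ℝ) :
    contourIntegral 1 (fun a => phase u a * q a) = ∫ ρ in Ioi (0 : ℝ), integrand q u ρ := by
  rw [contourIntegral, exp_ray_right, exp_ray_left]
  rfl

/-- The function `∫_C exp (i a³ / 3 + i a u) q(a) da / 2π`, for the contour with vertex `i`. -/
def airyInt (q : ℂ → ℂ) (u : ℝ) : ℝ :=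
  (contourIntegral 1 (fun a => phase u a * q a) / (2 * Real.pi)).re

/-- The weight `q` is measurable and of polynomial growth along the contour. -/
structure PolyBdd (B : ℝ) (m : ℕ) (q : ℂ → ℂ) : Prop where
  meas : Measurable q
  right : ∀ ρ, 0 ≤ ρ → ‖q (rayR ρ)‖ ≤ B * (1 + ρ) ^ m
  left : ∀ ρ, 0 ≤ ρ → ‖q (rayL ρ)‖ ≤ B * (1 + ρ) ^ m

lemma PolyBdd.nonneg {B : ℝ} {m : ℕ} {q : ℂ → ℂ} (h : PolyBdd B m q) : 0 ≤ B := by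
  have := (norm_nonneg _).trans (h.right 0 le_rfl)
  simpa using this

lemma PolyBdd.I_mul {B : ℝ} {m : ℕ} {q : ℂ → ℂ} (h : PolyBdd B m q) :
    PolyBdd B (m + 1) fun a => Complex.I * a * q a := by
  have hB := h.nonneg
  refine ⟨(by fun_prop : Measurable fun a : ℂ => Complex.I * a).mul h.meas, fun ρ hρ => ?_,
    fun ρ hρ => ?_⟩
  · rw [norm_mul, norm_mul, Complex.norm_I, one_mul, pow_succ]
    calc ‖rayR ρ‖ * ‖q (rayR ρ)‖ ≤ (1 + ρ) * (B * (1 + ρ) ^ m) := by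
          gcongr
          · exact norm_rayR_le hρ
          · exact h.right ρ hρ
      _ = _ := by ring
  · rw [norm_mul, norm_mul, Complex.norm_I, one_mul, pow_succ]
    calc ‖rayL ρ‖ * ‖q (rayL ρ)‖ ≤ (1 + ρ) * (B * (1 + ρ) ^ m) := by
          gcongr
          · exact norm_rayL_le hρ
          · exact h.left ρ hρ
      _ = _ := by ring

lemma measurable_integrand {q : ℂ → ℂ} (hq : Measurable q) (u : ℝ) :
    Measurable (integrand q u) := by
  unfold integrand
  have h1 := continuous_rayR.measurable
  have h2 := continuous_rayL.measurable
  have h3 := (continuous_phase u).measurable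
  fun_prop

/-- The integrands decay, uniformly for `u ≥ x`. -/
lemma exists_integrand_bound (m : ℕ) (x : ℝ) :
    ∃ C, 0 < C ∧ ∀ (B : ℝ) (q : ℂ → ℂ), PolyBdd B m q → ∀ u, x ≤ u → ∀ ρ, 0 ≤ ρ →
      ‖integrand q u ρ‖ ≤ C * B * Real.exp (-u) * Real.exp (-ρ) := by
  obtain ⟨C, hC, hb⟩ := exists_gaussian_bound m (1 + |x|) one_pos
  refine ⟨2 * Real.exp (1 / 3) * C, by positivity, fun B q hq u hu ρ hρ => ?_⟩
  have hB := hq.nonneg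
  have hs : (√3 / 2 : ℝ) ^ 2 = 3 / 4 := by rw [div_pow, sq_sqrt_three]; norm_num
  have h1 : ‖phase u (rayR ρ)‖ ≤ _ := norm_phase_le (x := x) one_pos hρ (by norm_num)
    (by norm_num) (by rw [hs]; norm_num) hu
  have h2 : ‖phase u (rayL ρ)‖ ≤ _ := norm_phase_le (x := x) one_pos hρ (by norm_num)
    (by norm_num) (by rw [neg_sq, hs]; norm_num) hu
  have key : Real.exp (-(u * 1)) * Real.exp (1 ^ 3 / 3 + (1 ^ 2 + |x|) * ρ - 1 * ρ ^ 2 / 2)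
      * (B * (1 + ρ) ^ m) ≤ Real.exp (1 / 3) * C * B * Real.exp (-u) * Real.exp (-ρ) := by
    have e : (1 : ℝ) ^ 3 / 3 + (1 ^ 2 + |x|) * ρ - 1 * ρ ^ 2 / 2
        = 1 / 3 + ((1 + |x|) * ρ - 1 * ρ ^ 2 / 2) := by ring
    rw [e, Real.exp_add, mul_one]
    calc _ = Real.exp (-u) * Real.exp (1 / 3) * B *
          ((1 + ρ) ^ m * Real.exp ((1 + |x|) * ρ - 1 * ρ ^ 2 / 2)) := by ring
      _ ≤ Real.exp (-u) * Real.exp (1 / 3) * B * (C * Real.exp (-ρ)) := by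
          exact mul_le_mul_of_nonneg_left (hb ρ hρ) (by positivity)
      _ = _ := by ring
  refine (norm_sub_le _ _).trans ?_
  rw [norm_mul, norm_mul, norm_mul, norm_mul, norm_dirR, norm_dirL, one_mul, one_mul]
  have h3 := mul_le_mul h1 (hq.right ρ hρ) (norm_nonneg _) (by positivity)
  have h4 := mul_le_mul h2 (hq.left ρ hρ) (norm_nonneg _) (by positivity)
  linarith

lemma integrableOn_exp_neg_Ioi_zero : IntegrableOn (fun ρ : ℝ => Real.exp (-ρ)) (Ioi 0) := by
  have h := exp_neg_integrableOn_Ioi 0 one_pos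
  simpa only [neg_mul, one_mul] using h

lemma PolyBdd.integrable {B : ℝ} {m : ℕ} {q : ℂ → ℂ} (h : PolyBdd B m q) (u : ℝ) :
    IntegrableOn (integrand q u) (Ioi 0) := by
  obtain ⟨C, hC, hb⟩ := exists_integrand_bound m u
  refine Integrable.mono' (integrableOn_exp_neg_Ioi_zero.const_mul (C * B * Real.exp (-u)))
    (measurable_integrand h.meas u).aestronglyMeasurable ?_
  filter_upwards [ae_restrict_mem measurableSet_Ioi] with ρ hρ
  exact hb B q h u le_rfl ρ (le_of_lt hρ)

lemma airyInt_eq (q : ℂ → ℂ) (u : ℝ) :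
    airyInt q u = (∫ ρ in Ioi (0 : ℝ), integrand q u ρ).re / (2 * Real.pi) := by
  rw [airyInt, contourIntegral_one]
  have : (2 * (Real.pi : ℂ)) = ((2 * Real.pi : ℝ) : ℂ) := by push_cast; ring
  rw [this, Complex.div_ofReal_re]

/-- The constant depends only on the degree m and on x, and B enters linearly. A weight of size
O(ε⁴) therefore gives a function of size O(ε⁴) exp(-u), uniformly in ε. -/
lemma exists_airyInt_bound (m : ℕ) (x : ℝ) :
    ∃ C, 0 < C ∧ ∀ (B : ℝ) (q : ℂ → ℂ), PolyBdd B m q → ∀ u, x ≤ u →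
      |airyInt q u| ≤ C * B * Real.exp (-u) := by
  obtain ⟨C, hC, hb⟩ := exists_integrand_bound m x
  refine ⟨C, hC, fun B q hq u hu => ?_⟩
  have hB := hq.nonneg
  have h1 : ‖∫ ρ in Ioi (0 : ℝ), integrand q u ρ‖
      ≤ ∫ ρ in Ioi (0 : ℝ), C * B * Real.exp (-u) * Real.exp (-ρ) := by
    refine norm_integral_le_of_norm_le (integrableOn_exp_neg_Ioi_zero.const_mul _) ?_
    filter_upwards [ae_restrict_mem measurableSet_Ioi] with ρ hρ
    exact hb B q hq u hu ρ (le_of_lt hρ)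
  rw [integral_const_mul, integral_exp_neg_Ioi_zero, mul_one] at h1
  rw [airyInt_eq, abs_div, abs_of_pos Real.two_pi_pos]
  refine (div_le_self (abs_nonneg _) ?_).trans ((Complex.abs_re_le_norm _).trans h1)
  linarith [Real.pi_gt_three]

lemma hasDerivAt_phase (u : ℝ) (a : ℂ) :
    HasDerivAt (fun u : ℝ => phase u a) (Complex.I * a * phase u a) u := by
  unfold phase
  have h1 : HasDerivAt (fun u : ℝ => Complex.I * a ^ 3 / 3 + Complex.I * a * (u : ℂ))
      (Complex.I * a) u := by
    have := ((Complex.ofRealCLM.hasDerivAt (x := u)).const_mul (Complex.I * a)).const_add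
      (Complex.I * a ^ 3 / 3)
    simpa using this
  exact h1.cexp.congr_deriv (mul_comm _ _)

lemma PolyBdd.hasDerivAt {B : ℝ} {m : ℕ} {q : ℂ → ℂ} (h : PolyBdd B m q) (u : ℝ) :
    HasDerivAt (airyInt q) (airyInt (fun a => Complex.I * a * q a) u) u := by
  obtain ⟨C, hC, hb⟩ := exists_integrand_bound (m + 1) (u - 1)
  have hB := h.nonneg
  have key := hasDerivAt_integral_of_dominated_loc_of_deriv_le (μ := volume.restrict (Ioi (0 : ℝ)))
    (F := fun u ρ => integrand q u ρ)
    (F' := fun u ρ => integrand (fun a => Complex.I * a * q a) u ρ)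
    (x₀ := u) (s := Metric.ball u 1)
    (bound := fun ρ => C * B * Real.exp (-(u - 1)) * Real.exp (-ρ))
    (Metric.ball_mem_nhds u one_pos)
    (Eventually.of_forall fun u' => (measurable_integrand h.meas u').aestronglyMeasurable)
    (h.integrable u) (measurable_integrand h.I_mul.meas u).aestronglyMeasurable
    ?_ (integrableOn_exp_neg_Ioi_zero.const_mul _) ?_
  · have h2 := key.2
    have h3 := (Complex.reCLM.hasFDerivAt.comp_hasDerivAt u h2).div_const (2 * Real.pi)
    simp only [Complex.reCLM_apply, Function.comp_def] at h3
    simp_rw [← airyInt_eq] at h3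
    exact h3
  · filter_upwards [ae_restrict_mem measurableSet_Ioi] with ρ hρ u' hu'
    rw [Real.ball_eq_Ioo] at hu'
    refine (hb B _ h.I_mul u' hu'.1.le ρ (le_of_lt hρ)).trans ?_
    gcongr
    exact hu'.1.le
  · refine Eventually.of_forall fun ρ u' _ => ?_
    have hR := ((hasDerivAt_phase u' (rayR ρ)).mul_const (q (rayR ρ))).const_mul dirR
    have hL := ((hasDerivAt_phase u' (rayL ρ)).mul_const (q (rayL ρ))).const_mul dirL
    refine (hR.sub hL).congr_deriv ?_
    simp only [integrand]
    ring

lemma PolyBdd.airyInt_add {B B' : ℝ} {m m' : ℕ} {q q' : ℂ → ℂ} (h : PolyBdd B m q)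
    (h' : PolyBdd B' m' q') (u : ℝ) :
    airyInt (fun a => q a + q' a) u = airyInt q u + airyInt q' u := by
  rw [airyInt_eq, airyInt_eq, airyInt_eq, ← add_div, ← Complex.add_re,
    ← integral_add (h.integrable u) (h'.integrable u)]
  congr 3
  funext ρ
  simp only [integrand]
  ring

lemma airyInt_smul (c : ℝ) (q : ℂ → ℂ) (u : ℝ) :
    airyInt (fun a => c * q a) u = c * airyInt q u := by
  rw [airyInt_eq, airyInt_eq, ← mul_div_assoc, ← Complex.re_ofReal_mul, ← integral_const_mul]
  congr 3
  funext ρ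
  simp only [integrand]
  ring

/-! ### The Airy function and its derivatives -/

/-- The `j`-th derivative of the Airy function, as a contour integral. -/
def airyD (j : ℕ) : ℝ → ℝ := airyInt fun a => (Complex.I * a) ^ j

lemma polyBdd_pow (j : ℕ) : PolyBdd 1 j fun a => (Complex.I * a) ^ j := by
  induction j with
  | zero => exact ⟨by fun_prop, fun ρ _ => by simp, fun ρ _ => by simp⟩
  | succ j ih => simpa only [pow_succ'] using ih.I_mul

lemma hasDerivAt_airyD (j : ℕ) (u : ℝ) : HasDerivAt (airyD j) (airyD (j + 1) u) u := by
  have := (polyBdd_pow j).hasDerivAt u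
  simp only [← pow_succ'] at this
  exact this

lemma airyD_zero : airyD 0 = airy := by
  funext u
  simp [airyD, airyInt, airy, airyC]

lemma deriv_airy : deriv airy = airyD 1 := by
  funext u
  rw [← airyD_zero]
  exact (hasDerivAt_airyD 0 u).deriv

lemma deriv_deriv_airy : deriv (deriv airy) = airyD 2 := by
  rw [deriv_airy]
  funext u
  exact (hasDerivAt_airyD 1 u).deriv

lemma hasDerivAt_phase_ray (u : ℝ) (d : ℂ) (ρ : ℝ) :
    HasDerivAt (fun ρ : ℝ => phase u (Complex.I * (1 : ℝ) + ρ * d))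
      (Complex.I * ((Complex.I * (1 : ℝ) + ρ * d) ^ 2 + u) * d
        * phase u (Complex.I * (1 : ℝ) + ρ * d)) ρ := by
  unfold phase
  have h0 : HasDerivAt (fun ρ : ℝ => Complex.I * ((1 : ℝ) : ℂ) + (ρ : ℂ) * d) d ρ := by
    have := ((Complex.ofRealCLM.hasDerivAt (x := ρ)).mul_const d).const_add
      (Complex.I * ((1 : ℝ) : ℂ))
    simpa using this
  have h1 := ((h0.pow 3).const_mul Complex.I).div_const 3
  have h2 := (h0.const_mul Complex.I).mul_const (u : ℂ)
  have h3 := (h1.add h2).cexp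
  refine h3.congr_deriv ?_
  simp only [Pi.add_apply, Pi.pow_apply]
  push_cast
  ring

/-- The Airy equation. -/
lemma airyD_two (u : ℝ) : airyD 2 u = u * airyD 0 u := by
  have hp1 := (polyBdd_pow 2)
  have hp0 := (polyBdd_pow 0)
  -- Along the contour the derivative of the phase is i(a² + u) da times the phase, that is -i((ia)²
  -- - u). The integral of this derivative vanishes, since the two rays start at the same vertex and
  -- the phase decays along both.
  have hI : ∀ ρ, HasDerivAt (fun ρ : ℝ => phase u (rayR ρ) - phase u (rayL ρ))
      (-(Complex.I * (integrand (fun a => (Complex.I * a) ^ 2) u ρ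
        - u * integrand (fun a => (Complex.I * a) ^ 0) u ρ))) ρ := by
    intro ρ
    refine ((hasDerivAt_phase_ray u dirR ρ).sub (hasDerivAt_phase_ray u dirL ρ)).congr_deriv ?_
    have hI : Complex.I ^ 2 = -1 := Complex.I_sq
    simp only [integrand, mul_pow, hI, rayR, rayL, dirR, dirL, pow_zero]
    ring
  have hint : IntegrableOn (fun ρ => -(Complex.I * (integrand (fun a => (Complex.I * a) ^ 2) u ρ
        - u * integrand (fun a => (Complex.I * a) ^ 0) u ρ))) (Ioi 0) :=
    (((hp1.integrable u).sub ((hp0.integrable u).const_mul _)).const_mul _).neg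
  have hlim : Tendsto (fun ρ : ℝ => phase u (rayR ρ) - phase u (rayL ρ)) atTop (𝓝 0) := by
    obtain ⟨C, hC, hb⟩ := exists_gaussian_bound 0 (1 + |u|) one_pos
    have hs : (√3 / 2 : ℝ) ^ 2 = 3 / 4 := by rw [div_pow, sq_sqrt_three]; norm_num
    refine squeeze_zero_norm' (a := fun ρ => 2 * Real.exp (-(u * 1)) * Real.exp (1 / 3) * C
      * Real.exp (-ρ)) ?_ ?_
    · filter_upwards [eventually_ge_atTop 0] with ρ hρ
      have h1 : ‖phase u (rayR ρ)‖ ≤ _ := norm_phase_le (x := u) one_pos hρ (by norm_num)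
        (by norm_num) (by rw [hs]; norm_num) le_rfl
      have h2 : ‖phase u (rayL ρ)‖ ≤ _ := norm_phase_le (x := u) one_pos hρ (by norm_num)
        (by norm_num) (by rw [neg_sq, hs]; norm_num) le_rfl
      refine (norm_sub_le _ _).trans ?_
      have e : (1 : ℝ) ^ 3 / 3 + (1 ^ 2 + |u|) * ρ - 1 * ρ ^ 2 / 2
        = 1 / 3 + ((1 + |u|) * ρ - 1 * ρ ^ 2 / 2) := by ring
      rw [e, Real.exp_add (1 / 3)] at h1 h2
      have h3 := hb ρ hρ
      rw [pow_zero, one_mul] at h3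
      calc _ ≤ _ := add_le_add h1 h2
        _ = 2 * Real.exp (-(u * 1)) * Real.exp (1 / 3)
            * Real.exp ((1 + |u|) * ρ - 1 * ρ ^ 2 / 2) := by ring
        _ ≤ 2 * Real.exp (-(u * 1)) * Real.exp (1 / 3) * (C * Real.exp (-ρ)) := by gcongr
        _ = _ := by ring
    · have := (Real.tendsto_exp_neg_atTop_nhds_zero).const_mul
        (2 * Real.exp (-(u * 1)) * Real.exp (1 / 3) * C)
      simpa using this
  have h := integral_Ioi_of_hasDerivAt_of_tendsto' (fun ρ _ => hI ρ) hint hlim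
  have h0 : phase u (rayR 0) - phase u (rayL 0) = 0 := by simp [rayR, rayL]
  rw [h0, sub_zero, integral_neg, neg_eq_zero, integral_const_mul] at h
  have h' := (mul_eq_zero.1 h).resolve_left Complex.I_ne_zero
  rw [integral_sub (hp1.integrable u) ((hp0.integrable u).const_mul _), integral_const_mul,
    sub_eq_zero] at h'
  rw [airyD, airyD, airyInt_eq, airyInt_eq, h', Complex.re_ofReal_mul, mul_div_assoc]

end RAiry
end

noncomputable section

namespace RAiry

open Filter Topology

/-! ### Kernels built from decaying functions -/

/-- Continuous functions that are `O(exp (-u))` on every half-line `[x, ∞)`. -/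
structure Decay (f : ℝ → ℝ) : Prop where
  cont : Continuous f
  bound : ∀ x, ∃ C, 0 ≤ C ∧ ∀ u, x ≤ u → |f u| ≤ C * Real.exp (-u)

lemma PolyBdd.decay {B : ℝ} {m : ℕ} {q : ℂ → ℂ} (h : PolyBdd B m q) : Decay (airyInt q) := by
  refine ⟨continuous_iff_continuousAt.2 fun u => (h.hasDerivAt u).continuousAt, fun x => ?_⟩
  obtain ⟨C, hC, hb⟩ := exists_airyInt_bound m x
  exact ⟨C * B, mul_nonneg hC.le h.nonneg, fun u hu => hb B q h u hu⟩

lemma decay_airyD (j : ℕ) : Decay (airyD j) := (polyBdd_pow j).decay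

/-- The kernel `∫_0^∞ f(w + u) g(w + v) dw`. -/
def kern (f g : ℝ → ℝ) (u v : ℝ) : ℝ := ∫ w in Ioi (0 : ℝ), f (w + u) * g (w + v)

lemma airyKernel_eq : airyKernel = kern (airyD 0) (airyD 0) := by
  rw [airyD_zero]; rfl

lemma abs_mul_shift_le {f g : ℝ → ℝ} {x C C' u v w : ℝ} (hC : 0 ≤ C) (hC' : 0 ≤ C')
    (hf : ∀ u, x ≤ u → |f u| ≤ C * Real.exp (-u)) (hg : ∀ u, x ≤ u → |g u| ≤ C' * Real.exp (-u))
    (hu : x ≤ u) (hv : x ≤ v) (hw : 0 ≤ w) :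
    |f (w + u) * g (w + v)| ≤ C * C' * (Real.exp (-u) * Real.exp (-v)) * Real.exp (-w) := by
  have h1 := hf (w + u) (by linarith)
  have h2 := hg (w + v) (by linarith)
  rw [abs_mul]
  calc |f (w + u)| * |g (w + v)|
      ≤ (C * Real.exp (-(w + u))) * (C' * Real.exp (-(w + v))) :=
        mul_le_mul h1 h2 (abs_nonneg _) (by positivity)
    _ = C * C' * (Real.exp (-u) * Real.exp (-v)) * Real.exp (-w) * Real.exp (-w) := by
        rw [neg_add, neg_add, Real.exp_add, Real.exp_add]; ring
    _ ≤ C * C' * (Real.exp (-u) * Real.exp (-v)) * Real.exp (-w) * 1 := by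
        gcongr
        exact Real.exp_le_one_iff.2 (by linarith)
    _ = _ := mul_one _

lemma Decay.integrable {f g : ℝ → ℝ} (hf : Decay f) (hg : Decay g) (u v : ℝ) :
    IntegrableOn (fun w => f (w + u) * g (w + v)) (Ioi 0) := by
  obtain ⟨C, hC, hb⟩ := hf.bound (min u v)
  obtain ⟨C', hC', hb'⟩ := hg.bound (min u v)
  have h1 := hf.cont
  have h2 := hg.cont
  refine Integrable.mono' (integrableOn_exp_neg_Ioi_zero.const_mul
    (C * C' * (Real.exp (-u) * Real.exp (-v))))
    (by fun_prop : Continuous fun w => f (w + u) * g (w + v)).aestronglyMeasurable ?_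
  filter_upwards [ae_restrict_mem measurableSet_Ioi] with w hw
  exact abs_mul_shift_le hC hC' hb hb' (min_le_left _ _) (min_le_right _ _) (le_of_lt hw)

lemma integral_le_of_abs_le_exp {F : ℝ → ℝ} {M : ℝ}
    (h : ∀ w, 0 < w → |F w| ≤ M * Real.exp (-w)) : |∫ w in Ioi (0 : ℝ), F w| ≤ M := by
  have h1 : ‖∫ w in Ioi (0 : ℝ), F w‖ ≤ ∫ w in Ioi (0 : ℝ), M * Real.exp (-w) := by
    refine norm_integral_le_of_norm_le (integrableOn_exp_neg_Ioi_zero.const_mul _) ?_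
    filter_upwards [ae_restrict_mem measurableSet_Ioi] with w hw
    exact h w hw
  rwa [integral_const_mul, integral_exp_neg_Ioi_zero, mul_one] at h1

lemma abs_kern_le {f g : ℝ → ℝ} {x C C' u v : ℝ} (hC : 0 ≤ C) (hC' : 0 ≤ C')
    (hf : ∀ u, x ≤ u → |f u| ≤ C * Real.exp (-u)) (hg : ∀ u, x ≤ u → |g u| ≤ C' * Real.exp (-u))
    (hu : x ≤ u) (hv : x ≤ v) : |kern f g u v| ≤ C * C' * (Real.exp (-u) * Real.exp (-v)) :=
  integral_le_of_abs_le_exp fun _ hw => abs_mul_shift_le hC hC' hf hg hu hv hw.le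

lemma Decay.continuous_kern {f g : ℝ → ℝ} (hf : Decay f) (hg : Decay g) :
    Continuous (Function.uncurry (kern f g)) := by
  rw [continuous_iff_continuousAt]
  rintro ⟨u₀, v₀⟩
  set x := min u₀ v₀ - 1 with hx
  obtain ⟨C, hC, hb⟩ := hf.bound x
  obtain ⟨C', hC', hb'⟩ := hg.bound x
  have h1 := hf.cont
  have h2 := hg.cont
  refine continuousAt_of_dominated (bound := fun w => C * C' * (Real.exp (-x) * Real.exp (-x))
    * Real.exp (-w)) (Eventually.of_forall fun p => ?_) ?_
    (integrableOn_exp_neg_Ioi_zero.const_mul _) (Eventually.of_forall fun w => ?_)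
  · exact (by fun_prop : Continuous fun w => f (w + p.1) * g (w + p.2)).aestronglyMeasurable
  · have hn : Ioi x ×ˢ Ioi x ∈ 𝓝 (u₀, v₀) := (isOpen_Ioi.prod isOpen_Ioi).mem_nhds
      ⟨by have := min_le_left u₀ v₀; simp only [mem_Ioi]; linarith,
        by have := min_le_right u₀ v₀; simp only [mem_Ioi]; linarith⟩
    filter_upwards [hn] with p hp
    filter_upwards [ae_restrict_mem measurableSet_Ioi] with w hw
    have hp1 : x < p.1 := hp.1
    have hp2 : x < p.2 := hp.2
    refine (abs_mul_shift_le hC hC' hb hb' hp1.le hp2.le (le_of_lt hw)).trans ?_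
    gcongr
  · fun_prop

/-- The integrand on the left is the derivative in w of f(w + u) g(w + v), which tends to zero at
infinity. -/
lemma kern_add_kern {f g f' g' : ℝ → ℝ} (hf : Decay f) (hg : Decay g) (hf' : Decay f')
    (hg' : Decay g') (hdf : ∀ u, HasDerivAt f (f' u) u) (hdg : ∀ u, HasDerivAt g (g' u) u)
    (u v : ℝ) : kern f' g u v + kern f g' u v = -(f u * g v) := by
  have hd : ∀ w ∈ Ici (0 : ℝ), HasDerivAt (fun w => f (w + u) * g (w + v))
      (f' (w + u) * g (w + v) + f (w + u) * g' (w + v)) w := fun w _ =>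
    ((hdf (w + u)).comp_add_const w u).mul ((hdg (w + v)).comp_add_const w v)
  have hlim : Tendsto (fun w => f (w + u) * g (w + v)) atTop (𝓝 0) := by
    obtain ⟨C, hC, hb⟩ := hf.bound (min u v)
    obtain ⟨C', hC', hb'⟩ := hg.bound (min u v)
    refine squeeze_zero_norm' (a := fun w => C * C' * (Real.exp (-u) * Real.exp (-v))
      * Real.exp (-w)) ?_ ?_
    · filter_upwards [eventually_ge_atTop 0] with w hw
      exact abs_mul_shift_le hC hC' hb hb' (min_le_left _ _) (min_le_right _ _) hw
    · simpa using (Real.tendsto_exp_neg_atTop_nhds_zero).const_mul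
        (C * C' * (Real.exp (-u) * Real.exp (-v)))
  have h := integral_Ioi_of_hasDerivAt_of_tendsto' hd
    ((hf'.integrable hg u v).add (hf.integrable hg' u v)) hlim
  rw [integral_add (hf'.integrable hg u v) (hf.integrable hg' u v), zero_add, zero_add,
    zero_sub] at h
  exact h

/-- The kernel `∫_0^∞ A⁽ⁱ⁾(w + u) A⁽ʲ⁾(w + v) dw`. -/
def kernD (i j : ℕ) : ℝ → ℝ → ℝ := kern (airyD i) (airyD j)

lemma kernD_succ (i j : ℕ) (u v : ℝ) :
    kernD (i + 1) j u v + kernD i (j + 1) u v = -(airyD i u * airyD j v) :=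
  kern_add_kern (decay_airyD i) (decay_airyD j) (decay_airyD _) (decay_airyD _)
    (hasDerivAt_airyD i) (hasDerivAt_airyD j) u v

lemma kernD_two_sub (u v : ℝ) :
    kernD 2 0 u v - kernD 0 2 u v = (u - v) * airyKernel u v := by
  rw [airyKernel_eq, kernD, kernD, kern, kern, kern, ← integral_sub
    ((decay_airyD 2).integrable (decay_airyD 0) u v)
    ((decay_airyD 0).integrable (decay_airyD 2) u v), ← integral_const_mul]
  congr 1
  funext w
  rw [airyD_two, airyD_two]
  ring

/-- The Christoffel–Darboux form of the Airy kernel: the Airy equation expresses the left-hand side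
as the integral of A''⊗A - A⊗A'', and two integrations by parts leave only boundary terms. It makes
K₂ a kernel of finite rank, and it describes the commutator of the Airy operator with multiplication
by the variable. -/
lemma sub_mul_airyKernel (u v : ℝ) :
    (u - v) * airyKernel u v = airyD 0 u * airyD 1 v - airyD 1 u * airyD 0 v := by
  have h1 := kernD_succ 1 0 u v
  have h2 := kernD_succ 0 1 u v
  norm_num at h1 h2
  linarith [kernD_two_sub u v]

lemma kernel1_eq (r : ℕ) (u v : ℝ) : kernel1 r u v = -(r : ℝ) * (airyD 0 u * airyD 0 v) := by
  rw [kernel1, airyD_zero]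

lemma kernel2_eq (r : ℕ) (u v : ℝ) : kernel2 r u v
    = -((r : ℝ) ^ 2 / 2) * (airyD 1 u * airyD 0 v + airyD 0 u * airyD 1 v)
      + (r : ℝ) / 2 * (airyD 0 u * airyD 1 v - airyD 1 u * airyD 0 v) := by
  rw [kernel2, sub_mul_airyKernel, deriv_airy, airyD_zero]

/-- By the Airy equation (v - u)A(u)A(v) = A(u)A''(v) - A''(u)A(v), so K₃ too involves only products
of derivatives of order at most two. -/
lemma kernel3_eq (r : ℕ) (u v : ℝ) : kernel3 r u v
    = -((r : ℝ) ^ 3 / 6) * (airyD 2 u * airyD 0 v + 2 * (airyD 1 u * airyD 1 v)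
      + airyD 0 u * airyD 2 v)
    + (r : ℝ) ^ 2 / 2 * (airyD 0 u * airyD 2 v - airyD 2 u * airyD 0 v)
    - (r : ℝ) / 3 * (airyD 2 u * airyD 0 v + airyD 0 u * airyD 2 v
      - airyD 1 u * airyD 1 v) := by
  rw [kernel3, deriv_deriv_airy, deriv_airy, airyD_two, airyD_two, airyD_zero]
  ring

/-! ### The expansion of the `r`-Airy kernel -/

/-- The weight must be controlled on the whole unbounded contour, so z is not assumed small, only
bounded away from 1. In the induction, multiplying the cubic polynomial for r + 1 by 1 - z gives the
one for r minus c z⁴, with c the top coefficient of the former. -/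
lemma taylor_inv_pow (r : ℕ) : ∃ C, 0 ≤ C ∧ ∀ z : ℂ, 2 / 5 ≤ ‖1 - z‖ →
    ‖((1 - z) ^ r)⁻¹ - (1 + r * z + (r * (r + 1) / 2) * z ^ 2
      + (r * (r + 1) * (r + 2) / 6) * z ^ 3)‖ ≤ C * ‖z‖ ^ 4 := by
  induction r with
  | zero => exact ⟨0, le_rfl, fun z _ => by simp⟩
  | succ r ih =>
    obtain ⟨C, hC, h⟩ := ih
    set c : ℝ := ((r : ℝ) + 1) * (r + 2) * (r + 3) / 6 with hc
    refine ⟨(C + c) * (5 / 2), by positivity, fun z hz => ?_⟩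
    have hz0 : 1 - z ≠ 0 := norm_ne_zero_iff.1 (by linarith)
    have e : ((1 - z) ^ (r + 1))⁻¹ - (1 + ((r + 1 : ℕ) : ℂ) * z
        + (((r + 1 : ℕ) : ℂ) * (((r + 1 : ℕ) : ℂ) + 1) / 2) * z ^ 2
        + (((r + 1 : ℕ) : ℂ) * (((r + 1 : ℕ) : ℂ) + 1) * (((r + 1 : ℕ) : ℂ) + 2) / 6) * z ^ 3)
        = ((((1 - z) ^ r)⁻¹ - (1 + r * z + (r * (r + 1) / 2) * z ^ 2
          + (r * (r + 1) * (r + 2) / 6) * z ^ 3)) + c * z ^ 4) * (1 - z)⁻¹ := by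
      rw [pow_succ, mul_inv]
      field_simp
      rw [hc]
      push_cast
      ring
    rw [e, norm_mul, norm_inv]
    have h1 : ‖1 - z‖⁻¹ ≤ 5 / 2 := by
      rw [inv_le_comm₀ (by linarith) (by norm_num)]; norm_num; linarith
    have h2 : ‖(c : ℂ) * z ^ 4‖ = c * ‖z‖ ^ 4 := by
      rw [norm_mul, norm_pow, Complex.norm_real, Real.norm_of_nonneg (by positivity)]
    calc _ ≤ (C * ‖z‖ ^ 4 + c * ‖z‖ ^ 4) * (5 / 2) := by
          gcongr
          exact (norm_add_le _ _).trans (add_le_add (h z hz) h2.le)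
      _ = _ := by ring

lemma taylor_pow (r : ℕ) : ∃ C, 0 ≤ C ∧ ∀ z : ℂ,
    ‖(1 + z) ^ r - (1 + r * z + (r * (r - 1) / 2) * z ^ 2
      + (r * (r - 1) * (r - 2) / 6) * z ^ 3)‖ ≤ C * ‖z‖ ^ 4 * (1 + ‖z‖) ^ r := by
  induction r with
  | zero => exact ⟨0, le_rfl, fun z => by simp⟩
  | succ r ih =>
    obtain ⟨C, hC, h⟩ := ih
    set c : ℝ := (r : ℝ) * (r - 1) * (r - 2) / 6 with hc
    refine ⟨C + |c|, by positivity, fun z => ?_⟩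
    have e : (1 + z) ^ (r + 1) - (1 + ((r + 1 : ℕ) : ℂ) * z
        + (((r + 1 : ℕ) : ℂ) * (((r + 1 : ℕ) : ℂ) - 1) / 2) * z ^ 2
        + (((r + 1 : ℕ) : ℂ) * (((r + 1 : ℕ) : ℂ) - 1) * (((r + 1 : ℕ) : ℂ) - 2) / 6) * z ^ 3)
        = ((1 + z) ^ r - (1 + r * z + (r * (r - 1) / 2) * z ^ 2
          + (r * (r - 1) * (r - 2) / 6) * z ^ 3)) * (1 + z) + c * z ^ 4 := by
      rw [pow_succ, hc]
      push_cast
      ring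
    rw [e]
    have h2 : ‖(c : ℂ) * z ^ 4‖ = |c| * ‖z‖ ^ 4 := by
      rw [norm_mul, norm_pow, Complex.norm_real, Real.norm_eq_abs]
    have h3 : ‖1 + z‖ ≤ 1 + ‖z‖ := (norm_add_le _ _).trans (by simp)
    have h4 : 1 ≤ (1 + ‖z‖) ^ (r + 1) := one_le_pow₀ (by linarith [norm_nonneg z])
    calc _ ≤ (C * ‖z‖ ^ 4 * (1 + ‖z‖) ^ r) * (1 + ‖z‖) + |c| * ‖z‖ ^ 4 * 1 := by
          refine (norm_add_le _ _).trans ?_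
          rw [norm_mul, h2, mul_one]
          gcongr
          exact h z
      _ ≤ (C * ‖z‖ ^ 4 * (1 + ‖z‖) ^ r) * (1 + ‖z‖) + |c| * ‖z‖ ^ 4 * (1 + ‖z‖) ^ (r + 1) := by
          gcongr
      _ = _ := by ring

/-! ### Cubic truncations of the weights -/

/-- The cubic combination `A + c₁ ε A' + c₂ ε² A'' + c₃ ε³ A'''`. -/
def cubic (c : Fin 4 → ℝ) (ε : ℝ) (u : ℝ) : ℝ := ∑ i : Fin 4, c i * ε ^ (i : ℕ) * airyD i u

lemma airyInt_sum {ι : Type*} (s : Finset ι) (c : ι → ℝ) (n : ι → ℕ) (u : ℝ) :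
    airyInt (fun a => ∑ i ∈ s, (c i : ℂ) * (Complex.I * a) ^ n i) u
      = ∑ i ∈ s, c i * airyD (n i) u ∧
    ∃ B m, PolyBdd B m (fun a => ∑ i ∈ s, (c i : ℂ) * (Complex.I * a) ^ n i) := by
  classical
  induction s using Finset.induction_on with
  | empty =>
    refine ⟨by simp [airyInt_eq, integrand], 0, 0, ?_⟩
    exact ⟨by simp only [Finset.sum_empty]; exact measurable_const,
      fun ρ _ => by simp, fun ρ _ => by simp⟩
  | insert a s ha ih =>
    obtain ⟨h1, B, m, h2⟩ := ih
    simp only [Finset.sum_insert ha]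
    have hp : PolyBdd |c a| (n a) fun z => (c a : ℂ) * (Complex.I * z) ^ n a := by
      have h3 := polyBdd_pow (n a)
      refine ⟨h3.meas.const_mul _, fun ρ hρ => ?_, fun ρ hρ => ?_⟩
      · rw [norm_mul, Complex.norm_real, Real.norm_eq_abs]
        have := h3.right ρ hρ
        rw [one_mul] at this
        gcongr
      · rw [norm_mul, Complex.norm_real, Real.norm_eq_abs]
        have := h3.left ρ hρ
        rw [one_mul] at this
        gcongr
    refine ⟨?_, |c a| + B, max (n a) m, ?_⟩
    · rw [hp.airyInt_add h2, airyInt_smul, h1]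
      rfl
    · have hB := h2.nonneg
      refine ⟨hp.meas.add h2.meas, fun ρ hρ => ?_, fun ρ hρ => ?_⟩
      · refine (norm_add_le _ _).trans ((add_le_add (hp.right ρ hρ) (h2.right ρ hρ)).trans ?_)
        rw [add_mul]
        gcongr
        · linarith
        · exact le_max_left _ _
        · linarith
        · exact le_max_right _ _
      · refine (norm_add_le _ _).trans ((add_le_add (hp.left ρ hρ) (h2.left ρ hρ)).trans ?_)
        rw [add_mul]
        gcongr
        · linarith
        · exact le_max_left _ _
        · linarith
        · exact le_max_right _ _

/-- If the weight differs from a cubic polynomial in `z = i ε a` by `O(ε⁴)`, then the integral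
differs from the corresponding combination of derivatives of the Airy function by `O(ε⁴)`. -/
lemma abs_airyInt_sub_cubic_le (m : ℕ) (x : ℝ) : ∃ C, 0 < C ∧ ∀ (B ε : ℝ) (c : Fin 4 → ℝ)
    (q : ℂ → ℂ), PolyBdd B m (fun a => q a - ∑ i : Fin 4, ((c i * ε ^ (i : ℕ) : ℝ) : ℂ)
      * (Complex.I * a) ^ (i : ℕ)) →
    ∀ u, x ≤ u → |airyInt q u - cubic c ε u| ≤ C * B * Real.exp (-u) := by
  obtain ⟨C, hC, hb⟩ := exists_airyInt_bound m x
  refine ⟨C, hC, fun B ε c q hq u hu => ?_⟩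
  obtain ⟨h1, B', m', h2⟩ := airyInt_sum Finset.univ (fun i : Fin 4 => c i * ε ^ (i : ℕ))
    (fun i => (i : ℕ)) u
  have h3 := hq.airyInt_add h2 u
  simp only [sub_add_cancel] at h3
  have h4 : airyInt q u = _ := h3
  rw [h4, h1]
  have : cubic c ε u = ∑ i : Fin 4, c i * ε ^ (i : ℕ) * airyD i u := rfl
  rw [this, add_sub_cancel_right]
  exact hb B _ hq u hu

/-- The weight of `A_r^-`, normalized. -/
def weightMinus (r : ℕ) (ε : ℝ) (a : ℂ) : ℂ := ((1 - ε * (Complex.I * a)) ^ r)⁻¹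

/-- The weight of `A_r^+`, normalized. -/
def weightPlus (r : ℕ) (ε : ℝ) (a : ℂ) : ℂ := (1 + ε * (Complex.I * a)) ^ r

/-- The coefficients of the expansion of `weightMinus`. -/
def coeffMinus (r : ℕ) : Fin 4 → ℝ := ![1, r, r * (r + 1) / 2, r * (r + 1) * (r + 2) / 6]

/-- The coefficients of the expansion of `weightPlus`. -/
def coeffPlus (r : ℕ) : Fin 4 → ℝ := ![1, r, r * (r - 1) / 2, r * (r - 1) * (r - 2) / 6]

/-- The pole of the weight stays away from the contour. The squared modulus is (ερ + (1 + ε)/2)² +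
3(1 + ε)²/4, which is at least 3/16 for ε ≥ -1/2, and 3/16 exceeds (2/5)². -/
lemma two_fifths_le_norm {ε ρ p : ℝ} (hε : -(1 / 2) ≤ ε) (hε0 : ε < 0)
    (hp : p ^ 2 = 3 / 4) :
    2 / 5 ≤ ‖1 - (ε : ℂ) * (Complex.I * (Complex.I * (1 : ℝ)
      + ρ * ((p : ℂ) + ((1 / 2 : ℝ) : ℂ) * Complex.I)))‖ := by
  have e : 1 - (ε : ℂ) * (Complex.I * (Complex.I * (1 : ℝ)
      + ρ * ((p : ℂ) + ((1 / 2 : ℝ) : ℂ) * Complex.I)))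
      = ((1 + ε * (1 + ρ / 2) : ℝ) : ℂ) + ((-(ε * ρ * p) : ℝ) : ℂ) * Complex.I := by
    push_cast
    linear_combination (-(ε : ℂ) - ε * ρ / 2) * Complex.I_sq
  rw [e, Complex.norm_add_mul_I]
  refine Real.le_sqrt_of_sq_le ?_
  nlinarith [sq_nonneg (ε * ρ + (1 + ε) / 2), mul_self_nonneg (1 + ε - 1 / 2)]

lemma norm_z_le {ε ρ : ℝ} {a : ℂ} (ha : ‖a‖ ≤ 1 + ρ) :
    ‖(ε : ℂ) * (Complex.I * a)‖ ≤ |ε| * (1 + ρ) := by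
  rw [norm_mul, norm_mul, Complex.norm_I, one_mul, Complex.norm_real, Real.norm_eq_abs]
  gcongr

lemma abs_pow_four (ε : ℝ) : |ε| ^ 4 = ε ^ 4 := by
  rw [show (4 : ℕ) = 2 * 2 from rfl, pow_mul, sq_abs, pow_mul]

lemma polyBdd_weightMinus (r : ℕ) : ∃ C, 0 ≤ C ∧ ∀ ε : ℝ, -(1 / 2) ≤ ε → ε < 0 →
    PolyBdd (C * ε ^ 4) 4 (fun a => weightMinus r ε a
      - ∑ i : Fin 4, ((coeffMinus r i * ε ^ (i : ℕ) : ℝ) : ℂ) * (Complex.I * a) ^ (i : ℕ)) := by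
  obtain ⟨C, hC, h⟩ := taylor_inv_pow r
  refine ⟨C, hC, fun ε h1 h2 => ?_⟩
  have e : ∀ a : ℂ, ∑ i : Fin 4, ((coeffMinus r i * ε ^ (i : ℕ) : ℝ) : ℂ)
      * (Complex.I * a) ^ (i : ℕ)
      = 1 + r * (ε * (Complex.I * a)) + (r * (r + 1) / 2) * (ε * (Complex.I * a)) ^ 2
      + (r * (r + 1) * (r + 2) / 6) * (ε * (Complex.I * a)) ^ 3 := by
    intro a
    simp [Fin.sum_univ_four, coeffMinus]
    ring
  simp_rw [e]
  have hs : (√3 / 2 : ℝ) ^ 2 = 3 / 4 := by rw [div_pow, sq_sqrt_three]; norm_num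
  refine ⟨by unfold weightMinus; fun_prop, fun ρ hρ => ?_, fun ρ hρ => ?_⟩
  · refine (h _ (two_fifths_le_norm h1 h2 hs)).trans ?_
    calc _ ≤ C * (|ε| * (1 + ρ)) ^ 4 := by gcongr; exact norm_z_le (norm_rayR_le hρ)
      _ = _ := by rw [mul_pow, abs_pow_four]; ring
  · refine (h _ (two_fifths_le_norm h1 h2 (by rw [neg_sq, hs]))).trans ?_
    calc _ ≤ C * (|ε| * (1 + ρ)) ^ 4 := by gcongr; exact norm_z_le (norm_rayL_le hρ)
      _ = _ := by rw [mul_pow, abs_pow_four]; ring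

lemma polyBdd_weightPlus (r : ℕ) : ∃ C, 0 ≤ C ∧ ∀ ε : ℝ, -(1 / 2) ≤ ε → ε < 0 →
    PolyBdd (C * ε ^ 4) (4 + r) (fun a => weightPlus r ε a
      - ∑ i : Fin 4, ((coeffPlus r i * ε ^ (i : ℕ) : ℝ) : ℂ) * (Complex.I * a) ^ (i : ℕ)) := by
  obtain ⟨C, hC, h⟩ := taylor_pow r
  refine ⟨C * 2 ^ r, by positivity, fun ε h1 h2 => ?_⟩
  have e : ∀ a : ℂ, ∑ i : Fin 4, ((coeffPlus r i * ε ^ (i : ℕ) : ℝ) : ℂ)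
      * (Complex.I * a) ^ (i : ℕ)
      = 1 + r * (ε * (Complex.I * a)) + (r * (r - 1) / 2) * (ε * (Complex.I * a)) ^ 2
      + (r * (r - 1) * (r - 2) / 6) * (ε * (Complex.I * a)) ^ 3 := by
    intro a
    simp [Fin.sum_univ_four, coeffPlus]
    ring
  simp_rw [e]
  have habs : |ε| ≤ 1 := by rw [abs_le]; constructor <;> linarith
  have key : ∀ ρ : ℝ, 0 ≤ ρ → ∀ a : ℂ, ‖a‖ ≤ 1 + ρ →
      C * ‖(ε : ℂ) * (Complex.I * a)‖ ^ 4 * (1 + ‖(ε : ℂ) * (Complex.I * a)‖) ^ r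
        ≤ C * 2 ^ r * ε ^ 4 * (1 + ρ) ^ (4 + r) := by
    intro ρ hρ a ha
    have h3 := norm_z_le (ε := ε) ha
    have h4 : 1 + ‖(ε : ℂ) * (Complex.I * a)‖ ≤ 2 * (1 + ρ) := by
      have : |ε| * (1 + ρ) ≤ 1 * (1 + ρ) := by gcongr
      linarith
    calc _ ≤ C * (|ε| * (1 + ρ)) ^ 4 * (2 * (1 + ρ)) ^ r := by gcongr
      _ = _ := by rw [mul_pow, mul_pow, abs_pow_four, pow_add]; ring
  exact ⟨by unfold weightPlus; fun_prop,
    fun ρ hρ => (h _).trans (key ρ hρ _ (norm_rayR_le hρ)),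
    fun ρ hρ => (h _).trans (key ρ hρ _ (norm_rayL_le hρ))⟩

/-- For t ≤ -2 the contours of A, of A_r⁻ and of A_r⁺ coincide, so the integrals can be compared
weight by weight and no contour has to be deformed. -/
lemma vertex_eq_one {t : ℝ} (ht : t ≤ -2) : vertex t = 1 := min_eq_left (by linarith)

lemma airyMinus_eq (r : ℕ) {t : ℝ} (ht : t ≤ -2) (u : ℝ) :
    airyMinus r t u = ((-t) ^ r)⁻¹ * airyInt (weightMinus r (1 / t)) u := by
  have ht0 : (t : ℂ) ≠ 0 := by exact_mod_cast (by linarith : t ≠ 0)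
  rw [airyMinus, airyMinusC, vertex_eq_one ht, ← airyInt_smul, airyInt]
  congr 3
  funext a
  congr 1
  have : Complex.I * a - (t : ℂ) = (-t : ℂ) * (1 - ((1 / t : ℝ) : ℂ) * (Complex.I * a)) := by
    push_cast
    field_simp
    ring
  rw [this, mul_pow, mul_inv, weightMinus]
  push_cast
  rfl

lemma airyPlus_eq (r : ℕ) {t : ℝ} (ht : t ≤ -2) (u : ℝ) :
    airyPlus r t u = (-t) ^ r * airyInt (weightPlus r (1 / t)) u := by
  have ht0 : (t : ℂ) ≠ 0 := by exact_mod_cast (by linarith : t ≠ 0)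
  rw [airyPlus, airyPlusC, vertex_eq_one ht, ← airyInt_smul, airyInt]
  congr 3
  funext a
  congr 1
  have : -(Complex.I * a) - (t : ℂ) = (-t : ℂ) * (1 + ((1 / t : ℝ) : ℂ) * (Complex.I * a)) := by
    push_cast
    field_simp
    ring
  rw [this, mul_pow, weightPlus]
  push_cast
  rfl

/-- The factors (-t)⁻ʳ and (-t)ʳ cancel in the product, which leaves the weights normalized to have
value 1 at 1/t = 0. -/
lemma rAiryKernel_eq (r : ℕ) {t : ℝ} (ht : t ≤ -2) :
    rAiryKernel r t = kern (airyInt (weightMinus r (1 / t))) (airyInt (weightPlus r (1 / t))) := by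
  funext u v
  rw [rAiryKernel, kern]
  congr 1
  funext w
  have ht0 : (-t) ^ r ≠ 0 := pow_ne_zero _ (by linarith)
  rw [airyMinus_eq r ht, airyPlus_eq r ht]
  field_simp

lemma exists_airyD_bound (n : ℕ) (x : ℝ) : ∃ M, 0 ≤ M ∧ ∀ i, i ≤ n → ∀ u, x ≤ u →
    |airyD i u| ≤ M * Real.exp (-u) := by
  induction n with
  | zero =>
    obtain ⟨M, hM, h⟩ := (decay_airyD 0).bound x
    exact ⟨M, hM, fun i hi u hu => by rw [Nat.le_zero.1 hi]; exact h u hu⟩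
  | succ n ih =>
    obtain ⟨M, hM, h⟩ := ih
    obtain ⟨M', hM', h'⟩ := (decay_airyD (n + 1)).bound x
    refine ⟨M + M', by positivity, fun i hi u hu => ?_⟩
    have := Real.exp_pos (-u)
    rcases Nat.lt_or_ge i (n + 1) with h1 | h1
    · refine (h i (by omega) u hu).trans ?_
      gcongr; linarith
    · have : i = n + 1 := by omega
      subst this
      refine (h' u hu).trans ?_
      gcongr; linarith

lemma decay_cubic (c : Fin 4 → ℝ) (ε : ℝ) : Decay (cubic c ε) := by
  refine ⟨continuous_finsetSum _ fun i _ => (decay_airyD i).cont.const_mul _, fun x => ?_⟩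
  obtain ⟨M, hM, h⟩ := exists_airyD_bound 3 x
  refine ⟨∑ i : Fin 4, |c i * ε ^ (i : ℕ)| * M, by positivity, fun u hu => ?_⟩
  rw [Finset.sum_mul]
  refine (Finset.abs_sum_le_sum_abs _ _).trans (Finset.sum_le_sum fun i _ => ?_)
  rw [abs_mul, mul_assoc]
  gcongr
  exact h i (by omega) u hu

lemma abs_cubic_le {c : Fin 4 → ℝ} {ε x M u : ℝ} (hε : |ε| ≤ 1)
    (h : ∀ i, i ≤ 3 → ∀ u, x ≤ u → |airyD i u| ≤ M * Real.exp (-u)) (hu : x ≤ u) :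
    |cubic c ε u| ≤ (∑ i : Fin 4, |c i|) * M * Real.exp (-u) := by
  rw [mul_assoc, Finset.sum_mul]
  refine (Finset.abs_sum_le_sum_abs _ _).trans (Finset.sum_le_sum fun i _ => ?_)
  rw [abs_mul, abs_mul, abs_pow]
  have h1 : |ε| ^ (i : ℕ) ≤ 1 := pow_le_one₀ (abs_nonneg _) hε
  calc |c i| * |ε| ^ (i : ℕ) * |airyD i u| ≤ |c i| * 1 * (M * Real.exp (-u)) := by
        gcongr
        exact h i (by omega) u hu
    _ = _ := by ring

/-- The product of the two cubics, truncated at order three. -/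
lemma kern_cubic_eq (c d : Fin 4 → ℝ) (ε u v : ℝ) :
    kern (cubic c ε) (cubic d ε) u v
      = ∑ i : Fin 4, ∑ j : Fin 4, c i * d j * ε ^ ((i : ℕ) + j) * kernD i j u v := by
  simp only [kern, cubic, kernD, Finset.sum_mul_sum]
  have hI : ∀ i j : Fin 4, IntegrableOn (fun w => c i * ε ^ (i : ℕ) * airyD i (w + u)
      * (d j * ε ^ (j : ℕ) * airyD j (w + v))) (Ioi 0) := fun i j => by
    refine (((decay_airyD i).integrable (decay_airyD j) u v).const_mul
      (c i * d j * ε ^ ((i : ℕ) + j))).congr (Eventually.of_forall fun w => ?_)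
    simp only [pow_add]
    ring
  rw [integral_finsetSum _ fun i _ => integrable_finsetSum _ fun j _ => hI i j]
  refine Finset.sum_congr rfl fun i _ => ?_
  rw [integral_finsetSum _ fun j _ => hI i j]
  refine Finset.sum_congr rfl fun j _ => ?_
  rw [← integral_const_mul]
  congr 1
  funext w
  rw [pow_add]
  ring

lemma exists_abs_kernD_le (x : ℝ) : ∃ M, 0 ≤ M ∧ ∀ i j, i ≤ 3 → j ≤ 3 → ∀ u v, x ≤ u → x ≤ v →
    |kernD i j u v| ≤ M * (Real.exp (-u) * Real.exp (-v)) := by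
  obtain ⟨M, hM, h⟩ := exists_airyD_bound 3 x
  exact ⟨M * M, by positivity, fun i j hi hj u v hu hv =>
    abs_kern_le hM hM (h i hi) (h j hj) hu hv⟩

/-- The terms of order at least four in the product of the two cubics. -/
def highOrder (c d : Fin 4 → ℝ) (ε u v : ℝ) : ℝ :=
  c 1 * d 3 * kernD 1 3 u v + c 2 * d 2 * kernD 2 2 u v + c 3 * d 1 * kernD 3 1 u v
    + ε * (c 2 * d 3 * kernD 2 3 u v + c 3 * d 2 * kernD 3 2 u v)
    + ε ^ 2 * (c 3 * d 3 * kernD 3 3 u v)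

/-- The coefficient of εⁿ is a combination of the kernels `kernD i j` with i + j = n. For n = 1, 2,
3 the alternating sum of its coefficients vanishes, because (1 - z)⁻ʳ (1 - z)ʳ = 1. The combination
is therefore a sum of multiples of `kernD (i + 1) j + kernD i (j + 1)`, which are boundary terms.
The multipliers are the alternating partial sums of the coefficients. -/
lemma kern_cubic_coeff (r : ℕ) (ε u v : ℝ) :
    kern (cubic (coeffMinus r) ε) (cubic (coeffPlus r) ε) u v
      = airyKernel u v + kernel1 r u v * ε + kernel2 r u v * ε ^ 2 + kernel3 r u v * ε ^ 3
        + ε ^ 4 * highOrder (coeffMinus r) (coeffPlus r) ε u v := by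
  have a00 := kernD_succ 0 0 u v
  have a10 := kernD_succ 1 0 u v
  have a01 := kernD_succ 0 1 u v
  have a20 := kernD_succ 2 0 u v
  have a11 := kernD_succ 1 1 u v
  have a02 := kernD_succ 0 2 u v
  norm_num at a00 a10 a01 a20 a11 a02
  have b0 : airyKernel u v = kernD 0 0 u v := by rw [airyKernel_eq]; rfl
  rw [kern_cubic_eq, kernel1_eq, kernel2_eq, kernel3_eq, b0, highOrder]
  simp [Fin.sum_univ_four, coeffMinus, coeffPlus]
  linear_combination (r * ε : ℝ) * a00 + (r * (r + 1) / 2 * ε ^ 2 : ℝ) * a10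
    + (r * (r - 1) / 2 * ε ^ 2 : ℝ) * a01
    + (r * (r + 1) * (r + 2) / 6 * ε ^ 3) * a20
    + ((r ^ 3 - r) / 3 * ε ^ 3) * a11
    + (r * (r - 1) * (r - 2) / 6 * ε ^ 3) * a02

lemma exists_highOrder_bound (c d : Fin 4 → ℝ) (x : ℝ) : ∃ M, 0 ≤ M ∧ ∀ ε, |ε| ≤ 1 →
    ∀ u v, x ≤ u → x ≤ v → |highOrder c d ε u v| ≤ M * (Real.exp (-u) * Real.exp (-v)) := by
  obtain ⟨M, hM, h⟩ := exists_abs_kernD_le x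
  refine ⟨(|c 1 * d 3| + |c 2 * d 2| + |c 3 * d 1| + 1 * (|c 2 * d 3| + |c 3 * d 2|)
    + 1 ^ 2 * |c 3 * d 3|) * M, by positivity, fun ε hε u v hu hv => ?_⟩
  have hb : ∀ (a : ℝ) (i j : ℕ), i ≤ 3 → j ≤ 3 → |a * kernD i j u v|
      ≤ |a| * (M * (Real.exp (-u) * Real.exp (-v))) := fun a i j hi hj => by
    rw [abs_mul]
    gcongr
    exact h i j hi hj u v hu hv
  rw [highOrder]
  calc _ ≤ |c 1 * d 3 * kernD 1 3 u v| + |c 2 * d 2 * kernD 2 2 u v| + |c 3 * d 1 * kernD 3 1 u v|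
      + |ε| * (|c 2 * d 3 * kernD 2 3 u v| + |c 3 * d 2 * kernD 3 2 u v|)
      + |ε| ^ 2 * |c 3 * d 3 * kernD 3 3 u v| := by
        refine (abs_add_le _ _).trans (add_le_add ((abs_add_le _ _).trans (add_le_add
          ((abs_add_le _ _).trans (add_le_add (abs_add_le _ _) le_rfl)) ?_)) ?_)
        · rw [abs_mul]; gcongr; exact abs_add_le _ _
        · rw [abs_mul, abs_pow]
    _ ≤ |c 1 * d 3| * (M * (Real.exp (-u) * Real.exp (-v)))
      + |c 2 * d 2| * (M * (Real.exp (-u) * Real.exp (-v)))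
      + |c 3 * d 1| * (M * (Real.exp (-u) * Real.exp (-v)))
      + 1 * (|c 2 * d 3| * (M * (Real.exp (-u) * Real.exp (-v)))
        + |c 3 * d 2| * (M * (Real.exp (-u) * Real.exp (-v))))
      + 1 ^ 2 * (|c 3 * d 3| * (M * (Real.exp (-u) * Real.exp (-v)))) := by
        have b1 := hb (c 1 * d 3) 1 3 (by norm_num) (by norm_num)
        have b2 := hb (c 2 * d 2) 2 2 (by norm_num) (by norm_num)
        have b3 := hb (c 3 * d 1) 3 1 (by norm_num) (by norm_num)
        have b4 := hb (c 2 * d 3) 2 3 (by norm_num) (by norm_num)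
        have b5 := hb (c 3 * d 2) 3 2 (by norm_num) (by norm_num)
        have b6 := hb (c 3 * d 3) 3 3 (by norm_num) (by norm_num)
        gcongr
    _ = _ := by ring

lemma kern_sub_kern {f g f' g' : ℝ → ℝ} (hf : Decay f) (hg : Decay g) (hf' : Decay f')
    (hg' : Decay g') (u v : ℝ) :
    kern f g u v - kern f' g' u v = kern (fun u => f u - f' u) g u v
      + kern f' (fun u => g u - g' u) u v := by
  simp only [kern, sub_mul, mul_sub]
  rw [integral_sub (hf.integrable hg u v) (hf'.integrable hg u v),
    integral_sub (hf'.integrable hg u v) (hf'.integrable hg' u v)]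
  ring

lemma polyBdd_of_sub_cubic {B ε : ℝ} {m : ℕ} {c : Fin 4 → ℝ} {q : ℂ → ℂ}
    (hq : PolyBdd B m (fun a => q a - ∑ i : Fin 4, ((c i * ε ^ (i : ℕ) : ℝ) : ℂ)
      * (Complex.I * a) ^ (i : ℕ))) : Decay (airyInt q) := by
  obtain ⟨-, B', m', h2⟩ := airyInt_sum Finset.univ (fun i : Fin 4 => c i * ε ^ (i : ℕ))
    (fun i => (i : ℕ)) 0
  have e : airyInt q = fun u => airyInt (fun a => q a - ∑ i : Fin 4,
      ((c i * ε ^ (i : ℕ) : ℝ) : ℂ) * (Complex.I * a) ^ (i : ℕ)) u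
      + airyInt (fun a => ∑ i : Fin 4, ((c i * ε ^ (i : ℕ) : ℝ) : ℂ)
        * (Complex.I * a) ^ (i : ℕ)) u := by
    funext u
    rw [← hq.airyInt_add h2 u]
    simp only [sub_add_cancel]
  rw [e]
  refine ⟨hq.decay.cont.add h2.decay.cont, fun x => ?_⟩
  obtain ⟨C, hC, h⟩ := hq.decay.bound x
  obtain ⟨C', hC', h'⟩ := h2.decay.bound x
  refine ⟨C + C', by positivity, fun u hu => (abs_add_le _ _).trans ?_⟩
  rw [add_mul]
  exact add_le_add (h u hu) (h' u hu)

lemma decay_weights (r : ℕ) {t : ℝ} (ht : t ≤ -2) :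
    Decay (airyInt (weightMinus r (1 / t))) ∧ Decay (airyInt (weightPlus r (1 / t))) := by
  have h1 : -(1 / 2) ≤ 1 / t := by
    rw [le_div_iff_of_neg (by linarith)]; linarith
  have h2 : 1 / t < 0 := by rw [one_div]; exact inv_lt_zero.2 (by linarith)
  obtain ⟨C, _, h⟩ := polyBdd_weightMinus r
  obtain ⟨C', _, h'⟩ := polyBdd_weightPlus r
  exact ⟨polyBdd_of_sub_cubic (h _ h1 h2), polyBdd_of_sub_cubic (h' _ h1 h2)⟩

/-- The expansion of the `r`-Airy kernel, uniformly on `[x, ∞)²`. -/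
theorem exists_rAiryKernel_expansion (r : ℕ) (x : ℝ) : ∃ M, 0 ≤ M ∧ ∀ t : ℝ, t ≤ -2 →
    ∀ u v, x ≤ u → x ≤ v →
    |rAiryKernel r t u v - (airyKernel u v + kernel1 r u v * (1 / t) + kernel2 r u v * (1 / t) ^ 2
      + kernel3 r u v * (1 / t) ^ 3)| ≤ M * (1 / t) ^ 4 * (Real.exp (-u) * Real.exp (-v)) := by
  obtain ⟨C₁, hC₁, h₁⟩ := polyBdd_weightMinus r
  obtain ⟨C₂, hC₂, h₂⟩ := polyBdd_weightPlus r
  obtain ⟨D₁, hD₁, k₁⟩ := abs_airyInt_sub_cubic_le 4 x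
  obtain ⟨D₂, hD₂, k₂⟩ := abs_airyInt_sub_cubic_le (4 + r) x
  obtain ⟨M, hM, hA⟩ := exists_airyD_bound 3 x
  obtain ⟨H, hH, hh⟩ := exists_highOrder_bound (coeffMinus r) (coeffPlus r) x
  set S₁ := (∑ i : Fin 4, |coeffMinus r i|) * M with hS₁
  set S₂ := (∑ i : Fin 4, |coeffPlus r i|) * M with hS₂
  have hS₁0 : 0 ≤ S₁ := by positivity
  have hS₂0 : 0 ≤ S₂ := by positivity
  refine ⟨D₁ * C₁ * (D₂ * C₂ + S₂) + S₁ * (D₂ * C₂) + H, by positivity,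
    fun t ht u v hu hv => ?_⟩
  set ε := 1 / t with hε
  have e1 : -(1 / 2) ≤ ε := by
    rw [hε, le_div_iff_of_neg (by linarith)]; linarith
  have e2 : ε < 0 := by rw [hε, one_div]; exact inv_lt_zero.2 (by linarith)
  have e3 : |ε| ≤ 1 := by rw [abs_le]; constructor <;> linarith
  have e4 : ε ^ 4 ≤ 1 := by rw [← abs_pow_four]; exact pow_le_one₀ (abs_nonneg _) e3
  have e5 : 0 ≤ ε ^ 4 := by positivity
  obtain ⟨d₁, d₂⟩ := decay_weights r ht
  have f₁ := k₁ _ ε _ _ (h₁ ε e1 e2)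
  have f₂ := k₂ _ ε _ _ (h₂ ε e1 e2)
  have g₁ : ∀ u, x ≤ u → |cubic (coeffMinus r) ε u| ≤ S₁ * Real.exp (-u) := fun u hu =>
    abs_cubic_le e3 hA hu
  have g₂ : ∀ u, x ≤ u → |airyInt (weightPlus r ε) u| ≤ (D₂ * C₂ + S₂) * Real.exp (-u) := by
    intro u hu
    have a1 := f₂ u hu
    have a2 : |cubic (coeffPlus r) ε u| ≤ S₂ * Real.exp (-u) := abs_cubic_le e3 hA hu
    have a3 : D₂ * (C₂ * ε ^ 4) * Real.exp (-u) ≤ D₂ * (C₂ * 1) * Real.exp (-u) := by gcongr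
    have a4 := abs_sub_abs_le_abs_sub (airyInt (weightPlus r ε) u) (cubic (coeffPlus r) ε u)
    linarith
  -- One factor is replaced by its cubic truncation at a time. Each replacement costs O(ε⁴), and the
  -- product of the truncations contributes its own terms of order at least four.
  have key := kern_sub_kern d₁ d₂ (decay_cubic (coeffMinus r) ε) (decay_cubic (coeffPlus r) ε) u v
  rw [kern_cubic_coeff] at key
  rw [rAiryKernel_eq r ht]
  have b1 := abs_kern_le (f := fun u => airyInt (weightMinus r ε) u - cubic (coeffMinus r) ε u)
    (g := airyInt (weightPlus r ε)) (C := D₁ * (C₁ * ε ^ 4)) (by positivity) (by positivity)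
    f₁ g₂ hu hv
  have b2 := abs_kern_le (f := cubic (coeffMinus r) ε)
    (g := fun u => airyInt (weightPlus r ε) u - cubic (coeffPlus r) ε u)
    (C' := D₂ * (C₂ * ε ^ 4)) hS₁0 (by positivity) g₁ f₂ hu hv
  have b3 : |ε ^ 4 * highOrder (coeffMinus r) (coeffPlus r) ε u v|
      ≤ ε ^ 4 * (H * (Real.exp (-u) * Real.exp (-v))) := by
    rw [abs_mul, abs_of_nonneg e5]
    gcongr
    exact hh ε e3 u v hu hv
  have : kern (airyInt (weightMinus r ε)) (airyInt (weightPlus r ε)) u v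
      - (airyKernel u v + kernel1 r u v * ε + kernel2 r u v * ε ^ 2 + kernel3 r u v * ε ^ 3)
      = kern (fun u => airyInt (weightMinus r ε) u - cubic (coeffMinus r) ε u)
          (airyInt (weightPlus r ε)) u v
        + kern (cubic (coeffMinus r) ε)
          (fun u => airyInt (weightPlus r ε) u - cubic (coeffPlus r) ε u) u v
        + ε ^ 4 * highOrder (coeffMinus r) (coeffPlus r) ε u v := by
    rw [← key]; ring
  rw [this]
  refine (abs_add_le _ _).trans ((add_le_add ((abs_add_le _ _).trans (add_le_add b1 b2))
    b3).trans (le_of_eq ?_))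
  ring

end RAiry
end

noncomputable section

namespace RAiry

open Filter Topology

/-! ### Translation and dilation of the Airy kernel -/

lemma exp_neg_le_wt {x u : ℝ} (hu : x ≤ u) : Real.exp (-u) ≤ wt x * wt u := by
  rw [← wt_sq, sq]
  exact mul_le_mul_of_nonneg_right (wt_anti hu) (wt_pos u).le

lemma exp_neg_mul_le_wt {x u v : ℝ} (hu : x ≤ u) (hv : x ≤ v) :
    Real.exp (-u) * Real.exp (-v) ≤ wt x ^ 2 * (wt u * wt v) := by
  calc _ ≤ (wt x * wt u) * (wt x * wt v) :=
        mul_le_mul (exp_neg_le_wt hu) (exp_neg_le_wt hv) (Real.exp_pos _).le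
          (mul_nonneg (wt_pos _).le (wt_pos _).le)
    _ = _ := by ring

lemma Decay.exists_dom {f : ℝ → ℝ} (hf : Decay f) (x : ℝ) : ∃ C, 0 ≤ C ∧ Dom x C f := by
  obtain ⟨C, hC, hb⟩ := hf.bound x
  have hx := wt_pos x
  refine ⟨C * wt x, by positivity, hf.cont.measurable, fun u hu => (hb u (le_of_lt hu)).trans ?_⟩
  rw [mul_assoc]
  exact mul_le_mul_of_nonneg_left (exp_neg_le_wt (le_of_lt hu)) hC

lemma Decay.exists_adm_kern {f g : ℝ → ℝ} (hf : Decay f) (hg : Decay g) (x : ℝ) :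
    ∃ C, 0 ≤ C ∧ Adm x C (kern f g) := by
  obtain ⟨C, hC, hb⟩ := hf.bound x
  obtain ⟨C', hC', hb'⟩ := hg.bound x
  have hx := wt_pos x
  refine ⟨C * C' * wt x ^ 2, by positivity, (hf.continuous_kern hg).measurable,
    fun u hu v hv => (abs_kern_le hC hC' hb hb' (le_of_lt hu) (le_of_lt hv)).trans ?_⟩
  rw [mul_assoc (C * C')]
  exact mul_le_mul_of_nonneg_left (exp_neg_mul_le_wt (le_of_lt hu) (le_of_lt hv)) (by positivity)

/-- Taylor's formula to first order, with remainder from two uses of the mean value inequality. The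
constant M in place of M/2 is immaterial. -/
lemma abs_sub_sub_mul_le {φ φ' φ'' : ℝ → ℝ} {M e : ℝ} (h1 : ∀ s, HasDerivAt φ (φ' s) s)
    (h2 : ∀ s, HasDerivAt φ' (φ'' s) s) (hM : ∀ s, |s| ≤ |e| → |φ'' s| ≤ M) :
    |φ e - φ 0 - e * φ' 0| ≤ M * e ^ 2 := by
  have hconv : Convex ℝ (Icc (-|e|) |e|) := convex_Icc _ _
  have h0 : (0 : ℝ) ∈ Icc (-|e|) |e| := ⟨by simp, abs_nonneg _⟩
  have he : e ∈ Icc (-|e|) |e| := ⟨neg_abs_le e, le_abs_self e⟩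
  have hM0 : 0 ≤ M := (abs_nonneg _).trans (hM 0 (by simp))
  have key : ∀ s ∈ Icc (-|e|) |e|, ‖φ' s - φ' 0‖ ≤ M * |e| := by
    intro s hs
    have h := hconv.norm_image_sub_le_of_norm_hasDerivWithin_le (C := M)
      (fun s _ => (h2 s).hasDerivWithinAt) (fun s hs => hM s (abs_le.2 hs)) h0 hs
    refine h.trans (mul_le_mul_of_nonneg_left ?_ hM0)
    rw [sub_zero]
    exact abs_le.2 hs
  have h := hconv.norm_image_sub_le_of_norm_hasDerivWithin_le
    (f := fun s => φ s - s * φ' 0) (f' := fun s => φ' s - φ' 0)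
    (fun s _ => ((h1 s).sub ((hasDerivAt_mul_const (φ' 0)))).hasDerivWithinAt) key h0 he
  simp only [zero_mul, sub_zero, Real.norm_eq_abs] at h
  calc |φ e - φ 0 - e * φ' 0| = |φ e - e * φ' 0 - φ 0| := by congr 1; ring
    _ ≤ M * |e| * |e| := h
    _ = M * e ^ 2 := by rw [mul_assoc, ← sq, sq_abs]

lemma exists_translate_bound (i j : ℕ) (x : ℝ) : ∃ M, 0 ≤ M ∧ ∀ e, |e| ≤ 1 → ∀ u v, x ≤ u →
    x ≤ v → |airyD i (u + e) * airyD j (v + e) - airyD i u * airyD j v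
      - e * (airyD (i + 1) u * airyD j v + airyD i u * airyD (j + 1) v)|
      ≤ M * e ^ 2 * (Real.exp (-u) * Real.exp (-v)) := by
  obtain ⟨C, hC, hb⟩ := exists_airyD_bound (i + j + 2) (x - 1)
  refine ⟨4 * (C * Real.exp 1) ^ 2, by positivity, fun e he u v hu hv => ?_⟩
  have hd : ∀ (k : ℕ) (u s : ℝ), HasDerivAt (fun s => airyD k (u + s)) (airyD (k + 1) (u + s)) s :=
    fun k u s => (hasDerivAt_airyD k (u + s)).comp_const_add u s
  have hB : ∀ k ≤ i + j + 2, ∀ u, x ≤ u → ∀ s, |s| ≤ |e| →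
      |airyD k (u + s)| ≤ C * Real.exp 1 * Real.exp (-u) := by
    intro k hk u hu s hs
    have hs' := abs_le.1 (hs.trans he)
    refine (hb k hk (u + s) (by linarith)).trans ?_
    rw [mul_assoc, ← Real.exp_add]
    gcongr
    linarith
  have h := abs_sub_sub_mul_le (e := e)
    (φ := fun s => airyD i (u + s) * airyD j (v + s))
    (φ' := fun s => airyD (i + 1) (u + s) * airyD j (v + s)
      + airyD i (u + s) * airyD (j + 1) (v + s))
    (φ'' := fun s => (airyD (i + 2) (u + s) * airyD j (v + s)
      + airyD (i + 1) (u + s) * airyD (j + 1) (v + s))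
      + (airyD (i + 1) (u + s) * airyD (j + 1) (v + s) + airyD i (u + s) * airyD (j + 2) (v + s)))
    (M := 4 * (C * Real.exp 1) ^ 2 * (Real.exp (-u) * Real.exp (-v)))
    (fun s => (hd i u s).mul (hd j v s))
    (fun s => ((hd (i + 1) u s).mul (hd j v s)).add ((hd i u s).mul (hd (j + 1) v s)))
    (fun s hs => ?_)
  · simp only [add_zero] at h
    refine h.trans (le_of_eq (by ring))
  · have hp : ∀ k ≤ i + j + 2, ∀ l ≤ i + j + 2, |airyD k (u + s) * airyD l (v + s)|
        ≤ (C * Real.exp 1) ^ 2 * (Real.exp (-u) * Real.exp (-v)) := by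
      intro k hk l hl
      rw [abs_mul]
      calc _ ≤ (C * Real.exp 1 * Real.exp (-u)) * (C * Real.exp 1 * Real.exp (-v)) :=
            mul_le_mul (hB k hk u hu s hs) (hB l hl v hv s hs) (abs_nonneg _) (by positivity)
        _ = _ := by ring
    have p1 := hp (i + 2) (by omega) j (by omega)
    have p2 := hp (i + 1) (by omega) (j + 1) (by omega)
    have p3 := hp i (by omega) (j + 2) (by omega)
    refine (abs_add_le _ _).trans ?_
    have q1 := abs_add_le (airyD (i + 2) (u + s) * airyD j (v + s))
      (airyD (i + 1) (u + s) * airyD (j + 1) (v + s))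
    have q2 := abs_add_le (airyD (i + 1) (u + s) * airyD (j + 1) (v + s))
      (airyD i (u + s) * airyD (j + 2) (v + s))
    linarith

lemma integral_sub_sub_mul {μ : Measure ℝ} {a b c d : ℝ → ℝ} (ha : Integrable a μ)
    (hb : Integrable b μ) (hc : Integrable c μ) (hd : Integrable d μ) (e : ℝ) :
    ∫ w, (a w - b w - e * (c w + d w)) ∂μ
      = ∫ w, a w ∂μ - ∫ w, b w ∂μ - e * (∫ w, c w ∂μ + ∫ w, d w ∂μ) := by
  rw [← integral_sub ha hb, ← integral_add hc hd, ← integral_const_mul]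
  exact integral_sub (ha.sub hb) ((hc.add hd).const_mul e)

/-- The Taylor bound for the products is integrated over w. The first-order term is a total
derivative in w and leaves -A(u)A(v). -/
lemma exists_airyKernel_translate_bound (x : ℝ) : ∃ M, 0 ≤ M ∧ ∀ e, |e| ≤ 1 → ∀ u v, x ≤ u →
    x ≤ v → |airyKernel (u + e) (v + e) - airyKernel u v + e * (airyD 0 u * airyD 0 v)|
      ≤ M * e ^ 2 * (Real.exp (-u) * Real.exp (-v)) := by
  obtain ⟨M, hM, hb⟩ := exists_translate_bound 0 0 x
  refine ⟨M, hM, fun e he u v hu hv => ?_⟩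
  have h0 := (decay_airyD 0).integrable (decay_airyD 0)
  have h1 := (decay_airyD 1).integrable (decay_airyD 0)
  have h2 := (decay_airyD 0).integrable (decay_airyD 1)
  have e1 : airyKernel (u + e) (v + e) - airyKernel u v + e * (airyD 0 u * airyD 0 v)
      = ∫ w in Ioi (0 : ℝ), (airyD 0 (w + u + e) * airyD 0 (w + v + e)
        - airyD 0 (w + u) * airyD 0 (w + v) - e * (airyD 1 (w + u) * airyD 0 (w + v)
          + airyD 0 (w + u) * airyD 1 (w + v))) := by
    have h3 : IntegrableOn (fun w => airyD 0 (w + u + e) * airyD 0 (w + v + e)) (Ioi 0) := by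
      simpa only [add_assoc] using h0 (u + e) (v + e)
    have h4 := kernD_succ 0 0 u v
    rw [integral_sub_sub_mul h3 (h0 u v) (h1 u v) (h2 u v)]
    simp only [kernD, kern, zero_add] at h4
    rw [h4, airyKernel_eq]
    simp only [kern, add_assoc]
    ring
  rw [e1]
  refine integral_le_of_abs_le_exp fun w hw => ?_
  refine (hb e he (w + u) (w + v) (by linarith) (by linarith)).trans ?_
  have : Real.exp (-(w + u)) * Real.exp (-(w + v))
      ≤ Real.exp (-u) * Real.exp (-v) * Real.exp (-w) := by
    rw [← Real.exp_add, ← Real.exp_add, ← Real.exp_add]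
    exact Real.exp_le_exp.2 (by linarith)
  calc _ ≤ M * e ^ 2 * (Real.exp (-u) * Real.exp (-v) * Real.exp (-w)) := by gcongr
    _ = _ := by ring

lemma airyD_three (u : ℝ) : airyD 3 u = airyD 0 u + u * airyD 1 u := by
  have h : HasDerivAt (airyD 2) (1 * airyD 0 u + u * airyD 1 u) u := by
    have h2 := (hasDerivAt_id u).mul (hasDerivAt_airyD 0 u)
    have : airyD 2 = fun u => id u * airyD 0 u := funext airyD_two
    rw [this]
    exact h2
  rw [(hasDerivAt_airyD 2 u).unique h, one_mul]

/-- Differentiating a dilation twice produces factors up to s². They are absorbed in the gap between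
the rate c ≥ 3/4 and the rate 1/2 of the weight, which is the reason for a weight decaying more
slowly than the Airy function. -/
lemma one_add_abs_sq_mul_exp_le {x s c : ℝ} (hs : x ≤ s) (hc : 3 / 4 ≤ c) (hc' : c ≤ 5 / 4) :
    (1 + |s|) ^ 2 * Real.exp (-(c * s)) ≤ 64 * Real.exp (1 + 2 * |x|) * wt s := by
  have h1 : (1 + |s|) ^ 2 ≤ 64 * Real.exp ((1 + |s|) / 4) := by
    have := Real.pow_div_factorial_le_exp ((1 + |s|) / 4) (by positivity) 2
    norm_num at this
    nlinarith [Real.exp_pos ((1 + |s|) / 4)]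
  calc (1 + |s|) ^ 2 * Real.exp (-(c * s))
      ≤ 64 * Real.exp ((1 + |s|) / 4) * Real.exp (-(c * s)) := by gcongr
    _ = 64 * Real.exp ((1 + |s|) / 4 - c * s) := by
        rw [mul_assoc, ← Real.exp_add]; rfl
    _ ≤ 64 * Real.exp (1 + 2 * |x| + -(s / 2)) := by
        gcongr
        rcases le_total 0 s with h | h
        · rw [abs_of_nonneg h]
          nlinarith [abs_nonneg x]
        · rw [abs_of_nonpos h]
          have : -s ≤ |x| := by linarith [neg_abs_le x]
          nlinarith
    _ = _ := by rw [Real.exp_add, wt]; ring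

/-- At e = 0 the derivative of (1 + e)² A((1 + e)s) A((1 + e)t) is 2A(s)A(t) + sA'(s)A(t) +
A(s)tA'(t). Since A''' = A + sA', this equals A'''(s)A(t) + A(s)A'''(t), and so can be integrated
explicitly. -/
lemma exists_dilate_bound (x : ℝ) : ∃ M, 0 ≤ M ∧ ∀ e, |e| ≤ 1 / 4 → ∀ s t, x ≤ s → x ≤ t →
    |(1 + e) ^ 2 * (airyD 0 ((1 + e) * s) * airyD 0 ((1 + e) * t)) - airyD 0 s * airyD 0 t
      - e * (airyD 3 s * airyD 0 t + airyD 0 s * airyD 3 t)| ≤ M * e ^ 2 * (wt s * wt t) := by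
  obtain ⟨C, hC, hb⟩ := exists_airyD_bound 2 (-(5 / 4) * |x|)
  set B := C * (64 * Real.exp (1 + 2 * |x|)) with hB
  have hB0 : 0 ≤ B := by positivity
  refine ⟨20 * B ^ 2, by positivity, fun e he s t hs ht => ?_⟩
  have hd : ∀ (k : ℕ) (s z : ℝ), HasDerivAt (fun z => airyD k ((1 + z) * s))
      (airyD (k + 1) ((1 + z) * s) * s) z := by
    intro k s z
    have h1 : HasDerivAt (fun z : ℝ => (1 + z) * s) (1 * s) z :=
      ((hasDerivAt_id z).const_add 1).mul_const s
    have := (hasDerivAt_airyD k ((1 + z) * s)).comp z h1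
    rwa [one_mul] at this
  have hA : ∀ k ≤ 2, ∀ m ≤ 2, ∀ s, x ≤ s → ∀ z, |z| ≤ |e| →
      |s ^ m * airyD k ((1 + z) * s)| ≤ B * wt s := by
    intro k hk m hm s hs z hz
    have hz' := abs_le.1 (hz.trans he)
    have hle : -(5 / 4) * |x| ≤ (1 + z) * s := by
      rcases le_total 0 s with h | h
      · nlinarith [abs_nonneg x]
      · have : -s ≤ |x| := by linarith [neg_abs_le x]
        nlinarith
    have h1 := hb k hk _ hle
    have h2 := one_add_abs_sq_mul_exp_le (c := 1 + z) hs (by linarith) (by linarith)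
    have h3 : |s| ^ m ≤ (1 + |s|) ^ 2 := by
      calc |s| ^ m ≤ (1 + |s|) ^ m := by gcongr; linarith
        _ ≤ (1 + |s|) ^ 2 := pow_le_pow_right₀ (by linarith [abs_nonneg s]) hm
    rw [abs_mul, abs_pow]
    calc |s| ^ m * |airyD k ((1 + z) * s)|
        ≤ (1 + |s|) ^ 2 * (C * Real.exp (-((1 + z) * s))) := by gcongr
      _ = C * ((1 + |s|) ^ 2 * Real.exp (-((1 + z) * s))) := by ring
      _ ≤ C * (64 * Real.exp (1 + 2 * |x|) * wt s) := by gcongr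
      _ = B * wt s := by rw [hB]; ring
  have hq : ∀ z : ℝ, HasDerivAt (fun z : ℝ => (1 + z) ^ 2) (2 * (1 + z)) z := by
    intro z
    have := ((hasDerivAt_id z).const_add 1).pow 2
    refine this.congr_deriv ?_
    simp
  have hl : ∀ z : ℝ, HasDerivAt (fun z : ℝ => 2 * (1 + z)) 2 z := by
    intro z
    have := ((hasDerivAt_id z).const_add 1).const_mul 2
    simpa using this
  have h := abs_sub_sub_mul_le (e := e)
    (φ := fun z => (1 + z) ^ 2 * (airyD 0 ((1 + z) * s) * airyD 0 ((1 + z) * t)))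
    (φ' := fun z => 2 * (1 + z) * (airyD 0 ((1 + z) * s) * airyD 0 ((1 + z) * t))
      + (1 + z) ^ 2 * (airyD 1 ((1 + z) * s) * s * airyD 0 ((1 + z) * t)
        + airyD 0 ((1 + z) * s) * (airyD 1 ((1 + z) * t) * t)))
    (φ'' := fun z => (2 * (airyD 0 ((1 + z) * s) * airyD 0 ((1 + z) * t))
      + 2 * (1 + z) * (airyD 1 ((1 + z) * s) * s * airyD 0 ((1 + z) * t)
        + airyD 0 ((1 + z) * s) * (airyD 1 ((1 + z) * t) * t)))
      + (2 * (1 + z) * (airyD 1 ((1 + z) * s) * s * airyD 0 ((1 + z) * t)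
        + airyD 0 ((1 + z) * s) * (airyD 1 ((1 + z) * t) * t))
      + (1 + z) ^ 2 * ((airyD 2 ((1 + z) * s) * s * s * airyD 0 ((1 + z) * t)
        + airyD 1 ((1 + z) * s) * s * (airyD 1 ((1 + z) * t) * t))
        + (airyD 1 ((1 + z) * s) * s * (airyD 1 ((1 + z) * t) * t)
        + airyD 0 ((1 + z) * s) * (airyD 2 ((1 + z) * t) * t * t)))))
    (M := 20 * B ^ 2 * (wt s * wt t))
    (fun z => (hq z).mul ((hd 0 s z).mul (hd 0 t z)))
    (fun z => ((hl z).mul ((hd 0 s z).mul (hd 0 t z))).add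
      ((hq z).mul ((((hd 1 s z).mul_const s).mul (hd 0 t z)).add
        ((hd 0 s z).mul ((hd 1 t z).mul_const t)))))
    (fun z hz => ?_)
  · simp only [add_zero, one_pow, one_mul, mul_one] at h
    rw [airyD_three, airyD_three]
    refine le_trans (le_of_eq ?_) (h.trans (le_of_eq (by ring)))
    congr 1
    ring
  · have hz' := abs_le.1 (hz.trans he)
    have hp : ∀ k ≤ 2, ∀ l ≤ 2, ∀ m ≤ 2, ∀ n ≤ 2,
        |s ^ m * airyD k ((1 + z) * s) * (t ^ n * airyD l ((1 + z) * t))|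
        ≤ B ^ 2 * (wt s * wt t) := by
      intro k hk l hl m hm n hn
      rw [abs_mul]
      have := wt_pos s
      calc _ ≤ (B * wt s) * (B * wt t) :=
            mul_le_mul (hA k hk m hm s hs z hz) (hA l hl n hn t ht z hz) (abs_nonneg _)
              (by positivity)
        _ = _ := by ring
    set N := B ^ 2 * (wt s * wt t) with hN
    have p00 := abs_le.1 (hp 0 (by norm_num) 0 (by norm_num) 0 (by norm_num) 0 (by norm_num))
    have p10 := abs_le.1 (hp 1 (by norm_num) 0 (by norm_num) 1 (by norm_num) 0 (by norm_num))
    have p01 := abs_le.1 (hp 0 (by norm_num) 1 (by norm_num) 0 (by norm_num) 1 (by norm_num))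
    have p20 := abs_le.1 (hp 2 (by norm_num) 0 (by norm_num) 2 (by norm_num) 0 (by norm_num))
    have p11 := abs_le.1 (hp 1 (by norm_num) 1 (by norm_num) 1 (by norm_num) 1 (by norm_num))
    have p02 := abs_le.1 (hp 0 (by norm_num) 2 (by norm_num) 0 (by norm_num) 2 (by norm_num))
    have hN0 : 0 ≤ N := by linarith
    set a00 := s ^ 0 * airyD 0 ((1 + z) * s) * (t ^ 0 * airyD 0 ((1 + z) * t)) with h00
    set a10 := s ^ 1 * airyD 1 ((1 + z) * s) * (t ^ 0 * airyD 0 ((1 + z) * t)) with h10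
    set a01 := s ^ 0 * airyD 0 ((1 + z) * s) * (t ^ 1 * airyD 1 ((1 + z) * t)) with h01
    set a20 := s ^ 2 * airyD 2 ((1 + z) * s) * (t ^ 0 * airyD 0 ((1 + z) * t)) with h20
    set a11 := s ^ 1 * airyD 1 ((1 + z) * s) * (t ^ 1 * airyD 1 ((1 + z) * t)) with h11
    set a02 := s ^ 0 * airyD 0 ((1 + z) * s) * (t ^ 2 * airyD 2 ((1 + z) * t)) with h02
    -- The three groups contribute at most 2N, 5 · 2N and 2 · 4N, by |1 + z| ≤ 5/4 and (1 + z)² ≤ 2.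
    have key : |2 * a00 + 4 * (1 + z) * (a10 + a01)
        + (1 + z) ^ 2 * (a20 + 2 * a11 + a02)| ≤ 20 * N := by
      have k1 : |2 * a00| ≤ 2 * N := by rw [abs_le]; constructor <;> linarith
      have k2 : |4 * (1 + z) * (a10 + a01)| ≤ 5 * (2 * N) := by
        rw [abs_mul]
        refine mul_le_mul ?_ ?_ (abs_nonneg _) (by norm_num)
        · rw [abs_le]; constructor <;> linarith
        · rw [abs_le]; constructor <;> linarith
      have k3 : |(1 + z) ^ 2 * (a20 + 2 * a11 + a02)| ≤ 2 * (4 * N) := by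
        rw [abs_mul]
        refine mul_le_mul ?_ ?_ (abs_nonneg _) (by norm_num)
        · rw [abs_le]; constructor <;> nlinarith
        · rw [abs_le]; constructor <;> linarith
      refine (abs_add_le _ _).trans ?_
      have := abs_add_le (2 * a00) (4 * (1 + z) * (a10 + a01))
      linarith
    rw [show 20 * B ^ 2 * (wt s * wt t) = 20 * N by rw [hN]; ring]
    refine le_trans (le_of_eq ?_) key
    congr 1
    rw [h00, h10, h01, h20, h11, h02]
    ring

/-- Substituting w ↦ (1 + e)w turns the dilated kernel into the integral of the dilated products
over shifted arguments. The first-order term is the sum of `kernD 3 0` and `kernD 0 3`, which three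
integrations by parts reduce to products of derivatives. -/
lemma exists_airyKernel_dilate_bound (x : ℝ) : ∃ M, 0 ≤ M ∧ ∀ e, |e| ≤ 1 / 4 → ∀ u v, x ≤ u →
    x ≤ v → |(1 + e) * airyKernel ((1 + e) * u) ((1 + e) * v) - airyKernel u v
      + e * (airyD 2 u * airyD 0 v - airyD 1 u * airyD 1 v + airyD 0 u * airyD 2 v)|
      ≤ M * e ^ 2 * (wt u * wt v) := by
  obtain ⟨M, hM, hb⟩ := exists_dilate_bound x
  refine ⟨M, hM, fun e he u v hu hv => ?_⟩
  have hpos : 0 < 1 + e := by linarith [(abs_le.1 he).1]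
  have h0 := (decay_airyD 0).integrable (decay_airyD 0)
  have h1 := (decay_airyD 3).integrable (decay_airyD 0) u v
  have h2 := (decay_airyD 0).integrable (decay_airyD 3) u v
  have h3 : IntegrableOn (fun w => (1 + e) ^ 2 * (airyD 0 ((1 + e) * (w + u))
      * airyD 0 ((1 + e) * (w + v)))) (Ioi 0) := by
    have := (integrableOn_Ioi_comp_mul_left_iff (fun w => airyD 0 (w + (1 + e) * u)
      * airyD 0 (w + (1 + e) * v)) 0 hpos).2 (by
        rw [mul_zero]; exact h0 ((1 + e) * u) ((1 + e) * v))
    simp only [← mul_add] at this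
    exact this.const_mul _
  have h4 : (1 + e) * airyKernel ((1 + e) * u) ((1 + e) * v)
      = ∫ w in Ioi (0 : ℝ), (1 + e) ^ 2 * (airyD 0 ((1 + e) * (w + u))
      * airyD 0 ((1 + e) * (w + v))) := by
    have := integral_comp_mul_left_Ioi (fun w => airyD 0 (w + (1 + e) * u)
      * airyD 0 (w + (1 + e) * v)) 0 hpos
    simp only [← mul_add] at this
    rw [integral_const_mul, this, mul_zero, smul_eq_mul, airyKernel_eq, kern]
    field_simp
  have e1 : (1 + e) * airyKernel ((1 + e) * u) ((1 + e) * v) - airyKernel u v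
      + e * (airyD 2 u * airyD 0 v - airyD 1 u * airyD 1 v + airyD 0 u * airyD 2 v)
      = ∫ w in Ioi (0 : ℝ), ((1 + e) ^ 2 * (airyD 0 ((1 + e) * (w + u))
        * airyD 0 ((1 + e) * (w + v))) - airyD 0 (w + u) * airyD 0 (w + v)
        - e * (airyD 3 (w + u) * airyD 0 (w + v) + airyD 0 (w + u) * airyD 3 (w + v))) := by
    have k1 := kernD_succ 2 0 u v
    have k2 := kernD_succ 1 1 u v
    have k3 := kernD_succ 0 2 u v
    norm_num at k1 k2 k3
    have k4 : kernD 3 0 u v + kernD 0 3 u v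
        = -(airyD 2 u * airyD 0 v - airyD 1 u * airyD 1 v + airyD 0 u * airyD 2 v) := by
      linarith
    rw [integral_sub_sub_mul h3 (h0 u v) h1 h2, h4]
    simp only [kernD, kern] at k4
    rw [k4, airyKernel_eq]
    simp only [kern]
    ring
  rw [e1]
  refine integral_le_of_abs_le_exp fun w hw => ?_
  refine (hb e he (w + u) (w + v) (by linarith) (by linarith)).trans (le_of_eq ?_)
  have : wt (w + u) * wt (w + v) = wt u * wt v * Real.exp (-w) := by
    simp only [wt]
    rw [← Real.exp_add, ← Real.exp_add, ← Real.exp_add]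
    congr 1
    ring
  rw [this]
  ring

end RAiry
end

noncomputable section

namespace RAiry

open Filter Topology

/-! ### Exponential moments of the Airy function -/

lemma integrable_exp_neg_mul_abs {c : ℝ} (hc : 0 < c) :
    Integrable fun w : ℝ => Real.exp (-(c * |w|)) := by
  rw [← integrableOn_univ, ← Iic_union_Ioi (a := (0 : ℝ))]
  refine IntegrableOn.union ?_ ?_
  · refine (integrableOn_exp_mul_Iic hc 0).congr_fun (fun w hw => ?_) measurableSet_Iic
    rw [abs_of_nonpos hw]
    simp
  · refine (exp_neg_integrableOn_Ioi 0 hc).congr_fun (fun w hw => ?_) measurableSet_Ioi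
    rw [abs_of_pos hw]
    simp

/-- Continuous functions that are `O(exp (-θ s))` on the whole line, for all `θ` in `(0, 1)`. -/
structure Slow (f : ℝ → ℝ) : Prop where
  cont : Continuous f
  bound : ∀ θ, 0 < θ → θ < 1 → ∃ C, 0 ≤ C ∧ ∀ s, |f s| ≤ C * Real.exp (-(θ * s))

/-- The bound with exponent η + κ serves for s ≥ 0 and the one with η - κ for s ≤ 0; together they
give exponential decay in both directions. -/
lemma Slow.exists_exp_mul_le {f : ℝ → ℝ} (hf : Slow f) {η κ : ℝ} (hκ : 0 < κ) (hκη : κ < η)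
    (hη : η + κ < 1) :
    ∃ C, 0 ≤ C ∧ ∀ s, Real.exp (η * s) * |f s| ≤ C * Real.exp (-(κ * |s|)) := by
  obtain ⟨C₁, h₁, b₁⟩ := hf.bound (η - κ) (by linarith) (by linarith)
  obtain ⟨C₂, h₂, b₂⟩ := hf.bound (η + κ) (by linarith) (by linarith)
  refine ⟨C₁ + C₂, by positivity, fun s => ?_⟩
  rcases le_total 0 s with h | h
  · calc Real.exp (η * s) * |f s| ≤ Real.exp (η * s) * (C₂ * Real.exp (-((η + κ) * s))) := by
          gcongr; exact b₂ s
      _ = C₂ * Real.exp (-(κ * |s|)) := by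
          rw [mul_left_comm, ← Real.exp_add, abs_of_nonneg h]; ring_nf
      _ ≤ _ := by gcongr; linarith
  · calc Real.exp (η * s) * |f s| ≤ Real.exp (η * s) * (C₁ * Real.exp (-((η - κ) * s))) := by
          gcongr; exact b₁ s
      _ = C₁ * Real.exp (-(κ * |s|)) := by
          rw [mul_left_comm, ← Real.exp_add, abs_of_nonpos h]; ring_nf
      _ ≤ _ := by gcongr; linarith

lemma Slow.integrable {f : ℝ → ℝ} (hf : Slow f) {θ : ℝ} (h0 : 0 < θ) (h1 : θ < 1) :
    Integrable fun s => Real.exp (θ * s) * f s := by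
  obtain ⟨κ, hκ, hκ'⟩ : ∃ κ, 0 < κ ∧ κ < min θ (1 - θ) :=
    exists_between (lt_min h0 (by linarith))
  rw [lt_min_iff] at hκ'
  obtain ⟨C, hC, hb⟩ := hf.exists_exp_mul_le hκ hκ'.1 (by linarith)
  have hc := hf.cont
  refine Integrable.mono' ((integrable_exp_neg_mul_abs hκ).const_mul C)
    (by fun_prop : Continuous fun s => Real.exp (θ * s) * f s).aestronglyMeasurable
    (Eventually.of_forall fun s => ?_)
  rw [Real.norm_eq_abs, abs_mul, Real.abs_exp]
  exact hb s

lemma Slow.id_mul {f : ℝ → ℝ} (hf : Slow f) : Slow fun s => s * f s := by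
  refine ⟨continuous_id.mul hf.cont, fun θ h0 h1 => ?_⟩
  obtain ⟨κ, hκ, hκ'⟩ : ∃ κ, 0 < κ ∧ κ < min θ (1 - θ) :=
    exists_between (lt_min h0 (by linarith))
  rw [lt_min_iff] at hκ'
  obtain ⟨C, hC, hb⟩ := hf.exists_exp_mul_le hκ hκ'.1 (by linarith)
  refine ⟨C / κ, by positivity, fun s => ?_⟩
  have h2 : κ * |s| ≤ Real.exp (κ * |s|) := by linarith [Real.add_one_le_exp (κ * |s|)]
  have h3 : |f s| = Real.exp (-(θ * s)) * (Real.exp (θ * s) * |f s|) := by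
    rw [← mul_assoc, ← Real.exp_add]; simp
  rw [abs_mul, h3]
  calc |s| * (Real.exp (-(θ * s)) * (Real.exp (θ * s) * |f s|))
      ≤ (Real.exp (κ * |s|) / κ) * (Real.exp (-(θ * s)) * (C * Real.exp (-(κ * |s|)))) := by
        refine mul_le_mul ?_ (mul_le_mul_of_nonneg_left (hb s) (Real.exp_pos _).le)
          (by positivity) (by positivity)
        rw [le_div_iff₀ hκ]; linarith
    _ = C / κ * Real.exp (-(θ * s)) * (Real.exp (κ * |s|) * Real.exp (-(κ * |s|))) := by ring
    _ = _ := by rw [← Real.exp_add]; simp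

lemma Slow.shift {f : ℝ → ℝ} (hf : Slow f) (d : ℝ) : Slow fun s => f (s + d) := by
  refine ⟨hf.cont.comp (continuous_add_const d), fun θ h0 h1 => ?_⟩
  obtain ⟨C, hC, hb⟩ := hf.bound θ h0 h1
  refine ⟨C * Real.exp (-(θ * d)), by positivity, fun s => (hb (s + d)).trans (le_of_eq ?_)⟩
  rw [mul_assoc, ← Real.exp_add]
  ring_nf

lemma Slow.integrable_mul {f g : ℝ → ℝ} (hf : Slow f) (hg : Slow g) {η : ℝ} (h0 : 0 < η)
    (h1 : η < 1 / 2) : Integrable fun s => Real.exp (2 * η * s) * (f s * g s) := by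
  obtain ⟨C, hC, hb⟩ := hf.exists_exp_mul_le (η := η) (κ := η / 2) (by linarith) (by linarith)
    (by linarith)
  have hc := hf.cont
  have hc' := hg.cont
  refine Integrable.mono' ((hg.integrable h0 (by linarith)).norm.const_mul C)
    (by fun_prop : Continuous fun s => Real.exp (2 * η * s) * (f s * g s)).aestronglyMeasurable
    (Eventually.of_forall fun s => ?_)
  have h2 : Real.exp (η * s) * |f s| ≤ C := (hb s).trans
    (mul_le_of_le_one_right hC (Real.exp_le_one_iff.2 (by have := abs_nonneg s; nlinarith)))
  rw [Real.norm_eq_abs, Real.norm_eq_abs, abs_mul, abs_mul, abs_mul, Real.abs_exp, Real.abs_exp]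
  calc Real.exp (2 * η * s) * (|f s| * |g s|)
      = (Real.exp (η * s) * |f s|) * (Real.exp (η * s) * |g s|) := by
        rw [show 2 * η * s = η * s + η * s by ring, Real.exp_add]; ring
    _ ≤ _ := by gcongr

/-- The Airy function is bounded, and its derivative grows at most like `|s|^{1/2}`, at `-∞`. -/
lemma exists_airy_growth : ∃ C, 0 ≤ C ∧ ∀ s ≤ -1, |airyD 0 s| ≤ C * |s| ∧ |airyD 1 s| ≤ C * |s| := by
  -- By the Airy equation the derivative of this energy is A'(s)²/s² ≥ 0. For s < 0 both summands
  -- are nonnegative, so on (-∞, -1] each of them is bounded by the value at -1.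
  set g : ℝ → ℝ := fun s => airyD 0 s ^ 2 - airyD 1 s ^ 2 / s with hg
  have hd : ∀ s < 0, HasDerivAt g (airyD 1 s ^ 2 / s ^ 2) s := by
    intro s hs
    have h1 := (hasDerivAt_airyD 0 s).pow 2
    have h2 := ((hasDerivAt_airyD 1 s).pow 2).div (hasDerivAt_id s) hs.ne
    refine (h1.sub h2).congr_deriv ?_
    have := hs.ne
    have h3 := airyD_two s
    simp only [id, zero_add, Nat.cast_ofNat, Nat.add_one_sub_one, pow_one, mul_one,
      Pi.pow_apply, show (1 + 1 : ℕ) = 2 from rfl, h3]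
    field_simp
    ring
  have hmono : MonotoneOn g (Iic (-1)) := by
    refine monotoneOn_of_deriv_nonneg (convex_Iic _) (fun s hs => ?_) (fun s hs => ?_)
      (fun s hs => ?_)
    · have : s ≤ -1 := hs
      exact (hd s (by linarith)).continuousAt.continuousWithinAt
    · rw [interior_Iic] at hs
      have : s < -1 := hs
      exact (hd s (by linarith)).differentiableAt.differentiableWithinAt
    · rw [interior_Iic] at hs
      have : s < -1 := hs
      rw [(hd s (by linarith)).deriv]
      positivity
  refine ⟨1 + g (-1), ?_, fun s hs => ?_⟩
  · simp only [hg]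
    have := sq_nonneg (airyD 0 (-1))
    have := sq_nonneg (airyD 1 (-1))
    linarith
  have h1 : g s ≤ g (-1) := hmono hs self_mem_Iic hs
  have hs0 : s < 0 := by linarith
  have habs : |s| = -s := abs_of_neg hs0
  have h2 : g s = airyD 0 s ^ 2 + airyD 1 s ^ 2 / |s| := by
    simp only [hg, habs, div_neg]; ring
  have h3 : 0 ≤ airyD 1 s ^ 2 / |s| := by positivity
  have h4 : airyD 0 s ^ 2 ≤ g (-1) := by nlinarith [sq_nonneg (airyD 0 s)]
  have h5 : airyD 1 s ^ 2 ≤ g (-1) * |s| := by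
    rw [← div_le_iff₀ (by rw [habs]; linarith)]; nlinarith [sq_nonneg (airyD 0 s)]
  have h6 : 0 ≤ g (-1) := (sq_nonneg _).trans h4
  have h7 : 1 ≤ |s| := by rw [habs]; linarith
  constructor
  · refine abs_le_of_sq_le_sq ?_ (by positivity)
    nlinarith [mul_nonneg h6 h6, mul_nonneg h6 (sub_nonneg.2 h7), mul_self_nonneg ((1 + g (-1)) * (|s| - 1))]
  · refine abs_le_of_sq_le_sq ?_ (by positivity)
    calc airyD 1 s ^ 2 ≤ g (-1) * |s| := h5
      _ ≤ (1 + g (-1)) ^ 2 * |s| ^ 2 :=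
        mul_le_mul (by nlinarith) (by nlinarith) (by positivity) (by positivity)
      _ = _ := by ring

lemma slow_of_decay {f : ℝ → ℝ} (hf : Decay f) {C : ℝ} (hC : 0 ≤ C)
    (h : ∀ s ≤ -1, |f s| ≤ C * |s|) : Slow f := by
  refine ⟨hf.cont, fun θ h0 h1 => ?_⟩
  obtain ⟨C', hC', hb⟩ := hf.bound (-1)
  refine ⟨C / θ + C' * Real.exp 1, by positivity, fun s => ?_⟩
  rcases le_total s (-1) with hs | hs
  · refine (h s hs).trans ?_
    have h2 : |s| ≤ Real.exp (-(θ * s)) / θ := by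
      rw [le_div_iff₀ h0, abs_of_neg (by linarith)]
      linarith [Real.add_one_le_exp (-(θ * s))]
    calc C * |s| ≤ C * (Real.exp (-(θ * s)) / θ) := by gcongr
      _ = C / θ * Real.exp (-(θ * s)) := by ring
      _ ≤ _ := by gcongr; linarith [mul_nonneg hC' (Real.exp_pos 1).le]
  · refine (hb s hs).trans ?_
    calc C' * Real.exp (-s) ≤ C' * (Real.exp 1 * Real.exp (-(θ * s))) := by
          rw [← Real.exp_add]
          gcongr
          nlinarith
      _ = C' * Real.exp 1 * Real.exp (-(θ * s)) := by ring
      _ ≤ _ := by gcongr; linarith [div_nonneg hC h0.le]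

lemma slow_airyD_zero : Slow (airyD 0) := by
  obtain ⟨C, hC, h⟩ := exists_airy_growth
  exact slow_of_decay (decay_airyD 0) hC fun s hs => (h s hs).1

lemma slow_airyD_one : Slow (airyD 1) := by
  obtain ⟨C, hC, h⟩ := exists_airy_growth
  exact slow_of_decay (decay_airyD 1) hC fun s hs => (h s hs).2

lemma slow_airyD_two : Slow (airyD 2) := by
  have : airyD 2 = fun s => s * airyD 0 s := funext airyD_two
  rw [this]
  exact slow_airyD_zero.id_mul

lemma integral_exp_mul_deriv {c : ℝ} {F F' : ℝ → ℝ} (hd : ∀ s, HasDerivAt F (F' s) s)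
    (hi : Integrable fun s => Real.exp (c * s) * F s)
    (hi' : Integrable fun s => Real.exp (c * s) * F' s) :
    ∫ s, Real.exp (c * s) * F' s = -c * ∫ s, Real.exp (c * s) * F s := by
  have hd' : ∀ s, HasDerivAt (fun s => Real.exp (c * s) * F s)
      (c * (Real.exp (c * s) * F s) + Real.exp (c * s) * F' s) s := by
    intro s
    have h1 : HasDerivAt (fun s : ℝ => Real.exp (c * s)) (Real.exp (c * s) * (c * 1)) s :=
      ((hasDerivAt_id s).const_mul c).exp
    refine (h1.mul (hd s)).congr_deriv ?_
    ring
  have h := integral_eq_zero_of_hasDerivAt_of_integrable hd' ((hi.const_mul c).add hi') hi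
  rw [integral_add (hi.const_mul c) hi', integral_const_mul] at h
  linarith

/-- The exponential moments of the Airy function. -/
def moment (θ : ℝ) : ℝ := ∫ s, Real.exp (θ * s) * airyD 0 s

/-- Differentiation brings down the factor s, and sA = A''. Two integrations by parts then turn A''
into θ² A. -/
lemma hasDerivAt_moment {θ : ℝ} (h0 : 0 < θ) (h1 : θ < 1) :
    HasDerivAt moment (θ ^ 2 * moment θ) θ := by
  set a := θ / 2 with ha
  set b := (θ + 1) / 2 with hb
  have hc := (decay_airyD 0).cont
  have key := hasDerivAt_integral_of_dominated_loc_of_deriv_le (μ := volume)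
    (F := fun θ s => Real.exp (θ * s) * airyD 0 s)
    (F' := fun θ s => Real.exp (θ * s) * (s * airyD 0 s))
    (x₀ := θ) (s := Ioo a b)
    (bound := fun s => ‖Real.exp (a * s) * (s * airyD 0 s)‖ + ‖Real.exp (b * s) * (s * airyD 0 s)‖)
    (Ioo_mem_nhds (by linarith) (by linarith))
    (Eventually.of_forall fun θ =>
      (by fun_prop : Continuous fun s => Real.exp (θ * s) * airyD 0 s).aestronglyMeasurable)
    (slow_airyD_zero.integrable h0 h1)
    (by fun_prop : Continuous fun s => Real.exp (θ * s) * (s * airyD 0 s)).aestronglyMeasurable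
    (Eventually.of_forall fun s θ' hθ' => ?_)
    ((slow_airyD_zero.id_mul.integrable (by linarith) (by linarith)).norm.add
      (slow_airyD_zero.id_mul.integrable (by linarith) (by linarith)).norm)
    (Eventually.of_forall fun s θ' _ => ?_)
  · refine key.2.congr_deriv ?_
    have e : ∀ s, s * airyD 0 s = airyD 2 s := fun s => (airyD_two s).symm
    simp only [e]
    rw [integral_exp_mul_deriv (hasDerivAt_airyD 1) (slow_airyD_one.integrable h0 h1)
      (slow_airyD_two.integrable h0 h1), integral_exp_mul_deriv (hasDerivAt_airyD 0)
      (slow_airyD_zero.integrable h0 h1) (slow_airyD_one.integrable h0 h1), moment]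
    ring
  · simp only [norm_mul, Real.norm_eq_abs, Real.abs_exp]
    rw [← add_mul]
    gcongr
    rcases le_total 0 s with h | h
    · have : Real.exp (θ' * s) ≤ Real.exp (b * s) := by gcongr; exact hθ'.2.le
      linarith [Real.exp_pos (a * s)]
    · have : Real.exp (θ' * s) ≤ Real.exp (a * s) :=
        Real.exp_le_exp.2 (mul_le_mul_of_nonpos_right hθ'.1.le h)
      linarith [Real.exp_pos (b * s)]
  · have h1 : HasDerivAt (fun θ : ℝ => Real.exp (θ * s)) (Real.exp (θ' * s) * (1 * s)) θ' :=
      ((hasDerivAt_id θ').mul_const s).exp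
    refine (h1.mul_const (airyD 0 s)).congr_deriv ?_
    ring

/-- The differential equation makes this product constant on (0, 1). The constant is found to be 1
by letting θ tend to 1. -/
lemma moment_eq_of_mem {θ θ' : ℝ} (h : θ ∈ Ioo (0 : ℝ) 1) (h' : θ' ∈ Ioo (0 : ℝ) 1) :
    moment θ * Real.exp (-(θ ^ 3 / 3)) = moment θ' * Real.exp (-(θ' ^ 3 / 3)) := by
  have hd : ∀ θ ∈ Ioo (0 : ℝ) 1, HasDerivAt (fun θ => moment θ * Real.exp (-(θ ^ 3 / 3))) 0 θ := by
    intro θ hθ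
    have h1 : HasDerivAt (fun θ : ℝ => Real.exp (-(θ ^ 3 / 3)))
        (Real.exp (-(θ ^ 3 / 3)) * -(3 * θ ^ 2 / 3)) θ := by
      have := ((hasDerivAt_pow 3 θ).div_const 3).neg.exp
      simpa using this
    refine ((hasDerivAt_moment hθ.1 hθ.2).mul h1).congr_deriv ?_
    ring
  exact isOpen_Ioo.is_const_of_deriv_eq_zero isPreconnected_Ioo
    (fun θ hθ => (hd θ hθ).differentiableAt.differentiableWithinAt)
    (fun θ hθ => (hd θ hθ).deriv) h h'

end RAiry
end

noncomputable section

namespace RAiry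

open Filter Topology

/-! ### The normalization of the Airy function -/

lemma airyD_four (u : ℝ) : airyD 4 u = 2 * airyD 1 u + u ^ 2 * airyD 0 u := by
  have h : HasDerivAt (airyD 3) (airyD 1 u + (1 * airyD 1 u + u * airyD 2 u)) u := by
    have h2 := (hasDerivAt_airyD 0 u).add ((hasDerivAt_id u).mul (hasDerivAt_airyD 1 u))
    have : airyD 3 = fun u => airyD 0 u + id u * airyD 1 u := funext airyD_three
    rw [this]
    exact h2
  rw [(hasDerivAt_airyD 3 u).unique h, airyD_two]
  ring

/-- The endpoint θ = 1 needs more than A = O(exp(-s)). Since (1 + s²)A = A + A'''' - 2A' is still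
O(exp(-s)), the function exp(s)A(s) is O(1/(1 + s²)) for s ≥ 0. -/
lemma exists_exp_mul_airy_bound : ∃ b : ℝ → ℝ, Integrable b ∧
    ∀ θ ∈ Icc (1 / 2 : ℝ) 1, ∀ s, Real.exp (θ * s) * |airyD 0 s| ≤ b s := by
  obtain ⟨C, hC, hb⟩ := exists_airyD_bound 4 0
  refine ⟨fun s => 4 * C * (1 + s ^ 2)⁻¹ + ‖Real.exp (1 / 2 * s) * airyD 0 s‖,
    (integrable_inv_one_add_sq.const_mul _).add
      (slow_airyD_zero.integrable (by norm_num) (by norm_num)).norm, fun θ hθ s => ?_⟩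
  beta_reduce
  rw [norm_mul, Real.norm_eq_abs, Real.norm_eq_abs, Real.abs_exp]
  have h4 : 0 ≤ 4 * C * (1 + s ^ 2)⁻¹ := by positivity
  rcases le_total 0 s with h | h
  · have h0 := hb 0 (by norm_num) s h
    have h1 := hb 1 (by norm_num) s h
    have h2 := hb 4 (by norm_num) s h
    have h3 : |(1 + s ^ 2) * airyD 0 s| ≤ 4 * C * Real.exp (-s) := by
      have e : (1 + s ^ 2) * airyD 0 s = airyD 0 s + airyD 4 s - 2 * airyD 1 s := by
        rw [airyD_four]; ring
      rw [e, abs_le]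
      have := abs_le.1 h0
      have := abs_le.1 h1
      have := abs_le.1 h2
      constructor <;> linarith
    rw [abs_mul, abs_of_pos (by positivity : 0 < 1 + s ^ 2)] at h3
    have h5 : Real.exp (θ * s) * |airyD 0 s| ≤ 4 * C * (1 + s ^ 2)⁻¹ := by
      rw [← div_eq_mul_inv, le_div_iff₀ (by positivity)]
      calc Real.exp (θ * s) * |airyD 0 s| * (1 + s ^ 2)
          = Real.exp (θ * s) * ((1 + s ^ 2) * |airyD 0 s|) := by ring
        _ ≤ Real.exp s * (4 * C * Real.exp (-s)) := by
            refine mul_le_mul (Real.exp_le_exp.2 ?_) h3 (by positivity) (Real.exp_pos _).le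
            nlinarith [hθ.2]
        _ = 4 * C * (Real.exp s * Real.exp (-s)) := by ring
        _ = 4 * C := by rw [← Real.exp_add]; simp
    have := mul_nonneg (Real.exp_pos (1 / 2 * s)).le (abs_nonneg (airyD 0 s))
    linarith
  · have : Real.exp (θ * s) * |airyD 0 s| ≤ Real.exp (1 / 2 * s) * |airyD 0 s| := by
      refine mul_le_mul_of_nonneg_right (Real.exp_le_exp.2 ?_) (abs_nonneg _)
      nlinarith [hθ.1]
    linarith

lemma tendsto_moment : Tendsto moment (𝓝[<] 1) (𝓝 (moment 1)) := by
  obtain ⟨b, hb, h⟩ := exists_exp_mul_airy_bound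
  have hc := (decay_airyD 0).cont
  refine tendsto_integral_filter_of_dominated_convergence b
    (Eventually.of_forall fun θ =>
      (by fun_prop : Continuous fun s => Real.exp (θ * s) * airyD 0 s).aestronglyMeasurable)
    ?_ hb (Eventually.of_forall fun s => ?_)
  · have : Icc (1 / 2 : ℝ) 1 ∈ 𝓝[<] (1 : ℝ) :=
      mem_of_superset (Ioo_mem_nhdsLT (by norm_num : (1 / 2 : ℝ) < 1)) Ioo_subset_Icc_self
    filter_upwards [this] with θ hθ
    refine Eventually.of_forall fun s => ?_
    rw [norm_mul, Real.norm_eq_abs, Real.norm_eq_abs, Real.abs_exp]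
    exact h θ hθ s
  · exact ((by fun_prop : Continuous fun θ : ℝ => Real.exp (θ * s) * airyD 0 s).tendsto
      1).mono_left nhdsWithin_le_nhds

/-- The regularized first exponential moment of the Airy function. -/
def gaussMoment (ε : ℝ) : ℝ := ∫ s, Real.exp (-(ε ^ 2 * s ^ 2)) * (Real.exp s * airyD 0 s)

lemma tendsto_gaussMoment : Tendsto gaussMoment (𝓝[>] 0) (𝓝 (moment 1)) := by
  obtain ⟨b, hb, h⟩ := exists_exp_mul_airy_bound
  have hc := (decay_airyD 0).cont
  have e : moment 1 = ∫ s, Real.exp (-(0 ^ 2 * s ^ 2)) * (Real.exp s * airyD 0 s) := by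
    simp [moment]
  rw [e]
  refine tendsto_integral_filter_of_dominated_convergence b
    (Eventually.of_forall fun ε => (by fun_prop : Continuous fun s : ℝ =>
      Real.exp (-(ε ^ 2 * s ^ 2)) * (Real.exp s * airyD 0 s)).aestronglyMeasurable)
    (Eventually.of_forall fun ε => Eventually.of_forall fun s => ?_) hb
    (Eventually.of_forall fun s => ?_)
  · rw [norm_mul, norm_mul, Real.norm_eq_abs, Real.norm_eq_abs, Real.norm_eq_abs, Real.abs_exp,
      Real.abs_exp]
    have h1 := h 1 (by norm_num) s
    rw [one_mul] at h1
    exact (mul_le_of_le_one_left (by positivity)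
      (Real.exp_le_one_iff.2 (by have := mul_nonneg (sq_nonneg ε) (sq_nonneg s); linarith))).trans h1
  · exact ((by fun_prop : Continuous fun ε : ℝ => Real.exp (-(ε ^ 2 * s ^ 2))
      * (Real.exp s * airyD 0 s)).tendsto 0).mono_left nhdsWithin_le_nhds

/-! ### Gaussian regularization along the two rays -/

/-- The properties shared by the directions of the two rays of the contour. -/
structure IsDirection (d : ℂ) : Prop where
  norm_eq : ‖d‖ = 1
  cube : d ^ 3 = Complex.I
  im_eq : d.im = 1 / 2
  sq_re : (d ^ 2).re = 1 / 2

lemma sq_sqrt_three_complex : ((√3 : ℝ) : ℂ) ^ 2 = 3 := by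
  rw [← Complex.ofReal_pow, sq_sqrt_three]; norm_num

lemma isDirection_dirR : IsDirection dirR := by
  have h := sq_sqrt_three_complex
  have h' := sq_sqrt_three
  have hI := Complex.I_sq
  refine ⟨norm_dirR, ?_, by simp [dirR], ?_⟩
  · rw [dirR]
    push_cast
    linear_combination (((√3 : ℝ) : ℂ) / 8 + 3 / 8 * Complex.I) * h
      + (3 * ((√3 : ℝ) : ℂ) / 8 + Complex.I / 8) * hI
  · rw [dirR, sq, Complex.mul_re]
    simp
    nlinarith

lemma isDirection_dirL : IsDirection dirL := by
  have h := sq_sqrt_three_complex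
  have h' := sq_sqrt_three
  have hI := Complex.I_sq
  refine ⟨norm_dirL, ?_, by simp [dirL], ?_⟩
  · rw [dirL]
    push_cast
    linear_combination (-((√3 : ℝ) : ℂ) / 8 + 3 / 8 * Complex.I) * h
      + (-3 * ((√3 : ℝ) : ℂ) / 8 + Complex.I / 8) * hI
  · rw [dirL, sq, Complex.mul_re]
    simp
    nlinarith

/-- The weight `d exp (i a³ / 3)` along the ray `a = i + ρ d`. -/
def rayWeight (d : ℂ) (ρ : ℝ) : ℂ := d * phase 0 (Complex.I * (1 : ℝ) + ρ * d)

lemma continuous_rayWeight (d : ℂ) : Continuous (rayWeight d) := by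
  unfold rayWeight phase; fun_prop

lemma IsDirection.norm_rayWeight {d : ℂ} (hd : IsDirection d) (ρ : ℝ) :
    ‖rayWeight d ρ‖ = Real.exp (1 / 3 + ρ / 2 - ρ ^ 2 / 2 - ρ ^ 3 / 3) := by
  rw [rayWeight, norm_mul, hd.norm_eq, one_mul, phase, Complex.norm_exp]
  congr 1
  have e : Complex.I * (Complex.I * (1 : ℝ) + ρ * d) ^ 3 / 3
      + Complex.I * (Complex.I * (1 : ℝ) + ρ * d) * (0 : ℝ)
      = ((1 / 3 - ρ ^ 3 / 3 : ℝ) : ℂ) - (ρ : ℂ) * (Complex.I * d) - ((ρ ^ 2 : ℝ) : ℂ) * d ^ 2 := by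
    have hI := Complex.I_sq
    have hc := hd.cube
    push_cast
    linear_combination (Complex.I ^ 2 / 3 - 1 / 3 + Complex.I * ρ * d + ρ ^ 2 * d ^ 2
      + ρ ^ 3 / 3) * hI + Complex.I * ρ ^ 3 / 3 * hc
  rw [e, Complex.sub_re, Complex.sub_re, Complex.ofReal_re, Complex.re_ofReal_mul,
    Complex.re_ofReal_mul, hd.sq_re, Complex.I_mul_re, hd.im_eq]
  ring

/-- The factor exp(s) cancels exactly the decay exp(-s) that comes from the vertex i, so that only
an exponential linear in ρd remains. This is the reason for computing the moment at θ = 1. -/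
lemma exp_mul_phase (d : ℂ) (ρ s : ℝ) :
    (Real.exp s : ℂ) * (d * phase s (Complex.I * (1 : ℝ) + ρ * d))
      = rayWeight d ρ * Complex.exp (Complex.I * (ρ * d) * s) := by
  rw [rayWeight, phase, phase, Complex.ofReal_exp, mul_left_comm, ← Complex.exp_add,
    mul_assoc d, ← Complex.exp_add]
  congr 2
  have hI := Complex.I_sq
  push_cast
  linear_combination (s : ℂ) * hI

lemma exp_mul_integrand (s ρ : ℝ) :
    (Real.exp s : ℂ) * integrand (fun a => (Complex.I * a) ^ 0) s ρ
      = rayWeight dirR ρ * Complex.exp (Complex.I * (ρ * dirR) * s)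
        - rayWeight dirL ρ * Complex.exp (Complex.I * (ρ * dirL) * s) := by
  rw [← exp_mul_phase, ← exp_mul_phase]
  simp only [integrand, pow_zero, mul_one, mul_sub]
  rfl

/-- Half of the cubic term absorbs bρ², however large b is, and the other half absorbs the linear
terms. -/
lemma cubic_exponent_le {b ρ : ℝ} (hb : 0 ≤ b) (hρ : 0 ≤ ρ) :
    ρ / 2 + b * ρ ^ 2 - ρ ^ 3 / 3 ≤ 9 + 36 * b ^ 3 - ρ := by
  have h1 : b * ρ ^ 2 - ρ ^ 3 / 6 ≤ 36 * b ^ 3 := by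
    rcases le_total ρ (6 * b) with h | h
    · have h2 : ρ ^ 2 ≤ (6 * b) ^ 2 := by gcongr
      have h3 : b * ρ ^ 2 ≤ b * (6 * b) ^ 2 := by gcongr
      nlinarith [pow_nonneg hρ 3]
    · have : 0 ≤ ρ ^ 2 * (ρ - 6 * b) := by
        have := sub_nonneg.2 h
        positivity
      nlinarith [pow_nonneg hb 3]
  have h2 : 3 / 2 * ρ - ρ ^ 3 / 6 ≤ 9 := by
    rcases le_total ρ 3 with h | h
    · nlinarith [pow_nonneg hρ 3]
    · nlinarith [mul_nonneg hρ (mul_nonneg (sub_nonneg.2 h) (by linarith : 0 ≤ ρ + 3))]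
  linarith

lemma IsDirection.norm_exp_le {d : ℂ} (hd : IsDirection d) {ε ρ s : ℝ} (hε : 0 < ε)
    (hρ : 0 ≤ ρ) :
    ‖Complex.exp (-(ε ^ 2 : ℂ) * s ^ 2)
      * (rayWeight d ρ * Complex.exp (Complex.I * (ρ * d) * s))‖
      ≤ Real.exp (10 + 36 * (1 / (8 * (ε ^ 2 / 2) * 2)) ^ 3)
        * (Real.exp (-(ε ^ 2 / 2) * s ^ 2) * Real.exp (-ρ)) := by
  -- This is 1/(8ε²), the coefficient for which -ρs/2 ≤ ε²s²/2 + bρ². Half of the Gaussian in s is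
  -- spent on this inequality and half is kept for integrability.
  set b : ℝ := 1 / (8 * (ε ^ 2 / 2) * 2) with hb
  have hb0 : 0 ≤ b := by positivity
  have hbε : b * (8 * ε ^ 2) = 1 := by rw [hb]; field_simp
  have h1 : (-(ε ^ 2 : ℂ) * s ^ 2) = ((-(ε ^ 2 * s ^ 2) : ℝ) : ℂ) := by push_cast; ring
  have h2 : (Complex.I * (ρ * d) * s).re = -(ρ * s / 2) := by
    have : Complex.I * (ρ * d) * s = ((ρ * s : ℝ) : ℂ) * (Complex.I * d) := by push_cast; ring
    rw [this, Complex.re_ofReal_mul, Complex.I_mul_re, hd.im_eq]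
    ring
  rw [norm_mul, norm_mul, hd.norm_rayWeight, Complex.norm_exp, Complex.norm_exp, h1, h2,
    Complex.ofReal_re, ← Real.exp_add, ← Real.exp_add, ← Real.exp_add, ← Real.exp_add]
  refine Real.exp_le_exp.2 ?_
  have h3 := cubic_exponent_le hb0 hρ
  have h4 : -(ρ * s / 2) ≤ ε ^ 2 / 2 * s ^ 2 + b * ρ ^ 2 := by
    have : 0 ≤ b * (2 * ε ^ 2 * s + ρ) ^ 2 := by positivity
    have e : b * (2 * ε ^ 2 * s + ρ) ^ 2
        = b * (8 * ε ^ 2) * (ε ^ 2 / 2 * s ^ 2 + ρ * s / 2) + b * ρ ^ 2 := by ring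
    rw [e, hbε, one_mul] at this
    linarith
  nlinarith [sq_nonneg ρ]

lemma IsDirection.integrable_prod {d : ℂ} (hd : IsDirection d) {ε : ℝ} (hε : 0 < ε) :
    Integrable (Function.uncurry fun s ρ : ℝ => Complex.exp (-(ε ^ 2 : ℂ) * s ^ 2)
      * (rayWeight d ρ * Complex.exp (Complex.I * (ρ * d) * s)))
      (volume.prod (volume.restrict (Ioi 0))) := by
  have hc := continuous_rayWeight d
  refine Integrable.mono' (((integrable_exp_neg_mul_sq (b := ε ^ 2 / 2) (by positivity)).mul_prod
    integrableOn_exp_neg_Ioi_zero).const_mul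
      (Real.exp (10 + 36 * (1 / (8 * (ε ^ 2 / 2) * 2)) ^ 3))) ?_ ?_
  · refine Continuous.aestronglyMeasurable ?_
    simp only [Function.uncurry_def]
    fun_prop
  · have : ∀ᵐ p : ℝ × ℝ ∂(volume.prod (volume.restrict (Ioi 0))), p.2 ∈ Ioi (0 : ℝ) :=
      Measure.quasiMeasurePreserving_snd.ae (ae_restrict_mem measurableSet_Ioi)
    filter_upwards [this] with p hp
    exact hd.norm_exp_le hε (le_of_lt hp)

lemma cpow_half_sq {ε : ℝ} (hε : 0 < ε) :
    ((Real.pi : ℂ) / (ε ^ 2 : ℂ)) ^ (1 / 2 : ℂ) = ((√Real.pi / ε : ℝ) : ℂ) := by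
  have h : (Real.pi : ℂ) / (ε ^ 2 : ℂ) = (((√Real.pi / ε : ℝ) : ℂ)) ^ 2 := by
    rw [← Complex.ofReal_pow (√Real.pi / ε), div_pow, Real.sq_sqrt Real.pi_pos.le]
    push_cast
    ring
  rw [h, one_div]
  refine Complex.sq_cpow_two_inv ?_
  rw [Complex.ofReal_re]
  have := Real.sqrt_pos.2 Real.pi_pos
  positivity

/-- The Gaussian factor justifies Fubini. The integral over s is then the Fourier integral of a
Gaussian, and the substitution ρ ↦ ερ brings it to a form with a limit as ε → 0. -/
lemma IsDirection.integral_integral {d : ℂ} (hd : IsDirection d) {ε : ℝ} (hε : 0 < ε) :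
    ∫ s : ℝ, ∫ ρ in Ioi (0 : ℝ), Complex.exp (-(ε ^ 2 : ℂ) * s ^ 2)
      * (rayWeight d ρ * Complex.exp (Complex.I * (ρ * d) * s))
      = √Real.pi * ∫ ρ in Ioi (0 : ℝ), rayWeight d (ε * ρ) * Complex.exp (-(d ^ 2 / 4) * ρ ^ 2) := by
  rw [integral_integral_swap (hd.integrable_prod hε)]
  have hre : 0 < ((ε ^ 2 : ℂ)).re := by
    rw [← Complex.ofReal_pow, Complex.ofReal_re]; positivity
  have h1 : ∀ ρ : ℝ, ∫ s : ℝ, Complex.exp (-(ε ^ 2 : ℂ) * s ^ 2)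
      * (rayWeight d ρ * Complex.exp (Complex.I * (ρ * d) * s))
      = ((√Real.pi / ε : ℝ) : ℂ)
        * (rayWeight d ρ * Complex.exp (-(ρ * d) ^ 2 / (4 * (ε ^ 2 : ℂ)))) := by
    intro ρ
    rw [← cpow_half_sq hε, mul_left_comm ((_ : ℂ) ^ (1 / 2 : ℂ)), ← fourierIntegral_gaussian hre, ← integral_const_mul]
    congr 1
    funext s
    ring
  simp only [h1]
  rw [integral_const_mul]
  have h2 := integral_comp_mul_left_Ioi (fun ρ : ℝ => rayWeight d ρ
    * Complex.exp (-(ρ * d) ^ 2 / (4 * (ε ^ 2 : ℂ)))) 0 hε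
  rw [mul_zero] at h2
  have hε' : (ε : ℂ) ≠ 0 := by exact_mod_cast hε.ne'
  have h3 : ∀ ρ : ℝ, rayWeight d (ε * ρ)
      * Complex.exp (-(((ε * ρ : ℝ) : ℂ) * d) ^ 2 / (4 * (ε ^ 2 : ℂ)))
      = rayWeight d (ε * ρ) * Complex.exp (-(d ^ 2 / 4) * ρ ^ 2) := by
    intro ρ
    congr 2
    push_cast
    field_simp
  simp only [h3] at h2
  rw [h2, Complex.real_smul, ← mul_assoc]
  congr 1
  push_cast
  ring

lemma rayWeight_zero (d : ℂ) : rayWeight d 0 = d * Real.exp (1 / 3) := by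
  rw [rayWeight, phase, Complex.ofReal_exp]
  congr 2
  have hI := Complex.I_sq
  push_cast
  linear_combination (Complex.I ^ 2 / 3 - 1 / 3) * hI

lemma IsDirection.tendsto {d : ℂ} (hd : IsDirection d) :
    Tendsto (fun ε : ℝ => ∫ ρ in Ioi (0 : ℝ), rayWeight d (ε * ρ)
      * Complex.exp (-(d ^ 2 / 4) * ρ ^ 2)) (𝓝[>] 0)
      (𝓝 (d * Real.exp (1 / 3) * ∫ ρ in Ioi (0 : ℝ), Complex.exp (-(d ^ 2 / 4) * ρ ^ 2))) := by
  have hc := continuous_rayWeight d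
  rw [← integral_const_mul]
  refine tendsto_integral_filter_of_dominated_convergence
    (fun ρ => Real.exp 10 * Real.exp (-(1 / 16) * ρ ^ 2))
    (Eventually.of_forall fun ε => (by fun_prop : Continuous fun ρ : ℝ => rayWeight d (ε * ρ)
      * Complex.exp (-(d ^ 2 / 4) * ρ ^ 2)).aestronglyMeasurable) ?_
    ((integrable_exp_neg_mul_sq (by norm_num)).const_mul _).integrableOn ?_
  · filter_upwards [Ioo_mem_nhdsGT (zero_lt_one (α := ℝ))] with ε hε
    filter_upwards [ae_restrict_mem measurableSet_Ioi] with ρ hρ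
    have hρ0 : 0 < ρ := hρ
    have h1 : (-(d ^ 2 / 4) * (ρ : ℂ) ^ 2).re = -(ρ ^ 2 / 8) := by
      have : -(d ^ 2 / 4) * (ρ : ℂ) ^ 2 = ((-(ρ ^ 2 / 4) : ℝ) : ℂ) * d ^ 2 := by push_cast; ring
      rw [this, Complex.re_ofReal_mul, hd.sq_re]
      ring
    rw [norm_mul, hd.norm_rayWeight, Complex.norm_exp, h1, ← Real.exp_add, ← Real.exp_add]
    refine Real.exp_le_exp.2 ?_
    have h2 : ε * ρ ≤ ρ := by nlinarith [hε.2]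
    have h3 : 0 ≤ ε * ρ := by have := hε.1; positivity
    nlinarith [pow_nonneg h3 2, pow_nonneg h3 3, sq_nonneg (ρ - 4)]
  · refine Eventually.of_forall fun ρ => ?_
    have := ((by fun_prop : Continuous fun ε : ℝ => rayWeight d (ε * ρ)
      * Complex.exp (-(d ^ 2 / 4) * ρ ^ 2)).tendsto 0).mono_left
      (nhdsWithin_le_nhds (s := Ioi (0 : ℝ)))
    rwa [zero_mul, rayWeight_zero] at this

/-- Here σ is the sign of Re d. It selects the branch of the square root of 4π/d², and is the reason
why the two rays give opposite values. -/
lemma IsDirection.gaussian {d : ℂ} (hd : IsDirection d) {σ : ℝ} (hσ : σ ^ 2 = 1)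
    (hpos : 0 < σ * d.re) :
    d * ∫ ρ in Ioi (0 : ℝ), Complex.exp (-(d ^ 2 / 4) * ρ ^ 2) = σ * √Real.pi := by
  have hd0 : d ≠ 0 := norm_ne_zero_iff.1 (by rw [hd.norm_eq]; norm_num)
  have hre : 0 < (d ^ 2 / 4).re := by
    have : d ^ 2 / 4 = ((1 / 4 : ℝ) : ℂ) * d ^ 2 := by push_cast; ring
    rw [this, Complex.re_ofReal_mul, hd.sq_re]
    norm_num
  have hσ' : (σ : ℂ) ^ 2 = 1 := by exact_mod_cast hσ
  have hpi : ((√Real.pi : ℝ) : ℂ) ^ 2 = Real.pi := by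
    rw [← Complex.ofReal_pow, Real.sq_sqrt Real.pi_pos.le]
  have h1 : (Real.pi : ℂ) / (d ^ 2 / 4) = (((2 * √Real.pi * σ : ℝ) : ℂ) * d⁻¹) ^ 2 := by
    push_cast
    rw [mul_pow, mul_pow, mul_pow, hσ', hpi]
    field_simp
    ring
  have h2 : 0 < (((2 * √Real.pi * σ : ℝ) : ℂ) * d⁻¹).re := by
    rw [Complex.re_ofReal_mul, Complex.inv_re, Complex.normSq_eq_norm_sq, hd.norm_eq]
    have := Real.sqrt_pos.2 Real.pi_pos
    have : 2 * √Real.pi * σ * (d.re / 1 ^ 2) = 2 * √Real.pi * (σ * d.re) := by ring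
    rw [this]
    positivity
  rw [integral_gaussian_complex_Ioi hre, h1, one_div, Complex.sq_cpow_two_inv h2]
  push_cast
  field_simp

lemma gaussMoment_eq {ε : ℝ} (hε : 0 < ε) : (gaussMoment ε : ℂ)
    = (√Real.pi * (∫ ρ in Ioi (0 : ℝ), rayWeight dirR (ε * ρ)
        * Complex.exp (-(dirR ^ 2 / 4) * ρ ^ 2))
      - √Real.pi * (∫ ρ in Ioi (0 : ℝ), rayWeight dirL (ε * ρ)
        * Complex.exp (-(dirL ^ 2 / 4) * ρ ^ 2))) / (2 * Real.pi) := by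
  have hR := isDirection_dirR.integrable_prod hε
  have hL := isDirection_dirL.integrable_prod hε
  rw [← isDirection_dirR.integral_integral hε, ← isDirection_dirL.integral_integral hε,
    ← integral_sub (by simpa using hR.integral_prod_left) (by simpa using hL.integral_prod_left),
    ← integral_div, gaussMoment, ← integral_complex_ofReal]
  refine integral_congr_ae ?_
  filter_upwards [hR.prod_right_ae, hL.prod_right_ae] with s h1 h2
  simp only [Function.uncurry_apply_pair] at h1 h2 ⊢
  rw [← integral_sub h1 h2]
  have h3 : ((airyD 0 s : ℝ) : ℂ)
      = (∫ ρ in Ioi (0 : ℝ), integrand (fun a => (Complex.I * a) ^ 0) s ρ) / (2 * Real.pi) := by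
    rw [airyD_zero, ← airyC_eq, airyC, ← contourIntegral_one]
    simp
  have h4 : ∀ ρ : ℝ, Complex.exp (-(ε ^ 2 : ℂ) * s ^ 2)
      * (rayWeight dirR ρ * Complex.exp (Complex.I * (ρ * dirR) * s))
      - Complex.exp (-(ε ^ 2 : ℂ) * s ^ 2)
      * (rayWeight dirL ρ * Complex.exp (Complex.I * (ρ * dirL) * s))
      = (Complex.exp (-(ε ^ 2 : ℂ) * s ^ 2) * Real.exp s)
        * integrand (fun a => (Complex.I * a) ^ 0) s ρ := by
    intro ρ
    rw [mul_assoc _ (Real.exp s : ℂ), exp_mul_integrand]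
    ring
  simp only [h4]
  rw [integral_const_mul]
  push_cast
  rw [h3]
  ring_nf

/-- In the limit the right-hand ray contributes π exp(1/3) and the left-hand ray -π exp(1/3). Their
difference divided by 2π is the moment. -/
lemma moment_one : moment 1 = Real.exp (1 / 3) := by
  have h1 : Tendsto (fun ε => (gaussMoment ε : ℂ)) (𝓝[>] 0) (𝓝 (moment 1 : ℂ)) :=
    (Complex.continuous_ofReal.tendsto _).comp tendsto_gaussMoment
  have h2 := ((isDirection_dirR.tendsto.const_mul (√Real.pi : ℂ)).sub
    (isDirection_dirL.tendsto.const_mul (√Real.pi : ℂ))).div_const (2 * Real.pi : ℂ)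
  have h3 : Tendsto (fun ε => (gaussMoment ε : ℂ)) (𝓝[>] 0) _ := h2.congr' (by
    filter_upwards [self_mem_nhdsWithin] with ε hε
    exact (gaussMoment_eq hε).symm)
  have h4 := tendsto_nhds_unique h1 h3
  have hR := isDirection_dirR.gaussian (σ := 1) (by norm_num) (by simp [dirR])
  have hL := isDirection_dirL.gaussian (σ := -1) (by norm_num) (by simp [dirL])
  have hpi : ((√Real.pi : ℝ) : ℂ) ^ 2 = Real.pi := by
    rw [← Complex.ofReal_pow, Real.sq_sqrt Real.pi_pos.le]
  have hpi0 : (Real.pi : ℂ) ≠ 0 := by exact_mod_cast Real.pi_ne_zero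
  rw [mul_right_comm, hR, mul_right_comm dirL, hL] at h4
  have h5 : (moment 1 : ℂ) = ((Real.exp (1 / 3) : ℝ) : ℂ) := by
    rw [h4, div_eq_iff (by simp)]
    push_cast
    linear_combination (2 * Complex.exp (1 / 3)) * hpi
  exact_mod_cast h5

lemma moment_eq {θ : ℝ} (h0 : 0 < θ) (h1 : θ < 1) : moment θ = Real.exp (θ ^ 3 / 3) := by
  have h2 : Tendsto (fun t => moment t * Real.exp (-(t ^ 3 / 3))) (𝓝[<] 1) (𝓝 1) := by
    have h3 : Tendsto (fun t : ℝ => Real.exp (-(t ^ 3 / 3))) (𝓝[<] 1)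
        (𝓝 (Real.exp (-(1 ^ 3 / 3)))) :=
      ((by fun_prop : Continuous fun t : ℝ => Real.exp (-(t ^ 3 / 3))).tendsto 1).mono_left
        nhdsWithin_le_nhds
    have := tendsto_moment.mul h3
    rwa [moment_one, ← Real.exp_add, one_pow, add_neg_cancel, Real.exp_zero] at this
  have h3 : Tendsto (fun _ : ℝ => moment θ * Real.exp (-(θ ^ 3 / 3))) (𝓝[<] (1 : ℝ)) (𝓝 1) := by
    refine h2.congr' ?_
    filter_upwards [Ioo_mem_nhdsLT (zero_lt_one (α := ℝ))] with t ht
    exact moment_eq_of_mem ht ⟨h0, h1⟩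
  have h4 := tendsto_nhds_unique h3 tendsto_const_nhds
  have h5 : moment θ = moment θ * Real.exp (-(θ ^ 3 / 3)) * Real.exp (θ ^ 3 / 3) := by
    rw [mul_assoc, ← Real.exp_add]; simp
  rw [h5, ← h4, one_mul]

end RAiry
end

noncomputable section

namespace RAiry

open Filter Topology

/-! ### The Airy transform is a contraction -/

/-- The correlation `∫ exp (2 η w) A(w + d) A(w) dw`. -/
def corr (η d : ℝ) : ℝ := ∫ w, Real.exp (2 * η * w) * (airyD 0 (w + d) * airyD 0 w)

/-- Let X and Y be the weighted integrals with the derivative on A(w + d) and on A(w). Integrating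
the derivative of the product gives X + Y = -2η corr. The Wronskian has derivative d · A(w + d)A(w)
by the Airy equation, which gives -2η(X - Y) = d corr. Solving for X gives the formula. -/
lemma hasDerivAt_corr {η : ℝ} (h0 : 0 < η) (h1 : η < 1 / 2) (d : ℝ) :
    HasDerivAt (corr η) (-(η + d / (4 * η)) * corr η d) d := by
  have hA := slow_airyD_zero
  have hB := slow_airyD_one
  have hC := slow_airyD_two
  have hc0 := hA.cont
  have hc1 := hB.cont
  obtain ⟨C, hC0, hCb⟩ := hB.exists_exp_mul_le (η := η) (κ := η / 2) (by linarith) (by linarith)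
    (by linarith)
  have hi := hA.integrable (θ := η) h0 (by linarith)
  have hI : ∀ {f g : ℝ → ℝ}, Slow f → Slow g →
      Integrable fun w => Real.exp (2 * η * w) * (f (w + d) * g w) := fun hf hg =>
    (hf.shift d).integrable_mul hg h0 h1
  have key := hasDerivAt_integral_of_dominated_loc_of_deriv_le (μ := volume)
    (F := fun d w => Real.exp (2 * η * w) * (airyD 0 (w + d) * airyD 0 w))
    (F' := fun d w => Real.exp (2 * η * w) * (airyD 1 (w + d) * airyD 0 w))
    (x₀ := d) (s := Metric.ball d 1)
    (bound := fun w => C * Real.exp (η * (|d| + 1)) * ‖Real.exp (η * w) * airyD 0 w‖)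
    (Metric.ball_mem_nhds d one_pos)
    (Eventually.of_forall fun d => (by fun_prop : Continuous fun w =>
      Real.exp (2 * η * w) * (airyD 0 (w + d) * airyD 0 w)).aestronglyMeasurable)
    (hI hA hA)
    (by fun_prop : Continuous fun w =>
      Real.exp (2 * η * w) * (airyD 1 (w + d) * airyD 0 w)).aestronglyMeasurable
    (Eventually.of_forall fun w d' hd' => ?_) (hi.norm.const_mul _)
    (Eventually.of_forall fun w d' _ => ?_)
  · refine key.2.congr_deriv ?_
    have hX := hI hB hA
    have hY := hI hA hB
    have e1 := integral_exp_mul_deriv (c := 2 * η)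
      (F := fun w => airyD 0 (w + d) * airyD 0 w)
      (F' := fun w => airyD 1 (w + d) * airyD 0 w + airyD 0 (w + d) * airyD 1 w)
      (fun w => ((hasDerivAt_airyD 0 (w + d)).comp_add_const w d).mul (hasDerivAt_airyD 0 w))
      (hI hA hA) ((hX.add hY).congr (Eventually.of_forall fun w => (mul_add _ _ _).symm))
    have e2 := integral_exp_mul_deriv (c := 2 * η)
      (F := fun w => airyD 1 (w + d) * airyD 0 w - airyD 0 (w + d) * airyD 1 w)
      (F' := fun w => d * (airyD 0 (w + d) * airyD 0 w))
      (fun w => ((((hasDerivAt_airyD 1 (w + d)).comp_add_const w d).mul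
        (hasDerivAt_airyD 0 w)).sub (((hasDerivAt_airyD 0 (w + d)).comp_add_const w d).mul
        (hasDerivAt_airyD 1 w))).congr_deriv (by
          norm_num
          rw [airyD_two, airyD_two]
          ring))
      ((hX.sub hY).congr (Eventually.of_forall fun w => (mul_sub _ _ _).symm))
      (((hI hA hA).const_mul d).congr (Eventually.of_forall fun w => by ring))
    simp only [mul_add, mul_sub] at e1 e2
    rw [integral_add hX hY] at e1
    rw [integral_sub hX hY] at e2
    have e3 : ∫ w, Real.exp (2 * η * w) * (d * (airyD 0 (w + d) * airyD 0 w)) = d * corr η d := by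
      rw [corr, ← integral_const_mul]
      congr 1
      funext w
      ring
    rw [e3] at e2
    rw [← corr] at e1
    set X := ∫ w, Real.exp (2 * η * w) * (airyD 1 (w + d) * airyD 0 w) with hXd
    set Y := ∫ w, Real.exp (2 * η * w) * (airyD 0 (w + d) * airyD 1 w) with hYd
    have hη : η ≠ 0 := h0.ne'
    field_simp
    linear_combination (2 * η) * e1 + e2
  · rw [Real.ball_eq_Ioo] at hd'
    have hd1 : -(|d| + 1) ≤ d' := by linarith [neg_abs_le d, hd'.1]
    have h2 : Real.exp (η * w) * |airyD 1 (w + d')| ≤ C * Real.exp (η * (|d| + 1)) := by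
      have h3 := hCb (w + d')
      have h4 : C * Real.exp (-(η / 2 * |w + d'|)) ≤ C := mul_le_of_le_one_right hC0
        (Real.exp_le_one_iff.2 (by have := abs_nonneg (w + d'); nlinarith))
      calc Real.exp (η * w) * |airyD 1 (w + d')|
          = Real.exp (-(η * d')) * (Real.exp (η * (w + d')) * |airyD 1 (w + d')|) := by
            rw [← mul_assoc, ← Real.exp_add]; ring_nf
        _ ≤ Real.exp (η * (|d| + 1)) * C := by
            refine mul_le_mul (Real.exp_le_exp.2 (by nlinarith)) (h3.trans h4) (by positivity)
              (Real.exp_pos _).le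
        _ = _ := mul_comm _ _
    rw [norm_mul, norm_mul, norm_mul]
    simp only [Real.norm_eq_abs, Real.abs_exp]
    calc Real.exp (2 * η * w) * (|airyD 1 (w + d')| * |airyD 0 w|)
        = (Real.exp (η * w) * |airyD 1 (w + d')|) * (Real.exp (η * w) * |airyD 0 w|) := by
          rw [show 2 * η * w = η * w + η * w by ring, Real.exp_add]; ring
      _ ≤ _ := by gcongr
  · exact (((hasDerivAt_airyD 0 (w + d')).comp_const_add w d').mul_const (airyD 0 w)).const_mul _

/-- The Gaussian density that describes the correlations of the Airy function. -/
def corrDensity (η d : ℝ) : ℝ := corr η 0 * Real.exp (-(1 / (8 * η)) * d ^ 2)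

/-- The first-order equation for the correlation integrates to a Gaussian in d, and the factor
exp(ηd) removes its linear exponent. -/
lemma corrDensity_eq {η : ℝ} (h0 : 0 < η) (h1 : η < 1 / 2) (d : ℝ) :
    corrDensity η d = Real.exp (η * d) * corr η d := by
  have hd : ∀ d, HasDerivAt (fun d => corr η d * Real.exp (η * d + 1 / (8 * η) * d ^ 2)) 0 d := by
    intro d
    have h2 : HasDerivAt (fun d : ℝ => Real.exp (η * d + 1 / (8 * η) * d ^ 2))
        (Real.exp (η * d + 1 / (8 * η) * d ^ 2) * (η * 1 + 1 / (8 * η) * (2 * d))) d := by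
      have := (((hasDerivAt_id d).const_mul η).add ((hasDerivAt_pow 2 d).const_mul
        (1 / (8 * η)))).exp
      simpa using this
    refine ((hasDerivAt_corr h0 h1 d).mul h2).congr_deriv ?_
    have := h0.ne'
    field_simp
    ring
  have h := is_const_of_deriv_eq_zero (fun d => (hd d).differentiableAt) (fun d => (hd d).deriv)
    d 0
  simp only [mul_zero, zero_pow two_ne_zero, add_zero, Real.exp_zero, mul_one] at h
  rw [corrDensity, ← h, Real.exp_add, mul_assoc, mul_assoc, ← Real.exp_add]
  simp
  ring

lemma corrDensity_nonneg (η d : ℝ) : 0 ≤ corrDensity η d := by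
  refine mul_nonneg (integral_nonneg fun w => ?_) (Real.exp_pos _).le
  simp only [add_zero, Pi.zero_apply]
  exact mul_nonneg (Real.exp_pos _).le (mul_self_nonneg _)

lemma corrDensity_neg (η d : ℝ) : corrDensity η (-d) = corrDensity η d := by
  simp [corrDensity]

lemma continuous_corrDensity (η : ℝ) : Continuous (corrDensity η) := by
  unfold corrDensity; fun_prop

lemma integrable_corrDensity {η : ℝ} (h0 : 0 < η) : Integrable (corrDensity η) :=
  (integrable_exp_neg_mul_sq (by positivity)).const_mul _

/-- The density is the autocorrelation of exp(ηw)A(w), so its total mass is the square of the moment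
at η. The mass tends to 1 as η → 0, which is how unitarity of the Airy transform enters. -/
lemma integral_corrDensity {η : ℝ} (h0 : 0 < η) (h1 : η < 1 / 2) :
    ∫ d, corrDensity η d = Real.exp (2 * η ^ 3 / 3) := by
  set f : ℝ → ℝ := fun w => Real.exp (η * w) * airyD 0 w with hf
  have hi : Integrable f := slow_airyD_zero.integrable h0 (by linarith)
  have h2 : Integrable (Function.uncurry fun w d : ℝ => f w * f (w + d))
      (volume.prod volume) :=
    (measurePreserving_prod_add volume volume).integrable_comp_of_integrable (hi.mul_prod hi)
  have h3 : ∀ d, corrDensity η d = ∫ w, f w * f (w + d) := by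
    intro d
    rw [corrDensity_eq h0 h1, corr, ← integral_const_mul]
    congr 1
    funext w
    simp only [hf]
    rw [show 2 * η * w = η * w + η * w by ring, mul_add η w d, Real.exp_add, Real.exp_add]
    ring
  simp only [h3]
  rw [← integral_integral_swap h2]
  simp only [integral_const_mul, integral_add_left_eq_self, integral_mul_const]
  have h4 : ∫ w, f w = Real.exp (η ^ 3 / 3) := moment_eq h0 (by linarith)
  rw [h4, ← Real.exp_add]
  ring_nf

lemma integral_exp_mul_airy_mul_airy {η : ℝ} (h0 : 0 < η) (h1 : η < 1 / 2) (u v : ℝ) :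
    ∫ w, Real.exp (2 * η * w) * (airyD 0 (w + u) * airyD 0 (w + v))
      = Real.exp (-(η * (u + v))) * corrDensity η (u - v) := by
  have h := integral_add_right_eq_self (μ := volume) (fun w => Real.exp (2 * η * w) *
    (airyD 0 (w + (u - v)) * airyD 0 w)) v
  rw [← corr] at h
  have e : ∀ w, Real.exp (2 * η * w) * (airyD 0 (w + u) * airyD 0 (w + v))
      = Real.exp (-(2 * η * v)) * (Real.exp (2 * η * (w + v)) *
        (airyD 0 (w + v + (u - v)) * airyD 0 (w + v))) := by
    intro w
    rw [← mul_assoc (Real.exp (-(2 * η * v))), ← Real.exp_add]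
    ring_nf
  simp only [e]
  rw [integral_const_mul, h, corrDensity_eq h0 h1, ← mul_assoc, ← Real.exp_add]
  ring_nf

/-! ### Quadratic estimates for the Airy transform -/

/-- The Airy transform of a function on `(x, ∞)`. -/
def airyTrans (j : ℕ) (x : ℝ) (F : L2 x) (w : ℝ) : ℝ := ∫ u, airyD j (w + u) * F u ∂(mu x)

lemma memLp_exp_neg_mul {c : ℝ} (hc : 0 < c) (x : ℝ) :
    MemLp (fun u => Real.exp (-(c * u))) 2 (mu x) := by
  rw [memLp_two_iff_integrable_sq
    (by fun_prop : Continuous fun u : ℝ => Real.exp (-(c * u))).aestronglyMeasurable]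
  refine (exp_neg_integrableOn_Ioi x (b := 2 * c) (by positivity)).congr
    (Eventually.of_forall fun u => ?_)
  simp only
  rw [← Real.exp_nat_mul]
  congr 1
  push_cast
  ring

lemma exists_exp_mul_airy_shift_le {η : ℝ} (h0 : 0 < η) (h1 : η < 1 / 2) (x : ℝ) :
    ∃ C, 0 ≤ C ∧ ∀ w u, x ≤ u → Real.exp (η * w) * |airyD 0 (w + u)|
      ≤ C * (Real.exp (-(η / 2 * |w|)) * Real.exp (-(η / 2 * u))) := by
  obtain ⟨C, hC0, hCb⟩ := slow_airyD_zero.exists_exp_mul_le (η := η) (κ := η / 2) (by linarith)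
    (by linarith) (by linarith)
  refine ⟨C * Real.exp (η * |x|), by positivity, fun w u hu => ?_⟩
  calc Real.exp (η * w) * |airyD 0 (w + u)|
      = Real.exp (-(η * u)) * (Real.exp (η * (w + u)) * |airyD 0 (w + u)|) := by
        rw [← mul_assoc, ← Real.exp_add]; ring_nf
    _ ≤ Real.exp (-(η * u)) * (C * Real.exp (-(η / 2 * |w + u|))) := 
        mul_le_mul_of_nonneg_left (hCb _) (Real.exp_pos _).le
    _ = C * Real.exp (-(η * u) - η / 2 * |w + u|) := by
        rw [mul_left_comm, ← Real.exp_add]; rfl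
    _ ≤ C * Real.exp (η * |x| + (-(η / 2 * |w|) + -(η / 2 * u))) := by
        gcongr
        have h2 : |w| ≤ |w + u| + |u| := by
          have := abs_sub (w + u) u
          rwa [add_sub_cancel_right] at this
        have h3 : |u| ≤ 2 * |x| + u := by
          rcases le_total 0 u with h | h
          · rw [abs_of_nonneg h]; linarith [abs_nonneg x]
          · rw [abs_of_nonpos h]; linarith [neg_abs_le x]
        nlinarith
    _ = _ := by rw [Real.exp_add, Real.exp_add]; ring

/-- Nonnegative measurable weights that are bounded by `exp (2 η w)`. -/
structure IsWeight (η : ℝ) (ω : ℝ → ℝ) : Prop where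
  pos : 0 < η
  lt_half : η < 1 / 2
  meas : Measurable ω
  nonneg : ∀ w, 0 ≤ ω w
  le_exp : ∀ w, ω w ≤ Real.exp (2 * η * w)

lemma IsWeight.integrable_quadratic {x η : ℝ} {ω : ℝ → ℝ} (hω : IsWeight η ω) (F : L2 x) :
    Integrable (Function.uncurry fun (w : ℝ) (p : ℝ × ℝ) =>
    ω w * ((airyD 0 (w + p.1) * F p.1) * (airyD 0 (w + p.2) * F p.2)))
    (volume.prod ((mu x).prod (mu x))) := by
  have h0 := hω.pos
  obtain ⟨C, hC, hb⟩ := exists_exp_mul_airy_shift_le h0 hω.lt_half x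
  have hc := (decay_airyD 0).cont
  have hg : Integrable (fun u => Real.exp (-(η / 2 * u)) * |F u|) (mu x) := by
    refine (integrable_mul_vec (memLp_exp_neg_mul (by positivity : 0 < η / 2) x) F).norm.congr
      (Eventually.of_forall fun u => ?_)
    simp
  have hF := (Lp.aestronglyMeasurable F)
  refine Integrable.mono' (((integrable_exp_neg_mul_abs h0).mul_prod
    (hg.mul_prod hg)).const_mul (C * C)) ?_ ?_
  · have m1 : AEStronglyMeasurable (fun z : ℝ × ℝ × ℝ => ω z.1)
        (volume.prod ((mu x).prod (mu x))) := (hω.meas.comp measurable_fst).aestronglyMeasurable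
    have m2 : AEStronglyMeasurable (fun z : ℝ × ℝ × ℝ => F z.2.1)
        (volume.prod ((mu x).prod (mu x))) := (hF.comp_fst (ν := mu x)).comp_snd
    have m3 : AEStronglyMeasurable (fun z : ℝ × ℝ × ℝ => F z.2.2)
        (volume.prod ((mu x).prod (mu x))) := (hF.comp_snd (μ := mu x)).comp_snd
    have m4 : AEStronglyMeasurable (fun z : ℝ × ℝ × ℝ => airyD 0 (z.1 + z.2.1))
        (volume.prod ((mu x).prod (mu x))) :=
      (by fun_prop : Continuous fun z : ℝ × ℝ × ℝ => airyD 0 (z.1 + z.2.1)).aestronglyMeasurable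
    have m5 : AEStronglyMeasurable (fun z : ℝ × ℝ × ℝ => airyD 0 (z.1 + z.2.2))
        (volume.prod ((mu x).prod (mu x))) :=
      (by fun_prop : Continuous fun z : ℝ × ℝ × ℝ => airyD 0 (z.1 + z.2.2)).aestronglyMeasurable
    exact m1.mul ((m4.mul m2).mul (m5.mul m3))
  · have hmem : ∀ᵐ u ∂(mu x), u ∈ Ioi x := ae_restrict_mem measurableSet_Ioi
    have q1 : ∀ᵐ z : ℝ × ℝ × ℝ ∂(volume.prod ((mu x).prod (mu x))), z.2.1 ∈ Ioi x :=
      Measure.quasiMeasurePreserving_snd.ae (Measure.quasiMeasurePreserving_fst.ae hmem)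
    have q2 : ∀ᵐ z : ℝ × ℝ × ℝ ∂(volume.prod ((mu x).prod (mu x))), z.2.2 ∈ Ioi x :=
      Measure.quasiMeasurePreserving_snd.ae (Measure.quasiMeasurePreserving_snd.ae hmem)
    filter_upwards [q1, q2] with ⟨w, u, v⟩ hu hv
    simp only [Function.uncurry_apply_pair, norm_mul, Real.norm_eq_abs]
    rw [abs_of_nonneg (hω.nonneg w)]
    calc ω w * (|airyD 0 (w + u)| * |F u| * (|airyD 0 (w + v)| * |F v|))
        ≤ Real.exp (2 * η * w) * (|airyD 0 (w + u)| * |F u| * (|airyD 0 (w + v)| * |F v|)) := by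
          gcongr; exact hω.le_exp w
      _ = (Real.exp (η * w) * |airyD 0 (w + u)|) * (Real.exp (η * w) * |airyD 0 (w + v)|)
          * (|F u| * |F v|) := by
          rw [show 2 * η * w = η * w + η * w by ring, Real.exp_add]; ring
      _ ≤ (C * (Real.exp (-(η / 2 * |w|)) * Real.exp (-(η / 2 * u))))
          * (C * (Real.exp (-(η / 2 * |w|)) * Real.exp (-(η / 2 * v)))) * (|F u| * |F v|) :=
          mul_le_mul_of_nonneg_right (mul_le_mul (hb w u (le_of_lt hu)) (hb w v (le_of_lt hv))
            (by positivity) (by positivity)) (by positivity)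
      _ = _ := by
          rw [show -(η * |w|) = -(η / 2 * |w|) + -(η / 2 * |w|) by ring, Real.exp_add]; ring

lemma IsWeight.integrable_mul_airyTrans_sq {x η : ℝ} {ω : ℝ → ℝ} (hω : IsWeight η ω)
    (F : L2 x) : Integrable fun w => ω w * airyTrans 0 x F w ^ 2 := by
  refine (hω.integrable_quadratic F).integral_prod_left.congr
    (Eventually.of_forall fun w => ?_)
  simp only [Function.uncurry_apply_pair]
  rw [integral_const_mul, sq, airyTrans,
    ← integral_prod_mul (fun u => airyD 0 (w + u) * F u) (fun u => airyD 0 (w + u) * F u)]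

lemma IsWeight.integral_mul_airyTrans_sq {x η : ℝ} {ω : ℝ → ℝ} (hω : IsWeight η ω)
    (F : L2 x) : ∫ w, ω w * airyTrans 0 x F w ^ 2
    = ∫ p : ℝ × ℝ, (F p.1 * F p.2) * (∫ w, ω w * (airyD 0 (w + p.1) * airyD 0 (w + p.2)))
      ∂((mu x).prod (mu x)) := by
  have h2 : ∀ w, ω w * airyTrans 0 x F w ^ 2 = ∫ p : ℝ × ℝ,
      ω w * ((airyD 0 (w + p.1) * F p.1) * (airyD 0 (w + p.2) * F p.2))
      ∂((mu x).prod (mu x)) := by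
    intro w
    rw [integral_const_mul, sq, airyTrans,
      ← integral_prod_mul (fun u => airyD 0 (w + u) * F u) (fun u => airyD 0 (w + u) * F u)]
  simp only [h2]
  rw [integral_integral_swap (hω.integrable_quadratic F)]
  congr 1
  funext p
  rw [← integral_const_mul]
  congr 1
  funext w
  ring

lemma IsWeight.integrable_mul_kernel {x η : ℝ} {ω : ℝ → ℝ} (hω : IsWeight η ω)
    (F : L2 x) : Integrable (fun p : ℝ × ℝ => (F p.1 * F p.2) *
    (∫ w, ω w * (airyD 0 (w + p.1) * airyD 0 (w + p.2)))) ((mu x).prod (mu x)) := by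
  refine (hω.integrable_quadratic F).integral_prod_right.congr
    (Eventually.of_forall fun p => ?_)
  simp only [Function.uncurry_apply_pair]
  rw [← integral_const_mul]
  congr 1
  funext w
  ring

lemma integral_sq_L2 {x : ℝ} (F : L2 x) : ∫ u, F u ^ 2 ∂(mu x) = ‖F‖ ^ 2 := by
  rw [← real_inner_self_eq_norm_sq, inner_eq_integral]
  simp only [sq]

lemma integrable_sq_L2 {x : ℝ} (F : L2 x) : Integrable (fun u => F u ^ 2) (mu x) := by
  simpa only [sq] using integrable_mul_L2 F F

/-- One half of the Schur test for a convolution kernel; the other half follows by exchanging the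
variables. -/
lemma schur_bound {x : ℝ} (F : L2 x) {g : ℝ → ℝ} (hg : Continuous g) (hgi : Integrable g)
    (hg0 : ∀ d, 0 ≤ g d) :
    Integrable (fun p : ℝ × ℝ => F p.1 ^ 2 * g (p.1 - p.2)) ((mu x).prod (mu x)) ∧
    ∫ p : ℝ × ℝ, F p.1 ^ 2 * g (p.1 - p.2) ∂((mu x).prod (mu x)) ≤ (∫ d, g d) * ‖F‖ ^ 2 := by
  have hF := Lp.aestronglyMeasurable F
  have hgu : ∀ u, Integrable (fun v => g (u - v)) := fun u => hgi.comp_sub_left u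
  have hgu' : ∀ u, Integrable (fun v => g (u - v)) (mu x) := fun u => (hgu u).integrableOn
  have hle : ∀ u, ∫ v, g (u - v) ∂(mu x) ≤ ∫ d, g d := by
    intro u
    have h := integral_sub_left_eq_self g volume u
    rw [← h]
    exact setIntegral_le_integral (hgu u) (Eventually.of_forall fun v => hg0 _)
  have hnn : ∀ u, 0 ≤ ∫ v, g (u - v) ∂(mu x) := fun u => integral_nonneg fun v => hg0 _
  have hm : AEStronglyMeasurable (fun p : ℝ × ℝ => F p.1 ^ 2 * g (p.1 - p.2))
      ((mu x).prod (mu x)) :=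
    ((hF.comp_fst (ν := mu x)).pow 2).mul (by fun_prop : Continuous fun p : ℝ × ℝ =>
      g (p.1 - p.2)).aestronglyMeasurable
  have hint : Integrable (fun p : ℝ × ℝ => F p.1 ^ 2 * g (p.1 - p.2)) ((mu x).prod (mu x)) := by
    refine (integrable_prod_iff hm).2 ⟨Eventually.of_forall fun u => (hgu' u).const_mul (F u ^ 2), ?_⟩
    refine Integrable.mono' ((integrable_sq_L2 F).mul_const (∫ d, g d))
      hm.norm.integral_prod_right' (Eventually.of_forall fun u => ?_)
    have : ∀ v, ‖F u ^ 2 * g (u - v)‖ = F u ^ 2 * g (u - v) := fun v =>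
      Real.norm_of_nonneg (mul_nonneg (sq_nonneg _) (hg0 _))
    simp only [this]
    rw [integral_const_mul, Real.norm_of_nonneg (mul_nonneg (sq_nonneg _) (hnn u))]
    exact mul_le_mul_of_nonneg_left (hle u) (sq_nonneg _)
  refine ⟨hint, ?_⟩
  rw [integral_prod _ hint]
  simp only [integral_const_mul]
  rw [← integral_sq_L2, ← integral_const_mul]
  refine integral_mono ?_ ((integrable_sq_L2 F).const_mul _) fun u => ?_
  · simpa only [integral_const_mul] using hint.integral_prod_left
  · simp only
    rw [mul_comm (∫ d, g d)]
    exact mul_le_mul_of_nonneg_left (hle u) (sq_nonneg _)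

lemma isWeight_exp {η : ℝ} (h0 : 0 < η) (h1 : η < 1 / 2) :
    IsWeight η fun w => Real.exp (2 * η * w) :=
  ⟨h0, h1, by fun_prop, fun w => (Real.exp_pos _).le, fun w => le_rfl⟩

/-- The kernel of this quadratic form is exp(-η(u + v)) times the Gaussian density of u - v. The
exponential is at most exp(-2ηx), and F(u)F(v) ≤ (F(u)² + F(v)²)/2 reduces the rest to the Schur
test. The constant tends to 1 as η → 0. -/
lemma integral_exp_mul_airyTrans_sq_le {x η : ℝ} (h0 : 0 < η) (h1 : η < 1 / 2) (F : L2 x) :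
    ∫ w, Real.exp (2 * η * w) * airyTrans 0 x F w ^ 2
      ≤ Real.exp (2 * η ^ 3 / 3 - 2 * η * x) * ‖F‖ ^ 2 := by
  have hω := isWeight_exp h0 h1
  rw [hω.integral_mul_airyTrans_sq F]
  have hi := hω.integrable_mul_kernel F
  obtain ⟨s1, s2⟩ := schur_bound F (continuous_corrDensity η) (integrable_corrDensity h0)
    (corrDensity_nonneg η)
  rw [integral_corrDensity h0 h1] at s2
  set g : ℝ × ℝ → ℝ := fun p => F p.1 ^ 2 * corrDensity η (p.1 - p.2) with hg
  have s3 := s1.swap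
  have s4 := integral_prod_swap (μ := mu x) (ν := mu x) g
  have hgs : ∀ p : ℝ × ℝ, g p.swap = F p.2 ^ 2 * corrDensity η (p.1 - p.2) := by
    intro p
    simp only [hg, Prod.fst_swap, Prod.snd_swap]
    rw [← corrDensity_neg, neg_sub]
  have hmem : ∀ᵐ u ∂(mu x), u ∈ Ioi x := ae_restrict_mem measurableSet_Ioi
  calc _ ≤ ∫ p : ℝ × ℝ, Real.exp (-(2 * η * x)) * ((g p + g p.swap) / 2)
        ∂((mu x).prod (mu x)) := by
        refine integral_mono_ae hi (((s1.add s3).div_const 2).const_mul _) ?_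
        filter_upwards [(Measure.quasiMeasurePreserving_fst (ν := mu x)).ae hmem,
          (Measure.quasiMeasurePreserving_snd (μ := mu x)).ae hmem] with p hu hv
        have hu' : x < p.1 := hu
        have hv' : x < p.2 := hv
        simp only [hgs]
        rw [integral_exp_mul_airy_mul_airy h0 h1]
        have hp := corrDensity_nonneg η (p.1 - p.2)
        have he : Real.exp (-(η * (p.1 + p.2))) ≤ Real.exp (-(2 * η * x)) :=
          Real.exp_le_exp.2 (by nlinarith)
        have hsq : F p.1 * F p.2 ≤ (F p.1 ^ 2 + F p.2 ^ 2) / 2 := by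
          nlinarith [sq_nonneg (F p.1 - F p.2)]
        calc F p.1 * F p.2 * (Real.exp (-(η * (p.1 + p.2))) * corrDensity η (p.1 - p.2))
            ≤ (F p.1 ^ 2 + F p.2 ^ 2) / 2
              * (Real.exp (-(η * (p.1 + p.2))) * corrDensity η (p.1 - p.2)) := by gcongr
          _ ≤ (F p.1 ^ 2 + F p.2 ^ 2) / 2
              * (Real.exp (-(2 * η * x)) * corrDensity η (p.1 - p.2)) := by gcongr
          _ = _ := by simp only [hg]; ring
    _ = Real.exp (-(2 * η * x)) * ∫ p, g p ∂((mu x).prod (mu x)) := by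
        rw [integral_const_mul, integral_div]
        congr 1
        have := integral_add s1 s3
        simp only [Function.comp] at this
        rw [this, s4]
        ring
    _ ≤ Real.exp (-(2 * η * x)) * (Real.exp (2 * η ^ 3 / 3) * ‖F‖ ^ 2) := by gcongr
    _ = _ := by rw [← mul_assoc, ← Real.exp_add]; ring_nf

lemma airyKernel_comm (u v : ℝ) : airyKernel u v = airyKernel v u := by
  simp only [airyKernel, mul_comm]

lemma integral_indicator_mul_airy (u v : ℝ) :
    ∫ w, (Ioi (0 : ℝ)).indicator 1 w * (airyD 0 (w + u) * airyD 0 (w + v)) = airyKernel u v := by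
  rw [airyKernel_eq, kern, ← integral_indicator measurableSet_Ioi]
  congr 1
  funext w
  by_cases hw : w ∈ Ioi (0 : ℝ)
  · simp [hw]
  · simp [hw]

lemma isWeight_indicator {η : ℝ} (h0 : 0 < η) (h1 : η < 1 / 2) :
    IsWeight η ((Ioi (0 : ℝ)).indicator 1) := by
  refine ⟨h0, h1, measurable_one.indicator measurableSet_Ioi,
    fun w => indicator_nonneg (fun _ _ => zero_le_one) w, fun w => ?_⟩
  by_cases hw : w ∈ Ioi (0 : ℝ)
  · have : (0 : ℝ) < w := hw
    rw [indicator_of_mem hw, Pi.one_apply]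
    exact Real.one_le_exp (by positivity)
  · rw [indicator_of_notMem hw]
    exact (Real.exp_pos _).le

/-- Opening the kernel as an integral over w > 0 and applying Fubini shows the Airy operator as a
Gram operator of the transform. -/
lemma inner_airyKernel {x C : ℝ} (h : Adm x C airyKernel) (F : L2 x) :
    inner ℝ F (h.op F) = ∫ w, (Ioi (0 : ℝ)).indicator 1 w * airyTrans 0 x F w ^ 2 := by
  -- Any exponent in (0, 1/2) would serve; it is used only for integrability.
  have hω := isWeight_indicator (η := 1 / 4) (by norm_num) (by norm_num)
  have hi := hω.integrable_mul_kernel F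
  rw [hω.integral_mul_airyTrans_sq F,
    integral_prod _ hi, inner_eq_integral]
  refine integral_congr_ae ?_
  rw [h.op_apply]
  filter_upwards [coeFn_vec (h.dom_apply F).memLp] with u hu
  rw [hu, apply, ← integral_const_mul]
  congr 1
  funext v
  rw [integral_indicator_mul_airy]
  ring

end RAiry
end

noncomputable section

namespace RAiry

open Filter Topology

/-! ### Injectivity of `1 - s K` for `0 ≤ s ≤ 1` -/

lemma hasDerivAt_airyTrans (j : ℕ) {x : ℝ} (F : L2 x) (w : ℝ) :
    HasDerivAt (airyTrans j x F) (airyTrans (j + 1) x F w) w := by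
  have hc := (decay_airyD j).cont
  have hc' := (decay_airyD (j + 1)).cont
  have hF := Lp.aestronglyMeasurable F
  obtain ⟨C, hC, hb⟩ := exists_airyD_bound (j + 1) (w - 1 + x)
  have hi : Integrable (fun u => Real.exp (-(1 * u)) * F u) (mu x) :=
    integrable_mul_vec (memLp_exp_neg_mul one_pos x) F
  have hle : ∀ i ≤ j + 1, ∀ᵐ u ∂(mu x), ∀ w' ∈ Metric.ball w 1, ‖airyD i (w' + u) * F u‖
      ≤ C * Real.exp (-(w - 1)) * ‖Real.exp (-(1 * u)) * F u‖ := by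
    intro i hi
    filter_upwards [ae_restrict_mem measurableSet_Ioi] with u hu w' hw'
    have hu' : x < u := hu
    rw [Real.ball_eq_Ioo] at hw'
    rw [norm_mul, norm_mul, ← mul_assoc]
    simp only [Real.norm_eq_abs, Real.abs_exp]
    gcongr
    refine (hb i hi (w' + u) (by linarith [hw'.1])).trans ?_
    rw [mul_assoc, ← Real.exp_add]
    gcongr
    linarith [hw'.1]
  have hm : ∀ i w', AEStronglyMeasurable (fun u => airyD i (w' + u) * F u) (mu x) := fun i w' =>
    ((decay_airyD i).cont.comp (continuous_const_add w')).aestronglyMeasurable.mul hF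
  refine (hasDerivAt_integral_of_dominated_loc_of_deriv_le (μ := mu x)
    (F := fun w u => airyD j (w + u) * F u) (F' := fun w u => airyD (j + 1) (w + u) * F u)
    (x₀ := w) (s := Metric.ball w 1)
    (bound := fun u => C * Real.exp (-(w - 1)) * ‖Real.exp (-(1 * u)) * F u‖)
    (Metric.ball_mem_nhds w one_pos) (Eventually.of_forall fun w' => hm j w') ?_ (hm (j + 1) w)
    (hle (j + 1) le_rfl) (hi.norm.const_mul _) (Eventually.of_forall fun u w' _ => ?_)).2
  · refine Integrable.mono' (hi.norm.const_mul (C * Real.exp (-(w - 1)))) (hm j w) ?_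
    filter_upwards [hle j (by omega)] with u hu
    exact hu w (Metric.mem_ball_self one_pos)
  · exact ((hasDerivAt_airyD j (w' + u)).comp_add_const w' u).mul_const (F u)

lemma continuous_airyTrans (j : ℕ) {x : ℝ} (F : L2 x) : Continuous (airyTrans j x F) :=
  continuous_iff_continuousAt.2 fun w => (hasDerivAt_airyTrans j F w).continuousAt

/-- The equation gives ‖F‖² = s ∫_{w>0} ≤ ∫_{w>0} of the squared transform, whereas the whole line
carries at most ‖F‖². So nothing is left for w < 0. As the contraction bound is available only with
the weight exp(2ηw), this is carried out on a bounded interval, with η → 0. -/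
lemma airyTrans_eq_zero_of_neg {x C s : ℝ} (h : Adm x C airyKernel) (hs1 : s ≤ 1)
    {F : L2 x} (hF : s • h.op F = F) {w : ℝ} (hw : w < 0) : airyTrans 0 x F w = 0 := by
  set N : ℝ := 1 - w with hN
  have hcont := continuous_airyTrans 0 F
  set q := ∫ w, (Ioi (0 : ℝ)).indicator 1 w * airyTrans 0 x F w ^ 2 with hq
  have hq0 : 0 ≤ q := integral_nonneg fun w =>
    mul_nonneg (indicator_nonneg (fun _ _ => zero_le_one) w) (sq_nonneg _)
  have hFq : ‖F‖ ^ 2 ≤ q := by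
    have h1 : ‖F‖ ^ 2 = s * q := by
      rw [← real_inner_self_eq_norm_sq, hq, ← inner_airyKernel h F, ← real_inner_smul_right, hF]
    rw [h1]
    exact mul_le_of_le_one_left hq0 hs1
  set ζ := ∫ w in Ioo (-N) 0, airyTrans 0 x F w ^ 2 with hζ
  have hζi : IntegrableOn (fun w => airyTrans 0 x F w ^ 2) (Ioo (-N) 0) :=
    ((hcont.pow 2).integrableOn_Icc).mono_set Ioo_subset_Icc_self
  have hζ0 : 0 ≤ ζ := integral_nonneg fun w => sq_nonneg _
  -- The weight exp(2ηw) is at least exp(-2ηN) on (-N, 0) and at least 1 for w > 0, so the total is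
  -- at least exp(-2ηN) ζ + q with q ≥ ‖F‖².
  have key : ∀ η ∈ Ioo (0 : ℝ) (1 / 2),
      Real.exp (-(2 * η * N)) * ζ ≤ (Real.exp (2 * η ^ 3 / 3 - 2 * η * x) - 1) * ‖F‖ ^ 2 := by
    intro η hη
    have hi1 := (isWeight_exp hη.1 hη.2).integrable_mul_airyTrans_sq F
    have hi2 := (isWeight_indicator hη.1 hη.2).integrable_mul_airyTrans_sq F
    have hi3 : Integrable (fun w => (Ioo (-N) 0).indicator
        (fun w => Real.exp (-(2 * η * N)) * airyTrans 0 x F w ^ 2) w) :=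
      (integrable_indicator_iff measurableSet_Ioo).2 (hζi.const_mul _)
    have hle : Real.exp (-(2 * η * N)) * ζ + q
        ≤ ∫ w, Real.exp (2 * η * w) * airyTrans 0 x F w ^ 2 := by
      rw [hζ, ← integral_const_mul, ← integral_indicator measurableSet_Ioo, hq,
        ← integral_add hi3 hi2]
      refine integral_mono (hi3.add hi2) hi1 fun w => ?_
      beta_reduce
      have hsq := sq_nonneg (airyTrans 0 x F w)
      by_cases h1 : w ∈ Ioi (0 : ℝ)
      · have h2 : w ∉ Ioo (-N) 0 := fun h => absurd h.2 (not_lt.2 (le_of_lt h1))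
        have h3 : (0 : ℝ) < w := h1
        rw [indicator_of_notMem h2, indicator_of_mem h1, zero_add, Pi.one_apply]
        exact mul_le_mul_of_nonneg_right (Real.one_le_exp (by have := hη.1; positivity)) hsq
      · rw [indicator_of_notMem h1, zero_mul, add_zero]
        by_cases h2 : w ∈ Ioo (-N) 0
        · rw [indicator_of_mem h2]
          refine mul_le_mul_of_nonneg_right (Real.exp_le_exp.2 ?_) hsq
          nlinarith [h2.1, hη.1]
        · rw [indicator_of_notMem h2]
          positivity
    have := integral_exp_mul_airyTrans_sq_le hη.1 hη.2 F
    nlinarith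
  have hlim : ζ ≤ 0 := by
    have t1 : Tendsto (fun η : ℝ => Real.exp (-(2 * η * N)) * ζ) (𝓝[>] 0) (𝓝 ζ) := by
      have := ((by fun_prop : Continuous fun η : ℝ => Real.exp (-(2 * η * N)) * ζ).tendsto
        0).mono_left (nhdsWithin_le_nhds (s := Ioi (0 : ℝ)))
      simpa using this
    have t2 : Tendsto (fun η : ℝ => (Real.exp (2 * η ^ 3 / 3 - 2 * η * x) - 1) * ‖F‖ ^ 2)
        (𝓝[>] 0) (𝓝 0) := by
      have := ((by fun_prop : Continuous fun η : ℝ =>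
        (Real.exp (2 * η ^ 3 / 3 - 2 * η * x) - 1) * ‖F‖ ^ 2).tendsto
        0).mono_left (nhdsWithin_le_nhds (s := Ioi (0 : ℝ)))
      simpa using this
    refine le_of_tendsto_of_tendsto t1 t2 ?_
    filter_upwards [Ioo_mem_nhdsGT (by norm_num : (0 : ℝ) < 1 / 2)] with η hη
    exact key η hη
  have hz := (setIntegral_eq_zero_iff_of_nonneg_ae
    (Eventually.of_forall fun w => sq_nonneg _) hζi).1 (le_antisymm hlim hζ0)
  have heq := Measure.eqOn_open_of_ae_eq hz isOpen_Ioo (hcont.pow 2).continuousOn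
    continuousOn_const
  have hmem : w ∈ Ioo (-N) 0 := ⟨by linarith, hw⟩
  have := heq hmem
  simpa using this

lemma airyTrans_eq_zero {x C s : ℝ} (h : Adm x C airyKernel) (hs1 : s ≤ 1)
    {F : L2 x} (hF : s • h.op F = F) : airyTrans 0 x F 0 = 0 ∧ airyTrans 1 x F 0 = 0 := by
  have h0 : EqOn (airyTrans 0 x F) (fun _ => 0) (Iio 0) := fun w hw =>
    airyTrans_eq_zero_of_neg h hs1 hF hw
  have h1 : EqOn (airyTrans 1 x F) (fun _ => 0) (Iio 0) := by
    intro w hw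
    have hd := hasDerivAt_airyTrans 0 F w
    have hz : HasDerivAt (airyTrans 0 x F) 0 w :=
      (hasDerivAt_const w (0 : ℝ)).congr_of_eventuallyEq (by
        filter_upwards [isOpen_Iio.mem_nhds hw] with w' hw'
        exact h0 hw')
    exact hd.unique hz
  have hcl : (0 : ℝ) ∈ closure (Iio (0 : ℝ)) := by simp
  exact ⟨h0.closure (continuous_airyTrans 0 F) continuous_const hcl,
    h1.closure (continuous_airyTrans 1 F) continuous_const hcl⟩

lemma exists_abs_apply_le {x : ℝ} (F : L2 x) :
    ∃ M, 0 ≤ M ∧ ∀ u, x ≤ u → |apply x airyKernel F u| ≤ M * Real.exp (-u) := by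
  obtain ⟨C, hC, hb⟩ := (decay_airyD 0).bound x
  have hi := (integrable_mul_vec (memLp_exp_neg_mul one_pos x) F).norm
  refine ⟨C * C * ∫ v, ‖Real.exp (-(1 * v)) * F v‖ ∂(mu x),
    mul_nonneg (mul_nonneg hC hC) (integral_nonneg fun v => norm_nonneg _), fun u hu => ?_⟩
  have h1 : ‖apply x airyKernel F u‖
      ≤ ∫ v, C * C * Real.exp (-u) * ‖Real.exp (-(1 * v)) * F v‖ ∂(mu x) := by
    refine norm_integral_le_of_norm_le (hi.const_mul _) ?_
    filter_upwards [ae_restrict_mem measurableSet_Ioi] with v hv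
    rw [norm_mul, norm_mul, airyKernel_eq]
    have h2 := abs_kern_le hC hC hb hb hu (le_of_lt hv)
    simp only [Real.norm_eq_abs, Real.abs_exp, one_mul]
    calc _ ≤ C * C * (Real.exp (-u) * Real.exp (-v)) * |F v| := by gcongr
      _ = _ := by ring
  rw [integral_const_mul] at h1
  refine h1.trans (le_of_eq (by ring))

lemma dom_id_mul_apply {x C s : ℝ} (h : Adm x C airyKernel) (F : L2 x) :
    ∃ D, Dom x D fun u => u * (s * apply x airyKernel F u) := by
  obtain ⟨M, hM, hb⟩ := exists_abs_apply_le F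
  refine ⟨|s| * M * (64 * Real.exp (1 + 2 * |x|)),
    measurable_id.mul ((h.dom_apply F).meas.const_mul s), fun u hu => ?_⟩
  have hu' : x ≤ u := le_of_lt hu
  have h1 := one_add_abs_sq_mul_exp_le (c := 1) hu' (by norm_num) (by norm_num)
  rw [one_mul] at h1
  rw [abs_mul, abs_mul]
  have h2 : |u| ≤ (1 + |u|) ^ 2 := by nlinarith [abs_nonneg u]
  calc |u| * (|s| * |apply x airyKernel F u|)
      ≤ (1 + |u|) ^ 2 * (|s| * (M * Real.exp (-u))) := by gcongr; exact hb u hu'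
    _ = |s| * M * ((1 + |u|) ^ 2 * Real.exp (-u)) := by ring
    _ ≤ |s| * M * (64 * Real.exp (1 + 2 * |x|) * wt u) := by gcongr
    _ = _ := by ring

/-- The eigenspaces of the Airy operator are invariant under multiplication by the variable. -/
lemma exists_id_mul_eigenvector {x C s : ℝ} (h : Adm x C airyKernel) (hs1 : s ≤ 1)
    {F : L2 x} (hF : s • h.op F = F) :
    ∃ G : L2 x, s • h.op G = G ∧ ∀ᵐ u ∂(mu x), G u = u * F u := by
  obtain ⟨D, hD⟩ := dom_id_mul_apply (s := s) h F
  have hFae : ∀ᵐ u ∂(mu x), F u = s * apply x airyKernel F u := by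
    have h1 := Lp.coeFn_smul s (h.op F)
    rw [hF] at h1
    have h2 := coeFn_vec (h.dom_apply F).memLp
    rw [← h.op_apply] at h2
    filter_upwards [h1, h2] with u hu1 hu2
    rw [hu1, Pi.smul_apply, hu2, smul_eq_mul]
  set G := vec x fun u => u * (s * apply x airyKernel F u) with hG
  have hGae : ∀ᵐ u ∂(mu x), G u = u * F u := by
    filter_upwards [coeFn_vec hD.memLp, hFae] with u hu1 hu2
    rw [hu1, hu2]
  refine ⟨G, ?_, hGae⟩
  obtain ⟨z0, z1⟩ := airyTrans_eq_zero h hs1 hF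
  simp only [airyTrans, zero_add] at z0 z1
  -- The commutator of the operator with multiplication by the variable has the kernel A⊗A' - A'⊗A.
  -- It annihilates F, because the transform and its derivative at w = 0 are the inner products of F
  -- with A and A'.
  have hap : ∀ u ∈ Ioi x, apply x airyKernel G u = u * apply x airyKernel F u := by
    intro u hu
    have i0 : Integrable (fun v => airyKernel u v * F v) (mu x) :=
      integrable_mul_vec (h.dom_left hu).memLp F
    obtain ⟨D0, -, d0⟩ := (decay_airyD 0).exists_dom x
    obtain ⟨D1, -, d1⟩ := (decay_airyD 1).exists_dom x
    have i1 := integrable_mul_vec d0.memLp F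
    have i2 := integrable_mul_vec d1.memLp F
    have e : apply x airyKernel G u = ∫ v, (u * (airyKernel u v * F v)
        - (airyD 0 u * (airyD 1 v * F v) - airyD 1 u * (airyD 0 v * F v))) ∂(mu x) := by
      refine integral_congr_ae ?_
      filter_upwards [hGae] with v hv
      rw [hv]
      linear_combination (-F v) * sub_mul_airyKernel u v
    have e1 := integral_sub (i0.const_mul u) ((i2.const_mul (airyD 0 u)).sub
      (i1.const_mul (airyD 1 u)))
    have e2 := integral_sub (i2.const_mul (airyD 0 u)) (i1.const_mul (airyD 1 u))
    simp only [Pi.sub_apply] at e1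
    rw [e, e1, e2, integral_const_mul, integral_const_mul, integral_const_mul, z0, z1, apply]
    ring
  refine Lp.ext ?_
  have h1 := Lp.coeFn_smul s (h.op G)
  have h2 := coeFn_vec (h.dom_apply G).memLp
  rw [← h.op_apply] at h2
  filter_upwards [h1, h2, coeFn_vec hD.memLp, ae_restrict_mem measurableSet_Ioi]
    with u hu1 hu2 hu3 hu4
  rw [hu1, Pi.smul_apply, hu2, hu3, hap u hu4, smul_eq_mul]
  ring

lemma continuous_airyKernel : Continuous (Function.uncurry airyKernel) := by
  rw [airyKernel_eq]
  exact (decay_airyD 0).continuous_kern (decay_airyD 0)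

/-- All functions uⁿF lie in the eigenspace for 1/s, which is finite dimensional by compactness.
Some nonzero polynomial p therefore satisfies pF = 0 almost everywhere, and the roots of p form a
null set. -/
theorem airyKernel_injective {x C s : ℝ} (h : Adm x C airyKernel) (hs0 : 0 ≤ s) (hs1 : s ≤ 1)
    {F : L2 x} (hF : s • h.op F = F) : F = 0 := by
  rcases hs0.eq_or_lt with rfl | hs
  · rw [← hF, zero_smul]
  have hex : ∀ n : ℕ, ∃ G : L2 x, s • h.op G = G ∧ ∀ᵐ u ∂(mu x), G u = u ^ n * F u := by
    intro n
    induction n with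
    | zero => exact ⟨F, hF, Eventually.of_forall fun u => by simp⟩
    | succ n ih =>
      obtain ⟨G, hG, hGae⟩ := ih
      obtain ⟨G', hG', hGae'⟩ := exists_id_mul_eigenvector h hs1 hG
      refine ⟨G', hG', ?_⟩
      filter_upwards [hGae, hGae'] with u hu hu'
      rw [hu', hu, pow_succ]
      ring
  choose G hG hGae using hex
  set V := Module.End.eigenspace h.op.toLinearMap s⁻¹ with hV
  have hmem : ∀ n, G n ∈ V := by
    intro n
    rw [hV, Module.End.mem_eigenspace_iff]
    conv_rhs => rw [← hG n]
    rw [inv_smul_smul₀ hs.ne']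
    rfl
  have : FiniteDimensional ℝ V := ContinuousLinearMap.finite_dimensional_eigenspace
    (h.isCompactOperator continuous_airyKernel.continuousOn) s⁻¹ (inv_ne_zero hs.ne')
  have hdep : ¬ LinearIndependent ℝ (fun n : ℕ => (⟨G n, hmem n⟩ : V)) := fun hli => by
    have := hli.finite_of_isNoetherian
    exact not_finite ℕ
  obtain ⟨t, g, hsum, i, hi, hgi⟩ := not_linearIndependent_iff.1 hdep
  have hsum' : ∑ n ∈ t, g n • G n = 0 := by
    have := congrArg (Submodule.subtype V) hsum
    simpa using this
  set p : Polynomial ℝ := ∑ n ∈ t, Polynomial.monomial n (g n) with hp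
  have hp0 : p ≠ 0 := by
    intro h0
    have : p.coeff i = g i := by
      rw [hp, Polynomial.finsetSum_coeff]
      simp [Polynomial.coeff_monomial, hi]
    rw [h0, Polynomial.coeff_zero] at this
    exact hgi this.symm
  have hpF : ∀ᵐ u ∂(mu x), p.eval u * F u = 0 := by
    have h1 : ∀ᵐ u ∂(mu x), (∑ n ∈ t, g n • G n : L2 x) u = ∑ n ∈ t, g n * G n u := by
      clear hsum hi hsum' hp hp0
      induction t using Finset.induction_on with
      | empty =>
        filter_upwards [Lp.coeFn_zero ℝ 2 (mu x)] with u hu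
        rw [Finset.sum_empty, Finset.sum_empty, hu, Pi.zero_apply]
      | insert n t hn ih =>
        rw [Finset.sum_insert hn]
        filter_upwards [ih, Lp.coeFn_smul (g n) (G n), Lp.coeFn_add (g n • G n)
          (∑ n ∈ t, g n • G n)] with u hu1 hu2 hu3
        rw [Finset.sum_insert hn, hu3, Pi.add_apply, hu1, hu2, Pi.smul_apply, smul_eq_mul]
    rw [hsum'] at h1
    filter_upwards [h1, Lp.coeFn_zero ℝ 2 (mu x), ae_all_iff.2 hGae] with u hu1 hu2 hu3
    rw [hu2] at hu1
    rw [hp, Polynomial.eval_finsetSum, Finset.sum_mul]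
    simp only [Polynomial.eval_monomial]
    rw [Pi.zero_apply] at hu1
    rw [hu1]
    refine Finset.sum_congr rfl fun n _ => ?_
    rw [hu3 n]
    ring
  have hroot : ∀ᵐ u ∂(mu x), p.eval u ≠ 0 := by
    refine ae_restrict_of_ae ?_
    rw [ae_iff]
    have := (Polynomial.finite_setOfPred_isRoot hp0).measure_zero volume
    simpa [Polynomial.IsRoot] using this
  refine Lp.ext ?_
  filter_upwards [hpF, hroot, Lp.coeFn_zero ℝ 2 (mu x)] with u hu1 hu2 hu3
  rw [hu3]
  exact (mul_eq_zero.1 hu1).resolve_left hu2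

end RAiry
end

noncomputable section

namespace RAiry

open Filter Topology

/-! ### Finite rank perturbations of the Airy kernel -/

lemma exists_adm_airyKernel (x : ℝ) : ∃ C, 0 ≤ C ∧ Adm x C airyKernel := by
  rw [airyKernel_eq]
  exact (decay_airyD 0).exists_adm_kern (decay_airyD 0) x

/-- A constant with which the Airy kernel is admissible. -/
def admConst (x : ℝ) : ℝ := (exists_adm_airyKernel x).choose

lemma adm_airyKernel (x : ℝ) : Adm x (admConst x) airyKernel :=
  (exists_adm_airyKernel x).choose_spec.2

/-- The Airy operator on `L²(x, ∞)`. -/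
def airyOp (x : ℝ) : L2 x →L[ℝ] L2 x := (adm_airyKernel x).op

lemma isUnit_one_sub_airyOp (x : ℝ) : IsUnit (1 - airyOp x) :=
  (adm_airyKernel x).isUnit_one_sub continuous_airyKernel.continuousOn fun F hF =>
    airyKernel_injective (adm_airyKernel x) zero_le_one le_rfl (by rw [one_smul]; exact hF)

lemma fredholmDet_airyKernel_pos (x : ℝ) : 0 < fredholmDet airyKernel x :=
  fredholmDet_pos (adm_airyKernel x) continuous_airyKernel.continuousOn fun _ hs _ hF =>
    airyKernel_injective (adm_airyKernel x) hs.1 hs.2 hF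

/-- The resolvent `(I - K)⁻¹` of the Airy operator. -/
def airyRes (x : ℝ) : L2 x →L[ℝ] L2 x := Ring.inverse (1 - airyOp x)

/-- The class of the `j`-th derivative of the Airy function in `L²(x, ∞)`. -/
def airyVec (x : ℝ) (j : ℕ) : L2 x := vec x (airyD j)

/-- The matrix elements `⟨A⁽ʲ⁾, (I - K)⁻¹ A⁽ᵏ⁾⟩` on `L²(x, ∞)`. -/
def resMat (x : ℝ) : Matrix (Fin 3) (Fin 3) ℝ :=
  Matrix.of fun j k => inner ℝ (airyVec x j) (airyRes x (airyVec x k))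

lemma inner_airyRes (x : ℝ) (F G : L2 x) :
    inner ℝ F (airyRes x G) = inner ℝ (airyRes x F) G := by
  have h : ∀ F, F = airyRes x F - airyOp x (airyRes x F) := fun F =>
    eq_sub_of_add_eq (inverse_apply (isUnit_one_sub_airyOp x) F).symm
  conv_lhs => rw [h F]
  conv_rhs => rw [h G]
  rw [inner_sub_left, inner_sub_right]
  congr 1
  exact (adm_airyKernel x).inner_op airyKernel_comm _ _

lemma resMat_comm (x : ℝ) (j k : Fin 3) : resMat x j k = resMat x k j := by
  simp only [resMat, Matrix.of_apply]
  rw [inner_airyRes, real_inner_comm]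

/-- The kernel `∑ c_{jk} A⁽ʲ⁾(u) A⁽ᵏ⁾(v)`. -/
def prodKernel (c : Matrix (Fin 3) (Fin 3) ℝ) (u v : ℝ) : ℝ :=
  ∑ j : Fin 3, ∑ k : Fin 3, c j k * (airyD j u * airyD k v)

lemma exists_dom_airyD (x : ℝ) : ∃ B, 0 ≤ B ∧ ∀ i : Fin 3, Dom x B (airyD i) := by
  obtain ⟨M, hM, hb⟩ := exists_airyD_bound 2 x
  have hx := wt_pos x
  refine ⟨M * wt x, by positivity, fun i => ⟨(decay_airyD i).cont.measurable, fun u hu =>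
    (hb i (by omega) u (le_of_lt hu)).trans ?_⟩⟩
  rw [mul_assoc]
  exact mul_le_mul_of_nonneg_left (exp_neg_le_wt (le_of_lt hu)) hM

lemma measurable_prodKernel (c : Matrix (Fin 3) (Fin 3) ℝ) :
    Measurable (Function.uncurry (prodKernel c)) := by
  have h : ∀ i : ℕ, Continuous (airyD i) := fun i => (decay_airyD i).cont
  refine Continuous.measurable ?_
  simp only [Function.uncurry_def, prodKernel]
  fun_prop

lemma exists_adm_prodKernel (x : ℝ) : ∃ B, 0 ≤ B ∧ ∀ (c : Matrix (Fin 3) (Fin 3) ℝ) (M : ℝ),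
    (∀ j k, |c j k| ≤ M) → Adm x (M * B) (prodKernel c) := by
  obtain ⟨B, hB, hd⟩ := exists_dom_airyD x
  refine ⟨9 * B ^ 2, by positivity, fun c M hc => ⟨measurable_prodKernel c, fun u hu v hv => ?_⟩⟩
  have hM : 0 ≤ M := (abs_nonneg _).trans (hc 0 0)
  have hu0 := wt_pos u
  have hv0 := wt_pos v
  have h1 : ∀ j k : Fin 3, |c j k * (airyD j u * airyD k v)| ≤ M * B ^ 2 * (wt u * wt v) := by
    intro j k
    rw [abs_mul, abs_mul]
    calc |c j k| * (|airyD j u| * |airyD k v|) ≤ M * ((B * wt u) * (B * wt v)) := by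
          gcongr
          · exact hc j k
          · exact (hd j).bound u hu
          · exact (hd k).bound v hv
      _ = _ := by ring
  calc |prodKernel c u v| ≤ ∑ j : Fin 3, ∑ k : Fin 3, |c j k * (airyD j u * airyD k v)| :=
        (Finset.abs_sum_le_sum_abs _ _).trans
          (Finset.sum_le_sum fun j _ => Finset.abs_sum_le_sum_abs _ _)
    _ ≤ ∑ j : Fin 3, ∑ k : Fin 3, M * B ^ 2 * (wt u * wt v) :=
        Finset.sum_le_sum fun j _ => Finset.sum_le_sum fun k _ => h1 j k
    _ = _ := by simp; ring

lemma fredholmDet_add_prodKernel (x : ℝ) (c : Matrix (Fin 3) (Fin 3) ℝ) :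
    fredholmDet (fun u v => airyKernel u v + prodKernel c u v) x
      = fredholmDet airyKernel x * (1 - resMat x * c).det := by
  obtain ⟨B, hB, hd⟩ := exists_dom_airyD x
  set f : Fin 3 → ℝ → ℝ := fun k u => ∑ j : Fin 3, c j k * airyD j u with hf
  -- The summand 1 lets the same constant M B dominate both the combinations `f k` and the functions
  -- A⁽ᵏ⁾ themselves.
  set M : ℝ := 1 + ∑ k, ∑ j, |c j k| with hM
  have hA : ∀ i : ℕ, Continuous (airyD i) := fun i => (decay_airyD i).cont
  have hfc : ∀ k, Continuous (f k) := fun k => by simp only [hf]; fun_prop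
  have hS : ∀ k, ∑ j, |c j k| ≤ M - 1 := fun k => by
    rw [hM, add_sub_cancel_left]
    exact Finset.single_le_sum (f := fun k => ∑ j, |c j k|)
      (fun k _ => Finset.sum_nonneg fun j _ => abs_nonneg _) (Finset.mem_univ k)
  have hM1 : 1 ≤ M := by
    have := (Finset.sum_nonneg fun j _ => abs_nonneg (c j 0)).trans (hS 0)
    linarith
  have hfd : ∀ k, Dom x (M * B) (f k) := fun k => ⟨(hfc k).measurable, fun u hu => by
    have hu0 := wt_pos u
    calc |f k u| ≤ ∑ j, |c j k| * (B * wt u) := by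
          refine (Finset.abs_sum_le_sum_abs _ _).trans (Finset.sum_le_sum fun j _ => ?_)
          rw [abs_mul]
          gcongr
          exact (hd j).bound u hu
      _ = (∑ j, |c j k|) * (B * wt u) := by rw [Finset.sum_mul]
      _ ≤ M * (B * wt u) := by
          gcongr
          linarith [hS k]
      _ = _ := by ring⟩
  have hgd : ∀ k : Fin 3, Dom x (M * B) (airyD k) := fun k => ⟨(hd k).meas, fun u hu => by
    have hu0 := wt_pos u
    refine ((hd k).bound u hu).trans ?_
    rw [mul_assoc]
    exact le_mul_of_one_le_left (by positivity) hM1⟩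
  have h := fredholmDet_add_degenerate (adm_airyKernel x) continuous_airyKernel.continuousOn
    (isUnit_one_sub_airyOp x) (f := f) (g := fun k : Fin 3 => airyD k)
    (fun k => (hfc k).continuousOn) hfd (fun k => (hA k).continuousOn) hgd
  have e1 : ∀ u v, prodKernel c u v = ∑ k : Fin 3, f k u * airyD k v := by
    intro u v
    rw [prodKernel, Finset.sum_comm]
    refine Finset.sum_congr rfl fun k _ => ?_
    rw [hf, Finset.sum_mul]
    refine Finset.sum_congr rfl fun j _ => by ring
  simp only [e1]
  rw [h]
  congr 3
  ext i k
  have hv : vec x (f k) = ∑ j : Fin 3, c j k • airyVec x j := by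
    symm
    refine eq_vec (hfd k).memLp ?_
    rw [Fin.sum_univ_three]
    filter_upwards [Lp.coeFn_add (c 0 k • airyVec x 0 + c 1 k • airyVec x 1) (c 2 k • airyVec x 2),
      Lp.coeFn_add (c 0 k • airyVec x 0) (c 1 k • airyVec x 1),
      Lp.coeFn_smul (c 0 k) (airyVec x 0), Lp.coeFn_smul (c 1 k) (airyVec x 1),
      Lp.coeFn_smul (c 2 k) (airyVec x 2), coeFn_vec (hd 0).memLp, coeFn_vec (hd 1).memLp,
      coeFn_vec (hd 2).memLp] with u h1 h2 h3 h4 h5 h6 h7 h8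
    have h6' : airyVec x 0 u = airyD 0 u := h6
    have h7' : airyVec x 1 u = airyD 1 u := h7
    have h8' : airyVec x 2 u = airyD 2 u := h8
    simp only [Fin.coe_ofNat_eq_mod, Nat.zero_mod, Nat.one_mod, Nat.reduceMod] at h1 h2 ⊢
    rw [h1, Pi.add_apply, h2, Pi.add_apply, h3, h4, h5, Pi.smul_apply, Pi.smul_apply,
      Pi.smul_apply, h6', h7', h8', hf]
    simp [Fin.sum_univ_three]
  rw [Matrix.of_apply, hv, map_sum, inner_sum, Matrix.mul_apply]
  refine Finset.sum_congr rfl fun j _ => ?_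
  rw [map_smul, real_inner_smul_right, mul_comm]
  rfl

/-- The Fredholm determinant of a small perturbation of a finite rank perturbation of the Airy
kernel. -/
lemma exists_fredholmDet_perturbation (x : ℝ) : ∃ L, 0 ≤ L ∧
    ∀ (c : Matrix (Fin 3) (Fin 3) ℝ) (k : ℝ → ℝ → ℝ) (δ : ℝ), (∀ i j, |c i j| ≤ 2) →
      Measurable (Function.uncurry k) → 0 ≤ δ → δ ≤ 1 →
      (∀ u v, x ≤ u → x ≤ v → |k u v - (airyKernel u v + prodKernel c u v)| ≤ δ * (wt u * wt v)) →
      |fredholmDet k x - fredholmDet airyKernel x * (1 - resMat x * c).det| ≤ L * δ := by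
  obtain ⟨B, hB, hadm⟩ := exists_adm_prodKernel x
  have h0 := adm_airyKernel x
  have hC := h0.nonneg
  -- The constant covers the Airy kernel, a finite rank part with coefficients at most 2 and an
  -- error δ ≤ 1. It is also at least 1, as the Lipschitz bound demands.
  set C := admConst x + 2 * B + 1 with hCdef
  refine ⟨|lipConst x C|, abs_nonneg _, fun c k δ hc hk hδ hδ1 hb => ?_⟩
  have h1 := (h0.add (hadm c 2 hc))
  have h2 : Adm x C k := by
    refine ⟨hk, fun u hu v hv => ?_⟩
    have h3 := hb u v (le_of_lt hu) (le_of_lt hv)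
    have h4 := h1.bound u hu v hv
    have h5 : k u v = (k u v - (airyKernel u v + prodKernel c u v))
        + (airyKernel u v + prodKernel c u v) := by ring
    rw [h5]
    have hw : 0 ≤ wt u * wt v := mul_nonneg (wt_pos u).le (wt_pos v).le
    refine (abs_add_le _ _).trans ((add_le_add h3 h4).trans ?_)
    rw [← add_mul]
    exact mul_le_mul_of_nonneg_right (by rw [hCdef]; linarith) hw
  have h3 := h2.abs_fredholmDet_sub_le (h1.mono (by rw [hCdef]; linarith))
    (by rw [hCdef]; linarith) hδ fun u hu v hv => hb u v (le_of_lt hu) (le_of_lt hv)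
  rw [fredholmDet_add_prodKernel] at h3
  exact h3.trans (mul_le_mul_of_nonneg_right (le_abs_self _) hδ)

/-! ### Derivatives of the Fredholm determinant -/

lemma hasDerivAt_of_abs_sub_le {f g : ℝ → ℝ} {x p M δ : ℝ} (hδ : 0 < δ)
    (h : ∀ e, |e| ≤ δ → |f (x + e) - g e| ≤ M * e ^ 2) (hg : HasDerivAt g p 0) :
    HasDerivAt f p x := by
  have h0 : f x = g 0 := by
    have := h 0 (by simpa using hδ.le)
    simp only [add_zero, ne_eq, OfNat.ofNat_ne_zero, not_false_eq_true, zero_pow, mul_zero] at this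
    exact sub_eq_zero.1 (abs_nonpos_iff.1 this)
  rw [hasDerivAt_iff_isLittleO_nhds_zero] at hg ⊢
  simp only [zero_add] at hg
  have h1 : (fun e => f (x + e) - g e) =o[𝓝 0] fun e : ℝ => e := by
    have h2 : (fun e => f (x + e) - g e) =O[𝓝 0] fun e : ℝ => e ^ 2 := by
      refine IsBigO.of_bound M ?_
      filter_upwards [Metric.closedBall_mem_nhds (0 : ℝ) hδ] with e he
      rw [Metric.mem_closedBall, dist_zero_right] at he
      rw [Real.norm_eq_abs, Real.norm_of_nonneg (sq_nonneg e)]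
      exact h e he
    exact h2.trans_isLittleO (by simpa using isLittleO_pow_id (n := 2) one_lt_two)
  refine (hg.add h1).congr_left fun e => ?_
  rw [h0]
  ring

lemma continuousAt_of_abs_sub_le {f : ℝ → ℝ} {x c M δ : ℝ} (hδ : 0 < δ)
    (h : ∀ e, |e| ≤ δ → |f (x + e) - c| ≤ M * |e|) : ContinuousAt f x := by
  have h0 : f x = c := by
    have := h 0 (by simpa using hδ.le)
    simp only [add_zero, abs_zero, mul_zero] at this
    exact sub_eq_zero.1 (abs_nonpos_iff.1 this)
  rw [ContinuousAt, h0, ← tendsto_sub_nhds_zero_iff]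
  have ht : Tendsto (fun e => f (x + e) - c) (𝓝 0) (𝓝 0) := by
    refine squeeze_zero_norm' (a := fun e => M * |e|) ?_ ?_
    · filter_upwards [Metric.closedBall_mem_nhds (0 : ℝ) hδ] with e he
      rw [Metric.mem_closedBall, dist_zero_right] at he
      exact h e he
    · have := (by fun_prop : Continuous fun e : ℝ => M * |e|).tendsto 0
      simpa using this
  have h2 : Tendsto (fun y => y - x) (𝓝 x) (𝓝 0) := by
    have := (continuous_sub_right x).tendsto x
    rwa [sub_self] at this
  have h3 := ht.comp h2
  simpa [Function.comp_def] using h3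

end RAiry
end

noncomputable section

namespace RAiry

open Filter Topology

/-! ### Moving the endpoint of the interval -/

lemma prodKernel_add_smul (c c' : Matrix (Fin 3) (Fin 3) ℝ) (e u v : ℝ) :
    prodKernel (c + e • c') u v = prodKernel c u v + e * prodKernel c' u v := by
  simp only [prodKernel, Matrix.add_apply, Matrix.smul_apply, smul_eq_mul, add_mul,
    Finset.sum_add_distrib, Finset.mul_sum, mul_assoc]

/-- The Fredholm determinant of a finite rank perturbation of the Airy kernel. -/
def perturbedDet (c : Matrix (Fin 3) (Fin 3) ℝ) (x : ℝ) : ℝ :=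
  fredholmDet (fun u v => airyKernel u v + prodKernel c u v) x

lemma perturbedDet_eq (c : Matrix (Fin 3) (Fin 3) ℝ) (x : ℝ) :
    perturbedDet c x = fredholmDet airyKernel x * (1 - resMat x * c).det :=
  fredholmDet_add_prodKernel x c

lemma measurable_translate (c : Matrix (Fin 3) (Fin 3) ℝ) (e : ℝ) : Measurable
    (Function.uncurry fun u v => airyKernel (u + e) (v + e) + prodKernel c (u + e) (v + e)) :=
  (continuous_airyKernel.measurable.add (measurable_prodKernel c)).comp
    (f := fun p : ℝ × ℝ => (p.1 + e, p.2 + e)) (by fun_prop)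

/-- Changing the endpoint by e is the same as translating the kernel by e. To first order this adds
e c₁ to the coefficients: the derivative of the finite rank part, less A⊗A from the Airy kernel. The
determinant is then det(1 - U(c₀ + e c₁)) times that of the Airy kernel, up to O(e²). -/
lemma hasDerivAt_perturbedDet {c₀ c₁ : Matrix (Fin 3) (Fin 3) ℝ} {x p : ℝ}
    (h₀ : ∀ i j, |c₀ i j| ≤ 1) (h₁ : ∀ i j, |c₁ i j| ≤ 4)
    (h : ∃ M, 0 ≤ M ∧ ∀ e, |e| ≤ 1 → ∀ u v, x ≤ u → x ≤ v →
      |prodKernel c₀ (u + e) (v + e) - prodKernel c₀ u v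
        - e * (prodKernel c₁ u v + airyD 0 u * airyD 0 v)|
        ≤ M * e ^ 2 * (Real.exp (-u) * Real.exp (-v)))
    (hp : HasDerivAt (fun e : ℝ => (1 - resMat x * (c₀ + e • c₁)).det) p 0) :
    HasDerivAt (perturbedDet c₀) (fredholmDet airyKernel x * p) x := by
  obtain ⟨M, hM, hb⟩ := h
  obtain ⟨M', hM', hb'⟩ := exists_airyKernel_translate_bound x
  obtain ⟨L, hL, hpert⟩ := exists_fredholmDet_perturbation x
  set m := (M + M') * wt x ^ 2 with hm
  have hx := wt_pos x
  have hm0 : 0 ≤ m := by positivity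
  -- The first bound keeps the coefficients of c₀ + e c₁ at most 1 + 4/4 = 2, the second keeps the
  -- error m e² at most 1.
  set δ : ℝ := min (1 / 4) (1 / (1 + m)) with hδ
  have hδ0 : 0 < δ := lt_min (by norm_num) (by positivity)
  refine hasDerivAt_of_abs_sub_le (M := L * m) hδ0 (fun e he => ?_) (hp.const_mul _)
  have he1 : |e| ≤ 1 / 4 := he.trans (min_le_left _ _)
  have he2 : |e| ≤ 1 / (1 + m) := he.trans (min_le_right _ _)
  have hsq : m * e ^ 2 ≤ 1 := by
    rw [le_div_iff₀ (by positivity)] at he2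
    rw [← sq_abs]
    nlinarith [abs_nonneg e]
  rw [perturbedDet, fredholmDet_translate]
  refine (hpert (c₀ + e • c₁) _ (m * e ^ 2) (fun i j => ?_) (measurable_translate c₀ e)
    (by positivity) hsq fun u v hu hv => ?_).trans (le_of_eq (by ring))
  · rw [Matrix.add_apply, Matrix.smul_apply, smul_eq_mul]
    refine (abs_add_le _ _).trans ?_
    rw [abs_mul]
    have := mul_le_mul he1 (h₁ i j) (abs_nonneg _) (by norm_num)
    linarith [h₀ i j]
  · rw [prodKernel_add_smul]
    have b1 := hb e (by linarith) u v hu hv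
    have b2 := hb' e (by linarith) u v hu hv
    have b3 := exp_neg_mul_le_wt hu hv
    have e1 : airyKernel (u + e) (v + e) + prodKernel c₀ (u + e) (v + e)
        - (airyKernel u v + (prodKernel c₀ u v + e * prodKernel c₁ u v))
        = (prodKernel c₀ (u + e) (v + e) - prodKernel c₀ u v
          - e * (prodKernel c₁ u v + airyD 0 u * airyD 0 v))
        + (airyKernel (u + e) (v + e) - airyKernel u v + e * (airyD 0 u * airyD 0 v)) := by ring
    rw [e1]
    calc _ ≤ _ := (abs_add_le _ _).trans (add_le_add b1 b2)
      _ = (M + M') * e ^ 2 * (Real.exp (-u) * Real.exp (-v)) := by ring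
      _ ≤ (M + M') * e ^ 2 * (wt x ^ 2 * (wt u * wt v)) := by gcongr
      _ = _ := by rw [hm]; ring

/-- This serves U₀₂ and U₁₁, which occur in the third derivative of Q₀; there continuity suffices.
Differentiating A''⊗A would lead to A''' and out of the 3×3 frame. -/
lemma continuous_perturbedDet {c : Matrix (Fin 3) (Fin 3) ℝ} (hc : ∀ i j, |c i j| ≤ 1)
    (h : ∀ x, ∃ M, 0 ≤ M ∧ ∀ e, |e| ≤ 1 → ∀ u v, x ≤ u → x ≤ v →
      |prodKernel c (u + e) (v + e) - prodKernel c u v|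
        ≤ M * |e| * (Real.exp (-u) * Real.exp (-v))) : Continuous (perturbedDet c) := by
  refine continuous_iff_continuousAt.2 fun x => ?_
  obtain ⟨M, hM, hb⟩ := h x
  obtain ⟨M', hM', hb'⟩ := exists_airyKernel_translate_bound x
  obtain ⟨N, hN, hA⟩ := (decay_airyD 0).bound x
  obtain ⟨L, hL, hpert⟩ := exists_fredholmDet_perturbation x
  set m := (M + M' + N * N) * wt x ^ 2 with hm
  have hx := wt_pos x
  have hm0 : 0 ≤ m := by positivity
  set δ : ℝ := min 1 (1 / (1 + m)) with hδ
  have hδ0 : 0 < δ := lt_min (by norm_num) (by positivity)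
  refine continuousAt_of_abs_sub_le (M := L * m)
    (c := fredholmDet airyKernel x * (1 - resMat x * c).det) hδ0 (fun e he => ?_)
  have he1 : |e| ≤ 1 := he.trans (min_le_left _ _)
  have he2 : |e| ≤ 1 / (1 + m) := he.trans (min_le_right _ _)
  have hsq : m * |e| ≤ 1 := by
    rw [le_div_iff₀ (by positivity)] at he2
    nlinarith [abs_nonneg e]
  rw [perturbedDet, fredholmDet_translate]
  refine (hpert c _ (m * |e|) (fun i j => (hc i j).trans one_le_two) (measurable_translate c e)
    (by positivity) hsq fun u v hu hv => ?_).trans (le_of_eq (by ring))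
  have b1 := hb e he1 u v hu hv
  have b2 := hb' e he1 u v hu hv
  have b3 := exp_neg_mul_le_wt hu hv
  have b4 : |e * (airyD 0 u * airyD 0 v)| ≤ |e| * (N * N * (Real.exp (-u) * Real.exp (-v))) := by
    rw [abs_mul, abs_mul]
    refine mul_le_mul_of_nonneg_left ?_ (abs_nonneg _)
    calc _ ≤ (N * Real.exp (-u)) * (N * Real.exp (-v)) :=
          mul_le_mul (hA u hu) (hA v hv) (abs_nonneg _) (by positivity)
      _ = _ := by ring
  have b5 : M' * e ^ 2 * (Real.exp (-u) * Real.exp (-v))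
      ≤ M' * |e| * (Real.exp (-u) * Real.exp (-v)) := by
    have : e ^ 2 ≤ |e| := by rw [← sq_abs]; nlinarith [abs_nonneg e]
    gcongr
  have e1 : airyKernel (u + e) (v + e) + prodKernel c (u + e) (v + e)
      - (airyKernel u v + prodKernel c u v)
      = (prodKernel c (u + e) (v + e) - prodKernel c u v)
      + ((airyKernel (u + e) (v + e) - airyKernel u v + e * (airyD 0 u * airyD 0 v))
        - e * (airyD 0 u * airyD 0 v)) := by ring
  rw [e1]
  calc _ ≤ M * |e| * (Real.exp (-u) * Real.exp (-v))
        + (M' * |e| * (Real.exp (-u) * Real.exp (-v))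
          + |e| * (N * N * (Real.exp (-u) * Real.exp (-v)))) := by
        refine (abs_add_le _ _).trans (add_le_add b1 ((abs_sub _ _).trans (add_le_add ?_ b4)))
        exact b2.trans b5
    _ = (M + M' + N * N) * |e| * (Real.exp (-u) * Real.exp (-v)) := by ring
    _ ≤ (M + M' + N * N) * |e| * (wt x ^ 2 * (wt u * wt v)) := by gcongr
    _ = _ := by rw [hm]; ring

lemma exists_translate_bound_linear (i j : ℕ) (x : ℝ) : ∃ M, 0 ≤ M ∧ ∀ e, |e| ≤ 1 → ∀ u v,
    x ≤ u → x ≤ v → |airyD i (u + e) * airyD j (v + e) - airyD i u * airyD j v|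
      ≤ M * |e| * (Real.exp (-u) * Real.exp (-v)) := by
  obtain ⟨M, hM, hb⟩ := exists_translate_bound i j x
  obtain ⟨N, hN, hA⟩ := exists_airyD_bound (i + j + 1) x
  refine ⟨M + 2 * N ^ 2, by positivity, fun e he u v hu hv => ?_⟩
  have hp : ∀ k ≤ i + j + 1, ∀ l ≤ i + j + 1,
      |airyD k u * airyD l v| ≤ N ^ 2 * (Real.exp (-u) * Real.exp (-v)) := by
    intro k hk l hl
    rw [abs_mul]
    calc _ ≤ (N * Real.exp (-u)) * (N * Real.exp (-v)) :=
          mul_le_mul (hA k hk u hu) (hA l hl v hv) (abs_nonneg _) (by positivity)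
      _ = _ := by ring
  have b1 := hb e he u v hu hv
  have b2 : |e * (airyD (i + 1) u * airyD j v + airyD i u * airyD (j + 1) v)|
      ≤ |e| * (2 * N ^ 2 * (Real.exp (-u) * Real.exp (-v))) := by
    rw [abs_mul]
    refine mul_le_mul_of_nonneg_left ((abs_add_le _ _).trans ?_) (abs_nonneg _)
    linarith [hp (i + 1) (by omega) j (by omega), hp i (by omega) (j + 1) (by omega)]
  have b3 : M * e ^ 2 * (Real.exp (-u) * Real.exp (-v))
      ≤ M * |e| * (Real.exp (-u) * Real.exp (-v)) := by
    have : e ^ 2 ≤ |e| := by rw [← sq_abs]; nlinarith [abs_nonneg e]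
    gcongr
  have e1 : airyD i (u + e) * airyD j (v + e) - airyD i u * airyD j v
      = (airyD i (u + e) * airyD j (v + e) - airyD i u * airyD j v
        - e * (airyD (i + 1) u * airyD j v + airyD i u * airyD (j + 1) v))
      + e * (airyD (i + 1) u * airyD j v + airyD i u * airyD (j + 1) v) := by ring
  rw [e1]
  calc _ ≤ _ := (abs_add_le _ _).trans (add_le_add (b1.trans b3) b2)
    _ = _ := by ring

/-! ### The matrix elements of the resolvent as functions of the endpoint -/

/-- The Fredholm determinant of the Airy kernel. -/
def airyDet (x : ℝ) : ℝ := fredholmDet airyKernel x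

lemma airyDet_pos (x : ℝ) : 0 < airyDet x := fredholmDet_airyKernel_pos x

lemma hasDerivAt_quadratic (a b c : ℝ) :
    HasDerivAt (fun e : ℝ => a + b * e + c * e ^ 2) b 0 := by
  have h := (((hasDerivAt_id (0 : ℝ)).const_mul b).const_add a).add
    ((hasDerivAt_pow 2 (0 : ℝ)).const_mul c)
  exact h.congr_deriv (by simp)

lemma hasDerivAt_airyDet (x : ℝ) : HasDerivAt airyDet (airyDet x * resMat x 0 0) x := by
  have h := hasDerivAt_perturbedDet (c₀ := 0) (c₁ := !![-1, 0, 0; 0, 0, 0; 0, 0, 0]) (x := x)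
    (p := resMat x 0 0) (by simp)
    (by intro i j; fin_cases i <;> fin_cases j <;> simp)
    ⟨0, le_rfl, fun e _ u v _ _ => by simp [prodKernel, Fin.sum_univ_three]⟩
    (by
      refine (hasDerivAt_quadratic 1 (resMat x 0 0) 0).congr_of_eventuallyEq
        (Eventually.of_forall fun e => ?_)
      simp [Matrix.det_fin_three, Matrix.mul_apply, Fin.sum_univ_three])
  have e : perturbedDet 0 = airyDet := by
    funext y
    simp [perturbedDet, airyDet, prodKernel]
  rwa [e] at h

/-- A single entry 1 at (k, j) in the coefficient matrix reads off U at (j, k). Thus the matrix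
elements of the resolvent become quotients of Fredholm determinants, which can be differentiated by
translation. -/
lemma perturbedDet_zero_zero (x : ℝ) :
    perturbedDet !![1, 0, 0; 0, 0, 0; 0, 0, 0] x = airyDet x * (1 - resMat x 0 0) := by
  rw [perturbedDet_eq, airyDet]
  simp [Matrix.det_fin_three, Matrix.mul_apply, Fin.sum_univ_three]

lemma perturbedDet_one_zero (x : ℝ) :
    perturbedDet !![0, 0, 0; 1, 0, 0; 0, 0, 0] x = airyDet x * (1 - resMat x 0 1) := by
  rw [perturbedDet_eq, airyDet]
  simp [Matrix.det_fin_three, Matrix.mul_apply, Fin.sum_univ_three]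

lemma perturbedDet_two_zero (x : ℝ) :
    perturbedDet !![0, 0, 0; 0, 0, 0; 1, 0, 0] x = airyDet x * (1 - resMat x 0 2) := by
  rw [perturbedDet_eq, airyDet]
  simp [Matrix.det_fin_three, Matrix.mul_apply, Fin.sum_univ_three]

lemma perturbedDet_one_one (x : ℝ) :
    perturbedDet !![0, 0, 0; 0, 1, 0; 0, 0, 0] x = airyDet x * (1 - resMat x 1 1) := by
  rw [perturbedDet_eq, airyDet]
  simp [Matrix.det_fin_three, Matrix.mul_apply, Fin.sum_univ_three]

lemma hasDerivAt_of_perturbedDet {c : Matrix (Fin 3) (Fin 3) ℝ} {j k : Fin 3} {x p : ℝ}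
    (he : ∀ x, perturbedDet c x = airyDet x * (1 - resMat x j k))
    (h : HasDerivAt (perturbedDet c) (airyDet x * p) x) :
    HasDerivAt (fun x => resMat x j k) (resMat x 0 0 * (1 - resMat x j k) - p) x := by
  have hpos := (airyDet_pos x).ne'
  have h1 := (h.div (hasDerivAt_airyDet x) hpos).const_sub 1
  have e : (fun y => 1 - perturbedDet c y / airyDet y) = fun y => resMat y j k := by
    funext y
    rw [he, mul_div_cancel_left₀ _ (airyDet_pos y).ne']
    ring
  have h2 : HasDerivAt (fun y => 1 - perturbedDet c y / airyDet y) _ x := h1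
  rw [e] at h2
  refine h2.congr_deriv ?_
  rw [he]
  field_simp
  ring

/-- Translation changes A⊗A by e(A'⊗A + A⊗A'), and the Airy kernel adds -e A⊗A; these are the
entries of c₁. -/
lemma hasDerivAt_resMat_zero_zero (x : ℝ) : HasDerivAt (fun x => resMat x 0 0)
    (2 * resMat x 0 1 - resMat x 0 0 ^ 2) x := by
  have hs := resMat_comm x 1 0
  have h := hasDerivAt_perturbedDet (c₀ := !![1, 0, 0; 0, 0, 0; 0, 0, 0])
    (c₁ := !![-1, 1, 0; 1, 0, 0; 0, 0, 0]) (x := x) (p := resMat x 0 0 - 2 * resMat x 0 1)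
    (by intro i j; fin_cases i <;> fin_cases j <;> simp)
    (by intro i j; fin_cases i <;> fin_cases j <;> simp)
    (by
      obtain ⟨M, hM, hb⟩ := exists_translate_bound 0 0 x
      refine ⟨M, hM, fun e he u v hu hv => le_trans (le_of_eq ?_) (hb e he u v hu hv)⟩
      congr 1
      simp [prodKernel, Fin.sum_univ_three]
      refine Or.inl ?_
      ring)
    (by
      -- The determinant is a polynomial of degree two in e. Its quadratic coefficient has no
      -- influence on the derivative, but is needed for the identity.
      refine (hasDerivAt_quadratic (1 - resMat x 0 0) (resMat x 0 0 - 2 * resMat x 0 1)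
        (resMat x 0 1 * resMat x 0 1 - resMat x 0 0 * resMat x 1 1)).congr_of_eventuallyEq
        (Eventually.of_forall fun e => ?_)
      simp [Matrix.det_fin_three, Matrix.mul_apply, Fin.sum_univ_three, hs]
      ring)
  refine (hasDerivAt_of_perturbedDet perturbedDet_zero_zero h).congr_deriv ?_
  ring

lemma hasDerivAt_resMat_zero_one (x : ℝ) : HasDerivAt (fun x => resMat x 0 1)
    (resMat x 0 2 + resMat x 1 1 - resMat x 0 0 * resMat x 0 1) x := by
  have hs := resMat_comm x 1 0
  have h := hasDerivAt_perturbedDet (c₀ := !![0, 0, 0; 1, 0, 0; 0, 0, 0])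
    (c₁ := !![-1, 0, 0; 0, 1, 0; 1, 0, 0]) (x := x)
    (p := resMat x 0 0 - resMat x 0 2 - resMat x 1 1)
    (by intro i j; fin_cases i <;> fin_cases j <;> simp)
    (by intro i j; fin_cases i <;> fin_cases j <;> simp)
    (by
      obtain ⟨M, hM, hb⟩ := exists_translate_bound 1 0 x
      refine ⟨M, hM, fun e he u v hu hv => le_trans (le_of_eq ?_) (hb e he u v hu hv)⟩
      congr 1
      simp [prodKernel, Fin.sum_univ_three]
      refine Or.inl ?_
      ring)
    (by
      refine (hasDerivAt_quadratic (1 - resMat x 0 1)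
        (resMat x 0 0 - resMat x 0 2 - resMat x 1 1)
        (-(resMat x 0 0 - resMat x 0 2) * resMat x 1 1
          + resMat x 0 1 * (resMat x 0 1 - resMat x 1 2))).congr_of_eventuallyEq
        (Eventually.of_forall fun e => ?_)
      simp [Matrix.det_fin_three, Matrix.mul_apply, Fin.sum_univ_three, hs]
      ring)
  refine (hasDerivAt_of_perturbedDet perturbedDet_one_zero h).congr_deriv ?_
  ring

lemma continuous_airyDet : Continuous airyDet :=
  continuous_iff_continuousAt.2 fun x => (hasDerivAt_airyDet x).continuousAt

lemma continuous_of_perturbedDet {c : Matrix (Fin 3) (Fin 3) ℝ} {j k : Fin 3}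
    (he : ∀ x, perturbedDet c x = airyDet x * (1 - resMat x j k))
    (h : Continuous (perturbedDet c)) : Continuous fun x => resMat x j k := by
  have h1 : Continuous fun y => 1 - perturbedDet c y / airyDet y :=
    continuous_const.sub (h.div continuous_airyDet fun x => (airyDet_pos x).ne')
  refine h1.congr fun y => ?_
  rw [he, mul_div_cancel_left₀ _ (airyDet_pos y).ne']
  ring

lemma continuous_resMat_zero_two : Continuous fun x => resMat x 0 2 := by
  refine continuous_of_perturbedDet perturbedDet_two_zero (continuous_perturbedDet
    (by intro i j; fin_cases i <;> fin_cases j <;> simp) fun x => ?_)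
  obtain ⟨M, hM, hb⟩ := exists_translate_bound_linear 2 0 x
  refine ⟨M, hM, fun e he u v hu hv => le_trans (le_of_eq ?_) (hb e he u v hu hv)⟩
  simp [prodKernel, Fin.sum_univ_three]

lemma continuous_resMat_one_one : Continuous fun x => resMat x 1 1 := by
  refine continuous_of_perturbedDet perturbedDet_one_one (continuous_perturbedDet
    (by intro i j; fin_cases i <;> fin_cases j <;> simp) fun x => ?_)
  obtain ⟨M, hM, hb⟩ := exists_translate_bound_linear 1 1 x
  refine ⟨M, hM, fun e he u v hu hv => le_trans (le_of_eq ?_) (hb e he u v hu hv)⟩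
  simp [prodKernel, Fin.sum_univ_three]

/-- The consequence of the behaviour of the Airy kernel under dilations. -/
lemma mul_resMat_zero_zero (x : ℝ) : x * resMat x 0 0 = 2 * resMat x 0 2 - resMat x 1 1 := by
  obtain ⟨M, hM, hb⟩ := exists_airyKernel_dilate_bound x
  obtain ⟨L, hL, hpert⟩ := exists_fredholmDet_perturbation x
  set δ : ℝ := min (1 / 4) (1 / (1 + M)) with hδ
  have hδ0 : 0 < δ := lt_min (by norm_num) (by positivity)
  have hs := resMat_comm x 2 0
  set c : Matrix (Fin 3) (Fin 3) ℝ := !![0, 0, -1; 0, 1, 0; -1, 0, 0] with hc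
  -- The derivative of y ↦ det(I - K⁽⁰⁾) on (yx, ∞) at y = 1 is computed in two ways. In the first,
  -- the dilated kernel is a perturbation by e c, where c stands for -(A''⊗A - A'⊗A' + A⊗A''), and
  -- the derivative of det(1 - eUc) is -tr(Uc).
  have h1 : HasDerivAt (fun e : ℝ => airyDet x * (1 - resMat x * (e • c)).det)
      (airyDet x * (2 * resMat x 0 2 - resMat x 1 1)) 0 := by
    set U := resMat x with hU
    have h3 : HasDerivAt (fun e : ℝ => (1 - U * (e • c)).det) (2 * U 0 2 - U 1 1) 0 := by
      have h4 := (hasDerivAt_quadratic 1 (2 * U 0 2 - U 1 1)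
        (U 0 2 ^ 2 - U 0 0 * U 2 2 - 2 * U 0 2 * U 1 1 + U 0 1 * U 1 2 + U 1 0 * U 2 1)).add
        ((hasDerivAt_pow 3 (0 : ℝ)).const_mul (-(c.det * U.det)))
      refine (h4.congr_deriv (by simp)).congr_of_eventuallyEq (Eventually.of_forall fun e => ?_)
      simp [hc, Matrix.det_fin_three, Matrix.mul_apply, Fin.sum_univ_three, hs]
      ring
    exact h3.const_mul _
  have h2 : HasDerivAt (fun y => airyDet (y * x))
      (airyDet x * (2 * resMat x 0 2 - resMat x 1 1)) 1 := by
    refine hasDerivAt_of_abs_sub_le (M := L * M) hδ0 (fun e he => ?_) h1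
    have he1 : |e| ≤ 1 / 4 := he.trans (min_le_left _ _)
    have he2 : |e| ≤ 1 / (1 + M) := he.trans (min_le_right _ _)
    have hsq : M * e ^ 2 ≤ 1 := by
      rw [le_div_iff₀ (by positivity)] at he2
      rw [← sq_abs]
      nlinarith [abs_nonneg e]
    have hpos : 0 < 1 + e := by linarith [(abs_le.1 he1).1]
    rw [airyDet, fredholmDet_dilate _ _ hpos]
    refine (hpert (e • c) _ (M * e ^ 2) (fun i j => ?_) ?_ (by positivity) hsq
      fun u v hu hv => ?_).trans (le_of_eq (by ring))
    · rw [Matrix.smul_apply, smul_eq_mul, abs_mul]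
      have : |c i j| ≤ 1 := by rw [hc]; fin_cases i <;> fin_cases j <;> simp
      nlinarith [abs_nonneg e, abs_nonneg (c i j)]
    · exact ((continuous_airyKernel.measurable).comp
        (f := fun p : ℝ × ℝ => ((1 + e) * p.1, (1 + e) * p.2)) (by fun_prop)).const_mul _
    · refine le_trans (le_of_eq ?_) (hb e he1 u v hu hv)
      congr 1
      simp [hc, prodKernel, Fin.sum_univ_three]
      ring
  -- The second computation is the chain rule with the known derivative in the endpoint.
  have h3 : HasDerivAt (fun y => airyDet (y * x)) (airyDet x * resMat x 0 0 * x) 1 := by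
    have h4 : HasDerivAt (fun y : ℝ => y * x) x 1 := hasDerivAt_mul_const x
    have h5 := hasDerivAt_airyDet (1 * x)
    have := h5.comp 1 h4
    rwa [one_mul] at this
  have h4 := h3.unique h2
  have hD := (airyDet_pos x).ne'
  refine mul_left_cancel₀ hD ?_
  rw [← h4]
  ring

/-! ### The logarithm of the Fredholm determinant -/

lemma hasDerivAt_Q0 (x : ℝ) : HasDerivAt Q0 (resMat x 0 0) x := by
  have h := (hasDerivAt_airyDet x).log (airyDet_pos x).ne'
  rwa [mul_div_cancel_left₀ _ (airyDet_pos x).ne'] at h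

lemma deriv_Q0 : deriv Q0 = fun x => resMat x 0 0 := funext fun x => (hasDerivAt_Q0 x).deriv

lemma deriv_deriv_Q0 : deriv (deriv Q0) = fun x => 2 * resMat x 0 1 - resMat x 0 0 ^ 2 := by
  rw [deriv_Q0]
  exact funext fun x => (hasDerivAt_resMat_zero_zero x).deriv

lemma hasDerivAt_deriv_deriv_Q0 (x : ℝ) : HasDerivAt (deriv (deriv Q0))
    (2 * resMat x 0 2 + 2 * resMat x 1 1 - 6 * resMat x 0 0 * resMat x 0 1
      + 2 * resMat x 0 0 ^ 3) x := by
  rw [deriv_deriv_Q0]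
  have h1 := (hasDerivAt_resMat_zero_one x).const_mul 2
  have h2 := (hasDerivAt_resMat_zero_zero x).pow 2
  refine (h1.sub h2).congr_deriv ?_
  simp
  ring

lemma deriv_deriv_deriv_Q0 : deriv (deriv (deriv Q0)) = fun x =>
    2 * resMat x 0 2 + 2 * resMat x 1 1 - 6 * resMat x 0 0 * resMat x 0 1
      + 2 * resMat x 0 0 ^ 3 := funext fun x => (hasDerivAt_deriv_deriv_Q0 x).deriv

lemma contDiff_Q0 : ContDiff ℝ 3 Q0 := by
  have c00 : Continuous fun x => resMat x 0 0 :=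
    continuous_iff_continuousAt.2 fun x => (hasDerivAt_resMat_zero_zero x).continuousAt
  have c01 : Continuous fun x => resMat x 0 1 :=
    continuous_iff_continuousAt.2 fun x => (hasDerivAt_resMat_zero_one x).continuousAt
  have c02 := continuous_resMat_zero_two
  have c11 := continuous_resMat_one_one
  rw [show (3 : WithTop ℕ∞) = 2 + 1 by norm_num, contDiff_succ_iff_deriv]
  refine ⟨fun x => (hasDerivAt_Q0 x).differentiableAt, by simp, ?_⟩
  rw [show (2 : WithTop ℕ∞) = 1 + 1 by norm_num, contDiff_succ_iff_deriv]
  refine ⟨fun x => by rw [deriv_Q0]; exact (hasDerivAt_resMat_zero_zero x).differentiableAt,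
    by simp, ?_⟩
  rw [show (1 : WithTop ℕ∞) = 0 + 1 by norm_num, contDiff_succ_iff_deriv]
  refine ⟨fun x => (hasDerivAt_deriv_deriv_Q0 x).differentiableAt, by simp, ?_⟩
  rw [contDiff_zero, deriv_deriv_deriv_Q0]
  fun_prop

end RAiry
end

noncomputable section

namespace RAiry

open Filter Topology

/-! ### Finite rank operators -/

lemma IsIntegralOperator.add {x : ℝ} {k k' : ℝ → ℝ → ℝ} {S T : L2 x →L[ℝ] L2 x}
    (hS : IsIntegralOperator x k S) (hT : IsIntegralOperator x k' T) :
    IsIntegralOperator x (fun u v => k u v + k' u v) (S + T) := by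
  intro F
  filter_upwards [hS F, hT F, Lp.coeFn_add (S F) (T F)] with u h1 h2 h3
  simp only [add_mul]
  refine ⟨h1.1.add h2.1, ?_⟩
  rw [add_apply, h3, Pi.add_apply, h1.2, h2.2, integral_add h1.1 h2.1]

lemma IsIntegralOperator.smul {x : ℝ} {k : ℝ → ℝ → ℝ} {T : L2 x →L[ℝ] L2 x} (c : ℝ)
    (hT : IsIntegralOperator x k T) : IsIntegralOperator x (fun u v => c * k u v) (c • T) := by
  intro F
  filter_upwards [hT F, Lp.coeFn_smul c (T F)] with u h1 h2
  simp only [mul_assoc]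
  refine ⟨h1.1.const_mul c, ?_⟩
  rw [smul_apply, h2, Pi.smul_apply, h1.2, integral_const_mul, smul_eq_mul]

lemma isIntegralOperator_zero (x : ℝ) :
    IsIntegralOperator x (fun _ _ => 0) (0 : L2 x →L[ℝ] L2 x) := by
  intro F
  filter_upwards [Lp.coeFn_zero ℝ 2 (volume.restrict (Ioi x))] with u h
  simp only [zero_mul, integral_zero, zero_apply]
  exact ⟨integrable_zero _ _ _, h⟩

lemma IsIntegralOperator.sum {x : ℝ} {ι : Type*} (s : Finset ι) {k : ι → ℝ → ℝ → ℝ}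
    {T : ι → L2 x →L[ℝ] L2 x} (h : ∀ i ∈ s, IsIntegralOperator x (k i) (T i)) :
    IsIntegralOperator x (fun u v => ∑ i ∈ s, k i u v) (∑ i ∈ s, T i) := by
  classical
  induction s using Finset.induction_on with
  | empty => simpa using isIntegralOperator_zero x
  | insert a s ha ih =>
    simp only [Finset.sum_insert ha]
    exact (h a (Finset.mem_insert_self a s)).add
      (ih fun i hi => h i (Finset.mem_insert_of_mem hi))

lemma isIntegralOperator_rankOne {x : ℝ} {f g : ℝ → ℝ} (hf : MemLp f 2 (mu x))
    (hg : MemLp g 2 (mu x)) : IsIntegralOperator x (fun u v => f u * g v)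
      (InnerProductSpace.rankOne ℝ (vec x f) (vec x g)) := by
  intro F
  filter_upwards [Lp.coeFn_smul (inner ℝ (vec x g) F) (vec x f), coeFn_vec hf] with u h1 h2
  simp only [mul_assoc]
  refine ⟨(integrable_mul_vec hg F).const_mul _, ?_⟩
  rw [InnerProductSpace.rankOne_apply, h1, Pi.smul_apply, h2, integral_const_mul,
    inner_vec_left hg, smul_eq_mul, mul_comm]

lemma memLp_airyD (x : ℝ) (j : Fin 3) : MemLp (airyD j) 2 (mu x) := by
  obtain ⟨B, -, hd⟩ := exists_dom_airyD x
  exact (hd j).memLp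

/-- The operator with kernel `∑ c_{jk} A⁽ʲ⁾(u) A⁽ᵏ⁾(v)` on `L²(x, ∞)`. -/
def prodOp (x : ℝ) (c : Matrix (Fin 3) (Fin 3) ℝ) : L2 x →L[ℝ] L2 x :=
  ∑ j : Fin 3, ∑ k : Fin 3, c j k • InnerProductSpace.rankOne ℝ (airyVec x j) (airyVec x k)

lemma isIntegralOperator_prodOp (x : ℝ) (c : Matrix (Fin 3) (Fin 3) ℝ) :
    IsIntegralOperator x (prodKernel c) (prodOp x c) :=
  IsIntegralOperator.sum _ fun j _ => IsIntegralOperator.sum _ fun k _ =>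
    (isIntegralOperator_rankOne (memLp_airyD x j) (memLp_airyD x k)).smul _

lemma prodOp_add (x : ℝ) (c c' : Matrix (Fin 3) (Fin 3) ℝ) :
    prodOp x (c + c') = prodOp x c + prodOp x c' := by
  simp only [prodOp, Matrix.add_apply, add_smul, Finset.sum_add_distrib]

lemma prodOp_smul (x a : ℝ) (c : Matrix (Fin 3) (Fin 3) ℝ) :
    prodOp x (a • c) = a • prodOp x c := by
  simp only [prodOp, Matrix.smul_apply, smul_assoc, Finset.smul_sum]

lemma prodOp_apply (x : ℝ) (c : Matrix (Fin 3) (Fin 3) ℝ) (F : L2 x) :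
    prodOp x c F
      = ∑ j : Fin 3, c.mulVec (fun k => inner ℝ (airyVec x k) F) j • airyVec x j := by
  simp only [prodOp, sum_apply, smul_apply, InnerProductSpace.rankOne_apply, Matrix.mulVec,
    dotProduct, Finset.sum_smul, smul_smul]

/-- Between two finite rank operators only the numbers ⟨A⁽ʲ⁾, (I - K⁽⁰⁾)⁻¹ A⁽ᵏ⁾⟩ matter. So the
polynomials in the L_i reduce to polynomials in 3×3 matrices with U in between. -/
lemma prodOp_mul_airyRes_mul_prodOp (x : ℝ) (c c' : Matrix (Fin 3) (Fin 3) ℝ) :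
    prodOp x c * airyRes x * prodOp x c' = prodOp x (c * resMat x * c') := by
  refine ContinuousLinearMap.ext fun F => ?_
  rw [mul_apply_eq_comp, mul_apply_eq_comp, prodOp_apply x c,
    prodOp_apply x (c * resMat x * c'), ← Matrix.mulVec_mulVec, ← Matrix.mulVec_mulVec]
  have h : (fun k : Fin 3 => inner ℝ (airyVec x k) (airyRes x (prodOp x c' F)))
      = (resMat x).mulVec (c'.mulVec fun k => inner ℝ (airyVec x k) F) := by
    funext k
    rw [prodOp_apply, map_sum, inner_sum, Matrix.mulVec, dotProduct]
    refine Finset.sum_congr rfl fun j _ => ?_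
    rw [map_smul, real_inner_smul_right, mul_comm]
    rfl
  rw [h]

lemma airyRes_mul_prodOp_mul (x : ℝ) (c c' : Matrix (Fin 3) (Fin 3) ℝ) :
    airyRes x * prodOp x c * (airyRes x * prodOp x c')
      = airyRes x * prodOp x (c * resMat x * c') := by
  rw [← prodOp_mul_airyRes_mul_prodOp]
  simp only [mul_assoc]

lemma hasTrace_airyRes_mul_prodOp (x : ℝ) (c : Matrix (Fin 3) (Fin 3) ℝ) :
    HasTrace (airyRes x * prodOp x c) (resMat x * c).trace := by
  have h : airyRes x * prodOp x c = ∑ j : Fin 3, ∑ k : Fin 3,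
      c j k • InnerProductSpace.rankOne ℝ (airyRes x (airyVec x j)) (airyVec x k) := by
    refine ContinuousLinearMap.ext fun F => ?_
    simp only [mul_apply_eq_comp, prodOp, sum_apply, smul_apply,
      InnerProductSpace.rankOne_apply, map_sum, map_smul]
  have ht : (resMat x * c).trace = ∑ j : Fin 3, ∑ k : Fin 3, c j k * resMat x k j := by
    rw [Matrix.trace, Finset.sum_comm]
    refine Finset.sum_congr rfl fun k _ => ?_
    rw [Matrix.diag_apply, Matrix.mul_apply]
    exact Finset.sum_congr rfl fun j _ => mul_comm _ _
  rw [h, ht]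
  exact HasTrace.sum _ fun j _ => HasTrace.sum _ fun k _ => (hasTrace_rankOne _ _).smul _

/-! ### The coefficients of the `r`-Airy kernel -/

/-- The coefficients of `K_1` with respect to the products `A⁽ʲ⁾(u) A⁽ᵏ⁾(v)`. -/
def coeff1 (r : ℝ) : Matrix (Fin 3) (Fin 3) ℝ := !![-r, 0, 0; 0, 0, 0; 0, 0, 0]

/-- The coefficients of `K_2` with respect to the products `A⁽ʲ⁾(u) A⁽ᵏ⁾(v)`. -/
def coeff2 (r : ℝ) : Matrix (Fin 3) (Fin 3) ℝ :=
  !![0, -(r ^ 2 / 2) + r / 2, 0; -(r ^ 2 / 2) - r / 2, 0, 0; 0, 0, 0]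

/-- The coefficients of `K_3` with respect to the products `A⁽ʲ⁾(u) A⁽ᵏ⁾(v)`. -/
def coeff3 (r : ℝ) : Matrix (Fin 3) (Fin 3) ℝ :=
  !![0, 0, -(r ^ 3 / 6) + r ^ 2 / 2 - r / 3; 0, -(r ^ 3 / 3) + r / 3, 0;
    -(r ^ 3 / 6) - r ^ 2 / 2 - r / 3, 0, 0]

lemma kernel1_eq_prodKernel (r : ℕ) : kernel1 r = prodKernel (coeff1 r) := by
  funext u v
  rw [kernel1_eq]
  simp [prodKernel, coeff1, Fin.sum_univ_three]

lemma kernel2_eq_prodKernel (r : ℕ) : kernel2 r = prodKernel (coeff2 r) := by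
  funext u v
  rw [kernel2_eq]
  simp [prodKernel, coeff2, Fin.sum_univ_three]
  ring

lemma kernel3_eq_prodKernel (r : ℕ) : kernel3 r = prodKernel (coeff3 r) := by
  funext u v
  rw [kernel3_eq]
  simp [prodKernel, coeff3, Fin.sum_univ_three]
  ring

/-- The coefficient of `1 / t` in the expansion of `Q(t, x)`. -/
def Q1 (r : ℕ) (x : ℝ) : ℝ := r * resMat x 0 0

/-- The coefficient of `1 / t²` in the expansion of `Q(t, x)`. -/
def Q2 (r : ℕ) (x : ℝ) : ℝ := (r : ℝ) ^ 2 / 2 * (2 * resMat x 0 1 - resMat x 0 0 ^ 2)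

/-- The coefficient of `1 / t³` in the expansion of `Q(t, x)`. -/
def Q3 (r : ℕ) (x : ℝ) : ℝ :=
  ((r : ℝ) ^ 3 / 3 + 2 * r / 3) * resMat x 0 2 + ((r : ℝ) ^ 3 / 3 - r / 3) * resMat x 1 1
    - (r : ℝ) ^ 3 * (resMat x 0 0 * resMat x 0 1) + (r : ℝ) ^ 3 / 3 * resMat x 0 0 ^ 3

lemma trace_coeff1 (r : ℕ) (x : ℝ) : (resMat x * coeff1 r).trace = -Q1 r x := by
  simp [Matrix.trace_fin_three, Matrix.mul_apply, Fin.sum_univ_three, coeff1, Q1]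
  ring

lemma trace_coeff2 (r : ℕ) (x : ℝ) :
    (resMat x * (coeff2 r + (1 / 2 : ℝ) • (coeff1 r * resMat x * coeff1 r))).trace = -Q2 r x := by
  have h := resMat_comm x 1 0
  simp only [Matrix.trace_fin_three, Matrix.mul_apply, Matrix.add_apply, Matrix.smul_apply,
    Fin.sum_univ_three]
  simp [coeff1, coeff2, Q2, h]
  ring

lemma trace_coeff3 (r : ℕ) (x : ℝ) :
    (resMat x * (coeff3 r + coeff1 r * resMat x * coeff2 r
      + (1 / 3 : ℝ) • (coeff1 r * resMat x * coeff1 r * resMat x * coeff1 r))).trace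
      = -Q3 r x := by
  have h := resMat_comm x 1 0
  have h' := resMat_comm x 2 0
  simp only [Matrix.trace_fin_three, Matrix.mul_apply, Matrix.add_apply, Matrix.smul_apply,
    Fin.sum_univ_three]
  simp [coeff1, coeff2, coeff3, Q3, h, h']
  ring

lemma exists_trace_operators (r : ℕ) (x : ℝ) :
    ∃ K₀ K₁ K₂ K₃ L₁ L₂ L₃ : L2 x →L[ℝ] L2 x,
      IsIntegralOperator x airyKernel K₀ ∧ IsIntegralOperator x (kernel1 r) K₁ ∧
      IsIntegralOperator x (kernel2 r) K₂ ∧ IsIntegralOperator x (kernel3 r) K₃ ∧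
      IsUnit (1 - K₀) ∧
      L₁ = Ring.inverse (1 - K₀) * K₁ ∧ L₂ = Ring.inverse (1 - K₀) * K₂ ∧
      L₃ = Ring.inverse (1 - K₀) * K₃ ∧
      HasTrace L₁ (-Q1 r x) ∧ HasTrace (L₂ + (1 / 2 : ℝ) • L₁ ^ 2) (-Q2 r x) ∧
      HasTrace (L₃ + L₁ * L₂ + (1 / 3 : ℝ) • L₁ ^ 3) (-Q3 r x) := by
  refine ⟨airyOp x, prodOp x (coeff1 r), prodOp x (coeff2 r), prodOp x (coeff3 r), _, _, _,
    (adm_airyKernel x).isIntegralOperator, ?_, ?_, ?_, isUnit_one_sub_airyOp x, rfl, rfl, rfl,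
    ?_, ?_, ?_⟩
  · rw [kernel1_eq_prodKernel]
    exact isIntegralOperator_prodOp x _
  · rw [kernel2_eq_prodKernel]
    exact isIntegralOperator_prodOp x _
  · rw [kernel3_eq_prodKernel]
    exact isIntegralOperator_prodOp x _
  · rw [← trace_coeff1]
    exact hasTrace_airyRes_mul_prodOp x _
  · rw [← trace_coeff2]
    convert hasTrace_airyRes_mul_prodOp x _ using 1
    rw [prodOp_add, prodOp_smul, mul_add, mul_smul_comm, ← airyRes_mul_prodOp_mul, sq]
    rfl
  · rw [← trace_coeff3]
    convert hasTrace_airyRes_mul_prodOp x _ using 1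
    rw [prodOp_add, prodOp_add, prodOp_smul, mul_add, mul_add, mul_smul_comm,
      ← airyRes_mul_prodOp_mul, ← airyRes_mul_prodOp_mul, ← airyRes_mul_prodOp_mul, pow_three']
    rfl

/-! ### The expansion of the logarithm of the Fredholm determinant -/

/-- The determinant is a polynomial in e, and the point is its coefficients up to e³; g is the
quotient of the remainder by e⁴, of which only continuity matters later. -/
lemma exists_det_expansion (r : ℕ) (x : ℝ) : ∃ g : ℝ → ℝ, Continuous g ∧ ∀ e : ℝ,
    (1 - resMat x * (e • coeff1 r + e ^ 2 • coeff2 r + e ^ 3 • coeff3 r)).det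
      = 1 + Q1 r x * e + (r : ℝ) ^ 2 * resMat x 0 1 * e ^ 2
        + (((r : ℝ) ^ 3 / 3 + 2 * r / 3) * resMat x 0 2
          + ((r : ℝ) ^ 3 / 3 - r / 3) * resMat x 1 1) * e ^ 3 + e ^ 4 * g e := by
  have h := resMat_comm x 1 0
  have h' := resMat_comm x 2 0
  set U := resMat x with hU
  set a := -(r : ℝ) with ha
  set b := -((r : ℝ) ^ 2 / 2) + r / 2 with hb
  set b' := -((r : ℝ) ^ 2 / 2) - r / 2 with hb'
  set d := -((r : ℝ) ^ 3 / 6) + (r : ℝ) ^ 2 / 2 - r / 3 with hd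
  set d₁ := -((r : ℝ) ^ 3 / 3) + r / 3 with hd₁
  set d' := -((r : ℝ) ^ 3 / 6) - (r : ℝ) ^ 2 / 2 - r / 3 with hd'
  -- The three columns of U c(e) are e α, e² β and e³ γ. Taking out these powers makes the order of
  -- each term of the determinant visible.
  set κ : Fin 3 → ℝ → ℝ := fun i e => U i 1 * b' + U i 2 * d' * e with hκ
  set α : Fin 3 → ℝ → ℝ := fun i e => U i 0 * a + e * κ i e with hα
  set β : Fin 3 → ℝ → ℝ := fun i e => U i 0 * b + U i 1 * d₁ * e with hβ
  set γ : Fin 3 → ℝ := fun i => U i 0 * d with hγ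
  refine ⟨fun e => (U 0 0 * a * (U 1 1 * d₁) + κ 0 e * β 1 e - U 0 1 * d₁ * (U 1 0 * a)
    - β 0 e * κ 1 e) + (α 0 e * γ 2 - γ 0 * α 2 e) + e * (β 1 e * γ 2 - γ 1 * β 2 e)
    - e ^ 2 * (α 0 e * (β 1 e * γ 2 - γ 1 * β 2 e) - β 0 e * (α 1 e * γ 2 - γ 1 * α 2 e)
      + γ 0 * (α 1 e * β 2 e - β 1 e * α 2 e)), ?_, fun e => ?_⟩
  · simp only [hα, hβ, hκ]
    fun_prop
  · have hc : e • coeff1 r + e ^ 2 • coeff2 r + e ^ 3 • coeff3 r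
        = !![e * a, e ^ 2 * b, e ^ 3 * d; e ^ 2 * b', e ^ 3 * d₁, 0; e ^ 3 * d', 0, 0] := by
      ext i j
      fin_cases i <;> fin_cases j <;> simp [coeff1, coeff2, coeff3, ha, hb, hb', hd, hd₁, hd']
    have hp1 : Q1 r x = -(U 0 0 * a) := by rw [Q1, ha, ← hU]; ring
    have hp2 : (r : ℝ) ^ 2 * U 0 1 = -(U 0 1 * b' + U 1 0 * b) := by rw [hb, hb', h]; ring
    have hp3 : ((r : ℝ) ^ 3 / 3 + 2 * r / 3) * U 0 2 + ((r : ℝ) ^ 3 / 3 - r / 3) * U 1 1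
        = -(U 0 2 * d' + U 2 0 * d + U 1 1 * d₁) := by rw [hd, hd', hd₁, h']; ring
    rw [hc, hp1, hp2, hp3]
    clear_value a b b' d d₁ d' U
    simp [Matrix.det_fin_three, Matrix.mul_apply, Fin.sum_univ_three, hα, hβ, hκ, hγ]
    ring

/-- With y = f - 1 = O(e), the logarithm is y - y²/2 + y³/3 + O(e⁴). Replacing y by its cubic part
changes this by O(e⁴), and the rest is the expansion of a polynomial. -/
lemma isBigO_log_cubic {α : Type*} {l : Filter α} {e f : α → ℝ} {p₁ p₂ p₃ : ℝ}
    (he : Tendsto e l (𝓝 0))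
    (h : (fun t => f t - (1 + p₁ * e t + p₂ * e t ^ 2 + p₃ * e t ^ 3)) =O[l] fun t => e t ^ 4) :
    (fun t => Real.log (f t) - (p₁ * e t + (p₂ - p₁ ^ 2 / 2) * e t ^ 2
      + (p₃ - p₁ * p₂ + p₁ ^ 3 / 3) * e t ^ 3)) =O[l] fun t => e t ^ 4 := by
  set P : α → ℝ := fun t => p₁ * e t + p₂ * e t ^ 2 + p₃ * e t ^ 3 with hP
  set y : α → ℝ := fun t => f t - 1 with hy
  have hpoly : ∀ g : ℝ → ℝ, Continuous g → (fun t => g (e t)) =O[l] fun _ => (1 : ℝ) :=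
    fun g hg => ((hg.tendsto 0).comp he).isBigO_one ℝ
  have hR : (fun t => y t - P t) =O[l] fun t => e t ^ 4 := by
    refine h.congr_left fun t => ?_
    simp only [hy, hP]
    ring
  have h4 : (fun t => e t ^ 4) =O[l] e := by
    refine ((isBigO_refl e l).mul (hpoly (fun s => s ^ 3) (by fun_prop))).congr
      (fun t => by ring) fun t => by ring
  have hPe : P =O[l] e := by
    refine ((isBigO_refl e l).mul
      (hpoly (fun s => p₁ + p₂ * s + p₃ * s ^ 2) (by fun_prop))).congr
      (fun t => by simp only [hP]; ring) fun t => by ring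
  have hye : y =O[l] e := ((hR.trans h4).add hPe).congr_left fun t => by ring
  have hy0 : Tendsto y l (𝓝 0) := hye.trans_tendsto he
  have hlog : (fun t => Real.log (f t) - (y t - y t ^ 2 / 2 + y t ^ 3 / 3))
      =O[l] fun t => e t ^ 4 := by
    refine IsBigO.trans ?_ (hye.pow 4)
    refine IsBigO.of_bound 2 ?_
    filter_upwards [hy0.eventually (Metric.closedBall_mem_nhds (0 : ℝ) one_half_pos)] with t ht
    rw [dist_zero_right, Real.norm_eq_abs] at ht
    have h1 := Real.abs_log_sub_add_sum_range_le (x := -y t) (by rw [abs_neg]; linarith) 3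
    rw [Real.norm_eq_abs, norm_pow, Real.norm_eq_abs]
    have e1 : Real.log (f t) - (y t - y t ^ 2 / 2 + y t ^ 3 / 3)
        = (∑ i ∈ Finset.range 3, (-y t) ^ (i + 1) / ((i : ℝ) + 1)) + Real.log (1 - -y t) := by
      have : 1 - -y t = f t := by simp only [hy]; ring
      rw [this]
      simp only [Finset.sum_range_succ, Finset.sum_range_zero]
      push_cast
      ring
    rw [e1]
    refine h1.trans ?_
    rw [abs_neg, div_le_iff₀ (by linarith)]
    have := mul_le_mul_of_nonneg_left ht (by positivity : 0 ≤ |y t| ^ 4)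
    norm_num
    linarith
  have hdiff : (fun t => (y t - y t ^ 2 / 2 + y t ^ 3 / 3) - (P t - P t ^ 2 / 2 + P t ^ 3 / 3))
      =O[l] fun t => e t ^ 4 := by
    have hy1 : Tendsto (fun t => 1 - (y t + P t) / 2 + (y t ^ 2 + y t * P t + P t ^ 2) / 3) l
        (𝓝 (1 - (0 + 0) / 2 + (0 ^ 2 + 0 * 0 + 0 ^ 2) / 3)) := by
      have hP0 := hPe.trans_tendsto he
      exact ((hy0.add hP0).div_const 2 |>.const_sub 1).add
        ((((hy0.pow 2).add (hy0.mul hP0)).add (hP0.pow 2)).div_const 3)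
    refine (hR.mul (hy1.isBigO_one ℝ)).congr (fun t => by ring) fun t => by ring
  have hpol : (fun t => (P t - P t ^ 2 / 2 + P t ^ 3 / 3) - (p₁ * e t
      + (p₂ - p₁ ^ 2 / 2) * e t ^ 2 + (p₃ - p₁ * p₂ + p₁ ^ 3 / 3) * e t ^ 3))
      =O[l] fun t => e t ^ 4 := by
    refine ((isBigO_refl (fun t => e t ^ 4) l).mul (hpoly (fun s => -(p₂ ^ 2 + 2 * p₁ * p₃
      + 2 * p₂ * p₃ * s + p₃ ^ 2 * s ^ 2) / 2 + (3 * p₁ ^ 2 * (p₂ + p₃ * s)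
      + 3 * p₁ * (p₂ + p₃ * s) ^ 2 * s + (p₂ + p₃ * s) ^ 3 * s ^ 2) / 3)
      (by fun_prop))).congr (fun t => ?_) fun t => by ring
    simp only [hP]
    ring
  exact ((hlog.add hdiff).add hpol).congr_left fun t => by ring

lemma tendsto_one_div_atBot : Tendsto (fun t : ℝ => 1 / t) atBot (𝓝 0) := by
  simpa only [one_div] using tendsto_inv_atBot_zero

lemma adm_rAiryKernel (r : ℕ) {t : ℝ} (ht : t ≤ -2) (x : ℝ) :
    ∃ C, 0 ≤ C ∧ Adm x C (rAiryKernel r t) := by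
  rw [rAiryKernel_eq r ht]
  exact (decay_weights r ht).1.exists_adm_kern (decay_weights r ht).2 x

/-- The uniform expansion of the r-Airy kernel places it within O(t⁻⁴), in the weighted norm, of a
finite rank perturbation with coefficients c(1/t). The Lipschitz bound and the expansion of det(1 -
Uc) then combine. -/
lemma isBigO_fredholmDet_rAiryKernel (r : ℕ) (x : ℝ) :
    (fun t => fredholmDet (rAiryKernel r t) x / airyDet x
      - (1 + Q1 r x * (1 / t) + (r : ℝ) ^ 2 * resMat x 0 1 * (1 / t) ^ 2
        + (((r : ℝ) ^ 3 / 3 + 2 * r / 3) * resMat x 0 2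
          + ((r : ℝ) ^ 3 / 3 - r / 3) * resMat x 1 1) * (1 / t) ^ 3))
      =O[atBot] fun t : ℝ => (1 / t) ^ 4 := by
  obtain ⟨M, hM, hb⟩ := exists_rAiryKernel_expansion r x
  obtain ⟨L, hL, hpert⟩ := exists_fredholmDet_perturbation x
  obtain ⟨g, hg, hdet⟩ := exists_det_expansion r x
  have hD := airyDet_pos x
  have hx := wt_pos x
  set c : ℝ → Matrix (Fin 3) (Fin 3) ℝ := fun e =>
    e • coeff1 r + e ^ 2 • coeff2 r + e ^ 3 • coeff3 r with hc
  set m := M * wt x ^ 2 with hm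
  have hm0 : 0 ≤ m := by positivity
  have hsmall : ∀ᶠ t : ℝ in atBot, ∀ i j, |c (1 / t) i j| ≤ 2 := by
    refine eventually_all.2 fun i => eventually_all.2 fun j => ?_
    have hcont : Continuous fun e => |c e i j| := by
      simp only [hc, Matrix.add_apply, Matrix.smul_apply, smul_eq_mul]
      fun_prop
    have h0 := (hcont.tendsto 0).comp tendsto_one_div_atBot
    have h1 : |c 0 i j| = 0 := by simp [hc]
    rw [h1] at h0
    exact (h0.eventually (gt_mem_nhds two_pos)).mono fun t ht => le_of_lt ht
  have hδ : ∀ᶠ t : ℝ in atBot, m * (1 / t) ^ 4 ≤ 1 := by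
    have h0 : Tendsto (fun t : ℝ => m * (1 / t) ^ 4) atBot (𝓝 (m * 0 ^ 4)) :=
      (tendsto_one_div_atBot.pow 4).const_mul m
    exact (h0.eventually (gt_mem_nhds (by simp))).mono fun t ht => le_of_lt ht
  have h1 : (fun t => fredholmDet (rAiryKernel r t) x / airyDet x
      - (1 - resMat x * c (1 / t)).det) =O[atBot] fun t : ℝ => (1 / t) ^ 4 := by
    refine IsBigO.of_bound (L * m / airyDet x) ?_
    filter_upwards [hsmall, hδ, eventually_le_atBot (-2)] with t h2 h3 ht
    obtain ⟨C, -, hadm⟩ := adm_rAiryKernel r ht x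
    have hp := hpert (c (1 / t)) (rAiryKernel r t) (m * (1 / t) ^ 4) h2 hadm.meas (by positivity)
      h3 fun u v hu hv => ?_
    · have e1 : fredholmDet (rAiryKernel r t) x / airyDet x - (1 - resMat x * c (1 / t)).det
          = (fredholmDet (rAiryKernel r t) x
            - airyDet x * (1 - resMat x * c (1 / t)).det) / airyDet x := by
        field_simp
      rw [e1, Real.norm_eq_abs, abs_div, abs_of_pos hD, Real.norm_of_nonneg (by positivity),
        div_mul_eq_mul_div, mul_assoc]
      exact div_le_div_of_nonneg_right hp hD.le
    · have e2 : airyKernel u v + prodKernel (c (1 / t)) u v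
          = airyKernel u v + kernel1 r u v * (1 / t) + kernel2 r u v * (1 / t) ^ 2
            + kernel3 r u v * (1 / t) ^ 3 := by
        have e3 : prodKernel ((1 / t) • coeff1 r) u v = 1 / t * prodKernel (coeff1 r) u v := by
          have := prodKernel_add_smul 0 (coeff1 r) (1 / t) u v
          rw [zero_add] at this
          rw [this]
          simp [prodKernel]
        rw [hc, prodKernel_add_smul, prodKernel_add_smul, e3, ← kernel1_eq_prodKernel,
          ← kernel2_eq_prodKernel, ← kernel3_eq_prodKernel]
        ring
      rw [e2]
      refine (hb t ht u v hu hv).trans ?_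
      calc M * (1 / t) ^ 4 * (Real.exp (-u) * Real.exp (-v))
          ≤ M * (1 / t) ^ 4 * (wt x ^ 2 * (wt u * wt v)) :=
            mul_le_mul_of_nonneg_left (exp_neg_mul_le_wt hu hv) (by positivity)
        _ = _ := by rw [hm]; ring
  have h2 : (fun t : ℝ => (1 / t) ^ 4 * g (1 / t)) =O[atBot] fun t : ℝ => (1 / t) ^ 4 := by
    refine ((isBigO_refl (fun t : ℝ => (1 / t) ^ 4) atBot).mul
      (((hg.tendsto 0).comp tendsto_one_div_atBot).isBigO_one ℝ)).congr
      (fun t => rfl) fun t => mul_one _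
  refine (h1.add h2).congr_left fun t => ?_
  rw [hdet (1 / t)]
  ring

lemma eventually_fredholmDet_rAiryKernel_pos (r : ℕ) (x : ℝ) :
    ∀ᶠ t : ℝ in atBot, 0 < fredholmDet (rAiryKernel r t) x := by
  have h := isBigO_fredholmDet_rAiryKernel r x
  set p₂ := (r : ℝ) ^ 2 * resMat x 0 1
  set p₃ := ((r : ℝ) ^ 3 / 3 + 2 * r / 3) * resMat x 0 2
    + ((r : ℝ) ^ 3 / 3 - r / 3) * resMat x 1 1
  have ht := tendsto_one_div_atBot
  have h4 : Tendsto (fun t : ℝ => (1 / t) ^ 4) atBot (𝓝 0) := by simpa using ht.pow 4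
  have hp : Continuous fun e : ℝ => 1 + Q1 r x * e + p₂ * e ^ 2 + p₃ * e ^ 3 := by fun_prop
  have h5 := (h.trans_tendsto h4).add ((hp.tendsto 0).comp ht)
  have h6 : Tendsto (fun t => fredholmDet (rAiryKernel r t) x / airyDet x) atBot (𝓝 1) := by
    simpa [Function.comp_def] using h5
  filter_upwards [h6.eventually (lt_mem_nhds zero_lt_one)] with t ht
  rwa [div_pos_iff_of_pos_right (airyDet_pos x)] at ht

/-- The logarithm of the quotient of the determinants is Q - Q₀, and the coefficients p₁, p₂ - p₁²/2
and p₃ - p₁p₂ + p₁³/3 are those found from the traces. -/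
lemma isBigO_Q (r : ℕ) (x : ℝ) :
    (fun t : ℝ => Q r t x - (Q0 x + Q1 r x / t + Q2 r x / t ^ 2 + Q3 r x / t ^ 3))
      =O[atBot] fun t : ℝ => 1 / t ^ 4 := by
  refine (isBigO_log_cubic tendsto_one_div_atBot
    (isBigO_fredholmDet_rAiryKernel r x)).congr' ?_ (Eventually.of_forall fun t => by simp)
  filter_upwards [eventually_fredholmDet_rAiryKernel_pos r x] with t ht
  rw [Real.log_div ht.ne' (airyDet_pos x).ne']
  simp only [Q, Q0, Q1, Q2, Q3, airyDet]
  ring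

lemma isBigO_rAiryKernel (r : ℕ) (u v : ℝ) :
    (fun t : ℝ => rAiryKernel r t u v -
      (airyKernel u v + kernel1 r u v / t + kernel2 r u v / t ^ 2 + kernel3 r u v / t ^ 3))
      =O[atBot] fun t : ℝ => 1 / t ^ 4 := by
  obtain ⟨M, hM, hb⟩ := exists_rAiryKernel_expansion r (min u v)
  refine IsBigO.of_bound (M * (Real.exp (-u) * Real.exp (-v))) ?_
  filter_upwards [eventually_le_atBot (-2)] with t ht
  have h := hb t ht u v (min_le_left _ _) (min_le_right _ _)
  rw [Real.norm_eq_abs, Real.norm_of_nonneg (by positivity)]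
  refine (le_of_eq ?_).trans (h.trans (le_of_eq ?_))
  · congr 1
    ring
  · ring

lemma Q1_eq (r : ℕ) (x : ℝ) : Q1 r x = r * iteratedDeriv 1 Q0 x := by
  rw [iteratedDeriv_one, deriv_Q0, Q1]

lemma Q2_eq (r : ℕ) (x : ℝ) : Q2 r x = (r : ℝ) ^ 2 / 2 * iteratedDeriv 2 Q0 x := by
  rw [iteratedDeriv_succ, iteratedDeriv_one, deriv_deriv_Q0, Q2]

/-- After subtraction of (r³/6) Q₀''' all terms cubic in r cancel and (r/3)(2U₀₂ - U₁₁) remains,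
which the dilation identity turns into (r/3) x U₀₀. -/
lemma Q3_eq (r : ℕ) (x : ℝ) : Q3 r x = (r : ℝ) ^ 3 / 6 * iteratedDeriv 3 Q0 x
    + (r : ℝ) / 3 * x * iteratedDeriv 1 Q0 x := by
  have h := mul_resMat_zero_zero x
  rw [iteratedDeriv_succ, iteratedDeriv_succ, iteratedDeriv_one, deriv_deriv_deriv_Q0, deriv_Q0,
    Q3, mul_assoc ((r : ℝ) / 3), h]
  ring

end RAiry
end

open RAiry in
theorem proposition8p1 (r : ℕ) :
    ∃ Q₁ Q₂ Q₃ : ℝ → ℝ,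
      -- the Fredholm determinants are given by convergent series and are positive
      (∀ x : ℝ, FredholmConverges airyKernel x ∧ 0 < fredholmDet airyKernel x ∧
        ∀ᶠ t : ℝ in Filter.atBot,
          FredholmConverges (rAiryKernel r t) x ∧ 0 < fredholmDet (rAiryKernel r t) x) ∧
      -- the kernels `K_i` are the coefficients of the expansion of the `r`-Airy kernel
      (∀ u v : ℝ,
        (fun t : ℝ => rAiryKernel r t u v -
          (airyKernel u v + kernel1 r u v / t + kernel2 r u v / t ^ 2 + kernel3 r u v / t ^ 3))
          =O[Filter.atBot] fun t : ℝ => 1 / t ^ 4) ∧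
      -- `Q₁, Q₂, Q₃` are the traces of the polynomials in `L_i = (I - K₀)⁻¹ K_i`
      (∀ x : ℝ, ∃ K₀ K₁ K₂ K₃ L₁ L₂ L₃ : L2 x →L[ℝ] L2 x,
        IsIntegralOperator x airyKernel K₀ ∧
        IsIntegralOperator x (kernel1 r) K₁ ∧
        IsIntegralOperator x (kernel2 r) K₂ ∧
        IsIntegralOperator x (kernel3 r) K₃ ∧
        IsUnit (1 - K₀) ∧
        L₁ = Ring.inverse (1 - K₀) * K₁ ∧
        L₂ = Ring.inverse (1 - K₀) * K₂ ∧
        L₃ = Ring.inverse (1 - K₀) * K₃ ∧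
        HasTrace L₁ (-Q₁ x) ∧
        HasTrace (L₂ + (1 / 2 : ℝ) • L₁ ^ 2) (-Q₂ x) ∧
        HasTrace (L₃ + L₁ * L₂ + (1 / 3 : ℝ) • L₁ ^ 3) (-Q₃ x)) ∧
      -- and they are the coefficients of the expansion of `Q(t, x)` as `t → -∞`
      (∀ x : ℝ,
        (fun t : ℝ => Q r t x - (Q0 x + Q₁ x / t + Q₂ x / t ^ 2 + Q₃ x / t ^ 3))
          =O[Filter.atBot] fun t : ℝ => 1 / t ^ 4) ∧
      ContDiff ℝ 3 Q0 ∧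
      (∀ x : ℝ, Q₁ x = r * iteratedDeriv 1 Q0 x) ∧
      (∀ x : ℝ, Q₂ x = (r : ℝ) ^ 2 / 2 * iteratedDeriv 2 Q0 x) ∧
      (∀ x : ℝ, Q₃ x = (r : ℝ) ^ 3 / 6 * iteratedDeriv 3 Q0 x
        + (r : ℝ) / 3 * x * iteratedDeriv 1 Q0 x) := by
  refine ⟨Q1 r, Q2 r, Q3 r, fun x => ⟨(adm_airyKernel x).fredholmConverges,
    fredholmDet_airyKernel_pos x, ?_⟩, isBigO_rAiryKernel r, exists_trace_operators r,
    isBigO_Q r, contDiff_Q0, Q1_eq r, Q2_eq r, Q3_eq r⟩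
  filter_upwards [eventually_fredholmDet_rAiryKernel_pos r x,
    Filter.eventually_le_atBot (-2)] with t h ht
  obtain ⟨C, -, hadm⟩ := adm_rAiryKernel r ht x
  exact ⟨hadm.fredholmConverges, h⟩
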